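/- **Setup.** All alphabets are finite and the input alphabets are non-empty; entropies are in bits. A 2DMBC consists of two independent discrete memoryless broadcast channels, a forward one $P_{Y_fZ_f|X_f}$ from Alice to Bob and Eve and a backward one $P_{Y_bZ_b|X_b}$ from Bob to Alice and Eve. It is an sd-2DMBC if each of the two channels $P_{YZ|X}$ satisfies $P_{YZ|X}=P_{Y|X}P_{Z|X}$ and is stochastically degraded, that is, there is a Markov chain $X\leftrightarrow\tilde Y\leftrightarrow\tilde Z$ or $X\leftrightarrow\tilde Z\leftrightarrow\tilde Y$ with $P_{\tilde Y|X}=P_{Y|X}$ and $P_{\tilde Z|X}=P_{Z|X}$. A protocol has finitely many rounds; in each round one fixed party sends a sequence of fixed length over its channel, computed from independent randomness and the sequences that this party has sent and received before. At the end one legitimate party computes a key $S$ and the other an estimate $\hat S$, each as a function of all the sequences it has sent and received. With $n_f,n_b$ the numbers of uses of the two channels ($n_f+n_b>0$) and $View_E$ all the sequences Eve receives, the protocol is $(R,\delta)$-secure if $$\frac{H(S)}{n_f+n_b}>R-\delta,\qquad \Pr(\hat S\ne S)<\delta,\qquad \frac{H(S|View_E)}{H(S)}>1-\delta,$$ the last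 condition being imposed only if $H(S)\neq0$. The secret-key capacity over a class of protocols is the largest $R\ge0$ such that for every $\delta>0$ some protocol of the class is $(R,\delta)$-secure. A party only sends i.i.d. variables in a protocol if all the letters it sends, over all rounds, are drawn independently from one common distribution (which the protocol may choose), independently of what it has seen before. Let $$L'_A=\sup\left\{\frac{n_fI(V_f;X_f|Z_f)+n_b[I(X_b;Y_b)-I(X_b;Z_b)]_+}{n_f+n_b}\ :\ n_fI(V_f;Y_f|X_f)<n_bI(X_b;Y_b)\right\},$$ $$L'_B=\sup\left\{\frac{n_bI(V_b;X_b|Z_b)+n_f[I(X_f;Y_f)-I(X_f;Z_f)]_+}{n_f+n_b}\ :\ n_bI(V_b;Y_b|X_b)<n_fI(X_f;Y_f)\right\},$$ over integers $n_f,n_b\ge0$ with $n_f+n_b>0$, input distributions $P_{X_f},P_{X_b}$, and finite-valued $V_f$ (resp. $V_b$) with $V_f\leftrightarrow Y_f\leftrightarrow(X_f,Z_f)$ (resp. $V_b\leftrightarrow Y_b\leftrightarrow(X_b,Z_b)$) a Markov chain and independent of $X_b$ (resp. $X_f$). A supremum over the empty set is $0$. **Theorem 2.** For every sd-2DMBC,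 the secret-key capacity over the protocols in which one of the legitimate parties (Alice or Bob) only sends i.i.d. variables equals $$\max\{L'_A,L'_B\}.$$ More precisely, the secret-key capacity over the protocols in which Alice only sends i.i.d. variables equals $L'_A$ if the set in the definition of $L'_A$ is non-empty, and the secret-key capacity over the protocols in which Bob only sends i.i.d. variables equals $L'_B$ if the set in the definition of $L'_B$ is non-empty. -/

import Mathlib

open scoped BigOperators

noncomputable section

/-! ## Entropy and mutual information (in bits) of random variables on a finite sample space

A law on a finite sample space `Ω` is given by its mass function `μ : Ω → ℝ`, and random variables
are functions on `Ω` with values in finite sets. -/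

namespace Info

/-- The probability of an event `E` under the mass function `μ`. -/
def prob {Ω : Type*} [Fintype Ω] (μ : Ω → ℝ) (E : Ω → Prop) : ℝ :=
  open Classical in ∑ ω with E ω, μ ω

/-- Shannon entropy `H(A)` in bits. -/
def entropy {Ω α : Type*} [Fintype Ω] [Fintype α] (μ : Ω → ℝ) (A : Ω → α) : ℝ :=
  (∑ a, Real.negMulLog (prob μ (fun ω => A ω = a))) / Real.log 2

/-- Conditional entropy `H(A | B) = H(A, B) - H(B)`. -/
def condEntropy {Ω α β : Type*} [Fintype Ω] [Fintype α] [Fintype β]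
    (μ : Ω → ℝ) (A : Ω → α) (B : Ω → β) : ℝ :=
  entropy μ (fun ω => (A ω, B ω)) - entropy μ B

/-- Mutual information `I(A; B) = H(A) - H(A | B)`. -/
def mutualInfo {Ω α β : Type*} [Fintype Ω] [Fintype α] [Fintype β]
    (μ : Ω → ℝ) (A : Ω → α) (B : Ω → β) : ℝ :=
  entropy μ A - condEntropy μ A B

/-- Conditional mutual information `I(A; B | C) = H(A | C) - H(A | B, C)`. -/
def condMutualInfo {Ω α β γ : Type*} [Fintype Ω] [Fintype α] [Fintype β] [Fintype γ]
    (μ : Ω → ℝ) (A : Ω → α) (B : Ω → β) (C : Ω → γ) : ℝ :=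
  condEntropy μ A C - condEntropy μ A (fun ω => (B ω, C ω))

end Info

/-! ## Discrete memoryless broadcast channels -/

/-- A discrete memoryless broadcast channel `X → (Y, Z)`: the conditional law `P_{YZ|X}` of the
output `Y` of the legitimate receiver and the output `Z` of the eavesdropper. -/
abbrev DMBC (X Y Z : Type*) := X → PMF (Y × Z)

namespace DMBC

/-- The marginal channel `P_{Y|X}`. -/
def toY {X Y Z : Type*} (W : DMBC X Y Z) (x : X) : PMF Y := (W x).map Prod.fst

/-- The marginal channel `P_{Z|X}`. -/
def toZ {X Y Z : Type*} (W : DMBC X Y Z) (x : X) : PMF Z := (W x).map Prod.snd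

/-- The channel consists of independent channels: `P_{YZ|X} = P_{Y|X} P_{Z|X}`. -/
def IndependentChannels {X Y Z : Type*} (W : DMBC X Y Z) : Prop :=
  ∀ x y z, W x (y, z) = W.toY x y * W.toZ x z

/-- Stochastically degraded in favor of `Y`: there is a Markov chain `X ↔ Y' ↔ Z'` with
`P_{Y'|X} = P_{Y|X}` and `P_{Z'|X} = P_{Z|X}`; `D` is the conditional law of `Z'` given `Y'`. -/
def DegradedInFavorOfY {X Y Z : Type*} (W : DMBC X Y Z) : Prop :=
  ∃ D : Y → PMF Z, ∀ x, W.toZ x = (W.toY x).bind D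

/-- Stochastically degraded in favor of `Z`: there is a Markov chain `X ↔ Z' ↔ Y'` with
`P_{Y'|X} = P_{Y|X}` and `P_{Z'|X} = P_{Z|X}`. -/
def DegradedInFavorOfZ {X Y Z : Type*} (W : DMBC X Y Z) : Prop :=
  ∃ D : Z → PMF Y, ∀ x, W.toY x = (W.toZ x).bind D

/-- The joint law of `(X, Y, Z)` for the input law `P` of `X`. -/
def jointLaw {X Y Z : Type*} (W : DMBC X Y Z) (P : PMF X) : X × Y × Z → ℝ :=
  fun ω => (P ω.1).toReal * (W ω.1 ω.2).toReal

/-- The joint law of `(V, X, Y, Z)` for the input law `P` of `X` and the conditional law `Q` of `V`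
given `Y`, so that `V ↔ Y ↔ (X, Z)` is a Markov chain. -/
def jointLawAux {X Y Z V : Type*} (W : DMBC X Y Z) (P : PMF X) (Q : Y → PMF V) :
    V × X × Y × Z → ℝ :=
  fun ω => W.jointLaw P ω.2 * (Q ω.2.2.1 ω.1).toReal

section
variable {X Y Z : Type*} [Fintype X] [Fintype Y] [Fintype Z] (W : DMBC X Y Z) (P : PMF X)

/-- `I(X; Y)`. -/
def infoXY : ℝ := Info.mutualInfo (W.jointLaw P) (fun ω => ω.1) (fun ω => ω.2.1)

/-- `I(X; Z)`. -/
def infoXZ : ℝ := Info.mutualInfo (W.jointLaw P) (fun ω => ω.1) (fun ω => ω.2.2)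

/-- `I(V; X | Z)`, where `V` is generated from `Y` through `Q`. -/
def infoVXgivenZ {V : Type*} [Fintype V] (Q : Y → PMF V) : ℝ :=
  Info.condMutualInfo (W.jointLawAux P Q) (fun ω => ω.1) (fun ω => ω.2.1) (fun ω => ω.2.2.2)

/-- `I(V; Y | X)`, where `V` is generated from `Y` through `Q`. -/
def infoVYgivenX {V : Type*} [Fintype V] (Q : Y → PMF V) : ℝ :=
  Info.condMutualInfo (W.jointLawAux P Q) (fun ω => ω.1) (fun ω => ω.2.2.1) (fun ω => ω.2.1)

end

end DMBC

/-! ## Two-way setups and secret-key establishment protocols -/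

/-- The two legitimate parties. -/
inductive Party
  | alice
  | bob
  deriving DecidableEq

/-- The other legitimate party. -/
def Party.other : Party → Party
  | .alice => .bob
  | .bob => .alice

/-- A 2DMBC: `W p` is the DMBC from the party `p` to the other party and to Eve. Thus
`W Party.alice` is the forward channel and `W Party.bob` the backward channel. -/
abbrev TwoDMBC (X Y Z : Party → Type*) := (p : Party) → DMBC (X p) (Y p) (Z p)

/-- An sd-2DMBC: both DMBCs are stochastically degraded (each in favor of either receiver) and
consist of independent channels. -/
def TwoDMBC.IsSD {X Y Z : Party → Type*} (W : TwoDMBC X Y Z) : Prop :=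
  ∀ p, ((W p).DegradedInFavorOfY ∨ (W p).DegradedInFavorOfZ) ∧ (W p).IndependentChannels

/-- The communication schedule of a protocol: the number of rounds, the sender of each round and
the length of the sequence sent in it. -/
structure Schedule where
  rounds : ℕ
  sender : Fin rounds → Party
  len : Fin rounds → ℕ

namespace Schedule

/-- The number of uses of the channel from the party `p`. -/
def uses (σ : Schedule) (p : Party) : ℕ := ∑ r with σ.sender r = p, σ.len r

/-- Everything that happens on the channels: in round `r` with sender `p`, a sequence of
triples (input letter, output letter of the other party, output letter of Eve). -/
abbrev Transcript (σ : Schedule) (X Y Z : Party → Type*) :=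
  (r : Fin σ.rounds) → Fin (σ.len r) → X (σ.sender r) × Y (σ.sender r) × Z (σ.sender r)

/-- What the party `q` has seen before round `k`: the sequences it has sent and the sequences it
has received. -/
abbrev View (σ : Schedule) (X Y : Party → Type*) (q : Party) (k : ℕ) :=
  ((r : {r : Fin σ.rounds // (r : ℕ) < k ∧ σ.sender r = q}) →
      Fin (σ.len r) → X (σ.sender r)) ×
    ((r : {r : Fin σ.rounds // (r : ℕ) < k ∧ σ.sender r ≠ q}) →
      Fin (σ.len r) → Y (σ.sender r))

/-- What Eve has seen at the end: the sequences she has received in all rounds. -/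
abbrev EveView (σ : Schedule) (Z : Party → Type*) :=
  (r : Fin σ.rounds) → Fin (σ.len r) → Z (σ.sender r)

/-- The view of the party `q` before round `k` in a given transcript. -/
def view {σ : Schedule} {X Y Z : Party → Type*} (q : Party) (k : ℕ)
    (ω : σ.Transcript X Y Z) : σ.View X Y q k :=
  (fun r i => (ω r i).1, fun r i => (ω r i).2.1)

/-- Eve's view in a given transcript. -/
def eveView {σ : Schedule} {X Y Z : Party → Type*} (ω : σ.Transcript X Y Z) : σ.EveView Z :=
  fun r i => (ω r i).2.2

end Schedule

/-- A multi-round secret-key establishment protocol. In round `r` the sender draws the sequence to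
be sent from the law `enc r v`, where `v` is its view before that round (this is computing the
sequence from `v` and fresh independent randomness). At the end `holder` computes the key `S`, and
the other party its estimate `Ŝ`, each from its own full view. -/
structure Protocol (X Y : Party → Type*) extends Schedule where
  enc : (r : Fin rounds) →
    toSchedule.View X Y (sender r) r → PMF (Fin (len r) → X (sender r))
  keyCard : ℕ
  holder : Party
  key : (q : Party) → toSchedule.View X Y q rounds → Fin keyCard

namespace Protocol

section
variable {X Y Z : Party → Type*} (prot : Protocol X Y)

/-- The law of the transcript when the protocol runs over the memoryless channels `W`. -/
def law (W : TwoDMBC X Y Z) (ω : prot.toSchedule.Transcript X Y Z) : ℝ :=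
  ∏ r, ((prot.enc r (Schedule.view (prot.sender r) r ω) (fun i => (ω r i).1)).toReal *
    ∏ i, (W (prot.sender r) (ω r i).1 (ω r i).2).toReal)

/-- The key `S`. -/
def keyS (ω : prot.toSchedule.Transcript X Y Z) : Fin prot.keyCard :=
  prot.key prot.holder (Schedule.view prot.holder prot.rounds ω)

/-- The estimate `Ŝ` of the key. -/
def keyEst (ω : prot.toSchedule.Transcript X Y Z) : Fin prot.keyCard :=
  prot.key prot.holder.other (Schedule.view prot.holder.other prot.rounds ω)

/-- The party `a` only sends i.i.d. variables: all letters it sends, in all rounds, are drawn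
independently from one and the same law, independently of its view. -/
def SendsIID (a : Party) : Prop :=
  ∃ P : (p : Party) → PMF (X p), ∀ r, prot.sender r = a →
    ∀ v x, prot.enc r v x = ∏ i, P (prot.sender r) (x i)

variable [∀ p, Fintype (X p)] [∀ p, Fintype (Y p)] [∀ p, Fintype (Z p)]

/-- The protocol is `(R, δ)`-secure over `W`. The secrecy condition `H(S | View_E) / H(S) > 1 - δ`
is imposed when `H(S) ≠ 0`, that is, when the ratio makes sense. -/
def Secure (W : TwoDMBC X Y Z) (R δ : ℝ) : Prop :=
  0 < prot.uses .alice + prot.uses .bob ∧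
  Info.entropy (prot.law W) prot.keyS / ((prot.uses .alice : ℝ) + prot.uses .bob) > R - δ ∧
  Info.prob (prot.law W) (fun ω => prot.keyEst ω ≠ prot.keyS ω) < δ ∧
  (Info.entropy (prot.law W) prot.keyS ≠ 0 →
    Info.condEntropy (prot.law W) prot.keyS Schedule.eveView / Info.entropy (prot.law W) prot.keyS > 1 - δ)

end

end Protocol

namespace TwoDMBC

section
variable {X Y Z : Party → Type*} [∀ p, Fintype (X p)] [∀ p, Fintype (Y p)] [∀ p, Fintype (Z p)]
  (W : TwoDMBC X Y Z)

/-- The rates `R ≥ 0` such that for every `δ > 0` there is an `(R, δ)`-secure protocol in the class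
`C` of protocols. -/
def achievableRates (C : Protocol X Y → Prop) : Set ℝ :=
  {R | 0 ≤ R ∧ ∀ δ > 0, ∃ prot : Protocol X Y, C prot ∧ prot.Secure W R δ}

/-- `R` is the secret-key capacity over the protocols in the class `C`: the largest achievable
rate. -/
def IsSecretKeyCapacity (C : Protocol X Y → Prop) (R : ℝ) : Prop :=
  IsGreatest (W.achievableRates C) R

/-- The values over which the maximum in the definition of `L'` is taken. Here `n` uses of the
channel `X → (Y, Z)` from `a` are combined with `m` uses of the channel `X' → (Y', Z')` from the
other party, `V ↔ Y ↔ (X, Z)` is a Markov chain, and `X'` is independent of `(V, X, Y, Z)`. -/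
def lowerBoundValues (a : Party) : Set ℝ :=
  {ρ | ∃ (n m k : ℕ) (P : PMF (X a)) (Q : Y a → PMF (Fin k)) (P' : PMF (X a.other)),
    0 < n + m ∧
    n * (W a).infoVYgivenX P Q < m * (W a.other).infoXY P' ∧
    ρ = (n * (W a).infoVXgivenZ P Q +
      m * max 0 ((W a.other).infoXY P' - (W a.other).infoXZ P')) / ((n : ℝ) + m)}

/-- `L' Party.alice` is `L'_A` and `L' Party.bob` is `L'_B`. -/
def L' (a : Party) : ℝ := sSup (W.lowerBoundValues a)

end

end TwoDMBC

end

/-! Converse. If `a` sends i.i.d. letters, they may be thought of as drawn beforehand. A protocol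
with any number of rounds then has the law of a two-stage experiment (`Protocol.law_eq`,
`twoWayLaw`): a source (X, Y, Z), made of n independent uses of the channel of `a`, followed by m
uses of the other channel, whose input A is generated from Y and whose outputs are (B, C). The key
of the party that observes Y is a function T of (Y, A). For V = (T, B) the chain V - Y - (X, Z)
holds, and H(T | X, B) is small by Fano's inequality. Up to this error, I(V; Y | X) ≤ I(A; B)
(`infoVY_twoWayLaw_le`) and H(T | Z, C) ≤ I(V; X | Z) + [I(A; B) - I(A; C)]_+
(`condEntropy_twoWayLaw_le`); the second bound needs degradedness.

These bounds are brought to single letters in two ways. The auxiliary variable of a pair of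
independent triples splits into one for each triple (`exists_split_aux`), where the independence of
the two receivers' channels is needed; the gain I(A; B) - I(A; C) is subadditive and concave for
degraded channels (`exists_single_letter_input`). The result satisfies the constraint of `L'` only
up to a small slack, and `exists_le_L'_of_approx` shows that a small slack changes the bound by a
factor close to 1. If no choice satisfies the constraint, the channel towards `a` has constant rows,
so what `a` receives is only local randomness; the rate is then bounded by the wiretap gain of the
channel of `a`, which is at most `L' a.other`.

Achievability. Two rounds suffice. The party `a` sends i.i.d. letters; the other party, seeing Y,
draws V and an input A conditioned on lying in a fixed bin of a random binning, and sends A. The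
bins must be few enough for Y to leave mass in each of them, and numerous enough for (X, B) to
identify the point; a second bin index is the key, and it is almost uniform given (Z, C) if there
are not too many keys (`exists_key_agreement`). For long blocks, Chernoff's bound turns these
conditions into inequalities between conditional entropies. The first two are compatible exactly
because n I(V; Y | X) < m I(A; B), and the last one gives the rate (`eventually_exists_key_of_lt`).
When the wiretap gain is not positive, A is first restricted to a random code that B can decode, and
secrecy comes from the source alone. -/

open scoped BigOperators

noncomputable section

/-! ### Laws, entropy, Gibbs' inequality and submodularity -/

namespace Info

/-- `μ` is the mass function of a probability law. -/
structure IsLaw {Ω : Type*} [Fintype Ω] (μ : Ω → ℝ) : Prop where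
  nonneg : ∀ ω, 0 ≤ μ ω
  sum_eq : ∑ ω, μ ω = 1

/-- The law of the random variable `A` under `μ`. -/
def push {Ω α : Type*} [Fintype Ω] (μ : Ω → ℝ) (A : Ω → α) (a : α) : ℝ :=
  prob μ (fun ω => A ω = a)

/-- The entropy of a mass function, in bits. -/
def ent {α : Type*} [Fintype α] (p : α → ℝ) : ℝ := (∑ a, Real.negMulLog (p a)) / Real.log 2

section
set_option linter.unusedSectionVars false
variable {Ω Ω' α β γ : Type*} [Fintype Ω] [Fintype Ω'] [Fintype α] [Fintype β] [Fintype γ]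

theorem log_two_pos : 0 < Real.log 2 := Real.log_pos one_lt_two

theorem prob_eq_sum_ite (μ : Ω → ℝ) (E : Ω → Prop) [DecidablePred E] :
    prob μ E = ∑ ω, if E ω then μ ω else 0 := by
  rw [prob, Finset.sum_filter]
  exact Finset.sum_congr rfl fun ω _ => by congr

theorem prob_congr {μ : Ω → ℝ} {E F : Ω → Prop} (h : ∀ ω, E ω ↔ F ω) : prob μ E = prob μ F := by
  have : E = F := funext fun ω => propext (h ω)
  rw [this]

theorem prob_mono {μ : Ω → ℝ} (hμ : ∀ ω, 0 ≤ μ ω) {E F : Ω → Prop} (h : ∀ ω, E ω → F ω) :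
    prob μ E ≤ prob μ F := by
  classical
  rw [prob_eq_sum_ite, prob_eq_sum_ite]
  refine Finset.sum_le_sum fun ω _ => ?_
  by_cases hE : E ω
  · simp [hE, h ω hE]
  · by_cases hF : F ω <;> simp [hE, hF, hμ ω]

theorem prob_nonneg {μ : Ω → ℝ} (hμ : ∀ ω, 0 ≤ μ ω) (E : Ω → Prop) : 0 ≤ prob μ E :=
  Finset.sum_nonneg fun ω _ => hμ ω

theorem prob_le_one {μ : Ω → ℝ} (hμ : IsLaw μ) (E : Ω → Prop) : prob μ E ≤ 1 := by
  classical
  rw [← hμ.sum_eq, prob_eq_sum_ite]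
  exact Finset.sum_le_sum fun ω _ => by split_ifs <;> simp [hμ.nonneg ω]

theorem prob_or_le {μ : Ω → ℝ} (hμ : ∀ ω, 0 ≤ μ ω) (E F : Ω → Prop) :
    prob μ (fun ω => E ω ∨ F ω) ≤ prob μ E + prob μ F := by
  classical
  rw [prob_eq_sum_ite, prob_eq_sum_ite, prob_eq_sum_ite, ← Finset.sum_add_distrib]
  refine Finset.sum_le_sum fun ω _ => ?_
  have := hμ ω
  by_cases hE : E ω <;> by_cases hF : F ω <;> simp [hE, hF, this]

theorem push_nonneg {Ω α : Type*} [Fintype Ω] {μ : Ω → ℝ} (hμ : ∀ ω, 0 ≤ μ ω) (A : Ω → α) (a : α) : 0 ≤ push μ A a :=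
  prob_nonneg hμ _

theorem push_apply {Ω α : Type*} [Fintype Ω] [DecidableEq α] (μ : Ω → ℝ) (A : Ω → α) (a : α) :
    push μ A a = ∑ ω, if A ω = a then μ ω else 0 := prob_eq_sum_ite _ _

/-- Change of variables for expectations; most facts about `push` reduce to it. -/
theorem sum_push_mul (μ : Ω → ℝ) (A : Ω → α) (g : α → ℝ) :
    ∑ a, push μ A a * g a = ∑ ω, μ ω * g (A ω) := by
  classical
  simp_rw [push_apply, Finset.sum_mul]
  rw [Finset.sum_comm]
  refine Finset.sum_congr rfl fun ω _ => ?_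
  simp [ite_mul]

theorem sum_push (μ : Ω → ℝ) (A : Ω → α) : ∑ a, push μ A a = ∑ ω, μ ω := by
  simpa using sum_push_mul μ A (fun _ => 1)

theorem IsLaw.push {μ : Ω → ℝ} (hμ : IsLaw μ) (A : Ω → α) : IsLaw (push μ A) :=
  ⟨push_nonneg hμ.nonneg A, by rw [sum_push, hμ.sum_eq]⟩

theorem prob_push (μ : Ω → ℝ) (A : Ω → α) (E : α → Prop) :
    prob (push μ A) E = prob μ (fun ω => E (A ω)) := by
  classical
  rw [prob_eq_sum_ite, prob_eq_sum_ite]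
  simpa using sum_push_mul μ A (fun a => if E a then 1 else 0)

theorem push_push {Ω α β : Type*} [Fintype Ω] [Fintype α] (μ : Ω → ℝ) (A : Ω → α) (f : α → β) :
    push (push μ A) f = push μ (fun ω => f (A ω)) := by
  funext b
  exact prob_push μ A (fun a => f a = b)

theorem push_id (μ : Ω → ℝ) : push μ (fun ω => ω) = μ := by
  classical
  funext a
  simp [push_apply]

theorem entropy_eq_ent (μ : Ω → ℝ) (A : Ω → α) : entropy μ A = ent (push μ A) := rfl

theorem entropy_congr_push {μ : Ω → ℝ} {ν : Ω' → ℝ} {A : Ω → α} {B : Ω' → α}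
    (h : push μ A = push ν B) : entropy μ A = entropy ν B := by
  rw [entropy_eq_ent, entropy_eq_ent, h]

theorem entropy_push (μ : Ω → ℝ) (A : Ω → α) (f : α → β) :
    entropy (push μ A) f = entropy μ (fun ω => f (A ω)) := by
  rw [entropy_eq_ent, push_push, entropy_eq_ent]

theorem entropy_eq_sum (μ : Ω → ℝ) (A : Ω → α) :
    entropy μ A = -(∑ ω, μ ω * Real.log (push μ A (A ω))) / Real.log 2 := by
  rw [entropy_eq_ent, ent, ← sum_push_mul μ A (fun a => Real.log (push μ A a))]
  congr 1
  rw [← Finset.sum_neg_distrib]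
  exact Finset.sum_congr rfl fun a _ => by rw [Real.negMulLog]; ring

/-- Random variables that determine each other have the same entropy. -/
theorem entropy_congr {μ : Ω → ℝ} {A : Ω → α} {B : Ω → β}
    (h : ∀ ω ω', A ω = A ω' ↔ B ω = B ω') : entropy μ A = entropy μ B := by
  rw [entropy_eq_sum, entropy_eq_sum]
  have : ∀ ω, push μ A (A ω) = push μ B (B ω) := fun ω => prob_congr fun ω' => h ω' ω
  simp_rw [this]

theorem le_push_self {μ : Ω → ℝ} (hμ : ∀ ω, 0 ≤ μ ω) (A : Ω → α) (ω : Ω) :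
    μ ω ≤ push μ A (A ω) := by
  classical
  rw [push_apply]
  have := Finset.single_le_sum (f := fun ω' => if A ω' = A ω then μ ω' else 0)
    (fun ω' _ => by split_ifs <;> simp [hμ ω']) (Finset.mem_univ ω)
  simpa using this

theorem push_le_push {Ω α β : Type*} [Fintype Ω] {μ : Ω → ℝ} (hμ : ∀ ω, 0 ≤ μ ω) {A : Ω → α} {B : Ω → β} {a : α} {b : β}
    (h : ∀ ω, A ω = a → B ω = b) : push μ A a ≤ push μ B b := prob_mono hμ h

theorem push_le_one {Ω α : Type*} [Fintype Ω] {μ : Ω → ℝ} (hμ : IsLaw μ) (A : Ω → α) (a : α) : push μ A a ≤ 1 :=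
  prob_le_one hμ _

theorem entropy_nonneg {μ : Ω → ℝ} (hμ : IsLaw μ) (A : Ω → α) : 0 ≤ entropy μ A :=
  div_nonneg (Finset.sum_nonneg fun a _ =>
    Real.negMulLog_nonneg (push_nonneg hμ.nonneg A a) (push_le_one hμ A a)) log_two_pos.le

theorem sum_push_pair_left (μ : Ω → ℝ) (A : Ω → α) (B : Ω → β) (b : β) :
    ∑ a, push μ (fun ω => (A ω, B ω)) (a, b) = push μ B b := by
  classical
  simp_rw [push_apply]
  rw [Finset.sum_comm]
  refine Finset.sum_congr rfl fun ω _ => ?_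
  simp [Prod.ext_iff, ite_and]

theorem sum_push_pair_right (μ : Ω → ℝ) (A : Ω → α) (B : Ω → β) (a : α) :
    ∑ b, push μ (fun ω => (A ω, B ω)) (a, b) = push μ A a := by
  classical
  simp_rw [push_apply]
  rw [Finset.sum_comm]
  refine Finset.sum_congr rfl fun ω _ => ?_
  simp [Prod.ext_iff, ite_and]

/-- Pointwise Gibbs inequality. -/
theorem sub_le_mul_log_sub {p q : ℝ} (hp : 0 ≤ p) (hq : 0 ≤ q) (h : q = 0 → p = 0) :
    p - q ≤ p * Real.log p - p * Real.log q := by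
  rcases hp.eq_or_lt with rfl | hp
  · simpa using hq
  have hq' : 0 < q := lt_of_le_of_ne hq fun h' => hp.ne' (h h'.symm)
  have h1 := Real.log_le_sub_one_of_pos (div_pos hq' hp)
  rw [Real.log_div hq'.ne' hp.ne'] at h1
  have h2 := mul_le_mul_of_nonneg_left h1 hp.le
  have h3 : p * (q / p - 1) = q - p := by field_simp
  linarith

theorem eq_of_mul_log_sub_eq {p q : ℝ} (hp : 0 ≤ p) (h : q = 0 → p = 0) (hq : 0 ≤ q)
    (heq : p * Real.log p - p * Real.log q = p - q) : p = q := by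
  rcases hp.eq_or_lt with rfl | hp
  · simp at heq; linarith
  have hq' : 0 < q := lt_of_le_of_ne hq fun h' => hp.ne' (h h'.symm)
  by_contra hne
  have h1 := Real.log_lt_sub_one_of_pos (div_pos hq' hp) (fun h' => hne (by
    rw [div_eq_one_iff_eq hp.ne'] at h'; exact h'.symm))
  rw [Real.log_div hq'.ne' hp.ne'] at h1
  have h2 := mul_lt_mul_of_pos_left h1 hp
  have h3 : p * (q / p - 1) = q - p := by field_simp
  linarith

/-- Gibbs' inequality. -/
theorem gibbs {p q : α → ℝ} (hp : ∀ a, 0 ≤ p a) (hq : ∀ a, 0 ≤ q a) (h : ∀ a, q a = 0 → p a = 0)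
    (hs : ∑ a, q a ≤ ∑ a, p a) : ∑ a, p a * Real.log (q a) ≤ ∑ a, p a * Real.log (p a) := by
  have := Finset.sum_le_sum fun a (_ : a ∈ Finset.univ) => sub_le_mul_log_sub (hp a) (hq a) (h a)
  rw [Finset.sum_sub_distrib, Finset.sum_sub_distrib] at this
  linarith

/-- The terms of the divergence are nonnegative, so each of them vanishes when the sum does. This
serves to show that a channel that never conveys information has constant rows. -/
theorem gibbs_eq {p q : α → ℝ} (hp : ∀ a, 0 ≤ p a) (hq : ∀ a, 0 ≤ q a) (h : ∀ a, q a = 0 → p a = 0)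
    (hs : ∑ a, q a = ∑ a, p a) (he : ∑ a, p a * Real.log (q a) = ∑ a, p a * Real.log (p a)) (a : α) :
    p a = q a := by
  have h0 : ∑ a, (p a * Real.log (p a) - p a * Real.log (q a) - (p a - q a)) = 0 := by
    rw [Finset.sum_sub_distrib, Finset.sum_sub_distrib, Finset.sum_sub_distrib]; linarith
  have h1 := (Finset.sum_eq_zero_iff_of_nonneg fun a _ =>
    sub_nonneg.2 (sub_le_mul_log_sub (hp a) (hq a) (h a))).1 h0 a (Finset.mem_univ a)
  exact eq_of_mul_log_sub_eq (hp a) (h a) (hq a) (sub_eq_zero.1 h1)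

/-- Submodularity of entropy. -/
theorem entropy_submodular {μ : Ω → ℝ} (hμ : IsLaw μ) (A : Ω → α) (B : Ω → β) (C : Ω → γ) :
    entropy μ (fun ω => (A ω, B ω, C ω)) + entropy μ C ≤
      entropy μ (fun ω => (A ω, C ω)) + entropy μ (fun ω => (B ω, C ω)) := by
  set p := push μ (fun ω => (A ω, B ω, C ω)) with hp
  set pac := push μ (fun ω => (A ω, C ω)) with hpac
  set pbc := push μ (fun ω => (B ω, C ω)) with hpbc
  set pc := push μ C with hpc
  have n1 : ∀ a, 0 ≤ p a := push_nonneg hμ.nonneg _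
  have n2 : ∀ a, 0 ≤ pac a := push_nonneg hμ.nonneg _
  have n3 : ∀ a, 0 ≤ pbc a := push_nonneg hμ.nonneg _
  have n4 : ∀ a, 0 ≤ pc a := push_nonneg hμ.nonneg _
  have l1 : ∀ a b c, p (a, b, c) ≤ pac (a, c) := fun a b c =>
    push_le_push hμ.nonneg (by simp +contextual)
  have l2 : ∀ a b c, p (a, b, c) ≤ pbc (b, c) := fun a b c =>
    push_le_push hμ.nonneg (by simp +contextual)
  have l3 : ∀ a c, pac (a, c) ≤ pc c := fun a c =>
    push_le_push hμ.nonneg (by simp +contextual)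
  -- The comparison law p(a,c) p(b,c) / p(c) makes A and B independent given C; submodularity is the
  -- nonnegativity of the divergence from it.
  have key := gibbs (p := p) (q := fun x => pac (x.1, x.2.2) * pbc x.2 / pc x.2.2) n1
    (fun x => div_nonneg (mul_nonneg (n2 _) (n3 _)) (n4 _))
    (fun ⟨a, b, c⟩ h => by
      simp only [div_eq_zero_iff, mul_eq_zero] at h
      have := l1 a b c
      have := l2 a b c
      have := l3 a c
      have := n1 (a, b, c)
      rcases h with (h | h) | h <;> linarith)
    (by
      have e1 : ∑ x : α × β × γ, pac (x.1, x.2.2) * pbc x.2 / pc x.2.2 = ∑ c, pc c * pc c / pc c := by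
        rw [Fintype.sum_prod_type]
        simp_rw [Fintype.sum_prod_type]
        rw [Finset.sum_comm]
        simp_rw [Finset.sum_comm (s := (Finset.univ : Finset α))]
        rw [Finset.sum_comm]
        refine Finset.sum_congr rfl fun c _ => ?_
        simp_rw [← Finset.sum_div, ← Finset.sum_mul, ← Finset.mul_sum]
        rw [hpac, hpbc, sum_push_pair_left, sum_push_pair_left]
      rw [e1, hp, sum_push, hμ.sum_eq, ← hμ.sum_eq, ← sum_push μ C]
      exact le_of_eq (Finset.sum_congr rfl fun c _ => by rw [mul_self_div_self]))
  have e2 : ∑ x, p x * Real.log (pac (x.1, x.2.2) * pbc x.2 / pc x.2.2) =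
      ∑ x, p x * (Real.log (pac (x.1, x.2.2)) + Real.log (pbc x.2) - Real.log (pc x.2.2)) := by
    refine Finset.sum_congr rfl fun ⟨a, b, c⟩ _ => ?_
    rcases (n1 (a, b, c)).eq_or_lt with h | h
    · rw [← h]; ring
    · have := l1 a b c
      have := l2 a b c
      have := l3 a c
      have h1 : 0 < pac (a, c) := by linarith
      have h2 : 0 < pbc (b, c) := by linarith
      have h3 : 0 < pc c := by linarith
      simp only
      rw [Real.log_div (mul_pos h1 h2).ne' h3.ne', Real.log_mul h1.ne' h2.ne']
  rw [e2, hp, sum_push_mul μ, sum_push_mul μ] at key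
  simp only [mul_add, mul_sub, Finset.sum_add_distrib, Finset.sum_sub_distrib] at key
  simp only [entropy_eq_sum]
  rw [← add_div, ← add_div]
  refine div_le_div_of_nonneg_right ?_ log_two_pos.le
  linarith

end
end Info

/-! ### Conditional entropy, Fano's inequality and Markov chains -/

namespace Info

section
set_option linter.unusedSectionVars false
variable {Ω Ω' α β γ δ : Type*} [Fintype Ω] [Fintype Ω'] [Fintype α] [Fintype β] [Fintype γ]
  [Fintype δ]

theorem entropy_le_log_card {μ : Ω → ℝ} (hμ : IsLaw μ) (A : Ω → α) :
    entropy μ A ≤ Real.log (Fintype.card α) / Real.log 2 := by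
  have hne : Nonempty α := by
    by_contra h
    rw [not_nonempty_iff] at h
    have : IsEmpty Ω := ⟨fun ω => h.elim (A ω)⟩
    simpa using hμ.sum_eq
  have hc : (0 : ℝ) < Fintype.card α := by exact_mod_cast Fintype.card_pos
  have key := gibbs (p := push μ A) (q := fun _ => (Fintype.card α : ℝ)⁻¹)
    (push_nonneg hμ.nonneg A) (fun _ => by positivity)
    (fun a h => absurd h (by positivity))
    (by rw [sum_push, hμ.sum_eq]; simp [hc.ne'])
  rw [← Finset.sum_mul, sum_push, hμ.sum_eq, Real.log_inv, sum_push_mul μ A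
    (fun a => Real.log (push μ A a))] at key
  rw [entropy_eq_sum]
  refine div_le_div_of_nonneg_right ?_ log_two_pos.le
  linarith

theorem push_const {μ : Ω → ℝ} (hμ : IsLaw μ) (c : α) : push μ (fun _ => c) c = 1 := by
  classical
  rw [push_apply]
  simp [hμ.sum_eq]

theorem entropy_const {μ : Ω → ℝ} (hμ : IsLaw μ) {A : Ω → α} (h : ∀ ω ω', A ω = A ω') :
    entropy μ A = 0 := by
  rw [entropy_congr (B := fun _ => ()) (by simpa using h)]
  rw [entropy_eq_sum]
  simp [push_const hμ]

/-- Conditioning on a third variable: `H(A | B, C) ≤ H(A | C)`. -/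
theorem condEntropy_le_condEntropy {μ : Ω → ℝ} (hμ : IsLaw μ) {A : Ω → α} {B : Ω → β} {C : Ω → γ}
    (h : ∀ ω ω', B ω = B ω' → C ω = C ω') : condEntropy μ A B ≤ condEntropy μ A C := by
  have h1 := entropy_submodular hμ A B C
  have h2 : entropy μ (fun ω => (A ω, B ω, C ω)) = entropy μ (fun ω => (A ω, B ω)) :=
    entropy_congr fun ω ω' => by
      have := h ω ω'
      simp only [Prod.mk.injEq]; tauto
  have h3 : entropy μ (fun ω => (B ω, C ω)) = entropy μ B :=
    entropy_congr fun ω ω' => by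
      have := h ω ω'
      simp only [Prod.mk.injEq]; tauto
  rw [condEntropy, condEntropy]
  linarith

theorem entropy_mono {μ : Ω → ℝ} (hμ : IsLaw μ) {A : Ω → α} {B : Ω → β}
    (h : ∀ ω ω', A ω = A ω' → B ω = B ω') : entropy μ B ≤ entropy μ A := by
  have h1 : entropy μ (fun ω => (A ω, B ω)) = entropy μ A :=
    entropy_congr fun ω ω' => by
      have := h ω ω'
      simp only [Prod.mk.injEq]; tauto
  -- `H(A, A, B) + H(B) ≤ H(A, B) + H(A, B)`
  have h2 := entropy_submodular hμ A A B
  have h3 : entropy μ (fun ω => (A ω, A ω, B ω)) = entropy μ A :=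
    entropy_congr fun ω ω' => by
      have := h ω ω'
      simp only [Prod.mk.injEq]; tauto
  linarith

theorem condEntropy_nonneg {μ : Ω → ℝ} (hμ : IsLaw μ) (A : Ω → α) (B : Ω → β) :
    0 ≤ condEntropy μ A B :=
  sub_nonneg.2 (entropy_mono hμ (by simp +contextual))

theorem condEntropy_le_entropy {μ : Ω → ℝ} (hμ : IsLaw μ) (A : Ω → α) (B : Ω → β) :
    condEntropy μ A B ≤ entropy μ A := by
  have := condEntropy_le_condEntropy hμ (A := A) (B := B) (C := fun _ => ()) (by simp)
  refine this.trans (le_of_eq ?_)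
  rw [condEntropy, entropy_const hμ (A := fun _ => ()) (by simp), sub_zero]
  exact entropy_congr (by simp)

theorem condEntropy_mono_left {μ : Ω → ℝ} (hμ : IsLaw μ) {A : Ω → α} {B : Ω → β} {C : Ω → γ}
    (h : ∀ ω ω', C ω = C ω' → A ω = A ω' → B ω = B ω') : condEntropy μ B C ≤ condEntropy μ A C := by
  have : entropy μ (fun ω => (B ω, C ω)) ≤ entropy μ (fun ω => (A ω, C ω)) :=
    entropy_mono hμ fun ω ω' => by
      have := h ω ω'
      simp only [Prod.mk.injEq]; tauto
  rw [condEntropy, condEntropy]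
  linarith

theorem condEntropy_congr {μ : Ω → ℝ} {A : Ω → α} {B : Ω → β} {C : Ω → γ} {D : Ω → δ}
    (h1 : ∀ ω ω', (A ω = A ω' ∧ B ω = B ω') ↔ (C ω = C ω' ∧ D ω = D ω'))
    (h2 : ∀ ω ω', B ω = B ω' ↔ D ω = D ω') : condEntropy μ A B = condEntropy μ C D := by
  rw [condEntropy, condEntropy, entropy_congr h2,
    entropy_congr (A := fun ω => (A ω, B ω)) (B := fun ω => (C ω, D ω))
      fun ω ω' => by simpa only [Prod.mk.injEq] using h1 ω ω']

theorem mutualInfo_nonneg {μ : Ω → ℝ} (hμ : IsLaw μ) (A : Ω → α) (B : Ω → β) :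
    0 ≤ mutualInfo μ A B := sub_nonneg.2 (condEntropy_le_entropy hμ A B)

theorem condMutualInfo_nonneg {μ : Ω → ℝ} (hμ : IsLaw μ) (A : Ω → α) (B : Ω → β) (C : Ω → γ) :
    0 ≤ condMutualInfo μ A B C :=
  sub_nonneg.2 (condEntropy_le_condEntropy hμ (by simp +contextual))

theorem condMutualInfo_congr_push {μ : Ω → ℝ} {ν : Ω' → ℝ} {A : Ω → α} {B : Ω → β} {C : Ω → γ}
    {A' : Ω' → α} {B' : Ω' → β} {C' : Ω' → γ}
    (h : push μ (fun ω => (A ω, B ω, C ω)) = push ν (fun ω => (A' ω, B' ω, C' ω))) :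
    condMutualInfo μ A B C = condMutualInfo ν A' B' C' := by
  have h1 : entropy μ (fun ω => (A ω, C ω)) = entropy ν (fun ω => (A' ω, C' ω)) := by
    rw [← entropy_push μ (fun ω => (A ω, B ω, C ω)) (fun x => (x.1, x.2.2)), h, entropy_push]
  have h2 : entropy μ C = entropy ν C' := by
    rw [← entropy_push μ (fun ω => (A ω, B ω, C ω)) (fun x => x.2.2), h, entropy_push]
  have h3 : entropy μ (fun ω => (B ω, C ω)) = entropy ν (fun ω => (B' ω, C' ω)) := by
    rw [← entropy_push μ (fun ω => (A ω, B ω, C ω)) (fun x => x.2), h, entropy_push]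
  have h4 : entropy μ (fun ω => (A ω, B ω, C ω)) = entropy ν (fun ω => (A' ω, B' ω, C' ω)) :=
    entropy_congr_push h
  rw [condMutualInfo, condMutualInfo, condEntropy, condEntropy, condEntropy, condEntropy,
    h1, h2, h3, h4]

theorem condEntropy_congr_push {μ : Ω → ℝ} {ν : Ω' → ℝ} {A : Ω → α} {B : Ω → β}
    {A' : Ω' → α} {B' : Ω' → β}
    (h : push μ (fun ω => (A ω, B ω)) = push ν (fun ω => (A' ω, B' ω))) :
    condEntropy μ A B = condEntropy ν A' B' := by
  have h2 : entropy μ B = entropy ν B' := by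
    rw [← entropy_push μ (fun ω => (A ω, B ω)) (fun x => x.2), h, entropy_push]
  rw [condEntropy, condEntropy, entropy_congr_push h, h2]

theorem mutualInfo_congr_push {μ : Ω → ℝ} {ν : Ω' → ℝ} {A : Ω → α} {B : Ω → β}
    {A' : Ω' → α} {B' : Ω' → β}
    (h : push μ (fun ω => (A ω, B ω)) = push ν (fun ω => (A' ω, B' ω))) :
    mutualInfo μ A B = mutualInfo ν A' B' := by
  have h2 : entropy μ A = entropy ν A' := by
    rw [← entropy_push μ (fun ω => (A ω, B ω)) (fun x => x.1), h, entropy_push]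
  rw [mutualInfo, mutualInfo, condEntropy_congr_push h, h2]

/-- Fano's inequality, for a variable `T` with values in `R` and its estimate `S`. -/
theorem fano {μ : Ω → ℝ} (hμ : IsLaw μ) (T S : Ω → α) (R : Finset α) (hR : ∀ ω, T ω ∈ R) :
    condEntropy μ T S ≤ (Real.binEntropy (prob μ (fun ω => T ω ≠ S ω)) +
      prob μ (fun ω => T ω ≠ S ω) * Real.log R.card) / Real.log 2 := by
  classical
  set e := prob μ (fun ω => T ω ≠ S ω) with he
  have he0 : 0 ≤ e := prob_nonneg hμ.nonneg _
  have he1 : e ≤ 1 := prob_le_one hμ _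
  have hcompl : prob μ (fun ω => T ω = S ω) = 1 - e := by
    rw [he, ← hμ.sum_eq, prob_eq_sum_ite, prob_eq_sum_ite, ← Finset.sum_sub_distrib]
    exact Finset.sum_congr rfl fun ω _ => by by_cases h : T ω = S ω <;> simp [h]
  have hRpos : 0 < (R.card : ℝ) := by
    have : Nonempty Ω := by
      by_contra h
      rw [not_nonempty_iff] at h
      simpa using hμ.sum_eq
    exact_mod_cast Finset.card_pos.2 ⟨_, hR (Classical.arbitrary Ω)⟩
  -- The comparison kernel keeps T = S with probability 1 - e and spreads e over `R`. Its rows may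
  -- fall short of mass 1, which Gibbs' inequality allows. The size of `α` itself never enters.
  set k : α → α → ℝ := fun t s => if t = s then 1 - e else if t ∈ R then e / R.card else 0 with hk
  have hk0 : ∀ t s, 0 ≤ k t s := fun t s => by
    simp only [hk]; split_ifs
    · linarith
    · positivity
    · exact le_rfl
  set P := push μ (fun ω => (T ω, S ω)) with hP
  have hPn : ∀ x, 0 ≤ P x := push_nonneg hμ.nonneg _
  have hPz : ∀ t s, t ∉ R → P (t, s) = 0 := fun t s ht => by
    rw [hP, push_apply]
    refine Finset.sum_eq_zero fun ω _ => if_neg fun h => ht ?_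
    rw [Prod.mk.injEq] at h; rw [← h.1]; exact hR ω
  have hPs : ∀ t s, P (t, s) ≤ push μ S s := fun t s => push_le_push hμ.nonneg (by simp +contextual)
  have hPe : ∀ t s, t ≠ s → P (t, s) ≤ e := fun t s hts => prob_mono hμ.nonneg fun ω h => by
    rw [Prod.mk.injEq] at h; rw [h.1, h.2]; exact hts
  have hPd : ∀ t, P (t, t) ≤ 1 - e := fun t => by
    rw [← hcompl]
    exact prob_mono hμ.nonneg fun ω h => by
      rw [Prod.mk.injEq] at h; rw [h.1, h.2]
  have hkz : ∀ t s, k t s = 0 → P (t, s) = 0 := fun t s h => by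
    simp only [hk] at h
    split_ifs at h with h1 h2
    · subst h1
      have := hPd t; have := hPn (t, t); linarith
    · have := hPe t s h1; have := hPn (t, s)
      have : e = 0 := by rcases div_eq_zero_iff.1 h with h | h <;> [exact h; linarith]
      linarith
    · exact hPz t s h2
  have key := gibbs (p := P) (q := fun x => push μ S x.2 * k x.1 x.2) hPn
    (fun x => mul_nonneg (push_nonneg hμ.nonneg _ _) (hk0 _ _))
    (fun ⟨t, s⟩ h => by
      rcases mul_eq_zero.1 h with h | h
      · have := hPs t s; have := hPn (t, s); simp only at h; linarith
      · exact hkz t s h)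
    (by
      rw [hP, sum_push, ← sum_push μ S, Fintype.sum_prod_type, Finset.sum_comm]
      refine Finset.sum_le_sum fun s _ => ?_
      simp only
      rw [← Finset.mul_sum]
      refine mul_le_of_le_one_right (push_nonneg hμ.nonneg _ _) ?_
      have : ∀ t, k t s ≤ (if t = s then 1 - e else 0) + (if t ∈ R then e / R.card else 0) := by
        intro t
        have : 0 ≤ e / R.card := by positivity
        simp only [hk]; split_ifs <;> linarith
      refine (Finset.sum_le_sum fun t _ => this t).trans ?_
      rw [Finset.sum_add_distrib, Finset.sum_ite_eq' Finset.univ s, ← Finset.sum_filter]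
      simp
      field_simp
      linarith)
  have e1 : ∑ x, P x * Real.log (push μ S x.2 * k x.1 x.2) =
      ∑ x, P x * (Real.log (push μ S x.2) +
        (if x.1 = x.2 then Real.log (1 - e) else Real.log e - Real.log R.card)) := by
    refine Finset.sum_congr rfl fun ⟨t, s⟩ _ => ?_
    rcases (hPn (t, s)).eq_or_lt with h | h
    · rw [← h]; ring
    have h1 : 0 < push μ S s := h.trans_le (hPs t s)
    have h2 : k t s ≠ 0 := fun h' => h.ne' (hkz t s h')
    simp only
    rw [Real.log_mul h1.ne' h2]
    congr 2
    simp only [hk] at h2 ⊢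
    split_ifs at h2 ⊢ with h3 h4
    · rfl
    · exact Real.log_div (fun h0 => h2 (by rw [h0, zero_div])) hRpos.ne'
    · exact absurd rfl h2
  rw [e1, hP, sum_push_mul μ, sum_push_mul μ] at key
  have e2 : ∑ ω, μ ω * (if T ω = S ω then Real.log (1 - e) else Real.log e - Real.log R.card) =
      (1 - e) * Real.log (1 - e) + e * (Real.log e - Real.log R.card) := by
    rw [← hcompl, he, prob_eq_sum_ite, prob_eq_sum_ite, Finset.sum_mul, Finset.sum_mul,
      ← Finset.sum_add_distrib]
    refine Finset.sum_congr rfl fun ω _ => ?_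
    by_cases h : T ω = S ω <;> simp [h]
  simp only [mul_add, Finset.sum_add_distrib] at key
  rw [e2] at key
  rw [condEntropy, entropy_eq_sum, entropy_eq_sum, ← sub_div]
  refine div_le_div_of_nonneg_right ?_ log_two_pos.le
  rw [Real.binEntropy, Real.log_inv, Real.log_inv]
  linarith

/-- `B` is generated from `F` through the kernel `K`, given `U` (which determines `F`). -/
def Gen (μ : Ω → ℝ) (B : Ω → β) (U : Ω → α) (F : Ω → γ) (K : γ → β → ℝ) : Prop :=
  ∀ u b, push μ (fun ω => (U ω, B ω)) (u, b) =
    ∑ ω, μ ω * (open Classical in if U ω = u then K (F ω) b else 0)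

/-- The defining identity can be summed over the fibres of a function of `U`. The function `G` need
not determine `F`. -/
theorem Gen.coarsen {μ : Ω → ℝ} {B : Ω → β} {U : Ω → α} {F : Ω → γ} {K : γ → β → ℝ}
    (h : Gen μ B U F K) (G : Ω → δ) (hG : ∀ ω ω', U ω = U ω' → G ω = G ω') : Gen μ B G F K := by
  classical
  intro c b
  -- `g` factors `G` through `U`; the values that `U` never takes are sent to `none`.
  set g : α → Option δ := fun u => if hu : ∃ ω, U ω = u then some (G hu.choose) else none with hg
  have hgU : ∀ ω, g (U ω) = some (G ω) := fun ω => by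
    have hu : ∃ ω', U ω' = U ω := ⟨ω, rfl⟩
    simp only [hg, dif_pos hu]
    rw [hG _ _ hu.choose_spec]
  have h1 : push μ (fun ω => (G ω, B ω)) (c, b) =
      ∑ u, if g u = some c then push μ (fun ω => (U ω, B ω)) (u, b) else 0 := by
    simp_rw [push_apply]
    have h2 : ∀ u, (if g u = some c then ∑ ω, if (U ω, B ω) = (u, b) then μ ω else 0 else 0) =
        ∑ ω, if g u = some c then if (U ω, B ω) = (u, b) then μ ω else 0 else 0 := by
      intro u; split_ifs <;> simp
    simp_rw [h2]
    rw [Finset.sum_comm]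
    refine Finset.sum_congr rfl fun ω _ => ?_
    have : ∀ u, (if g u = some c then if (U ω, B ω) = (u, b) then μ ω else 0 else 0) =
        if U ω = u then (if (G ω, B ω) = (c, b) then μ ω else 0) else 0 := by
      intro u
      by_cases hu : U ω = u
      · subst hu; simp [hgU, ite_and]
      · simp [hu]
    simp_rw [this]
    simp
  rw [h1]
  simp_rw [h _ b]
  simp_rw [← Finset.sum_filter]
  rw [Finset.sum_comm]
  refine Finset.sum_congr rfl fun ω _ => ?_
  rw [← Finset.mul_sum, Finset.sum_filter]
  congr 1
  have : ∀ u, (if g u = some c then if U ω = u then K (F ω) b else 0 else 0) =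
      if U ω = u then (if G ω = c then K (F ω) b else 0) else 0 := by
    intro u
    by_cases hu : U ω = u
    · subst hu; simp [hgU]
    · simp [hu]
  simp_rw [this]
  simp

/-- The conditional entropy of `B` given anything between `F` and `U` is the average entropy of the
kernel. -/
theorem Gen.condEntropy_eq {μ : Ω → ℝ} {B : Ω → β} {U : Ω → α} {F : Ω → γ} {K : γ → β → ℝ}
    (h : Gen μ B U F K) (hK : ∀ c, ∑ b, K c b = 1) (G : Ω → δ)
    (hG : ∀ ω ω', U ω = U ω' → G ω = G ω') (hF : ∀ ω ω', G ω = G ω' → F ω = F ω') :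
    condEntropy μ B G = ∑ ω, μ ω * ent (K (F ω)) := by
  classical
  have h' := h.coarsen G hG
  -- As `G` determines `F`, the kernel is a function of `G`. The values that `G` never takes get a
  -- zero row, which does no harm because they have no mass.
  set k : δ → β → ℝ := fun c => if hc : ∃ ω, G ω = c then K (F hc.choose) else 0 with hk
  have hkG : ∀ ω, k (G ω) = K (F ω) := fun ω => by
    have hu : ∃ ω', G ω' = G ω := ⟨ω, rfl⟩
    simp only [hk, dif_pos hu]
    rw [hF _ _ hu.choose_spec]
  have hpush : ∀ c b, push μ (fun ω => (G ω, B ω)) (c, b) = push μ G c * k c b := by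
    intro c b
    rw [h' c b, push_apply, Finset.sum_mul]
    refine Finset.sum_congr rfl fun ω _ => ?_
    by_cases hc : G ω = c
    · subst hc; simp [hkG]
    · simp [hc]
  have hsum : ∀ c, (∑ b, k c b) * Real.negMulLog (push μ G c) = Real.negMulLog (push μ G c) := by
    intro c
    by_cases hc : ∃ ω, G ω = c
    · obtain ⟨ω, rfl⟩ := hc
      rw [hkG, hK, one_mul]
    · have : push μ G c = 0 := by
        rw [push_apply]
        exact Finset.sum_eq_zero fun ω _ => if_neg fun h => hc ⟨ω, h⟩
      simp [this]
  rw [condEntropy, entropy_congr (A := fun ω => (B ω, G ω)) (B := fun ω => (G ω, B ω))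
    (by intro ω ω'; simp only [Prod.mk.injEq]; tauto)]
  rw [entropy_eq_ent, entropy_eq_ent, ent, ent, ← sub_div, Fintype.sum_prod_type]
  simp_rw [hpush, Real.negMulLog_mul, Finset.sum_add_distrib, ← Finset.sum_mul, hsum]
  rw [add_sub_cancel_left]
  simp_rw [← Finset.mul_sum]
  rw [sum_push_mul μ G (fun c => ∑ b, Real.negMulLog (k c b)), Finset.sum_div]
  refine Finset.sum_congr rfl fun ω _ => ?_
  rw [hkG, ent, mul_div_assoc]

/-- This is the form in which Markov chains are used: changing the conditioning anywhere between `F`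
and `U` does not affect the entropy of `B`. Each use yields a linear identity between joint
entropies, ready for `linarith`. -/
theorem Gen.condEntropy_eq_condEntropy {μ : Ω → ℝ} {B : Ω → β} {U : Ω → α} {F : Ω → γ}
    {K : γ → β → ℝ} {ε : Type*} [Fintype ε]
    (h : Gen μ B U F K) (hK : ∀ c, ∑ b, K c b = 1) (G : Ω → δ) (G' : Ω → ε)
    (hG : ∀ ω ω', U ω = U ω' → G ω = G ω') (hF : ∀ ω ω', G ω = G ω' → F ω = F ω')
    (hG' : ∀ ω ω', U ω = U ω' → G' ω = G' ω') (hF' : ∀ ω ω', G' ω = G' ω' → F ω = F ω') :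
    condEntropy μ B G = condEntropy μ B G' := by
  rw [h.condEntropy_eq hK G hG hF, h.condEntropy_eq hK G' hG' hF']

/-- Markov chains are read off from a factorization of the mass function, after a regrouping of the
coordinates by `e`. -/
theorem gen_of_equiv {μ : Ω → ℝ} (e : Ω ≃ α × β) (m : α → ℝ) (F : α → γ) (K : γ → β → ℝ)
    (hK : ∀ c, ∑ b, K c b = 1) (h : ∀ x, μ (e.symm x) = m x.1 * K (F x.1) x.2) :
    Gen μ (fun ω => (e ω).2) (fun ω => (e ω).1) (fun ω => F (e ω).1) K := by
  classical
  intro u b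
  rw [push_apply, ← e.symm.sum_comp, ← e.symm.sum_comp, Fintype.sum_prod_type,
    Fintype.sum_prod_type]
  simp only [Equiv.apply_symm_apply, h]
  rw [Finset.sum_eq_single u (fun x _ hx => Finset.sum_eq_zero fun y _ => by simp [hx]) (by simp),
    Finset.sum_eq_single u (fun x _ hx => Finset.sum_eq_zero fun y _ => by simp [hx]) (by simp)]
  simp only [Prod.mk.injEq, true_and, if_true]
  rw [← Finset.sum_mul, ← Finset.mul_sum, hK, mul_one]
  simp

theorem Gen.fst {μ : Ω → ℝ} {B : Ω → β} {C : Ω → δ} {U : Ω → α} {F : Ω → γ} {K : γ → β × δ → ℝ}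
    (h : Gen μ (fun ω => (B ω, C ω)) U F K) : Gen μ B U F (fun c b => ∑ d, K c (b, d)) := by
  classical
  intro u b
  have : push μ (fun ω => (U ω, B ω)) (u, b) =
      ∑ d, push μ (fun ω => (U ω, B ω, C ω)) (u, b, d) := by
    rw [← sum_push_pair_right μ (fun ω => (U ω, B ω)) C (u, b)]
    refine Finset.sum_congr rfl fun d _ => prob_congr fun ω => ?_
    simp only [Prod.mk.injEq]; tauto
  rw [this]
  simp_rw [h u]
  rw [Finset.sum_comm]
  refine Finset.sum_congr rfl fun ω _ => ?_
  rw [← Finset.mul_sum]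
  congr 1
  split_ifs <;> simp

theorem Gen.snd {μ : Ω → ℝ} {B : Ω → β} {C : Ω → δ} {U : Ω → α} {F : Ω → γ} {K : γ → β × δ → ℝ}
    (h : Gen μ (fun ω => (B ω, C ω)) U F K) : Gen μ C U F (fun c d => ∑ b, K c (b, d)) := by
  classical
  intro u b
  have : push μ (fun ω => (U ω, C ω)) (u, b) =
      ∑ d, push μ (fun ω => (U ω, B ω, C ω)) (u, d, b) := by
    rw [← sum_push_pair_right μ (fun ω => (U ω, C ω)) B (u, b)]
    refine Finset.sum_congr rfl fun d _ => prob_congr fun ω => ?_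
    simp only [Prod.mk.injEq]; tauto
  rw [this]
  simp_rw [h u]
  rw [Finset.sum_comm]
  refine Finset.sum_congr rfl fun ω _ => ?_
  rw [← Finset.mul_sum]
  congr 1
  split_ifs <;> simp

end
end Info

/-! ### Kernels, channel information and degraded channels -/

namespace Info

/-- All rows of `K` are probability laws. -/
def IsKernel {α β : Type*} [Fintype β] (K : α → β → ℝ) : Prop := ∀ a, IsLaw (K a)

/-- The joint law of an input with law `m` and the output of the kernel `K`. -/
def comp {α β : Type*} (m : α → ℝ) (K : α → β → ℝ) (x : α × β) : ℝ := m x.1 * K x.1 x.2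

/-- The composition of kernels. -/
def kcomp {α β γ : Type*} [Fintype β] (K : α → β → ℝ) (L : β → γ → ℝ) (a : α) (c : γ) : ℝ :=
  ∑ b, K a b * L b c

/-- The mutual information between the input, with law `m`, and the output of the channel `K`. -/
def chanInfo {α β : Type*} [Fintype α] [Fintype β] (m : α → ℝ) (K : α → β → ℝ) : ℝ :=
  mutualInfo (comp m K) Prod.fst Prod.snd

/-- The first marginal of a kernel. -/
def kfst {α β γ : Type*} [Fintype γ] (K : α → β × γ → ℝ) (a : α) (b : β) : ℝ := ∑ c, K a (b, c)

/-- The second marginal of a kernel. -/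
def ksnd {α β γ : Type*} [Fintype β] (K : α → β × γ → ℝ) (a : α) (c : γ) : ℝ := ∑ b, K a (b, c)

/-- The channel `L` is a degraded version of the channel `K`. -/
def Degraded {α β γ : Type*} [Fintype β] [Fintype γ] (K : α → β → ℝ) (L : α → γ → ℝ) : Prop :=
  ∃ D : β → γ → ℝ, IsKernel D ∧ L = kcomp K D

section
set_option linter.unusedSectionVars false
variable {α β γ δ : Type*} [Fintype α] [Fintype β] [Fintype γ] [Fintype δ]

theorem isLaw_comp {m : α → ℝ} {K : α → β → ℝ} (hm : IsLaw m) (hK : IsKernel K) :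
    IsLaw (comp m K) := by
  refine ⟨fun x => mul_nonneg (hm.nonneg _) ((hK _).nonneg _), ?_⟩
  simp_rw [Fintype.sum_prod_type, comp, ← Finset.mul_sum, (hK _).sum_eq, mul_one, hm.sum_eq]

theorem IsKernel.kfst {K : α → β × γ → ℝ} (hK : IsKernel K) : IsKernel (kfst K) := fun a =>
  ⟨fun _ => Finset.sum_nonneg fun _ _ => (hK a).nonneg _, by
    rw [← (hK a).sum_eq, Fintype.sum_prod_type]; rfl⟩

theorem IsKernel.ksnd {K : α → β × γ → ℝ} (hK : IsKernel K) : IsKernel (ksnd K) := fun a =>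
  ⟨fun _ => Finset.sum_nonneg fun _ _ => (hK a).nonneg _, by
    rw [← (hK a).sum_eq, Fintype.sum_prod_type, Finset.sum_comm]; rfl⟩

theorem IsKernel.kcomp {K : α → β → ℝ} {L : β → γ → ℝ} (hK : IsKernel K) (hL : IsKernel L) :
    IsKernel (kcomp K L) := fun a =>
  ⟨fun _ => Finset.sum_nonneg fun _ _ => mul_nonneg ((hK a).nonneg _) ((hL _).nonneg _), by
    simp_rw [Info.kcomp]
    rw [Finset.sum_comm]
    simp_rw [← Finset.mul_sum, (hL _).sum_eq, mul_one, (hK a).sum_eq]⟩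

theorem push_comp_fst (m : α → ℝ) {K : α → β → ℝ} (hK : IsKernel K) (f : α → γ) :
    push (comp m K) (fun x => f x.1) = push m f := by
  classical
  funext c
  rw [push_apply, push_apply, Fintype.sum_prod_type]
  refine Finset.sum_congr rfl fun a _ => ?_
  simp only [comp]
  split_ifs
  · rw [← Finset.mul_sum, (hK a).sum_eq, mul_one]
  · simp

theorem push_comp_map (m : α → ℝ) (f : α → γ) (K : γ → β → ℝ) :
    push (comp m (fun a => K (f a))) (fun x => (f x.1, x.2)) = comp (push m f) K := by
  classical
  funext ⟨c, b⟩
  rw [push_apply, comp, push_apply, Fintype.sum_prod_type, Finset.sum_mul]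
  refine Finset.sum_congr rfl fun a _ => ?_
  by_cases h : f a = c
  · subst h; simp [comp]
  · simp [h]

theorem push_comp_comp (m : α → ℝ) (K : α → β → ℝ) (L : β → γ → ℝ) :
    push (comp (comp m K) (fun x => L x.2)) (fun x => (x.1.1, x.2)) = comp m (kcomp K L) := by
  classical
  funext ⟨a, c⟩
  rw [push_apply, Fintype.sum_prod_type, Fintype.sum_prod_type, comp, kcomp]
  rw [Finset.sum_eq_single a (fun x _ hx => by simp [hx]) (by simp)]
  simp [comp, Finset.mul_sum, mul_assoc]

theorem push_comp_kfst (m : α → ℝ) (K : α → β × γ → ℝ) :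
    push (comp m K) (fun x => (x.1, x.2.1)) = comp m (kfst K) := by
  classical
  funext ⟨a, b⟩
  rw [push_apply, Fintype.sum_prod_type, comp, kfst]
  rw [Finset.sum_eq_single a (fun x _ hx => by simp [hx]) (by simp)]
  rw [Fintype.sum_prod_type, Finset.sum_eq_single b (fun x _ hx => by simp [hx]) (by simp)]
  simp [comp, Finset.mul_sum]

theorem push_comp_ksnd (m : α → ℝ) (K : α → β × γ → ℝ) :
    push (comp m K) (fun x => (x.1, x.2.2)) = comp m (ksnd K) := by
  classical
  funext ⟨a, c⟩
  rw [push_apply, Fintype.sum_prod_type, comp, ksnd]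
  rw [Finset.sum_eq_single a (fun x _ hx => by simp [hx]) (by simp)]
  rw [Fintype.sum_prod_type]
  simp [comp, Finset.mul_sum]

theorem gen_comp (m : α → ℝ) (f : α → γ) {K : γ → β → ℝ} (hK : IsKernel K) :
    Gen (comp m (fun a => K (f a))) Prod.snd Prod.fst (fun x => f x.1) K :=
  gen_of_equiv (Equiv.refl _) m f K (fun c => (hK c).sum_eq) fun _ => rfl

theorem condEntropy_comp (m : α → ℝ) {K : α → β → ℝ} (hK : IsKernel K) :
    condEntropy (comp m K) Prod.snd Prod.fst = ∑ a, m a * ent (K a) := by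
  have h := gen_comp m (fun a => a) hK
  rw [h.condEntropy_eq (fun a => (hK a).sum_eq) Prod.fst (fun _ _ h => h) (fun _ _ h => h)]
  rw [Fintype.sum_prod_type]
  refine Finset.sum_congr rfl fun a _ => ?_
  simp only [comp]
  rw [← Finset.sum_mul, ← Finset.mul_sum, (hK a).sum_eq, mul_one]

theorem mutualInfo_eq_swap {Ω : Type*} [Fintype Ω] (μ : Ω → ℝ) (A : Ω → α) (B : Ω → β) :
    mutualInfo μ A B = entropy μ B - condEntropy μ B A := by
  rw [mutualInfo, condEntropy, condEntropy,
    entropy_congr (A := fun ω => (A ω, B ω)) (B := fun ω => (B ω, A ω))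
      (by intro ω ω'; simp only [Prod.mk.injEq]; tauto)]
  ring

/-- The law of the output of a channel. -/
def outLaw (m : α → ℝ) (K : α → β → ℝ) (b : β) : ℝ := ∑ a, m a * K a b

theorem push_comp_snd (m : α → ℝ) (K : α → β → ℝ) : push (comp m K) Prod.snd = outLaw m K := by
  classical
  funext b
  rw [push_apply, Fintype.sum_prod_type, outLaw]
  simp [comp]

theorem IsLaw.outLaw {m : α → ℝ} {K : α → β → ℝ} (hm : IsLaw m) (hK : IsKernel K) :
    IsLaw (outLaw m K) := by
  rw [← push_comp_snd]; exact (isLaw_comp hm hK).push _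

theorem chanInfo_eq (m : α → ℝ) {K : α → β → ℝ} (hK : IsKernel K) :
    chanInfo m K = ent (outLaw m K) - ∑ a, m a * ent (K a) := by
  rw [chanInfo, mutualInfo_eq_swap, condEntropy_comp m hK, entropy_eq_ent, push_comp_snd]

theorem chanInfo_nonneg {m : α → ℝ} {K : α → β → ℝ} (hm : IsLaw m) (hK : IsKernel K) :
    0 ≤ chanInfo m K := mutualInfo_nonneg (isLaw_comp hm hK) _ _

theorem entropy_pair_comm {Ω : Type*} [Fintype Ω] (μ : Ω → ℝ) (A : Ω → α) (B : Ω → β) :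
    entropy μ (fun ω => (A ω, B ω)) = entropy μ (fun ω => (B ω, A ω)) :=
  entropy_congr (by intro ω ω'; simp only [Prod.mk.injEq]; tauto)

/-- The gain of `T` about the better of two channels fed by `A`, over a degraded version of it, is
at most the gain of `A`. -/
theorem condEntropy_sub_le_of_degraded {υ τ : Type*} [Fintype υ] [Fintype τ] {p : υ × α → ℝ}
    (hp : IsLaw p) {K : α → β → ℝ} {L : α → γ → ℝ} (hK : IsKernel K) (h : Degraded K L)
    (T : υ → τ) (G : υ → δ) :
    condEntropy (comp p (fun x => L x.2)) (fun x => T x.1.1) (fun x => (G x.1.1, x.2)) -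
      condEntropy (comp p (fun x => K x.2)) (fun x => T x.1.1) (fun x => (G x.1.1, x.2)) ≤
    chanInfo (push p Prod.snd) K - chanInfo (push p Prod.snd) L := by
  obtain ⟨D, hD, rfl⟩ := h
  have hK' : IsKernel (fun x : υ × α => K x.2) := fun x => hK x.2
  have hD' : IsKernel (fun x : (υ × α) × β => D x.2) := fun x => hD x.2
  -- Each term of the inequality involves only one of the two outputs, so stochastic degradedness
  -- may be replaced by a physical coupling A → B → C. There, H(T | G, C) - H(T | G, B) = I(T; B |
  -- G, C) ≤ I(A; B | C) = I(A; B) - I(A; C).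
  set ν := comp (comp p (fun x => K x.2)) (fun x => D x.2) with hν
  have hνl : IsLaw ν := isLaw_comp (isLaw_comp hp hK') hD'
  have e1 : push ν (fun x => x.1) = comp p (fun x => K x.2) := by
    rw [hν, push_comp_fst _ hD' (fun x => x), push_id]
  have e2 : push ν (fun x => (x.1.1, x.2)) = comp p (fun x => kcomp K D x.2) :=
    push_comp_comp p (fun x => K x.2) D
  have e3 : comp (push p Prod.snd) K = push ν (fun x => (x.1.1.2, x.1.2)) := by
    rw [← push_comp_map, ← e1, push_push]
  have e4 : comp (push p Prod.snd) (kcomp K D) = push ν (fun x => (x.1.1.2, x.2)) := by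
    rw [← push_comp_map, ← e2, push_push]
  rw [← e1, ← e2, chanInfo, chanInfo, e3, e4]
  simp only [condEntropy, mutualInfo, entropy_push]
  set U : ((υ × α) × β) × γ → υ := fun x => x.1.1.1
  set A : ((υ × α) × β) × γ → α := fun x => x.1.1.2
  set B : ((υ × α) × β) × γ → β := fun x => x.1.2
  set C : ((υ × α) × β) × γ → γ := fun x => x.2
  set T' : ((υ × α) × β) × γ → τ := fun x => T x.1.1.1
  set G' : ((υ × α) × β) × γ → δ := fun x => G x.1.1.1
  have g1 : Gen ν C (fun x => x.1) B D := gen_comp _ (fun x : (υ × α) × β => x.2) hD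
  have g2 : Gen ν (fun x => (B x, C x)) (fun x => x.1.1) A (fun a bc => K a bc.1 * D bc.1 bc.2) :=
    gen_of_equiv (Equiv.prodAssoc _ _ _) p (fun x : υ × α => x.2)
      (fun a bc => K a bc.1 * D bc.1 bc.2)
      (fun a => by
        simp_rw [Fintype.sum_prod_type, ← Finset.mul_sum, (hD _).sum_eq, mul_one, (hK _).sum_eq])
      (fun x => by simp only [hν, comp, Equiv.prodAssoc_symm_apply]; ring)
  -- C depends only on B (`k1`, `k2`, and later `k5`), and (B, C) only on A (`k3`, `k4`).
  have k1 := g1.condEntropy_eq_condEntropy (fun a => (hD a).sum_eq) (fun x => (G' x, B x)) B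
    (by rintro ω ω' h; simp only [B, G', h]) (by simp) (by rintro ω ω' h; simp only [B, h])
    (by simp)
  have k2 := g1.condEntropy_eq_condEntropy (fun a => (hD a).sum_eq) (fun x => (T' x, G' x, B x)) B
    (by rintro ω ω' h; simp only [B, G', T', h]) (by simp +contextual)
    (by rintro ω ω' h; simp only [B, h]) (by simp)
  have k3 := g2.condEntropy_eq_condEntropy (fun a => by
        simp_rw [Fintype.sum_prod_type, ← Finset.mul_sum, (hD _).sum_eq, mul_one, (hK _).sum_eq])
     (fun x => (T' x, G' x, A x)) A
    (by rintro ω ω' h; simp only [A, G', T', h]) (by simp +contextual)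
    (by rintro ω ω' h; simp only [A, h]) (by simp)
  have k4 := (show Gen ν C (fun x => x.1.1) A _ from g2.snd).condEntropy_eq_condEntropy (fun a => by
        rw [← Fintype.sum_prod_type_right (fun x : β × γ => K a x.1 * D x.1 x.2)]
        simp_rw [Fintype.sum_prod_type, ← Finset.mul_sum, (hD _).sum_eq, mul_one, (hK _).sum_eq])
     (fun x => (T' x, G' x, A x)) A
    (by rintro ω ω' h; simp only [A, G', T', h]) (by simp +contextual)
    (by rintro ω ω' h; simp only [A, h]) (by simp)
  have s1 := condEntropy_le_condEntropy hνl (A := B) (B := fun x => (G' x, C x)) (C := C)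
    (by simp)
  have s2 := condEntropy_le_condEntropy hνl (A := B) (B := fun x => (T' x, G' x, A x, C x))
    (C := fun x => (T' x, G' x, C x)) (by simp +contextual)
  have c1 : entropy ν (fun x => (A x, B x)) = entropy ν (fun x => (B x, A x)) :=
    entropy_pair_comm _ _ _
  have c2 : entropy ν (fun x => (A x, C x)) = entropy ν (fun x => (C x, A x)) :=
    entropy_pair_comm _ _ _
  have c3 : entropy ν (fun x => (C x, G' x, B x)) = entropy ν (fun x => (B x, G' x, C x)) :=
    entropy_congr (by intro ω ω'; simp only [Prod.mk.injEq]; tauto)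
  have c4 : entropy ν (fun x => (C x, T' x, G' x, B x)) =
      entropy ν (fun x => (B x, T' x, G' x, C x)) :=
    entropy_congr (by intro ω ω'; simp only [Prod.mk.injEq]; tauto)
  have c5 : entropy ν (fun x => ((B x, C x), T' x, G' x, A x)) =
      entropy ν (fun x => (B x, T' x, G' x, A x, C x)) :=
    entropy_congr (by intro ω ω'; simp only [Prod.mk.injEq]; tauto)
  have c6 : entropy ν (fun x => (C x, T' x, G' x, A x)) =
      entropy ν (fun x => (T' x, G' x, A x, C x)) :=
    entropy_congr (by intro ω ω'; simp only [Prod.mk.injEq]; tauto)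
  have k5 := g1.condEntropy_eq_condEntropy (fun a => (hD a).sum_eq) (fun x => (B x, A x)) B
    (by rintro ω ω' h; simp only [B, A, h]) (by simp +contextual)
    (by rintro ω ω' h; simp only [B, h]) (by simp)
  have c7 : entropy ν (fun x => (C x, B x, A x)) = entropy ν (fun x => ((B x, C x), A x)) :=
    entropy_congr (by intro ω ω'; simp only [Prod.mk.injEq]; tauto)
  have c8 : entropy ν (fun x => (B x, C x)) = entropy ν (fun x => (C x, B x)) :=
    entropy_pair_comm _ _ _
  simp only [condEntropy] at k1 k2 k3 k4 k5 s1 s2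
  change entropy ν (fun x => (T' x, G' x, C x)) - entropy ν (fun x => (G' x, C x)) -
    (entropy ν (fun x => (T' x, G' x, B x)) - entropy ν (fun x => (G' x, B x))) ≤
    entropy ν A - (entropy ν (fun x => (A x, B x)) - entropy ν B) -
    (entropy ν A - (entropy ν (fun x => (A x, C x)) - entropy ν C))
  linarith

end
end Info

/-! ### Degradedness in either order, and the two-stage experiment -/

namespace Info

section
set_option linter.unusedSectionVars false
variable {α β γ δ : Type*} [Fintype α] [Fintype β] [Fintype γ] [Fintype δ]

/-- In the physical coupling C adds nothing to B, hence H(T | G, B) = H(T | G, B, C) ≤ H(T | G, C).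
-/
theorem condEntropy_le_of_degraded {υ τ : Type*} [Fintype υ] [Fintype τ] {p : υ × α → ℝ}
    (hp : IsLaw p) {K : α → β → ℝ} {L : α → γ → ℝ} (hK : IsKernel K) (h : Degraded K L)
    (T : υ → τ) (G : υ → δ) :
    condEntropy (comp p (fun x => K x.2)) (fun x => T x.1.1) (fun x => (G x.1.1, x.2)) ≤
      condEntropy (comp p (fun x => L x.2)) (fun x => T x.1.1) (fun x => (G x.1.1, x.2)) := by
  obtain ⟨D, hD, rfl⟩ := h
  have hK' : IsKernel (fun x : υ × α => K x.2) := fun x => hK x.2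
  have hD' : IsKernel (fun x : (υ × α) × β => D x.2) := fun x => hD x.2
  set ν := comp (comp p (fun x => K x.2)) (fun x => D x.2) with hν
  have hνl : IsLaw ν := isLaw_comp (isLaw_comp hp hK') hD'
  have e1 : push ν (fun x => x.1) = comp p (fun x => K x.2) := by
    rw [hν, push_comp_fst _ hD' (fun x => x), push_id]
  have e2 : push ν (fun x => (x.1.1, x.2)) = comp p (fun x => kcomp K D x.2) :=
    push_comp_comp p (fun x => K x.2) D
  rw [← e1, ← e2]
  simp only [condEntropy, entropy_push]
  set B : ((υ × α) × β) × γ → β := fun x => x.1.2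
  set C : ((υ × α) × β) × γ → γ := fun x => x.2
  set T' : ((υ × α) × β) × γ → τ := fun x => T x.1.1.1
  set G' : ((υ × α) × β) × γ → δ := fun x => G x.1.1.1
  have g1 : Gen ν C (fun x => x.1) B D := gen_comp _ (fun x : (υ × α) × β => x.2) hD
  have k1 := g1.condEntropy_eq_condEntropy (fun a => (hD a).sum_eq) (fun x => (G' x, B x))
    (fun x => (T' x, G' x, B x))
    (by rintro ω ω' h; simp only [B, G', h]) (by simp) (by rintro ω ω' h; simp only [B, T', G', h])
    (by simp +contextual)
  have s1 := condEntropy_le_condEntropy hνl (A := T') (B := fun x => (G' x, B x, C x))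
    (C := fun x => (G' x, C x)) (by simp +contextual)
  have c3 : entropy ν (fun x => (C x, G' x, B x)) = entropy ν (fun x => (G' x, B x, C x)) :=
    entropy_congr (by intro ω ω'; simp only [Prod.mk.injEq]; tauto)
  have c4 : entropy ν (fun x => (C x, T' x, G' x, B x)) =
      entropy ν (fun x => (T' x, G' x, B x, C x)) :=
    entropy_congr (by intro ω ω'; simp only [Prod.mk.injEq]; tauto)
  simp only [condEntropy] at k1 s1
  change entropy ν (fun x => (T' x, G' x, B x)) - entropy ν (fun x => (G' x, B x)) ≤
    entropy ν (fun x => (T' x, G' x, C x)) - entropy ν (fun x => (G' x, C x))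
  linarith

/-- If `L` is the better channel, the left side is nonpositive; the positive part thus covers both
orders of degradedness. -/
theorem condEntropy_sub_le_max {υ τ : Type*} [Fintype υ] [Fintype τ] {p : υ × α → ℝ}
    (hp : IsLaw p) {K : α → β → ℝ} {L : α → γ → ℝ} (hK : IsKernel K) (hL : IsKernel L)
    (h : Degraded K L ∨ Degraded L K) (T : υ → τ) (G : υ → δ) :
    condEntropy (comp p (fun x => L x.2)) (fun x => T x.1.1) (fun x => (G x.1.1, x.2)) -
      condEntropy (comp p (fun x => K x.2)) (fun x => T x.1.1) (fun x => (G x.1.1, x.2)) ≤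
    max 0 (chanInfo (push p Prod.snd) K - chanInfo (push p Prod.snd) L) := by
  rcases h with h | h
  · exact (condEntropy_sub_le_of_degraded hp hK h T G).trans (le_max_right _ _)
  · exact (sub_nonpos.2 (condEntropy_le_of_degraded hp hL h T G)).trans (le_max_left _ _)

/-- Data processing is the case of constant `T` and `G` in `condEntropy_sub_le_of_degraded`, whose
left side then vanishes. -/
theorem chanInfo_le_of_degraded {p : α → ℝ} (hp : IsLaw p) {K : α → β → ℝ} {L : α → γ → ℝ}
    (hK : IsKernel K) (h : Degraded K L) : chanInfo p L ≤ chanInfo p K := by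
  have hK' : IsKernel (fun x : Unit × α => K x.2) := fun x => hK x.2
  have hp' : IsLaw (fun x : Unit × α => p x.2) :=
    ⟨fun x => hp.nonneg _, by rw [Fintype.sum_prod_type]; simp [hp.sum_eq]⟩
  have hL : IsKernel L := by obtain ⟨D, hD, rfl⟩ := h; exact hK.kcomp hD
  have hL' : IsKernel (fun x : Unit × α => L x.2) := fun x => hL x.2
  have := condEntropy_sub_le_of_degraded hp' hK h (fun _ => ()) (fun _ => ())
  have e : push (fun x : Unit × α => p x.2) Prod.snd = p := by
    classical
    funext a
    rw [push_apply, Fintype.sum_prod_type]; simp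
  rw [e] at this
  simp only [condEntropy] at this
  rw [entropy_congr (A := fun x : (Unit × α) × γ => ((), (), x.2)) (B := fun x => ((), x.2))
    (by simp), entropy_congr (A := fun x : (Unit × α) × β => ((), (), x.2))
    (B := fun x => ((), x.2)) (by simp)] at this
  linarith

end

section
variable {X Y Z A B C τ : Type*} [Fintype X] [Fintype Y] [Fintype Z] [Fintype A] [Fintype B]
  [Fintype C] [Fintype τ]

/-- The law of everything on the channels when the source `(X, Y, Z)` has law `p`, the input `A` is
generated from `Y` by `q`, and `w` is the channel from `A` to `(B, C)`. -/
def twoWayLaw (p : X × Y × Z → ℝ) (q : Y → A → ℝ) (w : A → B × C → ℝ) :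
    ((X × Y × Z) × A) × (B × C) → ℝ :=
  comp (comp p (fun s => q s.2.1)) (fun x => w x.2)

theorem isLaw_twoWayLaw {p : X × Y × Z → ℝ} {q : Y → A → ℝ} {w : A → B × C → ℝ} (hp : IsLaw p)
    (hq : IsKernel q) (hw : IsKernel w) : IsLaw (twoWayLaw p q w) :=
  isLaw_comp (isLaw_comp hp (fun s => hq s.2.1)) (fun x => hw x.2)

theorem gen_twoWayLaw {p : X × Y × Z → ℝ} {q : Y → A → ℝ} {w : A → B × C → ℝ}
    (hw : IsKernel w) : Gen (twoWayLaw p q w) (fun x => x.2.1) (fun x => x.1) (fun x => x.1.2)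
      (kfst w) :=
  Gen.fst (B := fun x : ((X × Y × Z) × A) × (B × C) => x.2.1) (C := fun x => x.2.2)
    (gen_comp _ (fun x : (X × Y × Z) × A => x.2) hw)

theorem chanInfo_twoWayLaw {p : X × Y × Z → ℝ} {q : Y → A → ℝ} {w : A → B × C → ℝ}
    (hw : IsKernel w) : chanInfo (push (twoWayLaw p q w) (fun x => x.1.2)) (kfst w) =
      mutualInfo (twoWayLaw p q w) (fun x => x.1.2) (fun x => x.2.1) := by
  refine mutualInfo_congr_push ?_
  have : push (twoWayLaw p q w) (fun x => x.1.2) = push (comp p (fun s => q s.2.1)) Prod.snd :=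
    push_comp_fst (comp p (fun s => q s.2.1)) (K := fun x => w x.2) (fun x => hw x.2) Prod.snd
  have h : _ = comp (comp p (fun s => q s.2.1)) (fun x => kfst w x.2) :=
    push_comp_kfst (comp p (fun s => q s.2.1)) (fun x => w x.2)
  rw [this, ← push_comp_map, ← h, push_push, push_push]
  rfl

/-- The description of the source that is conveyed by `B` and a function `T` of `(Y, A)`. -/
theorem infoVY_twoWayLaw_le {p : X × Y × Z → ℝ} {q : Y → A → ℝ} {w : A → B × C → ℝ}
    (hp : IsLaw p) (hq : IsKernel q) (hw : IsKernel w) (T : Y × A → τ) :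
    condMutualInfo (twoWayLaw p q w) (fun x => (T (x.1.1.2.1, x.1.2), x.2.1)) (fun x => x.1.1.2.1)
      (fun x => x.1.1.1) ≤
    chanInfo (push (twoWayLaw p q w) (fun x => x.1.2)) (kfst w) +
      condEntropy (twoWayLaw p q w) (fun x => T (x.1.1.2.1, x.1.2))
        (fun x => (x.1.1.1, x.2.1)) := by
  have hμ := isLaw_twoWayLaw hp hq hw
  rw [chanInfo_twoWayLaw hw, mutualInfo_eq_swap]
  have g := gen_twoWayLaw (p := p) (q := q) hw
  set μ := twoWayLaw p q w
  set X' : ((X × Y × Z) × A) × (B × C) → X := fun x => x.1.1.1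
  set Y' : ((X × Y × Z) × A) × (B × C) → Y := fun x => x.1.1.2.1
  set A' : ((X × Y × Z) × A) × (B × C) → A := fun x => x.1.2
  set B' : ((X × Y × Z) × A) × (B × C) → B := fun x => x.2.1
  set T' : ((X × Y × Z) × A) × (B × C) → τ := fun x => T (x.1.1.2.1, x.1.2)
  -- H(T, B | X) ≤ H(B) + H(T | X, B), while H(T, B | X, Y) ≥ H(B | X, Y, A) = H(B | A).
  have k := g.condEntropy_eq_condEntropy (fun a => (hw.kfst a).sum_eq) A'
    (fun x => (Y' x, X' x, A' x)) (by rintro ω ω' h; simp only [A', h]) (by simp)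
    (by rintro ω ω' h; simp only [A', X', Y', h]) (by simp)
  have s1 := condEntropy_le_condEntropy hμ (A := B') (B := fun x => (Y' x, X' x, A' x))
    (C := fun x => (Y' x, X' x)) (by simp +contextual)
  have s2 := condEntropy_le_entropy hμ B' X'
  have s3 := condEntropy_mono_left hμ (A := fun x => (T' x, B' x)) (B := B')
    (C := fun x => (Y' x, X' x)) (by simp +contextual)
  have c1 : entropy μ (fun x => ((T' x, B' x), X' x)) = entropy μ (fun x => (T' x, X' x, B' x)) :=
    entropy_congr (by intro ω ω'; simp only [Prod.mk.injEq]; tauto)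
  have c2 : entropy μ (fun x => (X' x, B' x)) = entropy μ (fun x => (B' x, X' x)) :=
    entropy_pair_comm _ _ _
  simp only [condMutualInfo, condEntropy] at k s1 s2 s3 ⊢
  linarith

/-- The secrecy of a function `T` of `(Y, A)` that is known from `(X, B)`. -/
theorem condEntropy_twoWayLaw_le {p : X × Y × Z → ℝ} {q : Y → A → ℝ} {w : A → B × C → ℝ}
    (hp : IsLaw p) (hq : IsKernel q) (hw : IsKernel w)
    (hd : Degraded (kfst w) (ksnd w) ∨ Degraded (ksnd w) (kfst w)) (T : Y × A → τ) :
    condEntropy (twoWayLaw p q w) (fun x => T (x.1.1.2.1, x.1.2)) (fun x => (x.1.1.2.2, x.2.2)) ≤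
    condMutualInfo (twoWayLaw p q w) (fun x => (T (x.1.1.2.1, x.1.2), x.2.1)) (fun x => x.1.1.1)
      (fun x => x.1.1.2.2) +
    max 0 (chanInfo (push (twoWayLaw p q w) (fun x => x.1.2)) (kfst w) -
      chanInfo (push (twoWayLaw p q w) (fun x => x.1.2)) (ksnd w)) +
    condEntropy (twoWayLaw p q w) (fun x => T (x.1.1.2.1, x.1.2)) (fun x => (x.1.1.1, x.2.1)) := by
  have hμ := isLaw_twoWayLaw hp hq hw
  have hpq := isLaw_comp hp (K := fun s => q s.2.1) (fun s => hq s.2.1)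
  have eA : push (twoWayLaw p q w) (fun x => x.1.2) = push (comp p (fun s => q s.2.1)) Prod.snd :=
    push_comp_fst (comp p (fun s => q s.2.1)) (K := fun x => w x.2) (fun x => hw x.2) Prod.snd
  -- The letter A is doubled: one copy feeds the channel, and the other belongs to the variable of
  -- which T is a function, as `condEntropy_sub_le_max` requires.
  set p' : ((X × Y × Z) × A) × A → ℝ := push (comp p (fun s => q s.2.1)) (fun x => (x, x.2))
  have hp' : IsLaw p' := hpq.push _
  have key := condEntropy_sub_le_max hp' hw.kfst hw.ksnd hd (fun x => T (x.1.2.1, x.2))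
    (fun x => x.1.2.2)
  have e1 : comp p' (fun x => kfst w x.2) =
      push (twoWayLaw p q w) (fun x => ((x.1, x.1.2), x.2.1)) := by
    rw [← push_comp_map]
    have h : _ = comp (comp p (fun s => q s.2.1)) (fun x => kfst w x.2) :=
      push_comp_kfst (comp p (fun s => q s.2.1)) (fun x => w x.2)
    rw [← h, push_push]; rfl
  have e2 : comp p' (fun x => ksnd w x.2) =
      push (twoWayLaw p q w) (fun x => ((x.1, x.1.2), x.2.2)) := by
    rw [← push_comp_map]
    have h : _ = comp (comp p (fun s => q s.2.1)) (fun x => ksnd w x.2) :=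
      push_comp_ksnd (comp p (fun s => q s.2.1)) (fun x => w x.2)
    rw [← h, push_push]; rfl
  have e3 : push p' Prod.snd = push (comp p (fun s => q s.2.1)) Prod.snd := push_push _ _ _
  rw [e1, e2, e3, ← eA] at key
  simp only [condEntropy, entropy_push] at key
  set μ := twoWayLaw p q w
  set X' : ((X × Y × Z) × A) × (B × C) → X := fun x => x.1.1.1
  set Z' : ((X × Y × Z) × A) × (B × C) → Z := fun x => x.1.1.2.2
  set B' : ((X × Y × Z) × A) × (B × C) → B := fun x => x.2.1
  set T' : ((X × Y × Z) × A) × (B × C) → τ := fun x => T (x.1.1.2.1, x.1.2)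
  -- H(T | Z, B) = H(T, B | Z) - H(B | Z) is at most I(T, B; X | Z) + H(T | X, B). Replacing B by C
  -- costs at most the wiretap gain, by `key`.
  have s1 := condEntropy_le_condEntropy hμ (A := T') (B := fun x => (B' x, X' x, Z' x))
    (C := fun x => (X' x, B' x)) (by simp +contextual)
  have s2 := condEntropy_le_condEntropy hμ (A := B') (B := fun x => (X' x, Z' x))
    (C := Z') (by simp +contextual)
  have c1 : entropy μ (fun x => (T' x, Z' x, B' x)) = entropy μ (fun x => ((T' x, B' x), Z' x)) :=
    entropy_congr (by intro ω ω'; simp only [Prod.mk.injEq]; tauto)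
  have c2 : entropy μ (fun x => (Z' x, B' x)) = entropy μ (fun x => (B' x, Z' x)) :=
    entropy_pair_comm _ _ _
  have c3 : entropy μ (fun x => (T' x, B' x, X' x, Z' x)) =
      entropy μ (fun x => ((T' x, B' x), X' x, Z' x)) :=
    entropy_congr (by intro ω ω'; simp only [Prod.mk.injEq]; tauto)
  simp only [condMutualInfo, condEntropy] at s1 s2 ⊢
  linarith

end
end Info

/-! ### Auxiliary variables: time sharing, and splitting over independent triples -/

namespace Info

/-- The joint law of `(V, X, Y, Z)` when `(X, Y, Z)` has law `p` and `V` is generated from `Y`. -/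
def auxLaw {V X Y Z : Type*} (p : X × Y × Z → ℝ) (Q : Y → V → ℝ) (ω : V × X × Y × Z) : ℝ :=
  p ω.2 * Q ω.2.2.1 ω.1

section
variable {V X Y Z : Type*} [Fintype V] [Fintype X] [Fintype Y] [Fintype Z]

/-- `I(V; X | Z)`, where `V` is generated from `Y`. -/
def auxX (p : X × Y × Z → ℝ) (Q : Y → V → ℝ) : ℝ :=
  condMutualInfo (auxLaw p Q) (fun ω => ω.1) (fun ω => ω.2.1) (fun ω => ω.2.2.2)

/-- `I(V; Y | X)`, where `V` is generated from `Y`. -/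
def auxY (p : X × Y × Z → ℝ) (Q : Y → V → ℝ) : ℝ :=
  condMutualInfo (auxLaw p Q) (fun ω => ω.1) (fun ω => ω.2.2.1) (fun ω => ω.2.1)

/-- Time sharing between two auxiliary kernels. -/
def mixKernel {V' : Type*} (t : ℝ) (Q : Y → V → ℝ) (Q' : Y → V' → ℝ) (y : Y) : V ⊕ V' → ℝ :=
  Sum.elim (fun v => (1 - t) * Q y v) (fun v => t * Q' y v)

/-- The joint law of two independent triples, regrouped. -/
def prodLaw {X' Y' Z' : Type*} (p : X × Y × Z → ℝ) (p' : X' × Y' × Z' → ℝ)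
    (s : (X × X') × (Y × Y') × (Z × Z')) : ℝ :=
  p (s.1.1, s.2.1.1, s.2.2.1) * p' (s.1.2, s.2.1.2, s.2.2.2)

/-- Given `X`, the variable `Z` is independent of `Y`. -/
def IndepGiven (p : X × Y × Z → ℝ) : Prop :=
  ∃ (m : X × Y → ℝ) (k : X → Z → ℝ), IsKernel k ∧ ∀ x y z, p (x, y, z) = m (x, y) * k x z

end

section
set_option linter.unusedSectionVars false
variable {V V' X Y Z X' Y' Z' : Type*} [Fintype V] [Fintype V'] [Fintype X] [Fintype Y] [Fintype Z]
  [Fintype X'] [Fintype Y'] [Fintype Z']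

theorem isLaw_auxLaw {p : X × Y × Z → ℝ} {Q : Y → V → ℝ} (hp : IsLaw p) (hQ : IsKernel Q) :
    IsLaw (auxLaw p Q) := by
  refine ⟨fun ω => mul_nonneg (hp.nonneg _) ((hQ _).nonneg _), ?_⟩
  rw [Fintype.sum_prod_type, Finset.sum_comm]
  simp_rw [auxLaw, ← Finset.mul_sum, (hQ _).sum_eq, mul_one, hp.sum_eq]

theorem push_auxLaw_snd (p : X × Y × Z → ℝ) {Q : Y → V → ℝ} (hQ : IsKernel Q) :
    push (auxLaw p Q) (fun ω => ω.2) = p := by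
  classical
  funext s
  rw [push_apply, Fintype.sum_prod_type, Finset.sum_comm,
    Finset.sum_eq_single s (fun x _ hx => by simp [hx]) (by simp)]
  simp only [if_true, auxLaw]
  rw [← Finset.mul_sum, (hQ _).sum_eq, mul_one]

theorem push_auxLaw_map (p : X × Y × Z → ℝ) (Q : Y → V → ℝ) (f : V → V') :
    push (auxLaw p Q) (fun ω => (f ω.1, ω.2)) = auxLaw p (fun y => push (Q y) f) := by
  classical
  funext ⟨v, s⟩
  rw [push_apply, auxLaw, push_apply, Fintype.sum_prod_type, Finset.mul_sum]
  refine Finset.sum_congr rfl fun u _ => ?_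
  rw [Finset.sum_eq_single s (fun x _ hx => by simp [hx]) (by simp)]
  by_cases h : f u = v <;> simp [auxLaw, h]

theorem auxX_eq {Ω : Type*} [Fintype Ω] {μ : Ω → ℝ} {A : Ω → V} {B : Ω → X} {C : Ω → Y} {D : Ω → Z}
    {p : X × Y × Z → ℝ} {Q : Y → V → ℝ}
    (h : push μ (fun ω => (A ω, B ω, C ω, D ω)) = auxLaw p Q) :
    auxX p Q = condMutualInfo μ A B D := by
  rw [auxX]
  refine condMutualInfo_congr_push ?_
  rw [← h, push_push]

theorem auxY_eq {Ω : Type*} [Fintype Ω] {μ : Ω → ℝ} {A : Ω → V} {B : Ω → X} {C : Ω → Y} {D : Ω → Z}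
    {p : X × Y × Z → ℝ} {Q : Y → V → ℝ}
    (h : push μ (fun ω => (A ω, B ω, C ω, D ω)) = auxLaw p Q) :
    auxY p Q = condMutualInfo μ A C B := by
  rw [auxY]
  refine condMutualInfo_congr_push ?_
  rw [← h, push_push]

theorem auxX_push (p : X × Y × Z → ℝ) (Q : Y → V → ℝ) {f : V → V'} (hf : Function.Injective f) :
    auxX p (fun y => push (Q y) f) = auxX p Q := by
  rw [auxX_eq (push_auxLaw_map p Q f), auxX, condMutualInfo, condMutualInfo, condEntropy,
    condEntropy, condEntropy, condEntropy,
    entropy_congr (A := fun ω : V × X × Y × Z => (f ω.1, ω.2.2.2)) (B := fun ω => (ω.1, ω.2.2.2))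
      (by simp [hf.eq_iff]),
    entropy_congr (A := fun ω : V × X × Y × Z => (f ω.1, ω.2.1, ω.2.2.2))
      (B := fun ω => (ω.1, ω.2.1, ω.2.2.2)) (by simp [hf.eq_iff])]

theorem auxY_push (p : X × Y × Z → ℝ) (Q : Y → V → ℝ) {f : V → V'} (hf : Function.Injective f) :
    auxY p (fun y => push (Q y) f) = auxY p Q := by
  rw [auxY_eq (push_auxLaw_map p Q f), auxY, condMutualInfo, condMutualInfo, condEntropy,
    condEntropy, condEntropy, condEntropy,
    entropy_congr (A := fun ω : V × X × Y × Z => (f ω.1, ω.2.1)) (B := fun ω => (ω.1, ω.2.1))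
      (by simp [hf.eq_iff]),
    entropy_congr (A := fun ω : V × X × Y × Z => (f ω.1, ω.2.2.1, ω.2.1))
      (B := fun ω => (ω.1, ω.2.2.1, ω.2.1)) (by simp [hf.eq_iff])]

theorem IsKernel.push {α β γ : Type*} [Fintype β] [Fintype γ] {Q : α → β → ℝ} (hQ : IsKernel Q)
    (f : β → γ) : IsKernel (fun y => Info.push (Q y) f) := fun y => (hQ y).push f

/-- An auxiliary variable may be taken with values in an initial segment of `ℕ`. -/
theorem exists_fin_kernel (p : X × Y × Z → ℝ) {Q : Y → V → ℝ} (hQ : IsKernel Q) :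
    ∃ (k : ℕ) (Q' : Y → Fin k → ℝ), IsKernel Q' ∧ auxX p Q' = auxX p Q ∧ auxY p Q' = auxY p Q :=
  ⟨Fintype.card V, fun y => push (Q y) (Fintype.equivFin V), hQ.push _,
    auxX_push p Q (Fintype.equivFin V).injective, auxY_push p Q (Fintype.equivFin V).injective⟩

theorem isKernel_mix {t : ℝ} (h0 : 0 ≤ t) (h1 : t ≤ 1) {Q : Y → V → ℝ} {Q' : Y → V' → ℝ}
    (hQ : IsKernel Q) (hQ' : IsKernel Q') : IsKernel (mixKernel t Q Q') := fun y => by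
  refine ⟨fun v => ?_, ?_⟩
  · rcases v with v | v
    · exact mul_nonneg (by linarith) ((hQ y).nonneg v)
    · exact mul_nonneg h0 ((hQ' y).nonneg v)
  · rw [Fintype.sum_sum_type]
    simp only [mixKernel, Sum.elim_inl, Sum.elim_inr, ← Finset.mul_sum, (hQ y).sum_eq,
      (hQ' y).sum_eq]
    ring

/-- The alphabets are disjoint, so the mixed variable reveals which kernel was used and the binary
entropy of `t` splits off. It cancels in differences, which makes `auxX` and `auxY` affine under
time sharing. -/
theorem entropy_mix {δ : Type*} [Fintype δ] {p : X × Y × Z → ℝ} (hp : IsLaw p) (t : ℝ)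
    {Q : Y → V → ℝ} {Q' : Y → V' → ℝ} (hQ : IsKernel Q) (hQ' : IsKernel Q') (f : X × Y × Z → δ) :
    entropy (auxLaw p (mixKernel t Q Q')) (fun ω => (ω.1, f ω.2)) =
      (1 - t) * entropy (auxLaw p Q) (fun ω => (ω.1, f ω.2)) +
      t * entropy (auxLaw p Q') (fun ω => (ω.1, f ω.2)) +
      (Real.negMulLog (1 - t) + Real.negMulLog t) / Real.log 2 := by
  classical
  have hl : ∀ v d, push (auxLaw p (mixKernel t Q Q')) (fun ω => (ω.1, f ω.2)) (Sum.inl v, d) =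
      (1 - t) * push (auxLaw p Q) (fun ω => (ω.1, f ω.2)) (v, d) := by
    intro v d
    rw [push_apply, push_apply, Fintype.sum_prod_type, Fintype.sum_prod_type,
      Finset.sum_eq_single (Sum.inl v) (fun x _ hx => by simp [hx]) (by simp),
      Finset.sum_eq_single v (fun x _ hx => by simp [hx]) (by simp), Finset.mul_sum]
    refine Finset.sum_congr rfl fun s _ => ?_
    by_cases h : f s = d <;> simp [auxLaw, mixKernel, h]; ring_nf
  have hr : ∀ v d, push (auxLaw p (mixKernel t Q Q')) (fun ω => (ω.1, f ω.2)) (Sum.inr v, d) =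
      t * push (auxLaw p Q') (fun ω => (ω.1, f ω.2)) (v, d) := by
    intro v d
    rw [push_apply, push_apply, Fintype.sum_prod_type, Fintype.sum_prod_type,
      Finset.sum_eq_single (Sum.inr v) (fun x _ hx => by simp [hx]) (by simp),
      Finset.sum_eq_single v (fun x _ hx => by simp [hx]) (by simp), Finset.mul_sum]
    refine Finset.sum_congr rfl fun s _ => ?_
    by_cases h : f s = d <;> simp [auxLaw, mixKernel, h]; ring_nf
  have s1 := ((isLaw_auxLaw hp hQ).push (fun ω => (ω.1, f ω.2))).sum_eq
  have s2 := ((isLaw_auxLaw hp hQ').push (fun ω => (ω.1, f ω.2))).sum_eq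
  rw [entropy_eq_ent, entropy_eq_ent, entropy_eq_ent, ent, ent, ent]
  rw [Fintype.sum_prod_type] at s1 s2
  rw [Fintype.sum_prod_type, Fintype.sum_prod_type, Fintype.sum_prod_type, Fintype.sum_sum_type]
  simp_rw [hl, hr, Real.negMulLog_mul, Finset.sum_add_distrib, ← Finset.mul_sum, ← Finset.sum_mul]
  rw [s1, s2]
  ring

theorem entropy_auxLaw_snd {δ : Type*} [Fintype δ] (p : X × Y × Z → ℝ) {Q : Y → V → ℝ}
    (hQ : IsKernel Q) (f : X × Y × Z → δ) :
    entropy (auxLaw p Q) (fun ω => f ω.2) = entropy p f := by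
  rw [← entropy_push (auxLaw p Q) (fun ω => ω.2), push_auxLaw_snd p hQ]

theorem auxX_mix {p : X × Y × Z → ℝ} (hp : IsLaw p) {t : ℝ} (h0 : 0 ≤ t) (h1 : t ≤ 1)
    {Q : Y → V → ℝ} {Q' : Y → V' → ℝ} (hQ : IsKernel Q) (hQ' : IsKernel Q') :
    auxX p (mixKernel t Q Q') = (1 - t) * auxX p Q + t * auxX p Q' := by
  have hM := isKernel_mix h0 h1 hQ hQ'
  simp only [auxX, condMutualInfo, condEntropy]
  rw [entropy_mix hp t hQ hQ' (fun s => s.2.2), entropy_mix hp t hQ hQ' (fun s => (s.1, s.2.2)),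
    entropy_auxLaw_snd p hM (fun s => s.2.2), entropy_auxLaw_snd p hM (fun s => (s.1, s.2.2)),
    entropy_auxLaw_snd p hQ (fun s => s.2.2), entropy_auxLaw_snd p hQ (fun s => (s.1, s.2.2)),
    entropy_auxLaw_snd p hQ' (fun s => s.2.2), entropy_auxLaw_snd p hQ' (fun s => (s.1, s.2.2))]
  ring

theorem auxY_mix {p : X × Y × Z → ℝ} (hp : IsLaw p) {t : ℝ} (h0 : 0 ≤ t) (h1 : t ≤ 1)
    {Q : Y → V → ℝ} {Q' : Y → V' → ℝ} (hQ : IsKernel Q) (hQ' : IsKernel Q') :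
    auxY p (mixKernel t Q Q') = (1 - t) * auxY p Q + t * auxY p Q' := by
  have hM := isKernel_mix h0 h1 hQ hQ'
  simp only [auxY, condMutualInfo, condEntropy]
  rw [entropy_mix hp t hQ hQ' (fun s => s.1), entropy_mix hp t hQ hQ' (fun s => (s.2.1, s.1)),
    entropy_auxLaw_snd p hM (fun s => s.1), entropy_auxLaw_snd p hM (fun s => (s.2.1, s.1)),
    entropy_auxLaw_snd p hQ (fun s => s.1), entropy_auxLaw_snd p hQ (fun s => (s.2.1, s.1)),
    entropy_auxLaw_snd p hQ' (fun s => s.1), entropy_auxLaw_snd p hQ' (fun s => (s.2.1, s.1))]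
  ring

theorem push_equiv {α β : Type*} [Fintype α] (μ : α → ℝ) (e : α ≃ β) (b : β) :
    push μ e b = μ (e.symm b) := by
  classical
  rw [push_apply, Finset.sum_eq_single (e.symm b)]
  · simp
  · intro a _ ha
    rw [if_neg]
    rintro rfl
    simp at ha
  · simp

theorem ent_indep {α β : Type*} [Fintype α] [Fintype β] {m : α → ℝ} {k : β → ℝ} (hm : IsLaw m)
    (hk : IsLaw k) : ent (comp m (fun _ => k)) = ent m + ent k := by
  rw [ent, ent, ent, Fintype.sum_prod_type]
  simp_rw [comp, Real.negMulLog_mul, Finset.sum_add_distrib, ← Finset.mul_sum, ← Finset.sum_mul]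
  rw [hm.sum_eq, hk.sum_eq]
  ring_nf

theorem push_indep {α β γ δ : Type*} [Fintype α] [Fintype β] (m : α → ℝ) (k : β → ℝ)
    (f : α → γ) (g : β → δ) : push (comp m (fun _ => k)) (fun x => (f x.1, g x.2)) =
      comp (push m f) (fun _ => push k g) := by
  classical
  funext ⟨c, d⟩
  rw [push_apply, comp, push_apply, push_apply, Fintype.sum_prod_type, Finset.sum_mul_sum]
  refine Finset.sum_congr rfl fun a _ => Finset.sum_congr rfl fun b _ => ?_
  by_cases h1 : f a = c <;> by_cases h2 : g b = d <;> simp [comp, h1, h2]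

theorem isLaw_prodLaw {p : X × Y × Z → ℝ} {p' : X' × Y' × Z' → ℝ} (hp : IsLaw p) (hp' : IsLaw p') :
    IsLaw (prodLaw p p') := by
  refine ⟨fun s => mul_nonneg (hp.nonneg _) (hp'.nonneg _), ?_⟩
  let e : (X × X') × (Y × Y') × (Z × Z') ≃ (X × Y × Z) × (X' × Y' × Z') :=
    ⟨fun s => ((s.1.1, s.2.1.1, s.2.2.1), (s.1.2, s.2.1.2, s.2.2.2)),
      fun s => ((s.1.1, s.2.1), (s.1.2.1, s.2.2.1), (s.1.2.2, s.2.2.2)),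
      fun _ => rfl, fun _ => rfl⟩
  rw [← e.symm.sum_comp, Fintype.sum_prod_type]
  have : ∀ x y, prodLaw p p' (e.symm (x, y)) = p x * p' y := fun _ _ => rfl
  simp_rw [this, ← Finset.mul_sum, hp'.sum_eq, mul_one, hp.sum_eq]

theorem entropy_prodLaw {α β : Type*} [Fintype α] [Fintype β] {p : X × Y × Z → ℝ}
    {p' : X' × Y' × Z' → ℝ} (hp : IsLaw p) (hp' : IsLaw p') (f : X × Y × Z → α)
    (g : X' × Y' × Z' → β) :
    entropy (prodLaw p p') (fun s => (f (s.1.1, s.2.1.1, s.2.2.1), g (s.1.2, s.2.1.2, s.2.2.2))) =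
      entropy p f + entropy p' g := by
  let e : (X × X') × (Y × Y') × (Z × Z') ≃ (X × Y × Z) × (X' × Y' × Z') :=
    ⟨fun s => ((s.1.1, s.2.1.1, s.2.2.1), (s.1.2, s.2.1.2, s.2.2.2)),
      fun s => ((s.1.1, s.2.1), (s.1.2.1, s.2.2.1), (s.1.2.2, s.2.2.2)),
      fun _ => rfl, fun _ => rfl⟩
  have h : push (prodLaw p p') e = comp p (fun _ => p') := by
    funext x; rw [push_equiv]; rfl
  rw [entropy_eq_ent, entropy_eq_ent, entropy_eq_ent, ← ent_indep (hp.push f) (hp'.push g),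
    ← push_indep, ← h, push_push]
  rfl

/-- The auxiliary variable of a pair of independent triples splits into auxiliary variables of the
two triples. -/
theorem exists_split_aux {p : X × Y × Z → ℝ} {p' : X' × Y' × Z' → ℝ} (hp : IsLaw p)
    (hp' : IsLaw p') (hi : IndepGiven p) (hi' : IndepGiven p') {q : Y × Y' → V → ℝ}
    (hq : IsKernel q) :
    ∃ (k k' : ℕ) (Q : Y → Fin k → ℝ) (Q' : Y' → Fin k' → ℝ), IsKernel Q ∧ IsKernel Q' ∧
      auxX (prodLaw p p') q ≤ auxX p Q + auxX p' Q' ∧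
      auxY p Q + auxY p' Q' ≤ auxY (prodLaw p p') q := by
  have hpp := isLaw_prodLaw hp hp'
  have hμ := isLaw_auxLaw hpp hq
  obtain ⟨m, kz, hkz, hm⟩ := hi
  obtain ⟨m', kz', hkz', hm'⟩ := hi'
  -- The new auxiliary variables are (V, X', Z') for the first triple and (V, X, Y, Z) for the
  -- second. The asymmetry mirrors the chain rule I(V; Y, Y' | X, X') = I(V; Y | X, X') + I(V; Y' |
  -- X, X', Y).
  let Q0 : Y → V × X' × Y' × Z' → ℝ := fun y x => p' x.2 * q (y, x.2.2.1) x.1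
  let Q1 : Y → V × X' × Z' → ℝ := fun y => push (Q0 y) (fun x => (x.1, x.2.1, x.2.2.2))
  let Q2 : Y' → V × X × Y × Z → ℝ := fun y x => p x.2 * q (x.2.2.1, y) x.1
  have hQ0 : IsKernel Q0 := fun y => isLaw_auxLaw (Q := fun y' => q (y, y')) hp' (fun y' => hq _)
  have hQ1 : IsKernel Q1 := hQ0.push _
  have hQ2 : IsKernel Q2 := fun y => isLaw_auxLaw (Q := fun y' => q (y', y)) hp (fun y' => hq _)
  obtain ⟨k, Q, hQ, hQX, hQY⟩ := exists_fin_kernel p hQ1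
  obtain ⟨k', Q', hQ', hQX', hQY'⟩ := exists_fin_kernel p' hQ2
  refine ⟨k, k', Q, Q', hQ, hQ', ?_⟩
  rw [hQX, hQX', hQY, hQY']
  clear hQX hQX' hQY hQY' hQ hQ' Q Q' k k'
  let e0 : V × (X × X') × (Y × Y') × (Z × Z') ≃ (V × X' × Y' × Z') × (X × Y × Z) :=
    ⟨fun s => ((s.1, s.2.1.2, s.2.2.1.2, s.2.2.2.2), (s.2.1.1, s.2.2.1.1, s.2.2.2.1)),
      fun s => (s.1.1, (s.2.1, s.1.2.1), (s.2.2.1, s.1.2.2.1), (s.2.2.2, s.1.2.2.2)),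
      fun _ => rfl, fun _ => rfl⟩
  let e2 : V × (X × X') × (Y × Y') × (Z × Z') ≃ (V × X × Y × Z) × (X' × Y' × Z') :=
    ⟨fun s => ((s.1, s.2.1.1, s.2.2.1.1, s.2.2.2.1), (s.2.1.2, s.2.2.1.2, s.2.2.2.2)),
      fun s => (s.1.1, (s.1.2.1, s.2.1), (s.1.2.2.1, s.2.2.1), (s.1.2.2.2, s.2.2.2)),
      fun _ => rfl, fun _ => rfl⟩
  set μ := auxLaw (prodLaw p p') q with hμdef
  have d0 : push μ e0 = auxLaw p Q0 := by
    funext ⟨⟨v, x', y', z'⟩, x, y, z⟩; rw [push_equiv]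
    change p (x, y, z) * p' (x', y', z') * q (y, y') v = p (x, y, z) * (p' (x', y', z') * q (y, y') v)
    ring
  have d1 : push μ (fun s => ((s.1, s.2.1.2, s.2.2.2.2), s.2.1.1, s.2.2.1.1, s.2.2.2.1)) =
      auxLaw p Q1 := by
    rw [← push_auxLaw_map, ← d0, push_push]; rfl
  have d2 : push μ (fun s => ((s.1, s.2.1.1, s.2.2.1.1, s.2.2.2.1), s.2.1.2, s.2.2.1.2,
      s.2.2.2.2)) = auxLaw p' Q2 := by
    change push μ e2 = _
    funext ⟨⟨v, x, y, z⟩, x', y', z'⟩; rw [push_equiv]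
    change p (x, y, z) * p' (x', y', z') * q (y, y') v = p' (x', y', z') * (p (x, y, z) * q (y, y') v)
    ring
  have iXY := entropy_prodLaw hp hp' (fun s => (s.2.1, s.1)) (fun s => (s.2.1, s.1))
  have iX := entropy_prodLaw hp hp' (fun s => s.1) (fun s => s.1)
  have m1 : push μ (fun s => (s.2.1.1, s.2.2.1.1, s.2.2.2.1)) = p := by
    rw [← push_auxLaw_snd p hQ1, ← d1, push_push]
  have m2 : push μ (fun s => (s.2.1.2, s.2.2.1.2, s.2.2.2.2)) = p' := by
    rw [← push_auxLaw_snd p' hQ2, ← d2, push_push]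
  have m12 := push_auxLaw_snd (prodLaw p p') hq
  rw [← hμdef] at m12
  have j1 : entropy p (fun s => (s.2.1, s.1)) = entropy μ (fun s => (s.2.2.1.1, s.2.1.1)) := by
    conv_lhs => rw [← m1]
    rw [entropy_push]
  have j2 : entropy p' (fun s => (s.2.1, s.1)) = entropy μ (fun s => (s.2.2.1.2, s.2.1.2)) := by
    conv_lhs => rw [← m2]
    rw [entropy_push]
  have j3 : entropy p (fun s => s.1) = entropy μ (fun s => s.2.1.1) := by
    conv_lhs => rw [← m1]
    rw [entropy_push]
  have j4 : entropy p' (fun s => s.1) = entropy μ (fun s => s.2.1.2) := by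
    conv_lhs => rw [← m2]
    rw [entropy_push]
  rw [j1, j2, ← m12, entropy_push] at iXY
  rw [j3, j4, ← m12, entropy_push] at iX
  -- Z depends only on X, and Z' only on X', even when V and the other variables are given; this is
  -- what `IndepGiven` provides.
  have gz : Gen μ (fun s => s.2.2.2.1)
      (fun s => (s.1, s.2.1.1, s.2.1.2, s.2.2.1.1, s.2.2.1.2, s.2.2.2.2)) (fun s => s.2.1.1) kz :=
    gen_of_equiv
      (⟨fun s => ((s.1, s.2.1.1, s.2.1.2, s.2.2.1.1, s.2.2.1.2, s.2.2.2.2), s.2.2.2.1),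
        fun s => (s.1.1, (s.1.2.1, s.1.2.2.1), (s.1.2.2.2.1, s.1.2.2.2.2.1),
          (s.2, s.1.2.2.2.2.2)), fun _ => rfl, fun _ => rfl⟩ :
        V × (X × X') × (Y × Y') × (Z × Z') ≃ (V × X × X' × Y × Y' × Z') × Z)
      (fun s => m (s.2.1, s.2.2.2.1) * p' (s.2.2.1, s.2.2.2.2.1, s.2.2.2.2.2) *
        q (s.2.2.2.1, s.2.2.2.2.1) s.1) (fun s => s.2.1) kz (fun c => (hkz c).sum_eq)
      (fun s => by
        obtain ⟨⟨v, x, x', y, y', z'⟩, z⟩ := s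
        change p (x, y, z) * p' (x', y', z') * q (y, y') v =
          m (x, y) * p' (x', y', z') * q (y, y') v * kz x z
        rw [hm]; ring)
  have gz' : Gen μ (fun s => s.2.2.2.2)
      (fun s => (s.1, s.2.1.1, s.2.1.2, s.2.2.1.1, s.2.2.1.2, s.2.2.2.1)) (fun s => s.2.1.2) kz' :=
    gen_of_equiv
      (⟨fun s => ((s.1, s.2.1.1, s.2.1.2, s.2.2.1.1, s.2.2.1.2, s.2.2.2.1), s.2.2.2.2),
        fun s => (s.1.1, (s.1.2.1, s.1.2.2.1), (s.1.2.2.2.1, s.1.2.2.2.2.1),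
          (s.1.2.2.2.2.2, s.2)), fun _ => rfl, fun _ => rfl⟩ :
        V × (X × X') × (Y × Y') × (Z × Z') ≃ (V × X × X' × Y × Y' × Z) × Z')
      (fun s => p (s.2.1, s.2.2.2.1, s.2.2.2.2.2) * m' (s.2.2.1, s.2.2.2.2.1) *
        q (s.2.2.2.1, s.2.2.2.2.1) s.1) (fun s => s.2.2.1) kz' (fun c => (hkz' c).sum_eq)
      (fun s => by
        obtain ⟨⟨v, x, x', y, y', z⟩, z'⟩ := s
        change p (x, y, z) * p' (x', y', z') * q (y, y') v =
          p (x, y, z) * m' (x', y') * q (y, y') v * kz' x' z'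
        rw [hm']; ring)
  rw [auxX_eq d1, auxX_eq d2, auxY_eq d1, auxY_eq d2, auxX, auxY, ← hμdef]
  set W : V × (X × X') × (Y × Y') × (Z × Z') → V := fun s => s.1
  set A : V × (X × X') × (Y × Y') × (Z × Z') → X := fun s => s.2.1.1
  set A' : V × (X × X') × (Y × Y') × (Z × Z') → X' := fun s => s.2.1.2
  set B : V × (X × X') × (Y × Y') × (Z × Z') → Y := fun s => s.2.2.1.1
  set B' : V × (X × X') × (Y × Y') × (Z × Z') → Y' := fun s => s.2.2.1.2
  set C : V × (X × X') × (Y × Y') × (Z × Z') → Z := fun s => s.2.2.2.1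
  set C' : V × (X × X') × (Y × Y') × (Z × Z') → Z' := fun s => s.2.2.2.2
  change condMutualInfo μ W (fun s => (A s, A' s)) (fun s => (C s, C' s)) ≤
      condMutualInfo μ (fun s => (W s, A' s, C' s)) A C +
      condMutualInfo μ (fun s => (W s, A s, B s, C s)) A' C' ∧
    condMutualInfo μ (fun s => (W s, A' s, C' s)) B A +
      condMutualInfo μ (fun s => (W s, A s, B s, C s)) B' A' ≤
    condMutualInfo μ W (fun s => (B s, B' s)) (fun s => (A s, A' s))
  change entropy μ (fun s => ((B s, A s), (B' s, A' s))) = entropy μ (fun s => (B s, A s)) +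
    entropy μ (fun s => (B' s, A' s)) at iXY
  change entropy μ (fun s => (A s, A' s)) = entropy μ A + entropy μ A' at iX
  constructor
  -- The chain rule for I(V; X, X' | Z, Z'), where conditions are dropped in the positive terms and
  -- added in a negative one.
  · have s1 := condEntropy_le_condEntropy hμ (A := A) (B := fun s => (A' s, C s, C' s)) (C := C)
      (by simp +contextual)
    have s2 := condEntropy_le_condEntropy hμ (A := A') (B := fun s => (C s, C' s)) (C := C')
      (by simp +contextual)
    have s3 := condEntropy_le_condEntropy hμ (A := A') (B := fun s => ((W s, A s, B s, C s), C' s))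
      (C := fun s => (W s, C s, C' s)) (by simp +contextual)
    simp only [condMutualInfo, condEntropy] at s1 s2 s3 ⊢
    have c1 : entropy μ (fun s => (A s, A' s, C s, C' s)) =
        entropy μ (fun s => ((A s, A' s), C s, C' s)) :=
      entropy_congr (by intro ω ω'; simp only [Prod.mk.injEq]; tauto)
    have c2 : entropy μ (fun s => (A' s, (W s, A s, B s, C s), C' s)) =
        entropy μ (fun s => ((W s, A s, B s, C s), A' s, C' s)) :=
      entropy_congr (by intro ω ω'; simp only [Prod.mk.injEq]; tauto)
    have c3 : entropy μ (fun s => (A' s, W s, C s, C' s)) =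
        entropy μ (fun s => ((W s, A' s, C' s), C s)) :=
      entropy_congr (by intro ω ω'; simp only [Prod.mk.injEq]; tauto)
    have c4 : entropy μ (fun s => (W s, (A s, A' s), C s, C' s)) =
        entropy μ (fun s => ((W s, A' s, C' s), A s, C s)) :=
      entropy_congr (by intro ω ω'; simp only [Prod.mk.injEq]; tauto)
    linarith
  -- The sum on the left exceeds the chain rule by I(X'; Y | X), I(Z'; Y | V, X, X'), I(X, Y; Y' |
  -- X') and I(Z; Y' | V, X, X', Y), and all four vanish: the first and third since the triples are
  -- independent, the others by the Markov chains.
  · have k1 := gz'.condEntropy_eq_condEntropy (fun c => (hkz' c).sum_eq)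
      (fun s => (W s, A s, A' s)) (fun s => (B s, W s, A s, A' s))
      (by simp +contextual [W, A, A']) (by simp +contextual [A'])
      (by simp +contextual [W, A, A', B]) (by simp +contextual [A'])
    have k2 := gz.condEntropy_eq_condEntropy (fun c => (hkz c).sum_eq)
      (fun s => (W s, A s, A' s, B s)) (fun s => (B' s, W s, A s, A' s, B s))
      (by simp +contextual [W, A, A', B]) (by simp +contextual [A])
      (by simp +contextual [W, A, A', B, B']) (by simp +contextual [A])
    simp only [condMutualInfo, condEntropy] at k1 k2 ⊢
    have c1 : entropy μ (fun s => ((B s, A s), (B' s, A' s))) =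
        entropy μ (fun s => ((B s, B' s), A s, A' s)) :=
      entropy_congr (by intro ω ω'; simp only [Prod.mk.injEq]; tauto)
    have c2 : entropy μ (fun s => (C' s, W s, A s, A' s)) =
        entropy μ (fun s => ((W s, A' s, C' s), A s)) :=
      entropy_congr (by intro ω ω'; simp only [Prod.mk.injEq]; tauto)
    have c3 : entropy μ (fun s => (C' s, B s, W s, A s, A' s)) =
        entropy μ (fun s => ((W s, A' s, C' s), B s, A s)) :=
      entropy_congr (by intro ω ω'; simp only [Prod.mk.injEq]; tauto)
    have c4 : entropy μ (fun s => (B s, W s, A s, A' s)) =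
        entropy μ (fun s => (W s, A s, A' s, B s)) :=
      entropy_congr (by intro ω ω'; simp only [Prod.mk.injEq]; tauto)
    have c5 : entropy μ (fun s => (C s, W s, A s, A' s, B s)) =
        entropy μ (fun s => ((W s, A s, B s, C s), A' s)) :=
      entropy_congr (by intro ω ω'; simp only [Prod.mk.injEq]; tauto)
    have c6 : entropy μ (fun s => (C s, B' s, W s, A s, A' s, B s)) =
        entropy μ (fun s => ((W s, A s, B s, C s), B' s, A' s)) :=
      entropy_congr (by intro ω ω'; simp only [Prod.mk.injEq]; tauto)
    have c7 : entropy μ (fun s => (B' s, W s, A s, A' s, B s)) =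
        entropy μ (fun s => (W s, (B s, B' s), A s, A' s)) :=
      entropy_congr (by intro ω ω'; simp only [Prod.mk.injEq]; tauto)
    have c8 : entropy μ (fun s => (W s, A s, A' s)) = entropy μ (fun s => (W s, A s, A' s)) := rfl
    linarith

end
end Info

/-! ### Blocks of independent letters and single-letterization -/

namespace Info

/-- The law of independent copies, indexed by `ι`, of a triple with law `p`. -/
def block {X Y Z : Type*} (ι : Type*) [Fintype ι] (p : X × Y × Z → ℝ)
    (s : (ι → X) × (ι → Y) × (ι → Z)) : ℝ := ∏ i, p (s.1 i, s.2.1 i, s.2.2 i)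

/-- Independent uses, indexed by `ι`, of the channel `K`. -/
def blockK {A B : Type*} (ι : Type*) [Fintype ι] (K : A → B → ℝ) (a : ι → A) (b : ι → B) : ℝ :=
  ∏ i, K (a i) (b i)

/-- Two channels used independently. -/
def prodK {A B A' B' : Type*} (K : A → B → ℝ) (K' : A' → B' → ℝ) (a : A × A') (b : B × B') : ℝ :=
  K a.1 b.1 * K' a.2 b.2

section
set_option linter.unusedSectionVars false
variable {ι V X Y Z X' Y' Z' A B C A' B' C' : Type*} [Fintype ι] [DecidableEq ι] [Fintype V] [Fintype X]
  [Fintype Y] [Fintype Z] [Fintype X'] [Fintype Y'] [Fintype Z'] [Fintype A] [Fintype B]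
  [Fintype C] [Fintype A'] [Fintype B'] [Fintype C']

theorem sum_prod_apply (g : ι → A → ℝ) : ∑ f : ι → A, ∏ i, g i (f i) = ∏ i, ∑ a, g i a := by
  classical
  rw [Finset.prod_univ_sum, Fintype.piFinset_univ]

/-- A function with values in triples as a triple of functions. -/
def tripleEquiv (ι X Y Z : Type*) : (ι → X) × (ι → Y) × (ι → Z) ≃ (ι → X × Y × Z) where
  toFun s i := (s.1 i, s.2.1 i, s.2.2 i)
  invFun f := (fun i => (f i).1, fun i => (f i).2.1, fun i => (f i).2.2)
  left_inv _ := rfl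
  right_inv _ := rfl

theorem isLaw_pi {p : A → ℝ} (hp : IsLaw p) : IsLaw (fun f : ι → A => ∏ i, p (f i)) :=
  ⟨fun _ => Finset.prod_nonneg fun _ _ => hp.nonneg _, by
    rw [sum_prod_apply]; simp [hp.sum_eq]⟩

theorem isLaw_block {p : X × Y × Z → ℝ} (hp : IsLaw p) : IsLaw (block ι p) := by
  classical
  refine ⟨fun s => Finset.prod_nonneg fun _ _ => hp.nonneg _, ?_⟩
  rw [← (tripleEquiv ι X Y Z).symm.sum_comp]
  exact (isLaw_pi hp).sum_eq

theorem IsKernel.blockK {K : A → B → ℝ} (hK : IsKernel K) : IsKernel (blockK ι K) := fun a =>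
  ⟨fun _ => Finset.prod_nonneg fun _ _ => (hK _).nonneg _, by
    classical
    simp_rw [Info.blockK]
    rw [sum_prod_apply (fun i b => K (a i) b)]
    simp [(hK _).sum_eq]⟩

theorem IsKernel.prodK {K : A → B → ℝ} {K' : A' → B' → ℝ} (hK : IsKernel K) (hK' : IsKernel K') :
    IsKernel (prodK K K') := fun a =>
  ⟨fun _ => mul_nonneg ((hK _).nonneg _) ((hK' _).nonneg _), by
    simp_rw [Info.prodK, Fintype.sum_prod_type, ← Finset.mul_sum, (hK' _).sum_eq, mul_one,
      (hK _).sum_eq]⟩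

theorem indepGiven_block {p : X × Y × Z → ℝ} (hi : IndepGiven p) : IndepGiven (block ι p) := by
  obtain ⟨m, k, hk, h⟩ := hi
  refine ⟨fun s => ∏ i, m (s.1 i, s.2 i), Info.blockK ι k, hk.blockK, fun x y z => ?_⟩
  simp only [block, Info.blockK, h, Finset.prod_mul_distrib]

theorem auxInfo_equiv {p : X × Y × Z → ℝ} {Q : Y → V → ℝ} {p' : X' × Y' × Z' → ℝ}
    {Q' : Y' → V → ℝ} (eX : X ≃ X') (eY : Y ≃ Y') (eZ : Z ≃ Z')
    (hp : ∀ x y z, p' (eX x, eY y, eZ z) = p (x, y, z)) (hQ : ∀ y, Q' (eY y) = Q y) :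
    auxX p' Q' = auxX p Q ∧ auxY p' Q' = auxY p Q := by
  have h : push (auxLaw p Q) (fun s => (s.1, eX s.2.1, eY s.2.2.1, eZ s.2.2.2)) =
      auxLaw p' Q' := by
    change push (auxLaw p Q) ((Equiv.refl V).prodCongr (eX.prodCongr (eY.prodCongr eZ))) = _
    funext ⟨v, x, y, z⟩
    rw [push_equiv]
    change p (eX.symm x, eY.symm y, eZ.symm z) * Q (eY.symm y) v = p' (x, y, z) * Q' y v
    rw [← hp, ← hQ]
    simp
  rw [auxX_eq h, auxY_eq h, auxX, auxY]
  simp only [condMutualInfo, condEntropy]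
  constructor
  · rw [entropy_congr (A := fun s : V × X × Y × Z => (s.1, eZ s.2.2.2)) (B := fun s => (s.1, s.2.2.2))
      (by simp), entropy_congr (A := fun s : V × X × Y × Z => eZ s.2.2.2) (B := fun s => s.2.2.2)
      (by simp), entropy_congr (A := fun s : V × X × Y × Z => (s.1, eX s.2.1, eZ s.2.2.2))
      (B := fun s => (s.1, s.2.1, s.2.2.2)) (by simp),
      entropy_congr (A := fun s : V × X × Y × Z => (eX s.2.1, eZ s.2.2.2))
      (B := fun s => (s.2.1, s.2.2.2)) (by simp)]
  · rw [entropy_congr (A := fun s : V × X × Y × Z => (s.1, eX s.2.1)) (B := fun s => (s.1, s.2.1))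
      (by simp), entropy_congr (A := fun s : V × X × Y × Z => eX s.2.1) (B := fun s => s.2.1)
      (by simp), entropy_congr (A := fun s : V × X × Y × Z => (s.1, eY s.2.2.1, eX s.2.1))
      (B := fun s => (s.1, s.2.2.1, s.2.1)) (by simp),
      entropy_congr (A := fun s : V × X × Y × Z => (eY s.2.2.1, eX s.2.1))
      (B := fun s => (s.2.2.1, s.2.1)) (by simp)]

theorem auxX_nonneg {p : X × Y × Z → ℝ} {Q : Y → V → ℝ} (hp : IsLaw p) (hQ : IsKernel Q) :
    0 ≤ auxX p Q := condMutualInfo_nonneg (isLaw_auxLaw hp hQ) _ _ _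

theorem auxY_nonneg {p : X × Y × Z → ℝ} {Q : Y → V → ℝ} (hp : IsLaw p) (hQ : IsKernel Q) :
    0 ≤ auxY p Q := condMutualInfo_nonneg (isLaw_auxLaw hp hQ) _ _ _

/-- Single-letterization of an auxiliary variable generated from `n` independent letters. -/
theorem exists_single_letter_aux {p : X × Y × Z → ℝ} (hp : IsLaw p) (hi : IndepGiven p) (n : ℕ) :
    ∀ (k : ℕ) (Q : (Fin n → Y) → Fin k → ℝ), IsKernel Q →
      ∃ (k' : ℕ) (Q' : Y → Fin k' → ℝ), IsKernel Q' ∧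
        auxX (block (Fin n) p) Q ≤ n * auxX p Q' ∧ n * auxY p Q' ≤ auxY (block (Fin n) p) Q := by
  induction n with
  | zero =>
    intro k Q hQ
    refine ⟨1, fun _ _ => 1, fun _ => ⟨fun _ => zero_le_one, by simp⟩, ?_, ?_⟩
    · simp only [Nat.cast_zero, zero_mul, auxX, condMutualInfo, condEntropy]
      rw [entropy_congr (A := fun ω : Fin k × (Fin 0 → X) × (Fin 0 → Y) × (Fin 0 → Z) =>
          (ω.1, ω.2.1, ω.2.2.2)) (B := fun ω => (ω.1, ω.2.2.2))
          (by intro ω ω'; simp only [Prod.mk.injEq, Subsingleton.elim ω.2.1 ω'.2.1, true_and]),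
        entropy_congr (A := fun ω : Fin k × (Fin 0 → X) × (Fin 0 → Y) × (Fin 0 → Z) =>
          (ω.2.1, ω.2.2.2)) (B := fun ω => ω.2.2.2)
          (by intro ω ω'; simp only [Prod.mk.injEq, Subsingleton.elim ω.2.1 ω'.2.1, true_and])]
      linarith
    · simpa using auxY_nonneg (isLaw_block hp) hQ
  | succ n ih =>
    intro k Q hQ
    obtain ⟨k1, k2, Q1, Q2, hQ1, hQ2, hX, hY⟩ := exists_split_aux hp (isLaw_block (ι := Fin n) hp)
      hi (indepGiven_block hi) (q := fun y => Q (Fin.cons y.1 y.2)) (fun y => hQ _)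
    obtain ⟨k3, Q3, hQ3, hX3, hY3⟩ := ih k2 Q2 hQ2
    have he := auxInfo_equiv (p := prodLaw p (block (Fin n) p)) (p' := block (Fin (n + 1)) p)
      (Q := fun y => Q (Fin.cons y.1 y.2)) (Q' := Q)
      (Fin.consEquiv fun _ => X) (Fin.consEquiv fun _ => Y) (Fin.consEquiv fun _ => Z)
      (fun x y z => by
        simp [block, prodLaw, Fin.prod_univ_succ, Fin.consEquiv]) (fun y => rfl)
    have h0 : (0 : ℝ) ≤ 1 / (n + 1) := by positivity
    have h1 : (1 : ℝ) / (n + 1) ≤ 1 := by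
      rw [div_le_one (by positivity)]; linarith [(Nat.cast_nonneg n : (0 : ℝ) ≤ n)]
    -- Time sharing with weight 1 / (n + 1) for the new letter turns the sum of the contributions
    -- into n + 1 times the contribution of one kernel.
    obtain ⟨k4, Q4, hQ4, hX4, hY4⟩ := exists_fin_kernel p (isKernel_mix h0 h1 hQ3 hQ1)
    refine ⟨k4, Q4, hQ4, ?_, ?_⟩
    · rw [he.1, hX4, auxX_mix hp h0 h1 hQ3 hQ1]
      have : ((n + 1 : ℕ) : ℝ) * ((1 - 1 / (n + 1)) * auxX p Q3 + 1 / (n + 1) * auxX p Q1) =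
          n * auxX p Q3 + auxX p Q1 := by
        push_cast; field_simp; ring
      rw [this]; linarith
    · rw [he.2, hY4, auxY_mix hp h0 h1 hQ3 hQ1]
      have : ((n + 1 : ℕ) : ℝ) * ((1 - 1 / (n + 1)) * auxY p Q3 + 1 / (n + 1) * auxY p Q1) =
          n * auxY p Q3 + auxY p Q1 := by
        push_cast; field_simp; ring
      rw [this]; linarith

theorem chanInfo_const {m : A → ℝ} (hm : IsLaw m) {k : B → ℝ} (hk : IsLaw k) :
    chanInfo m (fun _ => k) = 0 := by
  rw [chanInfo_eq m (fun _ => hk), ← Finset.sum_mul, hm.sum_eq, one_mul, sub_eq_zero]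
  congr 1
  funext b
  rw [outLaw, ← Finset.sum_mul, hm.sum_eq, one_mul]

theorem outLaw_kcomp (m : A → ℝ) (K : A → B → ℝ) (D : B → C → ℝ) :
    outLaw m (kcomp K D) = outLaw (outLaw m K) D := by
  funext c
  simp only [outLaw, kcomp, Finset.mul_sum, Finset.sum_mul]
  rw [Finset.sum_comm]
  exact Finset.sum_congr rfl fun _ _ => Finset.sum_congr rfl fun _ _ => by ring

/-- Time sharing between two input laws. -/
def mixLaw (t : ℝ) (m m' : A → ℝ) (a : A) : ℝ := (1 - t) * m a + t * m' a

theorem isLaw_mixLaw {t : ℝ} (h0 : 0 ≤ t) (h1 : t ≤ 1) {m m' : A → ℝ} (hm : IsLaw m)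
    (hm' : IsLaw m') : IsLaw (mixLaw t m m') :=
  ⟨fun a => add_nonneg (mul_nonneg (by linarith) (hm.nonneg a)) (mul_nonneg h0 (hm'.nonneg a)), by
    simp only [mixLaw, Finset.sum_add_distrib, ← Finset.mul_sum, hm.sum_eq, hm'.sum_eq]; ring⟩

/-- The mass function `(1 - t, t)` on `Bool`. -/
def boolLaw (t : ℝ) (b : Bool) : ℝ := if b then t else 1 - t

/-- The last term is the information that the output carries about the time-sharing bit. -/
theorem chanInfo_mix {t : ℝ} {m m' : A → ℝ} {K : A → B → ℝ} (hK : IsKernel K) (hm : IsLaw m)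
    (hm' : IsLaw m') :
    chanInfo (mixLaw t m m') K = (1 - t) * chanInfo m K + t * chanInfo m' K +
      chanInfo (boolLaw t) (fun b => if b then outLaw m' K else outLaw m K) := by
  rw [chanInfo_eq _ hK, chanInfo_eq _ hK, chanInfo_eq _ hK, chanInfo_eq (boolLaw t)
    (fun b => by cases b <;> simp [hm.outLaw hK, hm'.outLaw hK])]
  have h1 : outLaw (boolLaw t) (fun b => if b then outLaw m' K else outLaw m K) =
      outLaw (mixLaw t m m') K := by
    funext b
    simp only [outLaw, boolLaw, mixLaw, Fintype.sum_bool, add_mul, Finset.sum_add_distrib,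
      mul_assoc]
    simp [outLaw, Finset.mul_sum, add_comm]
  rw [h1]
  simp only [mixLaw, boolLaw, Fintype.sum_bool, add_mul, Finset.sum_add_distrib, mul_assoc,
    ← Finset.mul_sum]
  simp
  ring

/-- Concavity of the gain: its excess over the average is the difference between what the two
outputs reveal about the time-sharing bit, and this is nonnegative by data processing. -/
theorem gain_mix_ge {t : ℝ} (h0 : 0 ≤ t) (h1 : t ≤ 1) {m m' : A → ℝ} {K : A → B → ℝ}
    {L : A → C → ℝ} (hK : IsKernel K) (hm : IsLaw m) (hm' : IsLaw m') (h : Degraded K L) :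
    (1 - t) * (chanInfo m K - chanInfo m L) + t * (chanInfo m' K - chanInfo m' L) ≤
      chanInfo (mixLaw t m m') K - chanInfo (mixLaw t m m') L := by
  obtain ⟨D, hD, rfl⟩ := h
  rw [chanInfo_mix hK hm hm', chanInfo_mix (hK.kcomp hD) hm hm']
  have hb : IsLaw (boolLaw t) :=
    ⟨fun b => by cases b <;> simp [boolLaw, h0, h1], by simp [boolLaw]⟩
  have := chanInfo_le_of_degraded hb (K := fun b => if b then outLaw m' K else outLaw m K)
    (L := fun b => if b then outLaw m' (kcomp K D) else outLaw m (kcomp K D))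
    (fun b => by cases b <;> simp [hm.outLaw hK, hm'.outLaw hK])
    ⟨D, hD, by funext b; cases b <;> simp [outLaw_kcomp] <;> rfl⟩
  linarith

theorem degraded_const (K : A → B → ℝ) (hK : IsKernel K) {k : C → ℝ} (hk : IsLaw k) :
    Degraded K (fun _ => k) :=
  ⟨fun _ => k, fun _ => hk, by
    funext a c
    rw [kcomp, ← Finset.sum_mul, (hK a).sum_eq, one_mul]⟩

/-- A constant output is a degraded version of every channel and conveys nothing, so the gain over
it is the information itself. -/
theorem chanInfo_mix_ge {t : ℝ} (h0 : 0 ≤ t) (h1 : t ≤ 1) {m m' : A → ℝ} {K : A → B → ℝ}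
    (hK : IsKernel K) (hm : IsLaw m) (hm' : IsLaw m') :
    (1 - t) * chanInfo m K + t * chanInfo m' K ≤ chanInfo (mixLaw t m m') K := by
  have hu : IsLaw (fun _ : Unit => (1 : ℝ)) := ⟨fun _ => zero_le_one, by simp⟩
  have := gain_mix_ge h0 h1 hK hm hm' (degraded_const K hK hu)
  rw [chanInfo_const hm hu, chanInfo_const hm' hu, chanInfo_const (isLaw_mixLaw h0 h1 hm hm') hu]
    at this
  linarith

/-- Processing one of two variables does not increase their mutual information. -/
theorem mutualInfo_process {m : A × B → ℝ} (hm : IsLaw m) {D : A → C → ℝ} (hD : IsKernel D) :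
    mutualInfo (comp m (fun x => D x.1)) (fun x => x.2) (fun x => x.1.2) ≤
      mutualInfo m (fun x => x.1) (fun x => x.2) := by
  have hD' : IsKernel (fun x : A × B => D x.1) := fun x => hD x.1
  have hν := isLaw_comp hm hD'
  have e : push (comp m (fun x => D x.1)) (fun x => x.1) = m := by
    rw [push_comp_fst _ hD' (fun x => x), push_id]
  have g := gen_comp m (fun x : A × B => x.1) hD
  have k := g.condEntropy_eq_condEntropy (fun a => (hD a).sum_eq) (fun x => (x.1.2, x.1.1))
    (fun x => x.1.1) (by simp +contextual) (by simp) (by simp +contextual) (by simp)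
  have s := condEntropy_le_condEntropy hν (A := fun x => x.1.2) (B := fun x => (x.2, x.1.1))
    (C := fun x => x.2) (by simp)
  conv_rhs => rw [← e]
  rw [mutualInfo_eq_swap, mutualInfo_eq_swap]
  simp only [condEntropy, entropy_push] at k s ⊢
  have c1 : entropy (comp m (fun x => D x.1)) (fun x => (x.2, x.1.2, x.1.1)) =
      entropy (comp m (fun x => D x.1)) (fun x => (x.1.2, x.2, x.1.1)) :=
    entropy_congr (by intro ω ω'; simp only [Prod.mk.injEq]; tauto)
  linarith

theorem mutualInfo_comm {Ω : Type*} [Fintype Ω] (μ : Ω → ℝ) (S : Ω → A) (T : Ω → B) :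
    mutualInfo μ S T = mutualInfo μ T S := by
  rw [mutualInfo_eq_swap, mutualInfo]

theorem mutualInfo_process_both {m : A × A' → ℝ} (hm : IsLaw m) {D : A → C → ℝ} {D' : A' → C' → ℝ}
    (hD : IsKernel D) (hD' : IsKernel D') :
    mutualInfo (outLaw m (prodK D D')) (fun x => x.1) (fun x => x.2) ≤
      mutualInfo m (fun x => x.1) (fun x => x.2) := by
  classical
  have h1 := mutualInfo_process hm hD
  set m1 := push (comp m (fun x => D x.1)) (fun x => (x.1.2, x.2)) with hm1
  have hm1l : IsLaw m1 := (isLaw_comp hm (fun x => hD x.1)).push _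
  have h2 := mutualInfo_process hm1l hD'
  have e1 : mutualInfo m1 (fun x => x.1) (fun x => x.2) =
      mutualInfo (comp m (fun x => D x.1)) (fun x => x.2) (fun x => x.1.2) := by
    rw [mutualInfo_comm]
    exact mutualInfo_congr_push (by rw [hm1, push_push])
  have e2 : mutualInfo (comp m1 (fun x => D' x.1)) (fun x => x.2) (fun x => x.1.2) =
      mutualInfo (outLaw m (prodK D D')) (fun x => x.1) (fun x => x.2) := by
    rw [mutualInfo_comm]
    refine mutualInfo_congr_push ?_
    change _ = push (outLaw m (prodK D D')) (fun x => x)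
    rw [push_id]
    funext ⟨c, c'⟩
    have h3 : ∀ a' c, m1 (a', c) = ∑ a, m (a, a') * D a c := by
      intro a' c
      rw [hm1, push_apply, Fintype.sum_prod_type, Fintype.sum_prod_type]
      refine Finset.sum_congr rfl fun a _ => ?_
      rw [Finset.sum_eq_single a' (fun x _ hx => by simp [hx]) (by simp)]
      simp [comp]
    have h4 : push (comp m1 (fun x => D' x.1)) (fun x => (x.1.2, x.2)) (c, c') =
        ∑ a', m1 (a', c) * D' a' c' := by
      rw [push_apply, Fintype.sum_prod_type, Fintype.sum_prod_type]
      refine Finset.sum_congr rfl fun a' _ => ?_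
      rw [Finset.sum_eq_single c (fun x _ hx => by simp [hx]) (by simp)]
      simp [comp]
    rw [h4, outLaw, Fintype.sum_prod_type_right]
    simp_rw [h3, Finset.sum_mul, prodK, mul_assoc]
  rw [e1] at h2
  rw [e2] at h2
  exact h2.trans h1

theorem ent_prodK {K : A → B → ℝ} {K' : A' → B' → ℝ} (hK : IsKernel K) (hK' : IsKernel K')
    (a : A × A') : ent (prodK K K' a) = ent (K a.1) + ent (K' a.2) :=
  ent_indep (hK a.1) (hK' a.2)

theorem push_outLaw_prodK_fst (r : A × A' → ℝ) (K : A → B → ℝ) {K' : A' → B' → ℝ}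
    (hK' : IsKernel K') : push (outLaw r (prodK K K')) Prod.fst = outLaw (push r Prod.fst) K := by
  classical
  funext b
  rw [push_apply, outLaw, sum_push_mul r Prod.fst (fun a => K a b), Fintype.sum_prod_type,
    Finset.sum_eq_single b (fun x _ hx => by simp [hx]) (by simp)]
  simp only [if_true, outLaw, prodK]
  rw [Finset.sum_comm]
  simp_rw [← Finset.mul_sum, (hK' _).sum_eq, mul_one]

theorem push_outLaw_prodK_snd (r : A × A' → ℝ) {K : A → B → ℝ} (K' : A' → B' → ℝ)
    (hK : IsKernel K) : push (outLaw r (prodK K K')) Prod.snd = outLaw (push r Prod.snd) K' := by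
  classical
  funext b
  rw [push_apply, outLaw, sum_push_mul r Prod.snd (fun a => K' a b), Fintype.sum_prod_type_right,
    Finset.sum_eq_single b (fun x _ hx => by simp [hx]) (by simp)]
  simp only [if_true, outLaw, prodK]
  rw [Finset.sum_comm]
  refine Finset.sum_congr rfl fun a _ => ?_
  rw [← Finset.mul_sum, ← Finset.sum_mul, (hK _).sum_eq, one_mul]

/-- The noises are independent, so H(B, B' | A, A') is a sum; the only correction comes from the
dependence between the outputs. -/
theorem chanInfo_prodK {r : A × A' → ℝ} {K : A → B → ℝ} {K' : A' → B' → ℝ} (hK : IsKernel K)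
    (hK' : IsKernel K') :
    chanInfo r (prodK K K') = chanInfo (push r Prod.fst) K + chanInfo (push r Prod.snd) K' -
      mutualInfo (outLaw r (prodK K K')) (fun x => x.1) (fun x => x.2) := by
  rw [chanInfo_eq _ (hK.prodK hK'), chanInfo_eq _ hK, chanInfo_eq _ hK', mutualInfo, condEntropy,
    entropy_eq_ent, entropy_eq_ent, entropy_eq_ent, push_outLaw_prodK_fst r K hK',
    push_outLaw_prodK_snd r K' hK, push_id, sum_push_mul r Prod.fst (fun a => ent (K a)),
    sum_push_mul r Prod.snd (fun a => ent (K' a))]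
  simp_rw [ent_prodK hK hK', mul_add, Finset.sum_add_distrib]
  ring

/-- Subadditivity: the correction I(B; B') of the better channels is at least the correction I(C;
C') of the degraded ones, which arise from B and B' by separate processing. -/
theorem gain_prodK_le {r : A × A' → ℝ} (hr : IsLaw r) {K : A → B → ℝ} {K' : A' → B' → ℝ}
    {L : A → C → ℝ} {L' : A' → C' → ℝ} (hK : IsKernel K) (hK' : IsKernel K') (h : Degraded K L)
    (h' : Degraded K' L') :
    chanInfo r (prodK K K') - chanInfo r (prodK L L') ≤
      (chanInfo (push r Prod.fst) K - chanInfo (push r Prod.fst) L) +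
      (chanInfo (push r Prod.snd) K' - chanInfo (push r Prod.snd) L') := by
  obtain ⟨D, hD, rfl⟩ := h
  obtain ⟨D', hD', rfl⟩ := h'
  rw [chanInfo_prodK hK hK', chanInfo_prodK (hK.kcomp hD) (hK'.kcomp hD')]
  have e : prodK (kcomp K D) (kcomp K' D') = kcomp (prodK K K') (prodK D D') := by
    funext a c
    simp only [prodK, kcomp, Fintype.sum_prod_type, Finset.sum_mul_sum]
    exact Finset.sum_congr rfl fun _ _ => Finset.sum_congr rfl fun _ _ => by ring
  have := mutualInfo_process_both (hr.outLaw (hK.prodK hK')) hD hD'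
  rw [e, outLaw_kcomp]
  linarith

theorem chanInfo_equiv {r : A → ℝ} {K : A → B → ℝ} {K' : A' → B' → ℝ}
    (eA : A ≃ A') (eB : B ≃ B') (h : ∀ a b, K' (eA a) (eB b) = K a b) :
    chanInfo (push r eA) K' = chanInfo r K := by
  have h1 : comp (push r eA) K' = push (comp r K) (fun x => (eA x.1, eB x.2)) := by
    change _ = push (comp r K) (eA.prodCongr eB)
    funext ⟨a, b⟩
    rw [push_equiv]
    change push r eA a * K' a b = r (eA.symm a) * K (eA.symm a) (eB.symm b)
    rw [push_equiv, ← h]; simp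
  rw [chanInfo, h1, chanInfo]
  simp only [mutualInfo, condEntropy, entropy_push]
  rw [entropy_congr (A := fun x : A × B => eA x.1) (B := Prod.fst) (by simp),
    entropy_congr (A := fun x : A × B => eB x.2) (B := Prod.snd) (by simp),
    entropy_congr (A := fun x : A × B => (eA x.1, eB x.2)) (B := fun x => (x.1, x.2)) (by simp)]

theorem degraded_block {K : A → B → ℝ} {L : A → C → ℝ} (h : Degraded K L) :
    Degraded (blockK ι K) (blockK ι L) := by
  classical
  obtain ⟨D, hD, rfl⟩ := h
  refine ⟨blockK ι D, hD.blockK, ?_⟩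
  funext a c
  simp only [blockK, kcomp, ← Finset.prod_mul_distrib]
  rw [sum_prod_apply (fun i b => K (a i) b * D b (c i))]

/-- Single-letterization of the input of a channel. -/
theorem exists_single_letter_input [Nonempty A] {K : A → B → ℝ} (hK : IsKernel K) (m : ℕ) :
    ∀ r : (Fin m → A) → ℝ, IsLaw r → ∃ r' : A → ℝ, IsLaw r' ∧ ∀ L : A → C → ℝ, Degraded K L →
      chanInfo r (blockK (Fin m) K) - chanInfo r (blockK (Fin m) L) ≤
        m * (chanInfo r' K - chanInfo r' L) := by
  classical
  induction m with
  | zero =>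
    intro r hr
    refine ⟨Pi.single (Classical.arbitrary A) 1, ⟨fun a => ?_, by simp⟩, fun L h => ?_⟩
    · by_cases h : a = Classical.arbitrary A
      · subst h; simp
      · simp [h]
    · have hL : IsKernel L := by obtain ⟨D, hD, rfl⟩ := h; exact hK.kcomp hD
      have h1 : blockK (Fin 0) K = fun _ => fun _ => 1 := by
        funext a b; simp [blockK]
      have h2 : chanInfo r (blockK (Fin 0) K) = 0 := by
        rw [h1]; exact chanInfo_const hr ⟨fun _ => zero_le_one, by simp⟩
      have := chanInfo_nonneg hr (hL.blockK (ι := Fin 0))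
      simp only [Nat.cast_zero, zero_mul]
      linarith
  | succ m ih =>
    intro r hr
    set e := (Fin.consEquiv (n := m) fun _ => A).symm with he
    set r1 := push r e with hr1
    have hr1l : IsLaw r1 := hr.push _
    obtain ⟨r2, hr2, h2⟩ := ih (push r1 Prod.snd) (hr1l.push _)
    have h0 : (0 : ℝ) ≤ 1 / (m + 1) := by positivity
    have h1 : (1 : ℝ) / (m + 1) ≤ 1 := by
      rw [div_le_one (by positivity)]; linarith [(Nat.cast_nonneg m : (0 : ℝ) ≤ m)]
    have hr3 := hr1l.push (Prod.fst : A × (Fin m → A) → A)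
    -- The law is fixed before `L` is given: the same input must serve for the constraint, where `L`
    -- is constant, and for the wiretap gain.
    refine ⟨mixLaw (1 / (m + 1)) r2 (push r1 Prod.fst), isLaw_mixLaw h0 h1 hr2 hr3, fun L h => ?_⟩
    have k1 := gain_prodK_le hr1l hK (hK.blockK (ι := Fin m)) h (degraded_block h)
    have k2 := gain_mix_ge h0 h1 hK hr2 hr3 h
    have k3 := h2 L h
    have e1 : chanInfo r1 (prodK K (blockK (Fin m) K)) = chanInfo r (blockK (Fin (m + 1)) K) :=
      chanInfo_equiv e (Fin.consEquiv fun _ => B).symm (fun a b => by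
        simp [prodK, blockK, Fin.prod_univ_succ, he, Fin.consEquiv, Fin.tail])
    have e2 : chanInfo r1 (prodK L (blockK (Fin m) L)) = chanInfo r (blockK (Fin (m + 1)) L) :=
      chanInfo_equiv e (Fin.consEquiv fun _ => C).symm (fun a b => by
        simp [prodK, blockK, Fin.prod_univ_succ, he, Fin.consEquiv, Fin.tail])
    rw [← e1, ← e2]
    have k4 := mul_le_mul_of_nonneg_left k2 (by positivity : (0 : ℝ) ≤ m + 1)
    have e3 : ∀ u v : ℝ, ((m : ℝ) + 1) * ((1 - 1 / (m + 1)) * u + 1 / (m + 1) * v) = m * u + v := by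
      intro u v; field_simp; ring
    rw [e3] at k4
    push_cast
    linarith

end
end Info

/-! ### Single-letter bounds for the two-stage experiment -/

namespace Info

/-- Independent uses, indexed by `ι`, of a channel with two outputs. -/
def blockW {A B C : Type*} (ι : Type*) [Fintype ι] (w : A → B × C → ℝ) (a : ι → A)
    (x : (ι → B) × (ι → C)) : ℝ := ∏ i, w (a i) (x.1 i, x.2 i)

section
set_option linter.unusedSectionVars false
variable {ι X Y Z A B C : Type*} [Fintype ι] [DecidableEq ι] [Fintype X]
  [Fintype Y] [Fintype Z] [Fintype A] [Fintype B] [Fintype C]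

theorem kfst_blockW (w : A → B × C → ℝ) : kfst (blockW ι w) = blockK ι (kfst w) := by
  funext a b
  simp only [kfst, blockW, blockK]
  rw [sum_prod_apply (fun i c => w (a i) (b i, c))]

theorem ksnd_blockW (w : A → B × C → ℝ) : ksnd (blockW ι w) = blockK ι (ksnd w) := by
  funext a b
  simp only [ksnd, blockW, blockK]
  rw [sum_prod_apply (fun i c => w (a i) (c, b i))]

theorem IsKernel.blockW {w : A → B × C → ℝ} (hw : IsKernel w) : IsKernel (blockW ι w) := fun a =>
  ⟨fun _ => Finset.prod_nonneg fun _ _ => (hw _).nonneg _, by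
    have h : ∑ x : (ι → B) × (ι → C), Info.blockW ι w a x =
        ∑ f : ι → B × C, ∏ i, w (a i) (f i) :=
      (Equiv.arrowProdEquivProdArrow ι (fun _ => B) (fun _ => C)).symm.sum_comp
        (fun f : ι → B × C => ∏ i, w (a i) (f i))
    rw [h, sum_prod_apply (fun i => w (a i))]
    simp [(hw _).sum_eq]⟩

theorem push_twoWayLaw_aux {τ : Type*} [Fintype τ] (p : X × Y × Z → ℝ) (q : Y → A → ℝ)
    (w : A → B × C → ℝ) (T : Y × A → τ) :
    push (twoWayLaw p q w) (fun x => ((T (x.1.1.2.1, x.1.2), x.2.1), x.1.1.1, x.1.1.2.1, x.1.1.2.2)) =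
      auxLaw p (fun y => push (comp (q y) w) (fun x => (T (y, x.1), x.2.1))) := by
  classical
  funext ⟨v, s⟩
  rw [push_apply, auxLaw, push_apply, Finset.mul_sum, Fintype.sum_prod_type, Fintype.sum_prod_type,
    Finset.sum_eq_single s (fun x _ hx => by
      refine Finset.sum_eq_zero fun a _ => Finset.sum_eq_zero fun bc _ => if_neg fun h => hx ?_
      simp only [Prod.mk.injEq] at h
      exact h.2) (by simp), Fintype.sum_prod_type]
  refine Finset.sum_congr rfl fun a _ => Finset.sum_congr rfl fun bc _ => ?_
  simp only [Prod.mk.injEq, Prod.eta, and_true, twoWayLaw, comp]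
  by_cases h : (T (s.2.1, a), bc.1) = v
  · simp [h, mul_assoc]
  · simp [h]

/-- Single-letter form of what a protocol can achieve in which Alice sends `n` independent letters
before Bob sends `m` letters that depend on what he has received. -/
theorem exists_single_letter_bound [Nonempty A] {τ : Type*} [Fintype τ] {p : X × Y × Z → ℝ}
    (hp : IsLaw p) (hi : IndepGiven p) {w : A → B × C → ℝ} (hw : IsKernel w)
    (hd : Degraded (kfst w) (ksnd w) ∨ Degraded (ksnd w) (kfst w)) {n m : ℕ}
    {q : (Fin n → Y) → (Fin m → A) → ℝ} (hq : IsKernel q) (T : (Fin n → Y) × (Fin m → A) → τ) :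
    ∃ (k : ℕ) (Q : Y → Fin k → ℝ) (r : A → ℝ), IsKernel Q ∧ IsLaw r ∧
      n * auxY p Q ≤ m * chanInfo r (kfst w) +
        condEntropy (twoWayLaw (block (Fin n) p) q (blockW (Fin m) w))
          (fun x => T (x.1.1.2.1, x.1.2)) (fun x => (x.1.1.1, x.2.1)) ∧
      condEntropy (twoWayLaw (block (Fin n) p) q (blockW (Fin m) w))
          (fun x => T (x.1.1.2.1, x.1.2)) (fun x => (x.1.1.2.2, x.2.2)) ≤
        n * auxX p Q + m * max 0 (chanInfo r (kfst w) - chanInfo r (ksnd w)) +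
        condEntropy (twoWayLaw (block (Fin n) p) q (blockW (Fin m) w))
          (fun x => T (x.1.1.2.1, x.1.2)) (fun x => (x.1.1.1, x.2.1)) := by
  have hpn := isLaw_block (ι := Fin n) hp
  have hwm := hw.blockW (ι := Fin m)
  have h1 := infoVY_twoWayLaw_le hpn hq hwm T
  have hdm : Degraded (kfst (blockW (Fin m) w)) (ksnd (blockW (Fin m) w)) ∨
      Degraded (ksnd (blockW (Fin m) w)) (kfst (blockW (Fin m) w)) := by
    rw [kfst_blockW, ksnd_blockW]
    exact hd.imp degraded_block degraded_block
  have h2 := condEntropy_twoWayLaw_le hpn hq hwm hdm T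
  have hpush := push_twoWayLaw_aux (block (Fin n) p) q (blockW (Fin m) w) T
  rw [← auxY_eq hpush] at h1
  rw [← auxX_eq hpush] at h2
  have hQ0 : IsKernel (fun y => push (comp (q y) (blockW (Fin m) w))
      (fun x => (T (y, x.1), x.2.1))) := fun y => (isLaw_comp (hq y) hwm).push _
  obtain ⟨k0, Q0, hQ0', hX0, hY0⟩ := exists_fin_kernel (block (Fin n) p) hQ0
  obtain ⟨k, Q, hQ, hX, hY⟩ := exists_single_letter_aux hp hi n k0 Q0 hQ0'
  have hA := (isLaw_twoWayLaw hpn hq hwm).push (fun x => x.1.2)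
  obtain ⟨r, hr, hrL⟩ := exists_single_letter_input (C := C) hw.kfst m _ hA
  refine ⟨k, Q, r, hQ, hr, ?_, ?_⟩
  -- A constant channel into `C` turns the bound on gains into a bound on I(A; B). It exists because
  -- `C` has a point, the rows of `w` having mass 1.
  · have hC : Nonempty C := by
      obtain ⟨a⟩ := (inferInstance : Nonempty A)
      by_contra hC
      rw [not_nonempty_iff] at hC
      have := (hw a).sum_eq
      simp at this
    obtain ⟨c⟩ := hC
    classical
    have hc : IsLaw (Pi.single c (1 : ℝ) : C → ℝ) := ⟨fun a => by
      by_cases h : a = c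
      · subst h; simp
      · simp [h], by simp⟩
    have k1 := hrL _ (degraded_const _ hw.kfst hc)
    rw [chanInfo_const hr hc] at k1
    have k2 : blockK (Fin m) (fun _ : A => (Pi.single c (1 : ℝ) : C → ℝ)) =
        fun _ => fun b => ∏ i, (Pi.single c (1 : ℝ) : C → ℝ) (b i) := rfl
    rw [k2, chanInfo_const hA (isLaw_pi hc)] at k1
    rw [kfst_blockW] at h1
    linarith
  · have k3 : max 0 (chanInfo (push (twoWayLaw (block (Fin n) p) q (blockW (Fin m) w))
          (fun x => x.1.2)) (kfst (blockW (Fin m) w)) -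
        chanInfo (push (twoWayLaw (block (Fin n) p) q (blockW (Fin m) w))
          (fun x => x.1.2)) (ksnd (blockW (Fin m) w))) ≤
        m * max 0 (chanInfo r (kfst w) - chanInfo r (ksnd w)) := by
      have hm : (0 : ℝ) ≤ m := Nat.cast_nonneg m
      refine max_le (mul_nonneg hm (le_max_left _ _)) ?_
      -- If the second output is the better one, the gain of the block is nonpositive and nothing
      -- has to be single-lettered.
      rcases hd with hd | hd
      · rw [kfst_blockW, ksnd_blockW]
        exact (hrL _ hd).trans (mul_le_mul_of_nonneg_left (le_max_right _ _) hm)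
      · have := chanInfo_le_of_degraded hA hwm.ksnd (by
          rw [kfst_blockW, ksnd_blockW]; exact degraded_block hd :
            Degraded (ksnd (blockW (Fin m) w)) (kfst (blockW (Fin m) w)))
        exact (sub_nonpos.2 this).trans (mul_nonneg hm (le_max_left _ _))
    linarith

/-- The case of a backward channel whose output is independent of its input. -/
theorem condEntropy_le_of_const {τ : Type*} [Fintype τ] {P : X → ℝ} {v : X → Y × Z → ℝ}
    (hP : IsLaw P) (hv : IsKernel v)
    (hd : Degraded (kfst v) (ksnd v) ∨ Degraded (ksnd v) (kfst v))
    {q : Y → A → ℝ} (hq : IsKernel q) {w : A → B × C → ℝ} (hw : IsKernel w) {kb : B → ℝ}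
    (hkb : IsLaw kb) (hc : kfst w = fun _ => kb) (S : X × B → τ) :
    condEntropy (twoWayLaw (comp P v) q w) (fun x => S (x.1.1.1, x.2.1))
        (fun x => (x.1.1.2.2, x.2.2)) ≤
      max 0 (chanInfo P (kfst v) - chanInfo P (ksnd v)) +
      condEntropy (twoWayLaw (comp P v) q w) (fun x => S (x.1.1.1, x.2.1))
        (fun x => (x.1.1.2.1, x.1.2)) := by
  have hp := isLaw_comp hP hv
  have hμ := isLaw_twoWayLaw hp hq hw
  -- Taking C away from Eve only increases the equivocation. Without C, the variable B is
  -- independent of all the rest, a local randomness of the party that computes S.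
  have s1 := condEntropy_le_condEntropy hμ (A := fun x => S (x.1.1.1, x.2.1))
    (B := fun x => (x.1.1.2.2, x.2.2)) (C := fun x => x.1.1.2.2) (by simp +contextual)
  -- forgetting `C`, everything is a product
  have hBC : push (twoWayLaw (comp P v) q w) (fun x => (x.1, x.2.1)) =
      comp (comp (comp P v) (fun s => q s.2.1)) (fun _ => kb) := by
    have h : _ = comp (comp (comp P v) (fun s => q s.2.1)) (fun x => kfst w x.2) :=
      push_comp_kfst (comp (comp P v) (fun s => q s.2.1)) (fun x => w x.2)
    rw [hc] at h
    exact h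
  set ν := comp (comp (comp P v) (fun s : X × Y × Z => q s.2.1)) (fun _ => kb) with hν
  have hνl : IsLaw ν := by rw [← hBC]; exact hμ.push _
  have gA : Gen ν (fun x => x.1.2) (fun x => (x.1.1, x.2)) (fun x => x.1.1.2.1) q :=
    gen_of_equiv (⟨fun x => ((x.1.1, x.2), x.1.2), fun x => ((x.1.1, x.2), x.1.2), fun _ => rfl,
      fun _ => rfl⟩ : ((X × Y × Z) × A) × B ≃ ((X × Y × Z) × B) × A)
      (fun x => comp P v x.1 * kb x.2) (fun x => x.1.2.1) q (fun c => (hq c).sum_eq)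
      (fun x => by
        obtain ⟨⟨s, b⟩, a⟩ := x
        change comp P v s * q s.2.1 a * kb b = comp P v s * kb b * q s.2.1 a
        ring)
  -- A is generated from Y alone, so that H(S | Y, A) = H(S | Y).
  have k1 := gA.condEntropy_eq_condEntropy (fun c => (hq c).sum_eq)
    (fun x => (S (x.1.1.1, x.2), x.1.1.2.1)) (fun x => x.1.1.2.1)
    (by intro ω ω' h; simp only [Prod.mk.injEq] at h; simp [h]) (by simp +contextual)
    (by intro ω ω' h; simp only [Prod.mk.injEq] at h; simp [h]) (by simp)
  -- the forward channel
  set p' : (X × B) × X → ℝ := push (comp P (fun _ => kb)) (fun x => (x, x.1)) with hp'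
  have hp'l : IsLaw p' := (isLaw_comp hP (fun _ => hkb)).push _
  have key := condEntropy_sub_le_max hp'l hv.kfst hv.ksnd hd S (fun _ => ())
  have hsnd : push p' Prod.snd = P := by
    rw [hp', push_push]
    have := push_comp_fst P (K := fun _ => kb) (fun _ => hkb) (fun x => x)
    rw [push_id] at this
    exact this
  have hall : comp (comp P (fun _ => kb)) (fun x => v x.1) =
      push ν (fun x => ((x.1.1.1, x.2), x.1.1.2)) := by
    have h1 : push ν (fun x => (x.1.1, x.2)) = comp (comp P v) (fun _ => kb) := by
      rw [hν]
      have h2 := push_comp_map (comp (comp P v) (fun s : X × Y × Z => q s.2.1)) (fun x => x.1)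
        (fun _ : X × Y × Z => kb)
      rw [h2, push_comp_fst (comp P v) (K := fun s => q s.2.1) (fun s => hq _) (fun x => x), push_id]
    have h3 : push ν (fun x => ((x.1.1.1, x.2), x.1.1.2)) =
        push (push ν (fun x => (x.1.1, x.2))) (fun x => ((x.1.1, x.2), x.1.2)) := by
      rw [push_push]
    rw [h3, h1]
    change _ = push (comp (comp P v) (fun _ => kb))
      (⟨fun x => ((x.1.1, x.2), x.1.2), fun x => ((x.1.1, x.2), x.1.2), fun _ => rfl,
        fun _ => rfl⟩ : (X × Y × Z) × B ≃ (X × B) × (Y × Z))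
    funext ⟨⟨x, b⟩, yz⟩
    rw [push_equiv]
    change P x * kb b * v x yz = P x * v x yz * kb b
    ring
  have e1 : comp p' (fun x => kfst v x.2) =
      push ν (fun x => (((x.1.1.1, x.2), x.1.1.1), x.1.1.2.1)) := by
    rw [hp', ← push_comp_map]
    have h : _ = comp (comp P (fun _ => kb)) (fun x => kfst v x.1) :=
      push_comp_kfst (comp P (fun _ => kb)) (fun x => v x.1)
    rw [← h, hall, push_push, push_push]
  have e2 : comp p' (fun x => ksnd v x.2) =
      push ν (fun x => (((x.1.1.1, x.2), x.1.1.1), x.1.1.2.2)) := by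
    rw [hp', ← push_comp_map]
    have h : _ = comp (comp P (fun _ => kb)) (fun x => ksnd v x.1) :=
      push_comp_ksnd (comp P (fun _ => kb)) (fun x => v x.1)
    rw [← h, hall, push_push, push_push]
  rw [e1, e2, hsnd] at key
  simp only [condEntropy, entropy_push] at key k1
  rw [entropy_congr (A := fun x : ((X × Y × Z) × A) × B => (S (x.1.1.1, x.2), (), x.1.1.2.2))
      (B := fun x => (S (x.1.1.1, x.2), x.1.1.2.2)) (by simp),
    entropy_congr (A := fun x : ((X × Y × Z) × A) × B => (S (x.1.1.1, x.2), (), x.1.1.2.1))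
      (B := fun x => (S (x.1.1.1, x.2), x.1.1.2.1)) (by simp),
    entropy_congr (A := fun x : ((X × Y × Z) × A) × B => ((), x.1.1.2.1))
      (B := fun x => x.1.1.2.1) (by simp),
    entropy_congr (A := fun x : ((X × Y × Z) × A) × B => ((), x.1.1.2.2))
      (B := fun x => x.1.1.2.2) (by simp), ← hBC] at key
  rw [← hBC] at k1
  simp only [entropy_push] at key k1
  have c1 : entropy (twoWayLaw (comp P v) q w) (fun x => (x.1.2, S (x.1.1.1, x.2.1), x.1.1.2.1)) =
      entropy (twoWayLaw (comp P v) q w) (fun x => (S (x.1.1.1, x.2.1), x.1.1.2.1, x.1.2)) :=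
    entropy_congr (by intro ω ω'; simp only [Prod.mk.injEq]; tauto)
  have c2 : entropy (twoWayLaw (comp P v) q w) (fun x => (x.1.2, x.1.1.2.1)) =
      entropy (twoWayLaw (comp P v) q w) (fun x => (x.1.1.2.1, x.1.2)) :=
    entropy_pair_comm _ _ _
  simp only [condEntropy] at s1 ⊢
  linarith

theorem block_comp (P : X → ℝ) (v : X → Y × Z → ℝ) :
    block ι (comp P v) = comp (fun x : ι → X => ∏ i, P (x i)) (blockW ι v) := by
  funext s
  simp only [block, comp, blockW, Finset.prod_mul_distrib]

/-- A channel that conveys no information for any input law has constant rows. -/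
theorem exists_const_of_chanInfo_eq_zero [Nonempty A] {K : A → B → ℝ} (hK : IsKernel K)
    (h : ∀ r, IsLaw r → chanInfo r K = 0) : ∃ k : B → ℝ, IsLaw k ∧ K = fun _ => k := by
  classical
  -- The uniform law has full support, so equality in Gibbs' inequality between the joint law and
  -- the product of its marginals determines every row of `K`.
  obtain ⟨u, hul, hpos⟩ : ∃ u : A → ℝ, IsLaw u ∧ ∀ a, 0 < u a := by
    have hcard : (0 : ℝ) < Fintype.card A := by exact_mod_cast Fintype.card_pos
    exact ⟨fun _ => (Fintype.card A : ℝ)⁻¹, ⟨fun _ => by positivity, by simp [hcard.ne']⟩,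
      fun _ => by positivity⟩
  have h0 := h u hul
  refine ⟨outLaw u K, hul.outLaw hK, ?_⟩
  rw [chanInfo_eq u hK, sub_eq_zero] at h0
  have key := gibbs_eq (p := comp u K) (q := fun x => u x.1 * outLaw u K x.2)
    (isLaw_comp hul hK).nonneg (fun x => mul_nonneg (hpos _).le ((hul.outLaw hK).nonneg _))
    (fun x hx => by
      rcases mul_eq_zero.1 hx with hx | hx
      · exact absurd hx (hpos x.1).ne'
      · have := (Finset.sum_eq_zero_iff_of_nonneg (fun a _ =>
          mul_nonneg (hpos a).le ((hK a).nonneg x.2))).1 hx x.1 (Finset.mem_univ _)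
        exact this)
    (by
      rw [(isLaw_comp hul hK).sum_eq, Fintype.sum_prod_type]
      simp only [← Finset.mul_sum, (hul.outLaw hK).sum_eq, mul_one, hul.sum_eq])
    (by
      have e1 : ∀ x : A × B, comp u K x * Real.log (u x.1 * outLaw u K x.2) =
          comp u K x * Real.log (u x.1) + comp u K x * Real.log (outLaw u K x.2) := by
        intro x
        by_cases hx : comp u K x = 0
        · simp [hx]
        · have : outLaw u K x.2 ≠ 0 := fun h' => hx
            ((Finset.sum_eq_zero_iff_of_nonneg (fun a _ =>
              mul_nonneg (hpos a).le ((hK a).nonneg x.2))).1 h' x.1 (Finset.mem_univ _))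
          rw [Real.log_mul (hpos x.1).ne' this, mul_add]
      have e2 : ∀ x : A × B, comp u K x * Real.log (comp u K x) =
          comp u K x * Real.log (u x.1) + u x.1 * (K x.1 x.2 * Real.log (K x.1 x.2)) := by
        intro x
        by_cases hx : K x.1 x.2 = 0
        · simp [comp, hx]
        · rw [comp, Real.log_mul (hpos x.1).ne' hx]; ring
      simp_rw [e1, e2, Finset.sum_add_distrib]
      congr 1
      have e3 : ∑ x : A × B, comp u K x * Real.log (outLaw u K x.2) =
          -(∑ b, Real.negMulLog (outLaw u K b)) := by
        rw [Fintype.sum_prod_type_right, ← Finset.sum_neg_distrib]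
        refine Finset.sum_congr rfl fun b _ => ?_
        simp only [comp, outLaw]
        rw [← Finset.sum_mul, Real.negMulLog]; ring
      have e4 : ∑ x : A × B, u x.1 * (K x.1 x.2 * Real.log (K x.1 x.2)) =
          -(∑ a, u a * ∑ b, Real.negMulLog (K a b)) := by
        rw [Fintype.sum_prod_type, ← Finset.sum_neg_distrib]
        refine Finset.sum_congr rfl fun a _ => ?_
        simp only [Real.negMulLog, neg_mul, Finset.sum_neg_distrib, mul_neg, neg_neg,
          Finset.mul_sum]
      rw [e3, e4]
      simp only [ent, ← mul_div_assoc, ← Finset.sum_div] at h0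
      rw [div_left_inj' log_two_pos.ne'] at h0
      rw [h0])
  funext a b
  have := key (a, b)
  exact mul_left_cancel₀ (hpos a).ne' this

end
end Info

/-! ### From `PMF` channels to real-valued kernels -/

namespace Info

/-- The mass function of a `PMF`, with real values. -/
def massFn {α : Type*} (P : PMF α) (a : α) : ℝ := (P a).toReal

/-- The real-valued kernel of a broadcast channel. -/
def chan {X Y Z : Type*} (W : DMBC X Y Z) (x : X) : Y × Z → ℝ := massFn (W x)

section
set_option linter.unusedSectionVars false
variable {α β X Y Z V : Type*} [Fintype α] [Fintype β] [Fintype X] [Fintype Y] [Fintype Z]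
  [Fintype V]

theorem isLaw_massFn (P : PMF α) : IsLaw (massFn P) := by
  refine ⟨fun _ => ENNReal.toReal_nonneg, ?_⟩
  simp only [massFn]
  rw [← ENNReal.toReal_sum fun a _ => P.apply_ne_top a, ← tsum_fintype (L := .unconditional _), P.tsum_coe,
    ENNReal.toReal_one]

theorem exists_pmf {p : α → ℝ} (hp : IsLaw p) : ∃ P : PMF α, massFn P = p := by
  refine ⟨PMF.ofFintype (fun a => ENNReal.ofReal (p a)) ?_, ?_⟩
  · rw [← ENNReal.ofReal_sum_of_nonneg fun a _ => hp.nonneg a, hp.sum_eq, ENNReal.ofReal_one]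
  · funext a
    simp [massFn, ENNReal.toReal_ofReal (hp.nonneg a)]

theorem exists_pmf_kernel {K : α → β → ℝ} (hK : IsKernel K) :
    ∃ P : α → PMF β, (fun a => massFn (P a)) = K := by
  choose P hP using fun a => exists_pmf (hK a)
  exact ⟨P, funext hP⟩

theorem isKernel_chan (W : DMBC X Y Z) : IsKernel (chan W) := fun x => isLaw_massFn (W x)

theorem massFn_map (P : PMF α) (f : α → β) : massFn (P.map f) = push (massFn P) f := by
  classical
  funext b
  rw [massFn, PMF.map_apply, tsum_fintype, push_apply,
    ENNReal.toReal_sum fun a _ => by split_ifs <;> simp [P.apply_ne_top]]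
  refine Finset.sum_congr rfl fun a _ => ?_
  by_cases h : f a = b
  · simp [h, massFn]
  · simp [h, Ne.symm h]

theorem massFn_bind (P : PMF α) (D : α → PMF β) :
    massFn (P.bind D) = fun b => ∑ a, massFn P a * massFn (D a) b := by
  funext b
  rw [massFn, PMF.bind_apply, tsum_fintype, ENNReal.toReal_sum fun a _ =>
    ENNReal.mul_ne_top (P.apply_ne_top a) ((D a).apply_ne_top b)]
  simp [massFn]

theorem kfst_chan (W : DMBC X Y Z) : kfst (chan W) = fun x => massFn (W.toY x) := by
  classical
  funext x y
  rw [DMBC.toY, massFn_map, kfst, push_apply, Fintype.sum_prod_type,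
    Finset.sum_eq_single y (fun b _ hb => by simp [hb]) (by simp)]
  simp [chan]

theorem ksnd_chan (W : DMBC X Y Z) : ksnd (chan W) = fun x => massFn (W.toZ x) := by
  classical
  funext x z
  rw [DMBC.toZ, massFn_map, ksnd, push_apply, Fintype.sum_prod_type]
  simp [chan]

theorem infoXY_eq (W : DMBC X Y Z) (P : PMF X) :
    W.infoXY P = chanInfo (massFn P) (kfst (chan W)) := by
  refine mutualInfo_congr_push ?_
  change push (comp (massFn P) (chan W)) (fun ω => (ω.1, ω.2.1)) =
    push (comp (massFn P) (kfst (chan W))) (fun ω => ω)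
  rw [push_comp_kfst, push_id]

theorem infoXZ_eq (W : DMBC X Y Z) (P : PMF X) :
    W.infoXZ P = chanInfo (massFn P) (ksnd (chan W)) := by
  refine mutualInfo_congr_push ?_
  change push (comp (massFn P) (chan W)) (fun ω => (ω.1, ω.2.2)) =
    push (comp (massFn P) (ksnd (chan W))) (fun ω => ω)
  rw [push_comp_ksnd, push_id]

theorem infoVXgivenZ_eq {k : ℕ} (W : DMBC X Y Z) (P : PMF X) (Q : Y → PMF (Fin k)) :
    W.infoVXgivenZ P Q = auxX (W.jointLaw P) (fun y => massFn (Q y)) := rfl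

theorem infoVYgivenX_eq {k : ℕ} (W : DMBC X Y Z) (P : PMF X) (Q : Y → PMF (Fin k)) :
    W.infoVYgivenX P Q = auxY (W.jointLaw P) (fun y => massFn (Q y)) := rfl

theorem isLaw_jointLaw (W : DMBC X Y Z) (P : PMF X) : IsLaw (W.jointLaw P) :=
  isLaw_comp (isLaw_massFn P) (isKernel_chan W)

/-- The assumption P_{YZ|X} = P_{Y|X} P_{Z|X} enters the proof through this lemma only. -/
theorem indepGiven_jointLaw {W : DMBC X Y Z} (hW : W.IndependentChannels) (P : PMF X) :
    IndepGiven (W.jointLaw P) :=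
  ⟨fun s => massFn P s.1 * massFn (W.toY s.1) s.2, fun x => massFn (W.toZ x),
    fun x => isLaw_massFn _, fun x y z => by
      simp only [DMBC.jointLaw, hW x y z, ENNReal.toReal_mul, massFn]; ring⟩

theorem degraded_chan {W : DMBC X Y Z} (h : W.DegradedInFavorOfY ∨ W.DegradedInFavorOfZ) :
    Degraded (kfst (chan W)) (ksnd (chan W)) ∨ Degraded (ksnd (chan W)) (kfst (chan W)) := by
  rw [kfst_chan, ksnd_chan]
  refine h.imp ?_ ?_
  · rintro ⟨D, hD⟩
    exact ⟨fun y => massFn (D y), fun y => isLaw_massFn _, by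
      funext x; rw [hD x, massFn_bind]; rfl⟩
  · rintro ⟨D, hD⟩
    exact ⟨fun y => massFn (D y), fun y => isLaw_massFn _, by
      funext x; rw [hD x, massFn_bind]; rfl⟩

theorem chanInfo_le_log {r : α → ℝ} {K : α → β → ℝ} (hr : IsLaw r) (hK : IsKernel K) :
    chanInfo r K ≤ Real.log (Fintype.card α) / Real.log 2 := by
  have h := isLaw_comp hr hK
  rw [chanInfo, mutualInfo]
  linarith [entropy_le_log_card h (Prod.fst : α × β → α), condEntropy_nonneg h
    (Prod.fst : α × β → α) Prod.snd]

theorem auxX_le_log {p : X × Y × Z → ℝ} {Q : Y → V → ℝ} (hp : IsLaw p) (hQ : IsKernel Q) :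
    auxX p Q ≤ Real.log (Fintype.card X) / Real.log 2 := by
  have h := isLaw_auxLaw hp hQ
  have h1 := entropy_le_log_card h (fun ω => ω.2.1)
  have h2 := condEntropy_le_entropy h (fun ω => ω.2.1) (fun ω => ω.2.2.2)
  have h3 := condEntropy_nonneg h (fun ω => ω.2.1) (fun ω => (ω.1, ω.2.2.2))
  have c1 : entropy (auxLaw p Q) (fun ω => (ω.2.1, ω.1, ω.2.2.2)) =
      entropy (auxLaw p Q) (fun ω => (ω.1, ω.2.1, ω.2.2.2)) :=
    entropy_congr (by intro ω ω'; simp only [Prod.mk.injEq]; tauto)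
  simp only [auxX, condMutualInfo, condEntropy] at *
  linarith

end
end Info

/-! ### The supremum `L'` and its stability under a relaxed constraint -/

namespace TwoDMBC
open Info

section
variable {X Y Z : Party → Type*} [∀ p, Fintype (X p)] [∀ p, Fintype (Y p)] [∀ p, Fintype (Z p)]
  (W : TwoDMBC X Y Z)

/-- `[I(X; Y) - I(X; Z)]_+` for the input law `r` of the channel from `p`. -/
def wiretapGain (p : Party) (r : X p → ℝ) : ℝ :=
  max 0 (chanInfo r (kfst (chan (W p))) - chanInfo r (ksnd (chan (W p))))

theorem mem_lowerBoundValues {a : Party} {n m k : ℕ} {P : PMF (X a)} {Q : Y a → Fin k → ℝ}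
    (hQ : IsKernel Q) {r : X a.other → ℝ} (hr : IsLaw r) (hnm : 0 < n + m)
    (h : n * auxY ((W a).jointLaw P) Q < m * chanInfo r (kfst (chan (W a.other)))) :
    (n * auxX ((W a).jointLaw P) Q + m * W.wiretapGain a.other r) / ((n : ℝ) + m) ∈
      W.lowerBoundValues a := by
  obtain ⟨Q', rfl⟩ := exists_pmf_kernel hQ
  obtain ⟨P', rfl⟩ := exists_pmf hr
  refine ⟨n, m, k, P, Q', P', hnm, ?_, ?_⟩
  · rw [infoXY_eq, infoVYgivenX_eq]; exact h
  · rw [infoXY_eq, infoXZ_eq, infoVXgivenZ_eq]; rfl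

theorem wiretapGain_le {p : Party} {r : X p → ℝ} (hr : IsLaw r) :
    W.wiretapGain p r ≤ chanInfo r (kfst (chan (W p))) :=
  max_le (chanInfo_nonneg hr (isKernel_chan _).kfst)
    (sub_le_self _ (chanInfo_nonneg hr (isKernel_chan _).ksnd))

theorem bddAbove_lowerBoundValues (a : Party) : BddAbove (W.lowerBoundValues a) := by
  set M := max (Real.log (Fintype.card (X a)) / Real.log 2)
    (Real.log (Fintype.card (X a.other)) / Real.log 2) with hM
  refine ⟨M, ?_⟩
  rintro ρ ⟨n, m, k, P, Q, P', hnm, -, rfl⟩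
  rw [infoXY_eq, infoXZ_eq, infoVXgivenZ_eq]
  have hs : (0 : ℝ) < (n : ℝ) + m := by exact_mod_cast hnm
  rw [div_le_iff₀ hs]
  have h1 : auxX ((W a).jointLaw P) (fun y => massFn (Q y)) ≤ M :=
    (auxX_le_log (isLaw_jointLaw (W a) P) (fun y => isLaw_massFn (Q y))).trans (le_max_left _ _)
  have h2 : W.wiretapGain a.other (massFn P') ≤ M :=
    ((W.wiretapGain_le (isLaw_massFn P')).trans (chanInfo_le_log (isLaw_massFn P')
      (isKernel_chan _).kfst)).trans (le_max_right _ _)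
  rw [wiretapGain] at h2
  nlinarith [(Nat.cast_nonneg n : (0 : ℝ) ≤ n), (Nat.cast_nonneg m : (0 : ℝ) ≤ m)]

theorem lowerBoundValues_nonneg {a : Party} {ρ : ℝ} (h : ρ ∈ W.lowerBoundValues a) : 0 ≤ ρ := by
  obtain ⟨n, m, k, P, Q, P', hnm, -, rfl⟩ := h
  rw [infoVXgivenZ_eq]
  have h1 := auxX_nonneg (isLaw_jointLaw (W a) P) (Q := fun y => massFn (Q y))
    (fun y => isLaw_massFn (Q y))
  exact div_nonneg (add_nonneg (mul_nonneg (Nat.cast_nonneg n) h1)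
    (mul_nonneg (Nat.cast_nonneg m) (le_max_left _ _)))
    (add_nonneg (Nat.cast_nonneg n) (Nat.cast_nonneg m))

theorem L'_nonneg (a : Party) : 0 ≤ W.L' a := Real.sSup_nonneg fun _ h => W.lowerBoundValues_nonneg h

/-- The strict constraint forces some I(X'; Y') to be positive; extra uses of the channel with this
input will repair slightly violated constraints. -/
theorem exists_chanInfo_pos {a : Party} (h : (W.lowerBoundValues a).Nonempty) :
    ∃ r : X a.other → ℝ, IsLaw r ∧ 0 < chanInfo r (kfst (chan (W a.other))) := by
  obtain ⟨_, n, m, k, P, Q, P', hnm, hlt, -⟩ := h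
  refine ⟨massFn P', isLaw_massFn P', ?_⟩
  rw [infoXY_eq, infoVYgivenX_eq] at hlt
  have h1 := auxY_nonneg (isLaw_jointLaw (W a) P) (Q := fun y => massFn (Q y))
    (fun y => isLaw_massFn (Q y))
  have h2 := mul_nonneg (Nat.cast_nonneg (α := ℝ) n) h1
  exact pos_of_mul_pos_right (h2.trans_lt hlt) (Nat.cast_nonneg m)

/-- Zero uses of the channel of `a` and one use of the other channel are an admissible choice,
unless I(X'; Y') = 0, and then the gain vanishes too. -/
theorem wiretapGain_le_L' [∀ p, Nonempty (X p)] (a : Party) {r : X a.other → ℝ} (hr : IsLaw r) :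
    W.wiretapGain a.other r ≤ W.L' a := by
  rcases (chanInfo_nonneg hr (isKernel_chan (W a.other)).kfst).eq_or_lt with h | h
  · exact (W.wiretapGain_le hr).trans (h ▸ W.L'_nonneg a)
  · refine le_csSup (W.bddAbove_lowerBoundValues a) ?_
    have := W.mem_lowerBoundValues (a := a) (n := 0) (m := 1) (k := 1)
      (P := PMF.pure (Classical.arbitrary _)) (Q := fun _ _ => 1)
      (fun _ => ⟨fun _ => zero_le_one, by simp⟩) hr (by simp) (by simpa using h)
    simpa using this

/-- Concavity of the gain, with the contribution of `r'` dropped. If Eve's channel is the better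
one, the gain of `r` is 0. -/
theorem wiretapGain_mix_ge {p : Party}
    (hd : (W p).DegradedInFavorOfY ∨ (W p).DegradedInFavorOfZ) {t : ℝ} (h0 : 0 ≤ t) (h1 : t ≤ 1)
    {r r' : X p → ℝ} (hr : IsLaw r) (hr' : IsLaw r') :
    (1 - t) * W.wiretapGain p r ≤ W.wiretapGain p (mixLaw t r r') := by
  have hK := isKernel_chan (W p)
  rcases degraded_chan hd with h | h
  · have g := gain_mix_ge h0 h1 hK.kfst hr hr' h
    have g1 := chanInfo_le_of_degraded hr hK.kfst h
    have g2 := chanInfo_le_of_degraded hr' hK.kfst h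
    rw [wiretapGain, max_eq_right (sub_nonneg.2 g1)]
    refine le_trans ?_ ((g.trans (le_max_right 0 _)))
    nlinarith
  · have g1 := chanInfo_le_of_degraded hr hK.ksnd h
    rw [wiretapGain, max_eq_left (sub_nonpos.2 g1), mul_zero]
    exact le_max_left _ _

/-- The supremum `L'` also bounds the values for which the constraint is slightly violated. -/
theorem exists_le_L'_of_approx {a : Party}
    (hd : (W a.other).DegradedInFavorOfY ∨ (W a.other).DegradedInFavorOfZ)
    (hne : (W.lowerBoundValues a).Nonempty) :
    ∃ c > 0, ∀ (n m k : ℕ) (P : PMF (X a)) (Q : Y a → Fin k → ℝ) (r : X a.other → ℝ) (ε : ℝ),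
      IsKernel Q → IsLaw r → 0 < n + m → 0 ≤ ε →
      n * auxY ((W a).jointLaw P) Q ≤ m * chanInfo r (kfst (chan (W a.other))) + (n + m) * ε →
      n * auxX ((W a).jointLaw P) Q + m * W.wiretapGain a.other r ≤
        (n + m) * (W.L' a * (1 + ε / c)) := by
  obtain ⟨r₀, hr₀, hc⟩ := W.exists_chanInfo_pos hne
  set c := chanInfo r₀ (kfst (chan (W a.other)))
  refine ⟨c, hc, fun n m k P Q r ε hQ hr hnm hε hle => ?_⟩
  have hL := W.L'_nonneg a
  set L := W.L' a with hLdef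
  set s : ℝ := n + m with hs
  have hspos : 0 < s := by rw [hs]; exact_mod_cast hnm
  set N := n * auxX ((W a).jointLaw P) Q + m * W.wiretapGain a.other r with hN
  -- All uses are repeated J times, so that rounding the number of repairing uses costs only the
  -- fixed amount L, which is negligible for large J.
  have key : ∀ J : ℕ, 0 < J → J * N ≤ J * (s * (L * (1 + ε / c))) + L := by
    intro J hJ
    have hJ' : (0 : ℝ) < J := by exact_mod_cast hJ
    -- u uses with the input r₀ supply the missing information s J ε; one more than the integer part
    -- makes the constraint strict.
    set u : ℝ := s * J * ε / c with hu
    have hu0 : 0 ≤ u := by positivity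
    set k' : ℕ := ⌊u⌋₊ + 1 with hk'
    have hk1 : u < k' := by rw [hk']; push_cast; exact Nat.lt_floor_add_one u
    have hk2 : (k' : ℝ) ≤ u + 1 := by
      rw [hk']; push_cast; linarith [Nat.floor_le hu0]
    have hkpos : (0 : ℝ) < k' := hu0.trans_lt hk1
    set m₁ : ℕ := m * J + k' with hm₁
    have hm1pos : (0 : ℝ) < m₁ := by
      rw [hm₁]; push_cast; nlinarith [(Nat.cast_nonneg m : (0 : ℝ) ≤ m)]
    -- An element of `lowerBoundValues` has one input law for all its m₁ uses, so r and r₀ are mixed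
    -- in the proportion of their numbers of uses.
    set t : ℝ := k' / m₁ with ht
    have ht0 : 0 ≤ t := by positivity
    have ht1 : t ≤ 1 := by
      rw [ht, div_le_one hm1pos, hm₁]; push_cast
      nlinarith [(Nat.cast_nonneg m : (0 : ℝ) ≤ m)]
    have e1 : m₁ * t = k' := by rw [ht]; field_simp
    have e2 : m₁ * (1 - t) = m * J := by
      rw [mul_sub, e1, mul_one, hm₁]; push_cast; ring
    have hmix := isLaw_mixLaw ht0 ht1 hr hr₀
    have i1 := mul_le_mul_of_nonneg_left (chanInfo_mix_ge ht0 ht1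
      (isKernel_chan (W a.other)).kfst hr hr₀) hm1pos.le
    have i2 := mul_le_mul_of_nonneg_left (W.wiretapGain_mix_ge hd ht0 ht1 hr hr₀) hm1pos.le
    rw [mul_add, ← mul_assoc, ← mul_assoc, e1, e2] at i1
    rw [← mul_assoc, e2] at i2
    have i3 : u * c = s * J * ε := by rw [hu]; field_simp
    have i4 : u * c < k' * c := mul_lt_mul_of_pos_right hk1 hc
    have hmem := W.mem_lowerBoundValues (a := a) (n := n * J) (m := m₁) (P := P) hQ hmix
      (by omega) (by
        push_cast
        have := mul_le_mul_of_nonneg_left hle hJ'.le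
        nlinarith)
    have hsup := le_csSup (W.bddAbove_lowerBoundValues a) hmem
    rw [← L', ← hLdef] at hsup
    have hden : (0 : ℝ) < ((n * J : ℕ) : ℝ) + m₁ := by positivity
    rw [div_le_iff₀ hden] at hsup
    have e3 : ((n * J : ℕ) : ℝ) + m₁ ≤ s * J + u + 1 := by
      rw [hm₁, hs]; push_cast; linarith
    have e4 : L * (((n * J : ℕ) : ℝ) + m₁) ≤ L * (s * J + u + 1) :=
      mul_le_mul_of_nonneg_left e3 hL
    have e5 : L * (s * J + u + 1) = J * (s * (L * (1 + ε / c))) + L := by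
      rw [hu]; field_simp
    have e6 : J * N ≤ (n * J : ℕ) * auxX ((W a).jointLaw P) Q +
        m₁ * W.wiretapGain a.other (mixLaw t r r₀) := by
      rw [hN]; push_cast; linarith
    linarith
  by_contra hcon
  push Not at hcon
  set d := N - s * (L * (1 + ε / c)) with hd'
  have hdpos : 0 < d := sub_pos.2 hcon
  obtain ⟨J, hJ⟩ := exists_nat_gt (L / d)
  have hJ0 : (0 : ℝ) < J := (div_nonneg hL hdpos.le).trans_lt hJ
  have := key J (by exact_mod_cast hJ0)
  rw [div_lt_iff₀ hdpos] at hJ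
  have e7 : J * d = J * N - J * (s * (L * (1 + ε / c))) := by rw [hd']; ring
  linarith

end
end TwoDMBC

/-! ### Transcripts as one sequence of letters per channel -/

theorem Party.ne_iff_eq_other {p q : Party} : p ≠ q ↔ p = q.other := by
  cases p <;> cases q <;> simp [Party.other]

theorem Party.other_ne (q : Party) : q.other ≠ q := by cases q <;> simp [Party.other]

theorem Party.other_other (q : Party) : q.other.other = q := by cases q <;> rfl

namespace Schedule

section
variable (σ : Schedule)

/-- The uses of the channel from `p`. -/
abbrev Slot (p : Party) := Σ r : {r : Fin σ.rounds // σ.sender r = p}, Fin (σ.len r)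

theorem card_slot (p : Party) : Fintype.card (σ.Slot p) = σ.uses p := by
  rw [Fintype.card_sigma, uses]
  simp only [Fintype.card_fin]
  exact (Finset.sum_subtype (s := Finset.univ.filter fun r => σ.sender r = p) (fun r => by simp)
    fun r => σ.len r).symm

/-- An enumeration of the uses of the channel from `p`. -/
def slotEquiv (p : Party) : σ.Slot p ≃ Fin (σ.uses p) :=
  Fintype.equivFinOfCardEq (σ.card_slot p)

variable {T T' : Party → Type*}

/-- All the letters concerning the channel from `p`, in one sequence. -/
def gather (p : Party) (ω : (r : Fin σ.rounds) → Fin (σ.len r) → T (σ.sender r))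
    (j : Fin (σ.uses p)) : T p :=
  ((σ.slotEquiv p).symm j).1.2 ▸ ω ((σ.slotEquiv p).symm j).1.1 ((σ.slotEquiv p).symm j).2

/-- The letters of the rounds in which `p` sends, from those letters in one sequence. -/
def scatter (p : Party) (u : Fin (σ.uses p) → T p) (r : Fin σ.rounds) (h : σ.sender r = p)
    (i : Fin (σ.len r)) : T (σ.sender r) :=
  h.symm ▸ u (σ.slotEquiv p ⟨⟨r, h⟩, i⟩)

theorem cast_map (g : ∀ p, T p → T' p) {p q : Party} (h : p = q) (x : T p) :
    g q (h ▸ x) = h ▸ g p x := by subst h; rfl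

theorem cast_eq_of_heq {p : Party} {s s' : σ.Slot p}
    (ω : (r : Fin σ.rounds) → Fin (σ.len r) → T (σ.sender r)) (h : s = s') :
    (s.1.2 ▸ ω s.1.1 s.2 : T p) = s'.1.2 ▸ ω s'.1.1 s'.2 := by subst h; rfl

theorem gather_slotEquiv (p : Party) (ω : (r : Fin σ.rounds) → Fin (σ.len r) → T (σ.sender r))
    (r : Fin σ.rounds) (h : σ.sender r = p) (i : Fin (σ.len r)) :
    σ.gather p ω (σ.slotEquiv p ⟨⟨r, h⟩, i⟩) = h ▸ ω r i :=
  σ.cast_eq_of_heq ω ((σ.slotEquiv p).symm_apply_apply ⟨⟨r, h⟩, i⟩)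

theorem scatter_gather (p : Party) (ω : (r : Fin σ.rounds) → Fin (σ.len r) → T (σ.sender r))
    (r : Fin σ.rounds) (h : σ.sender r = p) (i : Fin (σ.len r)) :
    σ.scatter p (σ.gather p ω) r h i = ω r i := by
  rw [scatter, gather_slotEquiv]
  subst h; rfl

theorem gather_map (g : ∀ p, T p → T' p) (p : Party)
    (ω : (r : Fin σ.rounds) → Fin (σ.len r) → T (σ.sender r)) :
    σ.gather p (fun r i => g _ (ω r i)) = fun j => g p (σ.gather p ω j) := by
  funext j
  exact (cast_map g _ _).symm

theorem prod_gather {M : Type*} [CommMonoid M] (f : ∀ p, T p → M) (p : Party)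
    (ω : (r : Fin σ.rounds) → Fin (σ.len r) → T (σ.sender r)) :
    ∏ j, f p (σ.gather p ω j) =
      ∏ r with σ.sender r = p, ∏ i, f (σ.sender r) (ω r i) := by
  rw [← (σ.slotEquiv p).prod_comp, Fintype.prod_sigma]
  rw [Finset.prod_subtype (s := Finset.univ.filter fun r => σ.sender r = p)
    (p := fun r => σ.sender r = p) (fun r => by simp)]
  refine Finset.prod_congr rfl fun r _ => Finset.prod_congr rfl fun i _ => ?_
  obtain ⟨r, rfl⟩ := r
  rw [gather_slotEquiv]

/-- Separating the letters of the two channels. -/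
def splitEquiv (T : Party → Type*) (a b : Party) (hb : ∀ p, p ≠ a ↔ p = b) :
    ((r : Fin σ.rounds) → Fin (σ.len r) → T (σ.sender r)) ≃
      (Fin (σ.uses a) → T a) × (Fin (σ.uses b) → T b) where
  toFun ω := (σ.gather a ω, σ.gather b ω)
  invFun u r i := if h : σ.sender r = a then σ.scatter a u.1 r h i
    else σ.scatter b u.2 r ((hb _).1 h) i
  left_inv ω := by
    funext r i
    by_cases h : σ.sender r = a
    · simp [h, scatter_gather]
    · simp [h, scatter_gather]
  right_inv u := by
    have hab : ¬ b = a := (hb b).2 rfl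
    refine Prod.ext (funext fun j => ?_) (funext fun j => ?_)
    · obtain ⟨⟨⟨r, h⟩, i⟩, rfl⟩ := (σ.slotEquiv a).surjective j
      dsimp only
      rw [gather_slotEquiv, dif_pos h, scatter]
      exact eq_of_heq ((eqRec_heq _ _).trans (eqRec_heq _ _))
    · obtain ⟨⟨⟨r, h⟩, i⟩, rfl⟩ := (σ.slotEquiv b).surjective j
      dsimp only
      rw [gather_slotEquiv, dif_neg (h.trans_ne hab), scatter]
      exact eq_of_heq ((eqRec_heq _ _).trans (eqRec_heq _ _))

/-- `b` is a variable with the hypothesis `hb`, and not `a.other`, so that the roles of the parties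
can be exchanged: `a.other.other` is not `a` by definition. -/
theorem gather_inj {a b : Party} (hb : ∀ p, p ≠ a ↔ p = b)
    {ω ω' : (r : Fin σ.rounds) → Fin (σ.len r) → T (σ.sender r)} :
    ω = ω' ↔ σ.gather a ω = σ.gather a ω' ∧ σ.gather b ω = σ.gather b ω' := by
  rw [← (σ.splitEquiv T a b hb).apply_eq_iff_eq, Prod.ext_iff]; rfl

theorem prod_split {M : Type*} [CommMonoid M] {a b : Party} (hb : ∀ p, p ≠ a ↔ p = b)
    (f : Fin σ.rounds → M) :
    ∏ r, f r = (∏ r with σ.sender r = a, f r) * ∏ r with σ.sender r = b, f r := by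
  rw [← Finset.prod_filter_mul_prod_filter_not Finset.univ (fun r => σ.sender r = a)]
  simp_rw [← hb]

variable {X Y Z : Party → Type*}

/-- The view of `q = a` before round `k`, from the sequences of all its letters. -/
def mkView {q a b : Party} (hq : q = a) (hb : ∀ p, p ≠ a ↔ p = b) (k : ℕ)
    (x : Fin (σ.uses a) → X a) (y : Fin (σ.uses b) → Y b) : σ.View X Y q k :=
  (fun r i => σ.scatter a x r.1 (r.2.2.trans hq) i,
    fun r i => σ.scatter b y r.1 ((hb _).1 (r.2.2.trans_eq hq)) i)

theorem view_eq_mkView {q a b : Party} (hq : q = a) (hb : ∀ p, p ≠ a ↔ p = b) (k : ℕ)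
    (ω : σ.Transcript X Y Z) :
    view q k ω = σ.mkView hq hb k (fun j => (σ.gather (T := fun p => X p × Y p × Z p) a ω j).1)
      (fun j => (σ.gather (T := fun p => X p × Y p × Z p) b ω j).2.1) := by
  have h1 := σ.gather_map (T := fun p => X p × Y p × Z p) (T' := X) (fun p x => x.1) a ω
  have h2 := σ.gather_map (T := fun p => X p × Y p × Z p) (T' := Y) (fun p x => x.2.1) b ω
  rw [← h1, ← h2, mkView, view]
  simp only [scatter_gather]

end

end Schedule

namespace Info

/-- The first factor is split off: it depends on no coordinate of `f`, and fixing its value leaves a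
causal family with one factor less. `Nonempty` supplies the dummy argument `f₀`. -/
theorem sum_prod_causal {N : ℕ} {α : Fin N → Type*} [∀ r, Fintype (α r)] [∀ r, Nonempty (α r)]
    (k : (r : Fin N) → ((s : Fin N) → α s) → α r → ℝ)
    (hk : ∀ r f g, (∀ s < r, f s = g s) → k r f = k r g) (h1 : ∀ r f, ∑ x, k r f x = 1) :
    ∑ f : (s : Fin N) → α s, ∏ r, k r f (f r) = 1 := by
  classical
  induction N with
  | zero => simp
  | succ N ih =>
    rw [← (Fin.consEquiv α).sum_comp, Fintype.sum_prod_type]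
    let f₀ : (s : Fin (N + 1)) → α s := fun s => Classical.arbitrary _
    have : ∀ x : α 0, ∑ g : (s : Fin N) → α s.succ,
        ∏ r, k r (Fin.consEquiv α (x, g)) (Fin.consEquiv α (x, g) r) = k 0 f₀ x := by
      intro x
      simp_rw [Fin.prod_univ_succ]
      have e : ∀ g : (s : Fin N) → α s.succ,
          k 0 (Fin.consEquiv α (x, g)) (Fin.consEquiv α (x, g) 0) = k 0 f₀ x := fun g => by
        rw [hk 0 _ f₀ fun s hs => absurd hs (Fin.not_lt_zero s)]; rfl
      simp_rw [e, ← Finset.mul_sum]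
      refine (congrArg _ (ih (fun r g => k r.succ (Fin.consEquiv α (x, g))) ?_
        fun r f => h1 _ _)).trans (mul_one _)
      intro r f g hfg
      refine hk _ _ _ fun s hs => ?_
      induction s using Fin.cases with
      | zero => rfl
      | succ s => exact hfg s (Fin.succ_lt_succ_iff.1 hs)
    simp_rw [this]
    exact h1 0 f₀

end Info

/-! ### The law of a protocol in which one party sends i.i.d. letters -/

namespace Protocol
open Info

section
variable {X Y Z : Party → Type*} (prot : Protocol X Y) {a b : Party}

/-- The law of what `b` sends given what it receives from `a`. -/
def sendKernel (ha : ∀ p, p ≠ b ↔ p = a) (y : Fin (prot.uses a) → Y a)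
    (x : Fin (prot.uses b) → X b) : ℝ :=
  ∏ r with prot.sender r = b,
    if h : prot.sender r = b then
      massFn (prot.enc r (prot.mkView h ha r x y)) (prot.scatter b x r h)
    else 1

/-- With the received letters fixed, each round of `b` depends only on its own earlier rounds, so
the product is causal. -/
theorem isKernel_sendKernel [∀ p, Fintype (X p)] [∀ p, Nonempty (X p)]
    (ha : ∀ p, p ≠ b ↔ p = a) (hb : ∀ p, p ≠ a ↔ p = b) : IsKernel (prot.sendKernel ha) := by
  classical
  refine fun y => ⟨fun x => Finset.prod_nonneg fun r _ => ?_, ?_⟩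
  · split_ifs
    · exact (isLaw_massFn _).nonneg _
    · exact zero_le_one
  -- fictitious i.i.d. letters are added in the rounds in which `a` sends
  let P : (p : Party) → X p → ℝ := fun p => massFn (PMF.pure (Classical.arbitrary (X p)))
  have hP : ∀ p, IsLaw (P p) := fun p => isLaw_massFn _
  let k : (r : Fin prot.rounds) → ((s : Fin prot.rounds) → Fin (prot.len s) → X (prot.sender s)) →
      (Fin (prot.len r) → X (prot.sender r)) → ℝ := fun r f x =>
    if h : prot.sender r = b then
      massFn (prot.enc r (fun s i => f s.1 i,
        fun s i => prot.scatter a y s.1 ((ha _).1 (s.2.2.trans_eq h)) i)) x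
    else ∏ i, P (prot.sender r) (x i)
  have hk : ∀ r f g, (∀ s < r, f s = g s) → k r f = k r g := by
    intro r f g hfg
    funext x
    simp only [k]
    split_ifs with h
    · congr 4
      funext s
      exact hfg s.1 s.2.1
    · rfl
  have h1 : ∀ r f, ∑ x, k r f x = 1 := by
    intro r f
    simp only [k]
    split_ifs with h
    · exact (isLaw_massFn _).sum_eq
    · exact (isLaw_pi (hP _)).sum_eq
  have main := sum_prod_causal k hk h1
  have hab : a ≠ b := (ha a).2 rfl
  have e : ∀ f, ∏ r, k r f (f r) = (∏ j, P a (prot.gather a f j)) *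
      prot.sendKernel ha y (prot.gather b f) := by
    intro f
    rw [prot.prod_split hb, prot.prod_gather P]
    congr 1
    · refine Finset.prod_congr rfl fun r hr => ?_
      simp only [k]
      rw [dif_neg fun h => hab ((Finset.mem_filter.1 hr).2.symm.trans h)]
    · refine Finset.prod_congr rfl fun r hr => ?_
      simp only [k]
      rw [dif_pos (Finset.mem_filter.1 hr).2, dif_pos (Finset.mem_filter.1 hr).2]
      simp only [Schedule.mkView, Schedule.scatter_gather]
      congr 1
      funext i
      exact (prot.scatter_gather b f r _ i).symm
  simp_rw [e] at main
  have : ∑ u : (Fin (prot.uses a) → X a) × (Fin (prot.uses b) → X b),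
      (∏ j, P a (u.1 j)) * prot.sendKernel ha y u.2 = 1 := by
    rw [← (prot.splitEquiv X a b hb).sum_comp]
    exact main
  rw [Fintype.sum_prod_type] at this
  simp_rw [← Finset.mul_sum] at this
  rwa [← Finset.sum_mul, (isLaw_pi (hP a)).sum_eq, one_mul] at this

/-- The transcript, as the sequences of all the letters of each kind. -/
def sequences (hb : ∀ p, p ≠ a ↔ p = b) : prot.Transcript X Y Z ≃
    (((Fin (prot.uses a) → X a) × (Fin (prot.uses a) → Y a) × (Fin (prot.uses a) → Z a)) ×
      (Fin (prot.uses b) → X b)) × ((Fin (prot.uses b) → Y b) × (Fin (prot.uses b) → Z b)) :=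
  ((prot.splitEquiv (fun p => X p × Y p × Z p) a b hb).trans
    ((tripleEquiv _ _ _ _).symm.prodCongr (tripleEquiv _ _ _ _).symm)).trans
    (Equiv.prodAssoc _ _ _).symm

/-- Interaction disappears here. The letters of `a` ignore its view, so the product over the rounds
separates into a memoryless source and the answers of `b`, generated from all that `b` receives,
whatever the order of the rounds. -/
theorem law_eq (hb : ∀ p, p ≠ a ↔ p = b) (ha : ∀ p, p ≠ b ↔ p = a) (W : TwoDMBC X Y Z)
    {P : (p : Party) → PMF (X p)} (hP : ∀ r, prot.sender r = a →
      ∀ v x, prot.enc r v x = ∏ i, P (prot.sender r) (x i)) (ω : prot.Transcript X Y Z) :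
    prot.law W ω = twoWayLaw (block (Fin (prot.uses a)) ((W a).jointLaw (P a)))
      (prot.sendKernel ha) (blockW (Fin (prot.uses b)) (chan (W b)))
      (prot.sequences hb ω) := by
  have h1 := prot.prod_gather (T := fun p => X p × Y p × Z p)
    (fun p t => (W p).jointLaw (P p) t) a ω
  have h2 := prot.prod_gather (T := fun p => X p × Y p × Z p)
    (fun p t => chan (W p) t.1 t.2) b ω
  have h3 : prot.law W ω = (∏ r with prot.sender r = a, ∏ i, (W (prot.sender r)).jointLaw
      (P (prot.sender r)) (ω r i)) * (prot.sendKernel ha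
        (fun j => (prot.gather (T := fun p => X p × Y p × Z p) a ω j).2.1)
        (fun j => (prot.gather (T := fun p => X p × Y p × Z p) b ω j).1) *
      ∏ r with prot.sender r = b, ∏ i, chan (W (prot.sender r)) (ω r i).1 (ω r i).2) := by
    rw [law, prot.prod_split hb]
    congr 1
    · refine Finset.prod_congr rfl fun r hr => ?_
      rw [hP r (Finset.mem_filter.1 hr).2, ENNReal.toReal_prod, ← Finset.prod_mul_distrib]
      rfl
    · rw [sendKernel, ← Finset.prod_mul_distrib]
      refine Finset.prod_congr rfl fun r hr => ?_
      have h := (Finset.mem_filter.1 hr).2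
      rw [dif_pos h, prot.view_eq_mkView h ha]
      congr 2
      have g1 := prot.gather_map (T := fun p => X p × Y p × Z p) (T' := X) (fun p x => x.1) b ω
      rw [← g1]
      congr 1
      funext i
      exact (prot.scatter_gather (T := X) b (fun r i => (ω r i).1) r h i).symm
  rw [h3, ← h1, ← h2]
  exact (mul_assoc _ _ _).symm

end
end Protocol

/-! ### The converse for a single protocol -/

namespace Info

/-- The conditional entropy of the key that Fano's inequality allows, per channel use. -/
def fanoTerm (M δ : ℝ) : ℝ := (Real.binEntropy δ + δ * Real.log M) / Real.log 2

theorem fanoTerm_nonneg {M δ : ℝ} (hM : 1 ≤ M) (h0 : 0 ≤ δ) (h1 : δ ≤ 1) : 0 ≤ fanoTerm M δ :=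
  div_nonneg (add_nonneg (Real.binEntropy_nonneg h0 h1) (mul_nonneg h0 (Real.log_nonneg hM)))
    log_two_pos.le

theorem continuous_fanoTerm (M : ℝ) : Continuous (fanoTerm M) := by
  unfold fanoTerm
  exact ((Real.binEntropy_continuous.add (continuous_id.mul continuous_const)).div_const _)

theorem fanoTerm_zero (M : ℝ) : fanoTerm M 0 = 0 := by simp [fanoTerm]

section
variable {Ω α γ : Type*} [Fintype Ω] [Fintype α] [Fintype γ]

/-- The key alphabet of a protocol is unbounded, so Fano's inequality is applied to the range of the
key as a function of the sequences of one party. This range has at most M ^ s elements, which makes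
the bound linear in the number of uses. The binary entropy increases up to 1/2, whence the
restriction on `δ`. -/
theorem condEntropy_le_fanoTerm [DecidableEq α] {ι : Type*} [Fintype ι] {μ : Ω → ℝ} (hμ : IsLaw μ)
    (T S : Ω → α) (F : Ω → ι) (f : ι → α) (hT : ∀ ω, T ω = f (F ω)) {M δ : ℝ} {s : ℕ} (hM : 1 ≤ M)
    (hs : 0 < s) (hι : (Fintype.card ι : ℝ) ≤ M ^ s) (hδ : δ ≤ 1 / 2)
    (he : prob μ (fun ω => T ω ≠ S ω) < δ) : condEntropy μ T S ≤ s * fanoTerm M δ := by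
  have hF := fano hμ T S (Finset.univ.image f) (fun ω => by rw [hT]; simp)
  set e := prob μ (fun ω => T ω ≠ S ω)
  have he0 : 0 ≤ e := prob_nonneg hμ.nonneg _
  have hs1 : (1 : ℝ) ≤ s := by exact_mod_cast hs
  have hb : Real.binEntropy e ≤ Real.binEntropy δ :=
    Real.binEntropy_strictMonoOn.monotoneOn ⟨he0, by linarith⟩ ⟨he0.trans he.le, by linarith⟩ he.le
  have hb0 : 0 ≤ Real.binEntropy δ := Real.binEntropy_nonneg (he0.trans he.le) (by linarith)
  have hlog : Real.log (Finset.univ.image f).card ≤ s * Real.log M := by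
    rw [← Real.log_pow]
    rcases Nat.eq_zero_or_pos (Finset.univ.image f).card with h | h
    · rw [h]; simpa using Real.log_nonneg (one_le_pow₀ hM)
    · refine Real.log_le_log (by exact_mod_cast h) (le_trans ?_ hι)
      exact_mod_cast Finset.card_image_le
  have hlM := Real.log_nonneg hM
  refine hF.trans ?_
  rw [fanoTerm, ← mul_div_assoc]
  refine div_le_div_of_nonneg_right ?_ log_two_pos.le
  have h1 : e * Real.log (Finset.univ.image f).card ≤ δ * (s * Real.log M) :=
    (mul_le_mul_of_nonneg_left hlog he0).trans
      (mul_le_mul_of_nonneg_right he.le (by positivity))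
  nlinarith

/-- Used to pass from the key of one party to that of the other at the cost of a Fano term. -/
theorem condEntropy_le_add {β : Type*} [Fintype β] {μ : Ω → ℝ} (hμ : IsLaw μ) (S : Ω → α) (T : Ω → β)
    (E : Ω → γ) : condEntropy μ S E ≤ condEntropy μ T E + condEntropy μ S T := by
  have h1 := condEntropy_le_condEntropy hμ (A := S) (B := fun ω => (T ω, E ω)) (C := T)
    (by simp +contextual)
  have h2 := entropy_mono hμ (A := fun ω => (S ω, T ω, E ω)) (B := fun ω => (S ω, E ω))
    (by simp +contextual)
  simp only [condEntropy] at *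
  linarith

end
end Info

theorem TwoDMBC.wiretapGain_le_L'_other {X Y Z : Party → Type*} [∀ p, Fintype (X p)]
    [∀ p, Fintype (Y p)] [∀ p, Fintype (Z p)] [∀ p, Nonempty (X p)] (W : TwoDMBC X Y Z) (a : Party)
    {r : X a → ℝ} (hr : Info.IsLaw r) : W.wiretapGain a r ≤ W.L' a.other := by
  cases a
  · exact W.wiretapGain_le_L' .bob hr
  · exact W.wiretapGain_le_L' .alice hr

namespace Protocol
open Info

section
set_option linter.unusedSectionVars false
variable {X Y Z : Party → Type*} [∀ p, Fintype (X p)] [∀ p, Fintype (Y p)] [∀ p, Fintype (Z p)]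
  [∀ p, Nonempty (X p)]

/-- A bound on the number of values of a single letter. -/
def letterCount (X Y : Party → Type*) [∀ p, Fintype (X p)] [∀ p, Fintype (Y p)] (a b : Party) : ℝ :=
  (Fintype.card (X a) + 1) * (Fintype.card (Y a) + 1) *
    ((Fintype.card (X b) + 1) * (Fintype.card (Y b) + 1))

/-- If the constraint set of `a` is nonempty, the key `t` of the other party is bounded through `L'
a`. Otherwise the channel towards `a` conveys nothing to it, and the key `s` of `a` is bounded by
the wiretap gain of the channel of `a`, hence through `L' a.other`. That different keys are bounded
is harmless, since they nearly coincide. -/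
theorem exists_key_entropy_le {W : TwoDMBC X Y Z} (hW : W.IsSD) (a : Party) :
    ∃ Λ, (Λ = W.L' a ∨ (¬ (W.lowerBoundValues a).Nonempty ∧ Λ = W.L' a.other)) ∧ ∃ c > 0,
      ∀ (n m K : ℕ) (P : PMF (X a)) (q : (Fin n → Y a) → (Fin m → X a.other) → ℝ)
        (s : (Fin n → X a) × (Fin m → Y a.other) → Fin K)
        (t : (Fin n → Y a) × (Fin m → X a.other) → Fin K) (ε : ℝ), 0 < n + m → IsKernel q → 0 ≤ ε →
        ∀ μ, μ = twoWayLaw (block (Fin n) ((W a).jointLaw P)) q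
          (blockW (Fin m) (chan (W a.other))) →
        condEntropy μ (fun x => t (x.1.1.2.1, x.1.2)) (fun x => (x.1.1.1, x.2.1)) ≤ (n + m) * ε →
        condEntropy μ (fun x => s (x.1.1.1, x.2.1)) (fun x => (x.1.1.2.1, x.1.2)) ≤ (n + m) * ε →
        condEntropy μ (fun x => t (x.1.1.2.1, x.1.2)) (fun x => (x.1.1.2.2, x.2.2)) ≤
            (n + m) * (Λ * (1 + ε / c) + ε) ∨
          condEntropy μ (fun x => s (x.1.1.1, x.2.1)) (fun x => (x.1.1.2.2, x.2.2)) ≤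
            (n + m) * (Λ * (1 + ε / c) + ε) := by
  have hd := degraded_chan (hW a.other).1
  by_cases hne : (W.lowerBoundValues a).Nonempty
  · obtain ⟨c, hc, h⟩ := W.exists_le_L'_of_approx (hW a.other).1 hne
    refine ⟨_, Or.inl rfl, c, hc, ?_⟩
    rintro n m K P q s t ε hnm hq hε _ rfl h1 -
    obtain ⟨k, Q, r, hQ, hr, i1, i2⟩ := exists_single_letter_bound (isLaw_jointLaw (W a) P)
      (indepGiven_jointLaw (hW a).2 P) (isKernel_chan (W a.other)) hd hq t
    have := h n m k P Q r ε hQ hr hnm hε (by linarith)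
    rw [TwoDMBC.wiretapGain] at this
    left
    linarith
  -- Any positive constant would do here, because only 1 + ε / c ≥ 1 is needed.
  · refine ⟨_, Or.inr ⟨hne, rfl⟩, 1, one_pos, ?_⟩
    rintro n m K P q s t ε hnm hq hε _ rfl - h1
    right
    -- An input with positive information would give an element of the set with n = 0 and m = 1.
    have hzero : ∀ r, IsLaw r → chanInfo r (kfst (chan (W a.other))) = 0 := by
      intro r hr
      by_contra h0
      have hpos := lt_of_le_of_ne (chanInfo_nonneg hr (isKernel_chan (W a.other)).kfst) (Ne.symm h0)
      exact hne ⟨_, W.mem_lowerBoundValues (a := a) (n := 0) (m := 1) (k := 1)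
        (P := PMF.pure (Classical.arbitrary _)) (Q := fun _ _ => 1)
        (fun _ => ⟨fun _ => zero_le_one, by simp⟩) hr (by simp) (by simpa using hpos)⟩
    obtain ⟨kb, hkb, hconst⟩ := exists_const_of_chanInfo_eq_zero (isKernel_chan (W a.other)).kfst
      hzero
    have hva := isKernel_chan (W a)
    have hda := degraded_chan (hW a).1
    have e := block_comp (ι := Fin n) (massFn P) (chan (W a))
    have hmain := condEntropy_le_of_const (isLaw_pi (ι := Fin n) (isLaw_massFn P))
      (hva.blockW (ι := Fin n)) (by
        rw [kfst_blockW, ksnd_blockW]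
        exact hda.imp degraded_block degraded_block) hq
      ((isKernel_chan (W a.other)).blockW (ι := Fin m)) (isLaw_pi (ι := Fin m) hkb) (by
        rw [kfst_blockW, hconst]; rfl) s
    rw [← e, kfst_blockW, ksnd_blockW] at hmain
    have hL := W.L'_nonneg a.other
    have hgain : max 0 (chanInfo (fun x : Fin n → X a => ∏ i, massFn P (x i))
          (blockK (Fin n) (kfst (chan (W a)))) -
        chanInfo (fun x : Fin n → X a => ∏ i, massFn P (x i))
          (blockK (Fin n) (ksnd (chan (W a))))) ≤ n * W.L' a.other := by
      refine max_le (by positivity) ?_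
      rcases hda with hda | hda
      · obtain ⟨r', hr', hb⟩ := exists_single_letter_input (C := Z a) hva.kfst n _
          (isLaw_pi (ι := Fin n) (isLaw_massFn P))
        refine (hb _ hda).trans (mul_le_mul_of_nonneg_left ?_ (Nat.cast_nonneg n))
        exact (le_max_right _ _).trans (W.wiretapGain_le_L'_other a hr')
      · have := chanInfo_le_of_degraded (isLaw_pi (ι := Fin n) (isLaw_massFn P))
          (hva.ksnd.blockK (ι := Fin n)) (degraded_block (ι := Fin n) hda)
        have : 0 ≤ (n : ℝ) * W.L' a.other := by positivity
        linarith
    have : (0 : ℝ) ≤ m := Nat.cast_nonneg m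
    have h3 : (n : ℝ) * W.L' a.other ≤ (n + m) * (W.L' a.other * (1 + ε / 1)) := by
      have : 0 ≤ W.L' a.other * ε := by positivity
      have : 0 ≤ (n : ℝ) * (W.L' a.other * ε) := by positivity
      have : 0 ≤ (m : ℝ) * (W.L' a.other * ε) := by positivity
      have : 0 ≤ (m : ℝ) * W.L' a.other := by positivity
      rw [div_one]
      nlinarith
    have hmain' := hmain.trans (add_le_add hgain h1)
    refine hmain'.trans ?_
    linarith

theorem uses_add (prot : Protocol X Y) (a : Party) :
    prot.uses .alice + prot.uses .bob = prot.uses a + prot.uses a.other := by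
  cases a
  · rfl
  · exact add_comm _ _

/-- One Fano term comes from the single-letter bound, the other from passing, if necessary, from the
key that is bounded there to the key `S`. Neither Λ nor c depends on the protocol, so δ may tend to
0. -/
theorem rate_le_of_secure {W : TwoDMBC X Y Z} (hW : W.IsSD) (a : Party) :
    ∃ Λ, (Λ = W.L' a ∨ (¬ (W.lowerBoundValues a).Nonempty ∧ Λ = W.L' a.other)) ∧ ∃ c > 0,
      ∀ (prot : Protocol X Y) (R δ : ℝ), prot.SendsIID a → prot.Secure W R δ → 0 < δ → δ ≤ 1 / 2 →
        (1 - δ) * (R - δ) ≤ Λ * (1 + fanoTerm (letterCount X Y a a.other) δ / c) +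
          2 * fanoTerm (letterCount X Y a a.other) δ := by
  obtain ⟨Λ, hΛ, c, hc, h⟩ := exists_key_entropy_le hW a
  refine ⟨Λ, hΛ, c, hc, ?_⟩
  rintro prot R δ ⟨P, hP⟩ ⟨hpos, hrate, herr, hsec⟩ hδ0 hδ
  have hΛ0 : 0 ≤ Λ := by
    rcases hΛ with rfl | ⟨-, rfl⟩
    · exact W.L'_nonneg _
    · exact W.L'_nonneg _
  have hb : ∀ p, p ≠ a ↔ p = a.other := fun p => Party.ne_iff_eq_other
  have ha : ∀ p, p ≠ a.other ↔ p = a := fun p => by rw [Party.ne_iff_eq_other, Party.other_other]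
  set n := prot.uses a with hn
  set m := prot.uses a.other with hm
  have hnm : 0 < n + m := by rw [hn, hm, ← prot.uses_add a]; exact hpos
  have hcast : (prot.uses .alice : ℝ) + prot.uses .bob = (n : ℝ) + m := by
    exact_mod_cast congrArg (Nat.cast (R := ℝ)) (prot.uses_add a)
  rw [hcast] at hrate
  have hq := prot.isKernel_sendKernel ha hb
  set μ := twoWayLaw (block (Fin n) ((W a).jointLaw (P a))) (prot.sendKernel ha)
    (blockW (Fin m) (chan (W a.other))) with hμdef
  have hμ : IsLaw μ := isLaw_twoWayLaw (isLaw_block (isLaw_jointLaw _ _)) hq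
    ((isKernel_chan _).blockW)
  have hlaw : ∀ ω, prot.law W ω = μ (prot.sequences hb ω) := prot.law_eq hb ha W hP
  have hpush : push (prot.law W) (prot.sequences hb) = μ := by
    funext x
    rw [push_equiv, hlaw, Equiv.apply_symm_apply]
  -- The summands 1 in `letterCount` make it a bound for 1 and for each of the four cardinalities at
  -- once.
  have hM : (1 : ℝ) ≤ letterCount X Y a a.other := by
    rw [letterCount]
    have : ∀ k : ℕ, (1 : ℝ) ≤ (k : ℝ) + 1 := fun k => by simp
    exact one_le_mul_of_one_le_of_one_le
      (one_le_mul_of_one_le_of_one_le (this _) (this _))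
      (one_le_mul_of_one_le_of_one_le (this _) (this _))
  set M := letterCount X Y a a.other with hMdef
  set ε := fanoTerm M δ with hε
  have hε0 : 0 ≤ ε := fanoTerm_nonneg hM hδ0.le (by linarith)
  -- the keys of the two parties as functions of the sequences
  let s : (Fin n → X a) × (Fin m → Y a.other) → Fin prot.keyCard := fun x =>
    prot.key a (prot.mkView rfl hb prot.rounds x.1 x.2)
  let t : (Fin n → Y a) × (Fin m → X a.other) → Fin prot.keyCard := fun x =>
    prot.key a.other (prot.mkView rfl ha prot.rounds x.2 x.1)
  have hs : ∀ ω : prot.Transcript X Y Z, prot.key a (Schedule.view a prot.rounds ω) =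
      s ((prot.sequences hb ω).1.1.1, (prot.sequences hb ω).2.1) := fun ω => by
    rw [prot.view_eq_mkView rfl hb]; rfl
  have ht : ∀ ω : prot.Transcript X Y Z, prot.key a.other (Schedule.view a.other prot.rounds ω) =
      t ((prot.sequences hb ω).1.1.2.1, (prot.sequences hb ω).1.2) := fun ω => by
    rw [prot.view_eq_mkView rfl ha]; rfl
  have heve : ∀ ω ω' : prot.Transcript X Y Z, Schedule.eveView ω = Schedule.eveView ω' ↔
      ((prot.sequences hb ω).1.1.2.2, (prot.sequences hb ω).2.2) =
        ((prot.sequences hb ω').1.1.2.2, (prot.sequences hb ω').2.2) := fun ω ω' => by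
    rw [prot.gather_inj (T := Z) hb, Prod.mk.injEq]
    have h1 := fun p (ω : prot.Transcript X Y Z) =>
      prot.gather_map (T := fun p => X p × Y p × Z p) (T' := Z) (fun p x => x.2.2) p ω
    change (prot.gather (T := Z) a (fun r i => (ω r i).2.2) =
      prot.gather (T := Z) a (fun r i => (ω' r i).2.2) ∧
      prot.gather (T := Z) a.other (fun r i => (ω r i).2.2) =
      prot.gather (T := Z) a.other (fun r i => (ω' r i).2.2)) ↔ _
    rw [h1, h1, h1, h1]
    rfl
  let S' := fun x : (((Fin n → X a) × (Fin n → Y a) × (Fin n → Z a)) × (Fin m → X a.other)) ×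
    ((Fin m → Y a.other) × (Fin m → Z a.other)) => s (x.1.1.1, x.2.1)
  let T' := fun x : (((Fin n → X a) × (Fin n → Y a) × (Fin n → Z a)) × (Fin m → X a.other)) ×
    ((Fin m → Y a.other) × (Fin m → Z a.other)) => t (x.1.1.2.1, x.1.2)
  let E' := fun x : (((Fin n → X a) × (Fin n → Y a) × (Fin n → Z a)) × (Fin m → X a.other)) ×
    ((Fin m → Y a.other) × (Fin m → Z a.other)) => (x.1.1.2.2, x.2.2)
  have hcond : ∀ A : _ → Fin prot.keyCard, condEntropy (prot.law W)
      (fun ω => A (prot.sequences hb ω)) Schedule.eveView = condEntropy μ A E' := fun A => by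
    rw [condEntropy_congr (C := fun ω => A (prot.sequences hb ω))
      (D := fun ω => E' (prot.sequences hb ω)) (fun ω ω' => by rw [heve]) heve]
    refine condEntropy_congr_push ?_
    rw [← hpush, push_push]
  have hent : ∀ A : _ → Fin prot.keyCard, entropy (prot.law W)
      (fun ω => A (prot.sequences hb ω)) = entropy μ A := fun A => by
    rw [← hpush, entropy_push]
  have hM' : ∀ i j : ℕ, ∀ u v : ℝ, 0 ≤ u → 0 ≤ v → u ≤ M → v ≤ M → u ^ i * v ^ j ≤ M ^ (i + j) :=
    fun i j u v hu hv huM hvM => by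
      rw [pow_add]
      exact mul_le_mul (pow_le_pow_left₀ hu huM i) (pow_le_pow_left₀ hv hvM j) (by positivity)
        (by positivity)
  have hcards : (Fintype.card (X a) : ℝ) ≤ M ∧ (Fintype.card (Y a) : ℝ) ≤ M ∧
      (Fintype.card (X a.other) : ℝ) ≤ M ∧ (Fintype.card (Y a.other) : ℝ) ≤ M := by
    rw [hMdef, letterCount]
    set k1 : ℝ := (Fintype.card (X a) : ℝ)
    set k2 : ℝ := (Fintype.card (Y a) : ℝ)
    set k3 : ℝ := (Fintype.card (X a.other) : ℝ)
    set k4 : ℝ := (Fintype.card (Y a.other) : ℝ)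
    have h1 : 0 ≤ k1 := Nat.cast_nonneg _
    have h2 : 0 ≤ k2 := Nat.cast_nonneg _
    have h3 : 0 ≤ k3 := Nat.cast_nonneg _
    have h4 : 0 ≤ k4 := Nat.cast_nonneg _
    have g1 : k1 + k2 + 1 ≤ (k1 + 1) * (k2 + 1) := by nlinarith
    have g2 : k3 + k4 + 1 ≤ (k3 + 1) * (k4 + 1) := by nlinarith
    have g3 : k1 + k2 + k3 + k4 + 1 ≤ (k1 + 1) * (k2 + 1) * ((k3 + 1) * (k4 + 1)) := by
      nlinarith [mul_le_mul g1 g2 (by positivity) (by positivity),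
        mul_nonneg (add_nonneg h1 h2) (add_nonneg h3 h4)]
    refine ⟨?_, ?_, ?_, ?_⟩ <;> linarith
  have hTS : prob μ (fun x => T' x ≠ S' x) < δ → condEntropy μ T' S' ≤ (n + m : ℕ) * ε := fun he =>
    condEntropy_le_fanoTerm hμ T' S' (fun x => (x.1.1.2.1, x.1.2)) t (fun _ => rfl) hM hnm (by
      rw [Fintype.card_prod, Fintype.card_fun, Fintype.card_fun, Fintype.card_fin, Fintype.card_fin]
      push_cast
      exact hM' _ _ _ _ (Nat.cast_nonneg _) (Nat.cast_nonneg _) hcards.2.1 hcards.2.2.1) hδ he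
  have hST : prob μ (fun x => S' x ≠ T' x) < δ → condEntropy μ S' T' ≤ (n + m : ℕ) * ε := fun he =>
    condEntropy_le_fanoTerm hμ S' T' (fun x => (x.1.1.1, x.2.1)) s (fun _ => rfl) hM hnm (by
      rw [Fintype.card_prod, Fintype.card_fun, Fintype.card_fun, Fintype.card_fin, Fintype.card_fin]
      push_cast
      exact hM' _ _ _ _ (Nat.cast_nonneg _) (Nat.cast_nonneg _) hcards.1 hcards.2.2.2) hδ he
  -- A is the key of the holder, whoever that is; the error event is symmetric in the two keys.
  obtain ⟨A, hA, hAe, heA⟩ : ∃ A, (A = S' ∨ A = T') ∧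
      (fun ω => A (prot.sequences hb ω)) = prot.keyS ∧ prob μ (fun x => T' x ≠ S' x) < δ := by
    rcases eq_or_ne prot.holder a with hh | hh
    · refine ⟨S', Or.inl rfl, ?_, ?_⟩
      · funext ω
        change s _ = _
        rw [← hs, keyS, hh]
      · rw [← hpush, prob_push]
        convert herr using 5 with ω
        · change t _ = _
          rw [← ht, keyEst, hh]
        · change s _ = _
          rw [← hs, keyS, hh]
    · rw [hb] at hh
      refine ⟨T', Or.inr rfl, ?_, ?_⟩
      · funext ω
        change t _ = _
        rw [← ht, keyS, hh]
      · rw [← hpush, prob_push]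
        refine lt_of_eq_of_lt (prob_congr fun ω => ?_) herr
        have e1 : prot.keyS ω = T' (prot.sequences hb ω) := by
          change _ = t _
          rw [← ht, keyS, hh]
        have e2 : prot.keyEst ω = S' (prot.sequences hb ω) := by
          change _ = s _
          rw [← hs, keyEst, hh, Party.other_other]
        rw [e1, e2, ne_comm]
  have hTS' := hTS heA
  have hST' := hST ((prob_congr fun x => ne_comm).trans_lt heA)
  push_cast at hTS' hST'
  have hbound := h n m prot.keyCard (P a) (prot.sendKernel ha) s t ε hnm hq hε0 μ rfl
    ((condEntropy_le_condEntropy hμ (C := S') (by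
      intro ω ω' hω; exact congrArg s hω)).trans hTS')
    ((condEntropy_le_condEntropy hμ (C := T') (by
      intro ω ω' hω; exact congrArg t hω)).trans hST')
  set B := (n + m : ℝ) * (Λ * (1 + ε / c) + ε) with hB
  have hAB : condEntropy μ A E' ≤ B + (n + m) * ε := by
    have hz : (0 : ℝ) ≤ (n + m) * ε := by positivity
    have hT : condEntropy μ T' E' ≤ B + (n + m) * ε ∧ condEntropy μ S' E' ≤ B + (n + m) * ε := by
      rcases hbound with hbd | hbd
      · exact ⟨hbd.trans (by linarith),
          (condEntropy_le_add hμ S' T' E').trans (add_le_add hbd hST')⟩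
      · exact ⟨(condEntropy_le_add hμ T' S' E').trans (add_le_add hbd hTS'),
          hbd.trans (by linarith)⟩
    rcases hA with rfl | rfl
    · exact hT.2
    · exact hT.1
  rw [← hAe, hent] at hrate hsec
  rw [hcond] at hsec
  have hspos : (0 : ℝ) < (n : ℝ) + m := by exact_mod_cast hnm
  rw [gt_iff_lt, lt_div_iff₀ hspos] at hrate
  -- If H(S) = 0, the rate condition alone makes R - δ negative; otherwise the secrecy condition
  -- gives (1 - δ) H(S) < H(S | View_E).
  have hfinal : (1 - δ) * ((R - δ) * ((n : ℝ) + m)) ≤ B + (n + m) * ε := by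
    by_cases h0 : entropy μ A = 0
    · rw [h0] at hrate
      have : 0 ≤ B + (n + m) * ε := by positivity
      nlinarith
    · have hApos : 0 < entropy μ A := lt_of_le_of_ne (entropy_nonneg hμ A) (Ne.symm h0)
      have := hsec h0
      rw [gt_iff_lt, lt_div_iff₀ hApos] at this
      nlinarith
  have : ((1 - δ) * (R - δ)) * ((n : ℝ) + m) ≤ (Λ * (1 + ε / c) + 2 * ε) * ((n : ℝ) + m) := by
    rw [hB] at hfinal; linarith
  exact le_of_mul_le_mul_right this hspos

end
end Protocol

/-! ### Upper bounds on the capacities -/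

namespace TwoDMBC
open Info

section
variable {X Y Z : Party → Type*} [∀ p, Fintype (X p)] [∀ p, Fintype (Y p)] [∀ p, Fintype (Z p)]
  [∀ p, Nonempty (X p)]

/-- Arbitrarily small δ suffice for the limit in `rate_le_of_secure`. The hypothesis is `∃ᶠ` and not
`∀ᶠ` because in the union of the two classes the party that sends i.i.d. letters may change with δ.
-/
theorem le_of_frequently_secure {W : TwoDMBC X Y Z} (hW : W.IsSD) {a : Party} {R : ℝ}
    (h : ∃ᶠ δ in nhdsWithin (0 : ℝ) (Set.Ioi 0),
      ∃ prot : Protocol X Y, prot.SendsIID a ∧ prot.Secure W R δ) :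
    R ≤ W.L' a ∨ (¬ (W.lowerBoundValues a).Nonempty ∧ R ≤ W.L' a.other) := by
  obtain ⟨Λ, hΛ, c, hc, hle⟩ := Protocol.rate_le_of_secure hW a
  have hR : R ≤ Λ := by
    set f := fanoTerm (Protocol.letterCount X Y a a.other)
    have hf : Continuous f := continuous_fanoTerm _
    have hf0 : f 0 = 0 := fanoTerm_zero _
    have t1 : Filter.Tendsto (fun δ : ℝ => (1 - δ) * (R - δ)) (nhdsWithin 0 (Set.Ioi 0))
        (nhds R) := by
      have : Continuous (fun δ : ℝ => (1 - δ) * (R - δ)) := by fun_prop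
      have := this.tendsto 0
      simp only [sub_zero, one_mul] at this
      exact this.mono_left nhdsWithin_le_nhds
    have t2 : Filter.Tendsto (fun δ : ℝ => Λ * (1 + f δ / c) + 2 * f δ)
        (nhdsWithin 0 (Set.Ioi 0)) (nhds Λ) := by
      have : Continuous (fun δ : ℝ => Λ * (1 + f δ / c) + 2 * f δ) := by fun_prop
      have := this.tendsto 0
      simp only [hf0, zero_div, add_zero, mul_one, mul_zero] at this
      exact this.mono_left nhdsWithin_le_nhds
    refine le_of_tendsto_of_tendsto_of_frequently t1 t2 ?_
    have hsmall : ∀ᶠ δ in nhdsWithin (0 : ℝ) (Set.Ioi 0), 0 < δ ∧ δ ≤ 1 / 2 :=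
      Ioc_mem_nhdsGT (by norm_num)
    refine (h.and_eventually hsmall).mono ?_
    rintro δ ⟨⟨prot, h1, h2⟩, h3, h4⟩
    exact hle prot R δ h1 h2 h3 h4
  rcases hΛ with rfl | ⟨h1, rfl⟩
  · exact Or.inl hR
  · exact Or.inr ⟨h1, hR⟩

theorem le_L'_of_mem_achievableRates {W : TwoDMBC X Y Z} (hW : W.IsSD) {a : Party}
    (hne : (W.lowerBoundValues a).Nonempty) {R : ℝ}
    (h : R ∈ W.achievableRates (fun prot => prot.SendsIID a)) : R ≤ W.L' a := by
  refine (le_of_frequently_secure hW ?_).resolve_right fun h' => h'.1 hne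
  refine Filter.Eventually.frequently ?_
  filter_upwards [self_mem_nhdsWithin] with δ hδ using h.2 δ hδ

theorem le_max_of_mem_achievableRates {W : TwoDMBC X Y Z} (hW : W.IsSD) {R : ℝ}
    (h : R ∈ W.achievableRates (fun prot => ∃ a, prot.SendsIID a)) :
    R ≤ max (W.L' .alice) (W.L' .bob) := by
  have h1 : ∃ᶠ δ in nhdsWithin (0 : ℝ) (Set.Ioi 0),
      (∃ prot : Protocol X Y, prot.SendsIID .alice ∧ prot.Secure W R δ) ∨
        ∃ prot : Protocol X Y, prot.SendsIID .bob ∧ prot.Secure W R δ := by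
    refine Filter.Eventually.frequently ?_
    filter_upwards [self_mem_nhdsWithin] with δ hδ
    obtain ⟨prot, ⟨a, ha⟩, hs⟩ := h.2 δ hδ
    cases a
    · exact Or.inl ⟨prot, ha, hs⟩
    · exact Or.inr ⟨prot, ha, hs⟩
  -- One fixed party sends i.i.d. letters for arbitrarily small δ. Should its constraint set be
  -- empty, the rate is still bounded by the `L'` of the other party, so the maximum is a bound
  -- without any assumption of nonemptiness.
  rw [Filter.frequently_or_distrib] at h1
  rcases h1 with h1 | h1
  · rcases le_of_frequently_secure hW h1 with h2 | ⟨-, h2⟩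
    · exact le_max_of_le_left h2
    · exact le_max_of_le_right h2
  · rcases le_of_frequently_secure hW h1 with h2 | ⟨-, h2⟩
    · exact le_max_of_le_right h2
    · exact le_max_of_le_left h2

end
end TwoDMBC

/-! ### Averages over random binnings -/

namespace Info

/-- The average over all the functions `Φ : W → I`, that is, over all the binnings of `W`. -/
def binAvg {W I : Type*} [Fintype W] [DecidableEq W] [Fintype I] (f : (W → I) → ℝ) : ℝ :=
  ∑ Φ : W → I, (∏ _w : W, (Fintype.card I : ℝ)⁻¹) * f Φ

/-- The average of a function on a finite set. -/
def avg {I : Type*} [Fintype I] (g : I → ℝ) : ℝ := ∑ i, (Fintype.card I : ℝ)⁻¹ * g i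

section
set_option linter.unusedSectionVars false
variable {W I : Type*} [Fintype W] [DecidableEq W] [Fintype I]

theorem isLaw_uniform [Nonempty I] : IsLaw (fun _ : I => (Fintype.card I : ℝ)⁻¹) :=
  ⟨fun _ => by positivity, by
    simp [Finset.sum_const]⟩

theorem binAvg_add (f g : (W → I) → ℝ) :
    binAvg (fun Φ => f Φ + g Φ) = binAvg f + binAvg g := by
  simp only [binAvg, mul_add, Finset.sum_add_distrib]

theorem binAvg_mul_left (c : ℝ) (f : (W → I) → ℝ) : binAvg (fun Φ => c * f Φ) = c * binAvg f := by
  simp only [binAvg, Finset.mul_sum]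
  exact Finset.sum_congr rfl fun _ _ => by ring

theorem binAvg_sum {κ : Type*} (s : Finset κ) (f : κ → (W → I) → ℝ) :
    binAvg (fun Φ => ∑ k ∈ s, f k Φ) = ∑ k ∈ s, binAvg (f k) := by
  simp only [binAvg, Finset.mul_sum]
  exact Finset.sum_comm

theorem binAvg_mono {f g : (W → I) → ℝ} (h : ∀ Φ, f Φ ≤ g Φ) : binAvg f ≤ binAvg g :=
  Finset.sum_le_sum fun Φ _ => mul_le_mul_of_nonneg_left (h Φ)
    (Finset.prod_nonneg fun _ _ => by positivity)

theorem exists_le_binAvg [Nonempty I] (f : (W → I) → ℝ) : ∃ Φ, f Φ ≤ binAvg f := by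
  by_contra! h
  have hl := isLaw_pi (ι := W) (isLaw_uniform (I := I))
  have h1 : ∑ Φ : W → I, (∏ _w : W, (Fintype.card I : ℝ)⁻¹) * binAvg f = binAvg f := by
    rw [← Finset.sum_mul, hl.sum_eq, one_mul]
  have h2 : binAvg f < binAvg f := by
    conv_lhs => rw [← h1]
    have hpos : 0 < ∏ _w : W, (Fintype.card I : ℝ)⁻¹ :=
      Finset.prod_pos fun _ _ => inv_pos.2 (by exact_mod_cast Fintype.card_pos)
    exact Finset.sum_lt_sum_of_nonempty Finset.univ_nonempty fun Φ _ =>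
      mul_lt_mul_of_pos_left (h Φ) hpos
  exact lt_irrefl _ h2

theorem binAvg_const [Nonempty I] (c : ℝ) : binAvg (fun _ : W → I => c) = c := by
  rw [binAvg, ← Finset.sum_mul, (isLaw_pi (ι := W) (isLaw_uniform (I := I))).sum_eq, one_mul]

theorem avg_one [Nonempty I] : avg (fun _ : I => 1) = 1 := by
  simp [avg]

theorem avg_mul_left (c : ℝ) (g : I → ℝ) : avg (fun i => c * g i) = c * avg g := by
  simp only [avg, Finset.mul_sum]
  exact Finset.sum_congr rfl fun _ _ => by ring

/-- The bins of different points are independent and uniform; the first and second moments used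
below follow from this identity. -/
theorem binAvg_prod (h : W → I → ℝ) : binAvg (fun Φ => ∏ w, h w (Φ w)) = ∏ w, avg (h w) := by
  simp only [binAvg, avg, ← Finset.prod_mul_distrib]
  exact sum_prod_apply fun w i => (Fintype.card I : ℝ)⁻¹ * h w i

theorem binAvg_apply [Nonempty I] (g : I → ℝ) (w : W) : binAvg (fun Φ => g (Φ w)) = avg g := by
  have h := binAvg_prod (fun w' i => if w' = w then g i else 1)
  simp only [Finset.prod_ite_eq', Finset.mem_univ, if_true] at h
  rw [h, Finset.prod_eq_single w (fun w' _ hw => by simp [hw, avg_one]) (by simp)]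
  simp

theorem binAvg_apply_mul [Nonempty I] (g g' : I → ℝ) {w w' : W} (hw : w ≠ w') :
    binAvg (fun Φ => g (Φ w) * g' (Φ w')) = avg g * avg g' := by
  have h := binAvg_prod (fun v i => (if v = w then g i else 1) * (if v = w' then g' i else 1))
  simp only [Finset.prod_mul_distrib, Finset.prod_ite_eq', Finset.mem_univ, if_true] at h
  rw [h, ← Finset.mul_prod_erase _ _ (Finset.mem_univ w),
    ← Finset.mul_prod_erase _ _ (Finset.mem_erase.2 ⟨hw.symm, Finset.mem_univ w'⟩),
    Finset.prod_eq_one, mul_one]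
  · simp [hw, hw.symm]
  · intro v hv
    simp only [Finset.mem_erase, Finset.mem_univ, and_true] at hv
    simp [hv.1, hv.2, avg_one]

theorem binAvg_abs_le_sqrt [Nonempty I] (f : (W → I) → ℝ) :
    binAvg (fun Φ => |f Φ|) ≤ Real.sqrt (binAvg (fun Φ => f Φ ^ 2)) := by
  refine Real.le_sqrt_of_sq_le ?_
  have hl := isLaw_pi (ι := W) (isLaw_uniform (I := I))
  have h := Finset.sum_mul_sq_le_sq_mul_sq Finset.univ
    (fun Φ : W → I => Real.sqrt (∏ _w : W, (Fintype.card I : ℝ)⁻¹))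
    (fun Φ => Real.sqrt (∏ _w : W, (Fintype.card I : ℝ)⁻¹) * |f Φ|)
  have hn : 0 ≤ ∏ _w : W, (Fintype.card I : ℝ)⁻¹ := Finset.prod_nonneg fun _ _ => by positivity
  simp only [mul_pow, Real.sq_sqrt hn, hl.sum_eq, one_mul, ← mul_assoc, Real.mul_self_sqrt hn,
    sq_abs] at h
  exact h

/-- The cross terms vanish, since the bins of distinct points are independent and `h` has mean zero.
-/
theorem binAvg_sum_sq [Nonempty I] (u : W → ℝ) {h : I → ℝ} (h0 : avg h = 0) :
    binAvg (fun Φ => (∑ w, u w * h (Φ w)) ^ 2) = (∑ w, u w ^ 2) * avg (fun i => h i ^ 2) := by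
  have e : ∀ Φ : W → I, (∑ w, u w * h (Φ w)) ^ 2 =
      ∑ w, ∑ w', (u w * u w') * (h (Φ w) * h (Φ w')) := fun Φ => by
    rw [sq, Finset.sum_mul_sum]
    exact Finset.sum_congr rfl fun _ _ => Finset.sum_congr rfl fun _ _ => by ring
  simp_rw [e]
  rw [binAvg_sum, Finset.sum_mul]
  refine Finset.sum_congr rfl fun w _ => ?_
  rw [binAvg_sum, Finset.sum_eq_single w]
  · rw [binAvg_mul_left, ← sq]
    congr 1
    rw [← binAvg_apply _ w]
    simp only [sq]
  · intro w' _ hw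
    rw [binAvg_mul_left, binAvg_apply_mul _ _ hw.symm, h0]
    ring
  · simp

/-- The mass that a random binning gives to a bin concentrates when most of the mass is on
light points. -/
theorem binAvg_abs_bin_sub_le [Nonempty I] {u : W → ℝ} (hu : ∀ w, 0 ≤ u w) {g : I → ℝ}
    (hg : ∀ i, g i = 0 ∨ g i = 1) {G : W → Prop} [DecidablePred G] {t : ℝ} (ht : 0 ≤ t)
    (hG : ∀ w, G w → u w ≤ t) :
    binAvg (fun Φ => |∑ w, u w * g (Φ w) - (∑ w, u w) * avg g|) ≤
      2 * (∑ w, if G w then 0 else u w) * avg g + Real.sqrt (t * (∑ w, u w) * avg g) := by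
  have hg0 : ∀ i, 0 ≤ g i := fun i => by rcases hg i with h | h <;> simp [h]
  have ha0 : 0 ≤ avg g := Finset.sum_nonneg fun i _ => mul_nonneg (by positivity) (hg0 i)
  -- The light points are controlled by the second moment, the variance of a sum of small
  -- independent terms being small. For the heavy ones the triangle inequality suffices, which gives
  -- the factor 2.
  set ug : W → ℝ := fun w => if G w then u w else 0 with hug
  set ub : W → ℝ := fun w => if G w then 0 else u w with hub
  have hub0 : ∀ w, 0 ≤ ub w := fun w => by simp only [hub]; split_ifs <;> simp [hu w]
  have hug0 : ∀ w, 0 ≤ ug w := fun w => by simp only [hug]; split_ifs <;> simp [hu w]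
  have hsplit : ∀ w, u w = ug w + ub w := fun w => by simp only [hug, hub]; split_ifs <;> simp
  have hpt : ∀ Φ : W → I, |∑ w, u w * g (Φ w) - (∑ w, u w) * avg g| ≤
      |∑ w, ug w * (g (Φ w) - avg g)| + (∑ w, ub w * g (Φ w) + (∑ w, ub w) * avg g) := by
    intro Φ
    have e : ∑ w, u w * g (Φ w) - (∑ w, u w) * avg g =
        ∑ w, ug w * (g (Φ w) - avg g) + (∑ w, ub w * g (Φ w) - (∑ w, ub w) * avg g) := by
      simp only [hsplit, add_mul, Finset.sum_add_distrib, mul_sub, Finset.sum_sub_distrib,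
        Finset.sum_mul]
      ring
    rw [e]
    refine (abs_add_le _ _).trans (add_le_add le_rfl ?_)
    have h1 : 0 ≤ ∑ w, ub w * g (Φ w) := Finset.sum_nonneg fun w _ => mul_nonneg (hub0 w) (hg0 _)
    have h2 : 0 ≤ (∑ w, ub w) * avg g := mul_nonneg (Finset.sum_nonneg fun w _ => hub0 w) ha0
    rw [abs_le]; constructor <;> linarith
  refine (binAvg_mono hpt).trans ?_
  have hlin : binAvg (fun Φ : W → I => ∑ w, ub w * g (Φ w)) = (∑ w, ub w) * avg g := by
    rw [binAvg_sum, Finset.sum_mul]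
    exact Finset.sum_congr rfl fun w _ => by rw [binAvg_mul_left, binAvg_apply]
  rw [binAvg_add, binAvg_add, binAvg_const, hlin]
  have h0 : avg (fun i => g i - avg g) = 0 := by
    have h1 := avg_one (I := I)
    simp only [avg, mul_one] at h1
    simp only [avg, mul_sub, Finset.sum_sub_distrib, ← Finset.sum_mul, h1, one_mul, sub_self]
  have hsq : avg (fun i => (g i - avg g) ^ 2) ≤ avg g := by
    have h1 := avg_one (I := I)
    simp only [avg, mul_one] at h1
    have e : avg (fun i => (g i - avg g) ^ 2) = avg g - avg g ^ 2 := by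
      have : ∀ i, (g i - avg g) ^ 2 = g i - 2 * avg g * g i + avg g ^ 2 := fun i => by
        rcases hg i with h | h <;> rw [h] <;> ring
      have e2 : avg (fun i => (g i - avg g) ^ 2) =
          avg g - 2 * avg g * avg g + avg g ^ 2 := by
        conv_lhs => rw [avg]
        simp_rw [this, mul_add, mul_sub, Finset.sum_add_distrib, Finset.sum_sub_distrib,
          ← Finset.sum_mul, h1, one_mul]
        congr 2
        exact avg_mul_left _ g
      rw [e2]; ring
    rw [e]
    nlinarith [sq_nonneg (avg g)]
  have hmain : binAvg (fun Φ : W → I => |∑ w, ug w * (g (Φ w) - avg g)|) ≤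
      Real.sqrt (t * (∑ w, u w) * avg g) := by
    refine (binAvg_abs_le_sqrt _).trans (Real.sqrt_le_sqrt ?_)
    rw [binAvg_sum_sq ug h0]
    refine mul_le_mul ?_ hsq (Finset.sum_nonneg fun i _ => by positivity)
      (mul_nonneg ht (Finset.sum_nonneg fun w _ => hu w))
    rw [Finset.mul_sum]
    refine Finset.sum_le_sum fun w _ => ?_
    simp only [hug]
    split_ifs with h
    · nlinarith [hG w h, hu w]
    · simpa using mul_nonneg ht (hu w)
  linarith

end
end Info

/-! ### Decoding in a random bin, and equivocation of almost uniform keys -/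

namespace Info

section
set_option linter.unusedSectionVars false
variable {Ω W I O α β : Type*} [Fintype Ω] [Fintype W] [Fintype I] [Fintype O] [Fintype α]
  [Fintype β]

open Classical in
/-- A point on the list `S` that is in the code `{w | C (Φ w)}`. -/
def decode [Nonempty W] (C : I → Prop) (S : Finset W) (Φ : W → I) : W :=
  if h : ∃ w ∈ S, C (Φ w) then h.choose else Classical.arbitrary W

theorem decode_eq [Nonempty W] {C : I → Prop} {S : Finset W} {Φ : W → I} {w : W} (hw : w ∈ S)
    (hC : C (Φ w)) (h : ∀ w' ∈ S, C (Φ w') → w' = w) : decode C S Φ = w := by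
  have hex : ∃ w ∈ S, C (Φ w) := ⟨w, hw, hC⟩
  rw [decode, dif_pos hex]
  exact h _ hex.choose_spec.1 hex.choose_spec.2

/-- The weight is the law conditioned on `F` lying in the random code, but normalized by the average
probability `π` of the code. Decoding fails only if `F` is off its list or another point of the list
lies in the code; pairwise independence bounds the latter by `ℓ * π`. -/
theorem binAvg_decode_le [DecidableEq W] [Nonempty W] [Nonempty I] {μ : Ω → ℝ}
    (hμ : IsLaw μ)
    (F : Ω → W) (S : Ω → Finset W) {ℓ : ℝ} (hS : ∀ ω, ((S ω).card : ℝ) ≤ ℓ) (C : I → Prop)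
    [DecidablePred C] {π : ℝ} (hπ : avg (fun i => if C i then (1 : ℝ) else 0) = π) (hπ0 : 0 < π) :
    binAvg (fun Φ : W → I => prob (fun ω => μ ω * (π⁻¹ * if C (Φ (F ω)) then 1 else 0))
      (fun ω => decode C (S ω) Φ ≠ F ω)) ≤ prob μ (fun ω => F ω ∉ S ω) + ℓ * π := by
  classical
  set g : I → ℝ := fun i => if C i then (1 : ℝ) else 0 with hg
  have hg0 : ∀ i, 0 ≤ g i := fun i => by simp only [hg]; split_ifs <;> simp
  have hpt : ∀ Φ : W → I, prob (fun ω => μ ω * (π⁻¹ * if C (Φ (F ω)) then 1 else 0))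
      (fun ω => decode C (S ω) Φ ≠ F ω) ≤
      ∑ ω, μ ω * π⁻¹ * ((if F ω ∉ S ω then 1 else 0) * g (Φ (F ω)) +
        ∑ w ∈ (S ω).erase (F ω), g (Φ (F ω)) * g (Φ w)) := by
    intro Φ
    rw [prob_eq_sum_ite]
    refine Finset.sum_le_sum fun ω _ => ?_
    have hn : 0 ≤ ∑ w ∈ (S ω).erase (F ω), g (Φ (F ω)) * g (Φ w) :=
      Finset.sum_nonneg fun w _ => mul_nonneg (hg0 _) (hg0 _)
    have hc : 0 ≤ μ ω * π⁻¹ := mul_nonneg (hμ.nonneg ω) (inv_pos.2 hπ0).le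
    have hn2 : 0 ≤ (if F ω ∉ S ω then 1 else 0) * g (Φ (F ω)) :=
      mul_nonneg (by split_ifs <;> simp) (hg0 _)
    have hrhs := mul_nonneg hc (add_nonneg hn2 hn)
    by_cases hne : decode C (S ω) Φ ≠ F ω
    · rw [if_pos hne, ← mul_assoc]
      by_cases hC : C (Φ (F ω))
      · refine mul_le_mul_of_nonneg_left ?_ hc
        have hg1 : g (Φ (F ω)) = 1 := by simp [hg, hC]
        rw [if_pos hC]
        by_cases hin : F ω ∈ S ω
        · obtain ⟨w, hw, hCw⟩ : ∃ w ∈ (S ω).erase (F ω), C (Φ w) := by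
            by_contra! hcon
            refine hne (decode_eq hin hC fun w' hw' hC' => ?_)
            by_contra hne'
            exact hcon w' (Finset.mem_erase.2 ⟨hne', hw'⟩) hC'
          have h1 := Finset.single_le_sum (f := fun w => g (Φ (F ω)) * g (Φ w))
            (fun w _ => mul_nonneg (hg0 _) (hg0 _)) hw
          have h2 : g (Φ w) = 1 := by simp [hg, hCw]
          simp only [hg1, h2, mul_one] at h1
          rw [hg1]
          rw [hg1] at hn2
          simp only [one_mul] at h1 ⊢
          linarith
        · rw [if_pos hin, hg1, one_mul]
          rw [hg1] at hn
          linarith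
      · rw [if_neg hC, mul_zero]
        exact hrhs
    · rw [if_neg hne]
      exact hrhs
  refine (binAvg_mono hpt).trans ?_
  rw [binAvg_sum]
  have hω : ∀ ω, binAvg (fun Φ : W → I => μ ω * π⁻¹ * ((if F ω ∉ S ω then 1 else 0) * g (Φ (F ω)) +
        ∑ w ∈ (S ω).erase (F ω), g (Φ (F ω)) * g (Φ w))) ≤
      (if F ω ∉ S ω then μ ω else 0) + μ ω * (ℓ * π) := by
    intro ω
    rw [binAvg_mul_left, binAvg_add, binAvg_mul_left, binAvg_apply, binAvg_sum,
      Finset.sum_congr rfl fun w hw => binAvg_apply_mul g g (Finset.ne_of_mem_erase hw).symm, hπ,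
      Finset.sum_const, nsmul_eq_mul]
    have hcard : (((S ω).erase (F ω)).card : ℝ) ≤ ℓ :=
      le_trans (by exact_mod_cast Finset.card_le_card (Finset.erase_subset _ _)) (hS ω)
    have e : μ ω * π⁻¹ * ((if F ω ∉ S ω then 1 else 0) * π + ((S ω).erase (F ω)).card * (π * π)) =
        (if F ω ∉ S ω then μ ω else 0) + μ ω * (((S ω).erase (F ω)).card * π) := by
      split_ifs
      · field_simp; ring
      · field_simp
    rw [e]
    have := mul_le_mul_of_nonneg_left (mul_le_mul_of_nonneg_right hcard hπ0.le) (hμ.nonneg ω)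
    linarith
  refine (Finset.sum_le_sum fun ω _ => hω ω).trans ?_
  rw [Finset.sum_add_distrib, prob_eq_sum_ite, ← Finset.sum_mul]
  rw [hμ.sum_eq, one_mul]

/-- A key that is almost uniform and almost independent of `O` has a large equivocation. -/
theorem condEntropy_ge_of_close {μ : Ω → ℝ} (hμ : IsLaw μ) {L : ℕ} (K : Ω → Fin L) (F : Ω → O)
    {m : O → ℝ} {η : ℝ} (hL : 2 ≤ L)
    (h : ∑ k, ∑ o, |push μ (fun ω => (K ω, F ω)) (k, o) - m o / L| ≤ η) :
    (1 - 4 * η) * (Real.log L - Real.log 2) / Real.log 2 ≤ condEntropy μ K F := by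
  classical
  have hL0 : (0 : ℝ) < L := by exact_mod_cast (by omega : 0 < L)
  set ν := push μ (fun ω => (K ω, F ω)) with hν
  set νo := push μ F with hνo
  have hν0 : ∀ x, 0 ≤ ν x := push_nonneg hμ.nonneg _
  have hνo0 : ∀ x, 0 ≤ νo x := push_nonneg hμ.nonneg _
  have hmarg : ∀ o, ∑ k, ν (k, o) = νo o := fun o => sum_push_pair_left μ K F o
  have hlaw : IsLaw ν := hμ.push _
  have hlog : 0 ≤ Real.log L - Real.log 2 :=
    sub_nonneg.2 (Real.log_le_log two_pos (by exact_mod_cast hL))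
  -- distance to the product of the uniform law with the marginal
  have h1 : ∑ k, ∑ o, |ν (k, o) - νo o / L| ≤ 2 * η := by
    have hm : ∑ o, |νo o - m o| ≤ η := by
      refine le_trans ?_ h
      rw [Finset.sum_comm]
      refine Finset.sum_le_sum fun o _ => ?_
      rw [← hmarg]
      have : ∑ k : Fin L, ν (k, o) - m o = ∑ k : Fin L, (ν (k, o) - m o / L) := by
        rw [Finset.sum_sub_distrib, Finset.sum_const, Finset.card_univ, Fintype.card_fin,
          nsmul_eq_mul, mul_div_cancel₀ _ hL0.ne']
      rw [this]
      exact Finset.abs_sum_le_sum_abs _ _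
    have h2 : ∀ (k : Fin L) (o : O), |ν (k, o) - νo o / L| ≤
        |ν (k, o) - m o / L| + |νo o - m o| / L := by
      intro k o
      have e : ν (k, o) - νo o / L = (ν (k, o) - m o / L) + (-(νo o - m o) / L) := by ring
      rw [e]
      refine (abs_add_le _ _).trans (le_of_eq ?_)
      rw [abs_div, abs_neg, abs_of_pos hL0]
    refine (Finset.sum_le_sum fun k _ => Finset.sum_le_sum fun o _ => h2 k o).trans ?_
    simp_rw [Finset.sum_add_distrib]
    rw [Finset.sum_const, Finset.card_univ, Fintype.card_fin, nsmul_eq_mul, ← Finset.sum_div,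
      mul_div_cancel₀ _ hL0.ne']
    linarith
  -- A bad point has at most twice the mass of its distance to the product law, so the bad points
  -- have mass at most 4 η. Elsewhere log (νo / ν) ≥ log L - log 2. On the bad points only
  -- nonnegativity is used, so the size of `O` does not matter.
  set bad : Fin L × O → Prop := fun x => 2 * (νo x.2 / L) < ν x with hbad
  have hbadle : ∑ x, (if bad x then ν x else 0) ≤ 4 * η := by
    have : ∀ x : Fin L × O, (if bad x then ν x else 0) ≤ 2 * |ν x - νo x.2 / L| := fun x => by
      split_ifs with hx
      · have := le_abs_self (ν x - νo x.2 / L)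
        simp only [hbad] at hx
        linarith
      · positivity
    refine (Finset.sum_le_sum fun x _ => this x).trans ?_
    rw [← Finset.mul_sum, Fintype.sum_prod_type]
    linarith
  have hH : condEntropy μ K F =
      (∑ x, ν x * (Real.log (νo x.2) - Real.log (ν x))) / Real.log 2 := by
    rw [condEntropy, entropy_eq_sum, entropy_eq_sum, ← sub_div]
    congr 1
    have e2 := sum_push_mul μ (fun ω => (K ω, F ω)) (fun x => Real.log (νo x.2) - Real.log (ν x))
    rw [← hν] at e2
    rw [e2]
    simp only [mul_sub, Finset.sum_sub_distrib]
    ring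
  rw [hH]
  refine div_le_div_of_nonneg_right ?_ log_two_pos.le
  have hpt : ∀ x, (ν x - if bad x then ν x else 0) * (Real.log L - Real.log 2) ≤
      ν x * (Real.log (νo x.2) - Real.log (ν x)) := by
    intro x
    rcases (hν0 x).eq_or_lt with h0 | h0
    · simp [← h0]
    have hle : ν x ≤ νo x.2 := by
      rw [← hmarg]
      exact Finset.single_le_sum (f := fun k => ν (k, x.2)) (fun k _ => hν0 _) (Finset.mem_univ x.1)
    split_ifs with hx
    · rw [sub_self, zero_mul]
      exact mul_nonneg h0.le (sub_nonneg.2 (Real.log_le_log h0 hle))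
    · rw [sub_zero]
      refine mul_le_mul_of_nonneg_left ?_ h0.le
      simp only [hbad, not_lt] at hx
      rw [← Real.log_div hL0.ne' two_ne_zero, ← Real.log_div (h0.trans_le hle).ne' h0.ne']
      refine Real.log_le_log (by positivity) ?_
      rw [le_div_iff₀ h0, div_mul_eq_mul_div, div_le_iff₀ two_pos]
      have := mul_le_mul_of_nonneg_left hx hL0.le
      have e : (L : ℝ) * (2 * (νo x.2 / L)) = νo x.2 * 2 := by field_simp
      linarith
  refine le_trans ?_ (Finset.sum_le_sum fun x _ => hpt x)
  rw [← Finset.sum_mul, Finset.sum_sub_distrib, hlaw.sum_eq]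
  exact mul_le_mul_of_nonneg_right (by linarith) hlog

theorem sum_abs_push_sub_le (μ ν : Ω → ℝ) (F : Ω → α) :
    ∑ a, |push μ F a - push ν F a| ≤ ∑ ω, |μ ω - ν ω| := by
  classical
  have e : ∀ a, push μ F a - push ν F a = ∑ ω, if F ω = a then μ ω - ν ω else 0 := fun a => by
    rw [push_apply, push_apply, ← Finset.sum_sub_distrib]
    exact Finset.sum_congr rfl fun ω _ => by split_ifs <;> simp
  simp_rw [e]
  refine (Finset.sum_le_sum fun a _ => Finset.abs_sum_le_sum_abs _ _).trans (le_of_eq ?_)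
  rw [Finset.sum_comm]
  refine Finset.sum_congr rfl fun ω _ => ?_
  rw [Finset.sum_eq_single (F ω)] <;> simp +contextual [eq_comm]

theorem sum_abs_push_sub_push_le {μ : Ω → ℝ} (hμ : ∀ ω, 0 ≤ μ ω) (F G : Ω → α) :
    ∑ a, |push μ F a - push μ G a| ≤ 2 * prob μ (fun ω => F ω ≠ G ω) := by
  classical
  have e : ∀ a, |push μ F a - push μ G a| ≤
      ∑ ω, if F ω ≠ G ω then (if F ω = a then μ ω else 0) + (if G ω = a then μ ω else 0) else 0 :=
    fun a => by
      rw [push_apply, push_apply, ← Finset.sum_sub_distrib]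
      refine (Finset.abs_sum_le_sum_abs _ _).trans (Finset.sum_le_sum fun ω _ => ?_)
      by_cases h : F ω = G ω
      · simp [h]
      · rw [if_pos h]
        refine (abs_sub _ _).trans (le_of_eq ?_)
        congr 1 <;> split_ifs <;> simp [hμ ω]
  refine (Finset.sum_le_sum fun a _ => e a).trans (le_of_eq ?_)
  rw [Finset.sum_comm, prob_eq_sum_ite, Finset.mul_sum]
  refine Finset.sum_congr rfl fun ω _ => ?_
  split_ifs
  · rw [Finset.sum_add_distrib]
    simp [two_mul]
  · simp

theorem prob_le_add_sum_abs {μ ν : Ω → ℝ} (E : Ω → Prop) :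
    prob μ E ≤ prob ν E + ∑ ω, |μ ω - ν ω| := by
  classical
  rw [prob_eq_sum_ite, prob_eq_sum_ite, ← Finset.sum_add_distrib]
  refine Finset.sum_le_sum fun ω _ => ?_
  split_ifs
  · linarith [le_abs_self (μ ω - ν ω)]
  · positivity

end
end Info

/-! ### Conditioning a kernel on a set -/

namespace Info

/-- The kernel `q` conditioned on a set with indicator function `g` (and `q` itself if the set has
mass zero). -/
def condKernel {Y W : Type*} [Fintype W] (q : Y → W → ℝ) (g : W → ℝ) (y : Y) (v : W) : ℝ :=
  if ∑ v, q y v * g v = 0 then q y v else q y v * g v / ∑ v, q y v * g v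

section
set_option linter.unusedSectionVars false
variable {X Y Z W A B C O κ Ω : Type*} [Fintype X] [Fintype Y] [Fintype Z] [Fintype W] [Fintype A]
  [Fintype B] [Fintype C] [Fintype O] [Fintype κ] [Fintype Ω]

theorem isKernel_condKernel {q : Y → W → ℝ} (hq : IsKernel q) {g : W → ℝ} (hg : ∀ v, 0 ≤ g v) :
    IsKernel (condKernel q g) := by
  intro y
  unfold condKernel
  by_cases h : ∑ v, q y v * g v = 0
  · simp only [if_pos h]; exact hq y
  · simp only [if_neg h]
    refine ⟨fun v => div_nonneg (mul_nonneg ((hq y).nonneg v) (hg v))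
      (Finset.sum_nonneg fun v _ => mul_nonneg ((hq y).nonneg v) (hg v)), ?_⟩
    rw [← Finset.sum_div, div_self h]

/-- Conditioning divides by the mass s of the set, and the approximation multiplies by `M`, the
inverse of the expected mass. The two functions are proportional, at distance |M s - 1|, which is
also the bound in the degenerate case s = 0. -/
theorem sum_abs_condKernel_sub_le {q : Y → W → ℝ} (hq : IsKernel q) {g : W → ℝ} (hg : ∀ v, 0 ≤ g v)
    (M : ℝ) (y : Y) :
    ∑ v, |condKernel q g y v - q y v * (M * g v)| ≤ |M * (∑ v, q y v * g v) - 1| := by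
  have hn : ∀ v, 0 ≤ q y v * g v := fun v => mul_nonneg ((hq y).nonneg v) (hg v)
  unfold condKernel
  by_cases h : ∑ v, q y v * g v = 0
  · have h0 := (Finset.sum_eq_zero_iff_of_nonneg fun v _ => hn v).1 h
    simp only [if_pos h]
    rw [h, mul_zero, zero_sub, abs_neg, abs_one, ← (hq y).sum_eq]
    refine le_of_eq (Finset.sum_congr rfl fun v hv => ?_)
    rw [mul_left_comm, h0 v hv, mul_zero, sub_zero, abs_of_nonneg ((hq y).nonneg v)]
  · simp only [if_neg h]
    set s := ∑ v, q y v * g v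
    have hs : 0 < s := lt_of_le_of_ne (Finset.sum_nonneg fun v _ => hn v) (Ne.symm h)
    have e : ∀ v, |q y v * g v / s - q y v * (M * g v)| = q y v * g v * (|M * s - 1| / s) := by
      intro v
      have : q y v * g v / s - q y v * (M * g v) = q y v * g v * (-(M * s - 1) / s) := by
        field_simp; ring
      rw [this, abs_mul, abs_of_nonneg (hn v), abs_div, abs_neg, abs_of_pos hs]
    simp_rw [e]
    rw [← Finset.sum_mul]
    exact le_of_eq (mul_div_cancel₀ _ hs.ne')

theorem sum_twoWayLaw_mul {p : X × Y × Z → ℝ} {q : Y → A → ℝ} {w : A → B × C → ℝ}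
    (hw : IsKernel w) (F : (X × Y × Z) × A → ℝ) :
    ∑ ω, twoWayLaw p q w ω * F ω.1 = ∑ s, p s * ∑ a, q s.2.1 a * F (s, a) := by
  rw [Fintype.sum_prod_type]
  have : ∀ x : (X × Y × Z) × A, ∑ t : B × C, twoWayLaw p q w (x, t) * F (x, t).1 =
      p x.1 * (q x.1.2.1 x.2 * F x) := fun x => by
    have e : ∀ t : B × C, twoWayLaw p q w (x, t) * F (x, t).1 =
        p x.1 * (q x.1.2.1 x.2 * F x) * w x.2 t := fun t => by
      simp only [twoWayLaw, comp]; ring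
    simp_rw [e]
    rw [← Finset.mul_sum, (hw x.2).sum_eq, mul_one]
  simp_rw [this]
  rw [Fintype.sum_prod_type]
  simp_rw [Finset.mul_sum]

theorem sum_abs_twoWayLaw_sub {p : X × Y × Z → ℝ} (hp : IsLaw p) {q q' : Y → A → ℝ}
    {w : A → B × C → ℝ} (hw : IsKernel w) :
    ∑ ω, |twoWayLaw p q w ω - twoWayLaw p q' w ω| =
      ∑ s, p s * ∑ a, |q s.2.1 a - q' s.2.1 a| := by
  have h := sum_twoWayLaw_mul (p := p) (q := fun y a => |q y a - q' y a|) hw (fun _ => 1)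
  simp only [mul_one] at h
  rw [← h]
  refine Finset.sum_congr rfl fun ω _ => ?_
  simp only [twoWayLaw, comp]
  rw [← sub_mul, ← mul_sub, abs_mul, abs_mul, abs_of_nonneg (hp.nonneg _),
    abs_of_nonneg ((hw _).nonneg _)]

theorem push_twoWayLaw {p : X × Y × Z → ℝ} {q : Y → W → ℝ} (f : W → A) (w : A → B × C → ℝ) :
    push (twoWayLaw p q (fun v => w (f v))) (fun ω => ((ω.1.1, f ω.1.2), ω.2)) =
      twoWayLaw p (fun y => push (q y) f) w := by
  classical
  funext ⟨⟨s, a⟩, t⟩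
  rw [push_apply, Fintype.sum_prod_type, Fintype.sum_prod_type, Finset.sum_eq_single s]
  · change _ = p s * push (q s.2.1) f a * w a t
    rw [push_apply, Finset.mul_sum, Finset.sum_mul]
    refine Finset.sum_congr rfl fun v _ => ?_
    rw [Finset.sum_eq_single t]
    · by_cases h : f v = a <;> simp [h, twoWayLaw, comp]
    · intro t' _ ht; simp [ht]
    · simp
  · intro s' _ hs; simp [hs]
  · simp

theorem push_mul_apply (μ : Ω → ℝ) (V : Ω → W) (F : Ω → O) (h : W → ℝ) (k : W → κ) [DecidableEq κ]
    (x : κ) (o : O) :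
    push (fun ω => μ ω * h (V ω)) (fun ω => (k (V ω), F ω)) (x, o) =
      ∑ v, push μ (fun ω => (V ω, F ω)) (v, o) * (h v * if k v = x then 1 else 0) := by
  classical
  have e := sum_push_mul μ (fun ω => (V ω, F ω))
    (fun y => h y.1 * (if k y.1 = x then 1 else 0) * if y.2 = o then 1 else 0)
  rw [Fintype.sum_prod_type] at e
  simp only [mul_ite, mul_one, mul_zero, Finset.sum_ite_eq', Finset.mem_univ, if_true] at e
  rw [push_apply]
  simp only [mul_ite, mul_one, mul_zero, e]
  refine Finset.sum_congr rfl fun ω _ => ?_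
  by_cases h1 : k (V ω) = x <;> by_cases h2 : F ω = o <;> simp [h1, h2]

end
end Info

/-! ### Average mass of a random bin, and secrecy of its index -/

namespace Info

section
set_option linter.unusedSectionVars false
variable {X Y Z W A B C I : Type*} [Fintype X] [Fintype Y] [Fintype Z] [Fintype W] [Fintype A]
  [Fintype B] [Fintype C] [Fintype I]

theorem avg_ite_eq [DecidableEq I] (i₀ : I) :
    avg (fun i => if i = i₀ then (1 : ℝ) else 0) = (Fintype.card I : ℝ)⁻¹ := by
  simp [avg]

theorem avg_ite_fst_eq {M L : ℕ} (hL : 0 < L) (i₀ : Fin M) :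
    avg (fun i : Fin M × Fin L => if i.1 = i₀ then (1 : ℝ) else 0) = (M : ℝ)⁻¹ := by
  have hL' : (L : ℝ) ≠ 0 := by positivity
  simp only [avg, Fintype.card_prod, Fintype.card_fin, Fintype.sum_prod_type]
  rw [Finset.sum_eq_single i₀ (fun i _ hi => by simp [hi]) (by simp)]
  simp only [if_true, mul_one, Finset.sum_const, Finset.card_univ, Fintype.card_fin, nsmul_eq_mul]
  push_cast
  rw [mul_inv, mul_left_comm, mul_inv_cancel₀ hL', mul_one]

/-- A random bin, made of the points `v` with `C (Φ v)`, has conditional mass close to its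
expectation. -/
theorem binAvg_condMass_le [DecidableEq W] [Nonempty I] {p : X × Y × Z → ℝ} (hp : IsLaw p)
    {q : Y → W → ℝ} (hq : IsKernel q) {w : W → B × C → ℝ} (hw : IsKernel w) (C' : I → Prop)
    [DecidablePred C'] {M : ℝ} (hM : 0 < M)
    (hπ : avg (fun i => if C' i then (1 : ℝ) else 0) = M⁻¹) {τ : ℝ} (hτ : 0 ≤ τ) :
    binAvg (fun Φ : W → I => ∑ s, p s * |M * (∑ v, q s.2.1 v * if C' (Φ v) then 1 else 0) - 1|) ≤
      2 * prob (twoWayLaw p q w) (fun ω => τ < q ω.1.1.2.1 ω.1.2) + Real.sqrt (τ * M) := by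
  classical
  -- For each y, the light points are those of conditional mass at most τ; averaging the heavy mass
  -- over the source gives the probability on the right.
  have hpt : ∀ s : X × Y × Z,
      binAvg (fun Φ : W → I => |M * (∑ v, q s.2.1 v * if C' (Φ v) then 1 else 0) - 1|) ≤
        2 * (∑ v, if τ < q s.2.1 v then q s.2.1 v else 0) + Real.sqrt (τ * M) := by
    intro s
    have h := binAvg_abs_bin_sub_le (I := I) (u := q s.2.1) (hq s.2.1).nonneg
      (g := fun i => if C' i then 1 else 0) (fun i => by split_ifs <;> simp)
      (G := fun v => q s.2.1 v ≤ τ) hτ (fun v hv => hv)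
    rw [hπ, (hq s.2.1).sum_eq] at h
    have e : ∀ Φ : W → I, |M * (∑ v, q s.2.1 v * if C' (Φ v) then 1 else 0) - 1| =
        M * |(∑ v, q s.2.1 v * if C' (Φ v) then 1 else 0) - 1 * M⁻¹| := fun Φ => by
      rw [← abs_of_pos hM, ← abs_mul, abs_of_pos hM]
      congr 1
      field_simp
    simp_rw [e]
    rw [binAvg_mul_left]
    refine (mul_le_mul_of_nonneg_left h hM.le).trans (le_of_eq ?_)
    have e1 : M * Real.sqrt (τ * 1 * M⁻¹) = Real.sqrt (τ * M) := by
      conv_lhs => rw [← Real.sqrt_sq hM.le, ← Real.sqrt_mul (by positivity)]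
      rw [Real.sqrt_sq hM.le]
      congr 1
      field_simp
    rw [mul_add, e1]
    congr 1
    have e2 : ∀ v, (if q s.2.1 v ≤ τ then 0 else q s.2.1 v) =
        if τ < q s.2.1 v then q s.2.1 v else 0 := fun v => by
      by_cases hv : q s.2.1 v ≤ τ
      · rw [if_pos hv, if_neg (not_lt.2 hv)]
      · rw [if_neg hv, if_pos (not_le.1 hv)]
    simp_rw [e2]
    field_simp
  rw [binAvg_sum]
  simp_rw [binAvg_mul_left]
  refine (Finset.sum_le_sum fun s _ => mul_le_mul_of_nonneg_left (hpt s) (hp.nonneg s)).trans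
    (le_of_eq ?_)
  simp_rw [mul_add, Finset.sum_add_distrib]
  rw [← Finset.sum_mul, hp.sum_eq, one_mul]
  congr 1
  rw [prob_eq_sum_ite]
  have h := sum_twoWayLaw_mul (p := p) (q := q) hw (fun x => if τ < q x.1.2.1 x.2 then 1 else 0)
  simp only [mul_ite, mul_one, mul_zero] at h
  rw [h, Finset.mul_sum]
  exact Finset.sum_congr rfl fun s _ => by ring

/-- The key that a random binning assigns is almost uniform and almost independent of what Eve
knows. -/
theorem binAvg_secrecy_le {Ω O : Type*} [Fintype Ω] [Fintype O] [DecidableEq W] {ν : Ω → ℝ}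
    (hν : IsLaw ν) (V : Ω → W) (F : Ω → O) {M L : ℕ} (hM : 0 < M) (hL : 0 < L) (i₀ : Fin M)
    {τ : ℝ} (hτ : 0 ≤ τ) :
    binAvg (fun Φ : W → Fin M × Fin L => ∑ k, ∑ o,
      |push (fun ω => ν ω * (M * if (Φ (V ω)).1 = i₀ then 1 else 0))
        (fun ω => ((Φ (V ω)).2, F ω)) (k, o) - push ν F o / L|) ≤
      2 * prob ν (fun ω => τ * push ν F (F ω) < push ν (fun ω => (V ω, F ω)) (V ω, F ω)) +
        Real.sqrt (τ * (M * L)) := by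
  classical
  have : Nonempty (Fin M × Fin L) := ⟨⟨⟨0, hM⟩, ⟨0, hL⟩⟩⟩
  have hM' : (0 : ℝ) < M := by exact_mod_cast hM
  have hL' : (0 : ℝ) < L := by exact_mod_cast hL
  set P := push ν F with hP
  set u : O → W → ℝ := fun o v => push ν (fun ω => (V ω, F ω)) (v, o) with hu
  have hu0 : ∀ o v, 0 ≤ u o v := fun o v => push_nonneg hν.nonneg _ _
  have hP0 : ∀ o, 0 ≤ P o := fun o => push_nonneg hν.nonneg _ _
  have hus : ∀ o, ∑ v, u o v = P o := fun o => sum_push_pair_left ν V F o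
  -- For fixed k and o the mass in question is that of the bin (i₀, k), on average a fraction 1 / (M
  -- L) of `P o`. A point is light if its conditional mass given o is at most τ.
  have hpt : ∀ (k : Fin L) (o : O), binAvg (fun Φ : W → Fin M × Fin L =>
      |push (fun ω => ν ω * (M * if (Φ (V ω)).1 = i₀ then 1 else 0))
        (fun ω => ((Φ (V ω)).2, F ω)) (k, o) - P o / L|) ≤
      (2 * (∑ v, if τ * P o < u o v then u o v else 0) + P o * Real.sqrt (τ * (M * L))) / L := by
    intro k o
    have h := binAvg_abs_bin_sub_le (I := Fin M × Fin L) (u := u o) (hu0 o)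
      (g := fun i => if i = (i₀, k) then 1 else 0) (fun i => by split_ifs <;> simp)
      (G := fun v => u o v ≤ τ * P o) (mul_nonneg hτ (hP0 o)) (fun v hv => hv)
    rw [avg_ite_eq, hus, Fintype.card_prod, Fintype.card_fin, Fintype.card_fin] at h
    push_cast at h
    have e : ∀ Φ : W → Fin M × Fin L,
        |push (fun ω => ν ω * (M * if (Φ (V ω)).1 = i₀ then 1 else 0))
          (fun ω => ((Φ (V ω)).2, F ω)) (k, o) - P o / L| =
        M * |∑ v, u o v * (if Φ v = (i₀, k) then 1 else 0) - P o * ((M : ℝ) * L)⁻¹| := fun Φ => by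
      have := push_mul_apply ν V F (fun v => (M : ℝ) * if (Φ v).1 = i₀ then 1 else 0)
        (fun v => (Φ v).2) k o
      rw [this]
      conv_rhs => rw [← abs_of_pos hM', ← abs_mul, abs_of_pos hM']
      congr 1
      rw [mul_sub, Finset.mul_sum]
      congr 1
      · refine Finset.sum_congr rfl fun v _ => ?_
        have : Φ v = (i₀, k) ↔ (Φ v).1 = i₀ ∧ (Φ v).2 = k := Prod.ext_iff
        by_cases h1 : (Φ v).1 = i₀ <;> by_cases h2 : (Φ v).2 = k <;>
          simp [this, h1, h2, u, mul_comm]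
      · field_simp
    simp_rw [e]
    rw [binAvg_mul_left]
    refine (mul_le_mul_of_nonneg_left h hM'.le).trans (le_of_eq ?_)
    have e1 : (M : ℝ) * Real.sqrt (τ * P o * P o * ((M : ℝ) * L)⁻¹) =
        P o * Real.sqrt (τ * (M * L)) / L := by
      have : τ * P o * P o * ((M : ℝ) * L)⁻¹ = (P o / (M * L)) ^ 2 * (τ * (M * L)) := by
        field_simp
      rw [this, Real.sqrt_mul (sq_nonneg _), Real.sqrt_sq (div_nonneg (hP0 o) (by positivity))]
      field_simp
    rw [mul_add, e1, add_div]
    congr 1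
    have e2 : ∀ v, (if u o v ≤ τ * P o then 0 else u o v) =
        if τ * P o < u o v then u o v else 0 := fun v => by
      by_cases hv : u o v ≤ τ * P o
      · rw [if_pos hv, if_neg (not_lt.2 hv)]
      · rw [if_neg hv, if_pos (not_le.1 hv)]
    simp_rw [e2]
    field_simp
  rw [binAvg_sum]
  simp_rw [binAvg_sum]
  refine (Finset.sum_le_sum fun k _ => Finset.sum_le_sum fun o _ => hpt k o).trans (le_of_eq ?_)
  rw [Finset.sum_const, Finset.card_univ, Fintype.card_fin, nsmul_eq_mul, ← Finset.sum_div,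
    mul_div_cancel₀ _ hL'.ne', Finset.sum_add_distrib, ← Finset.sum_mul, ← Finset.mul_sum,
    (hν.push F).sum_eq, one_mul]
  congr 2
  have := prob_push ν (fun ω => (V ω, F ω)) (fun x => τ * P x.2 < u x.2 x.1)
  rw [← this, prob_eq_sum_ite, Fintype.sum_prod_type, Finset.sum_comm]

end
end Info

/-! ### One-shot key agreement -/

namespace Info

section
set_option linter.unusedSectionVars false
variable {X Y Z W A B C : Type*} [Fintype X] [Fintype Y] [Fintype Z] [Fintype W] [Fintype A]
  [Fintype B] [Fintype C]

/-- One-shot key agreement by random binning: from `Y`, the sender draws `V` in a random bin and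
sends `f V`. Both parties recover `V` and take a second bin index of it as the key. -/
theorem exists_key_agreement [Nonempty W] {p : X × Y × Z → ℝ} (hp : IsLaw p) {q : Y → W → ℝ}
    (hq : IsKernel q) (f : W → A) {w : A → B × C → ℝ} (hw : IsKernel w) {M L : ℕ} (hM : 0 < M)
    (hL : 2 ≤ L) {τ₁ τ₃ ℓ₁ ℓ₂ ε η : ℝ} (hτ₁ : 0 ≤ τ₁) (hτ₃ : 0 ≤ τ₃) {ν : _ → ℝ}
    (hν : ν = twoWayLaw p q (fun v => w (f v)))
    (h1 : prob ν (fun ω => τ₁ < q ω.1.1.2.1 ω.1.2) ≤ ε)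
    (SA : X × B → Finset W) (hSA : ∀ o, ((SA o).card : ℝ) ≤ ℓ₁)
    (hSA' : prob ν (fun ω => ω.1.2 ∉ SA (ω.1.1.1, ω.2.1)) ≤ ε)
    (SB : Y × A → Finset W) (hSB : ∀ o, ((SB o).card : ℝ) ≤ ℓ₂)
    (hSB' : prob ν (fun ω => ω.1.2 ∉ SB (ω.1.1.2.1, f ω.1.2)) ≤ ε)
    (h3 : prob ν (fun ω => τ₃ * push ν (fun ω => (ω.1.1.2.2, ω.2.2)) (ω.1.1.2.2, ω.2.2) <
      push ν (fun ω => (ω.1.2, ω.1.1.2.2, ω.2.2)) (ω.1.2, ω.1.1.2.2, ω.2.2)) ≤ ε)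
    (hη : 6 * ε + Real.sqrt (τ₁ * M) + (ℓ₁ + ℓ₂) * (M : ℝ)⁻¹ + Real.sqrt (τ₃ * (M * L)) ≤ η) :
    ∃ q' : Y → A → ℝ, IsKernel q' ∧ ∃ (kA : X × B → Fin L) (kB : Y × A → Fin L),
      prob (twoWayLaw p q' w) (fun ω => kA (ω.1.1.1, ω.2.1) ≠ kB (ω.1.1.2.1, ω.1.2)) ≤ η ∧
      (1 - 8 * η) * (Real.log L - Real.log 2) / Real.log 2 ≤
        condEntropy (twoWayLaw p q' w) (fun ω => kB (ω.1.1.2.1, ω.1.2))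
          (fun ω => (ω.1.1.2.2, ω.2.2)) := by
  classical
  have hL0 : 0 < L := by omega
  have hM' : (0 : ℝ) < M := by exact_mod_cast hM
  have : Nonempty (Fin M × Fin L) := ⟨⟨⟨0, hM⟩, ⟨0, hL0⟩⟩⟩
  have hwf : IsKernel (fun v => w (f v)) := fun v => hw (f v)
  have hνl : IsLaw ν := hν ▸ isLaw_twoWayLaw hp hq hwf
  -- The first bin index is fixed in advance and V is conditioned on it, so no index has to be
  -- transmitted. M must be small enough for this given Y (`τ₁`) and large enough for decoding from
  -- the lists (`ℓ₁`, `ℓ₂`), while M L must be small enough to hide the second index from Eve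
  -- (`τ₃`).
  set i₀ : Fin M := ⟨0, hM⟩
  set C' : Fin M × Fin L → Prop := fun i => i.1 = i₀ with hC'
  have hπ : avg (fun i : Fin M × Fin L => if C' i then (1 : ℝ) else 0) = (M : ℝ)⁻¹ :=
    avg_ite_fst_eq hL0 i₀
  have b1 := binAvg_condMass_le hp hq hwf C' hM' hπ hτ₁
  rw [← hν] at b1
  have b2 := binAvg_decode_le hνl (fun ω => ω.1.2) (fun ω => SA (ω.1.1.1, ω.2.1))
    (fun ω => hSA _) C' hπ (inv_pos.2 hM')
  -- V is drawn with fresh randomness, but the key has to be a function of (Y, A); so the sender,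
  -- too, must recover V, from Y and f V.
  have b3 := binAvg_decode_le hνl (fun ω => ω.1.2) (fun ω => SB (ω.1.1.2.1, f ω.1.2))
    (fun ω => hSB _) C' hπ (inv_pos.2 hM')
  have b4 := binAvg_secrecy_le hνl (fun ω => ω.1.2) (fun ω => (ω.1.1.2.2, ω.2.2)) hM hL0 i₀ hτ₃
  rw [inv_inv] at b2 b3
  set ι : (W → Fin M × Fin L) → _ → ℝ := fun Φ ω =>
    ν ω * ((M : ℝ) * if (Φ ω.1.2).1 = i₀ then 1 else 0) with hι
  -- A single binning is good for the sum of the four errors, whose terms 2 ε, ε, ε and 2 ε make up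
  -- 6 ε.
  obtain ⟨Φ, hΦ⟩ := exists_le_binAvg (fun Φ : W → Fin M × Fin L =>
    ((∑ s, p s * |(M : ℝ) * (∑ v, q s.2.1 v * if C' (Φ v) then 1 else 0) - 1|) +
      prob (ι Φ) (fun ω => decode C' (SA (ω.1.1.1, ω.2.1)) Φ ≠ ω.1.2)) +
    (prob (ι Φ) (fun ω => decode C' (SB (ω.1.1.2.1, f ω.1.2)) Φ ≠ ω.1.2) +
      ∑ k, ∑ o, |push (ι Φ) (fun ω => ((Φ ω.1.2).2, ω.1.1.2.2, ω.2.2)) (k, o) -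
        push ν (fun ω => (ω.1.1.2.2, ω.2.2)) o / L|))
  rw [binAvg_add, binAvg_add, binAvg_add] at hΦ
  set d := ∑ s, p s * |(M : ℝ) * (∑ v, q s.2.1 v * if C' (Φ v) then 1 else 0) - 1| with hd
  set eA := prob (ι Φ) (fun ω => decode C' (SA (ω.1.1.1, ω.2.1)) Φ ≠ ω.1.2) with heA
  set eB := prob (ι Φ) (fun ω => decode C' (SB (ω.1.1.2.1, f ω.1.2)) Φ ≠ ω.1.2) with heB
  set sec := ∑ k, ∑ o, |push (ι Φ) (fun ω => ((Φ ω.1.2).2, ω.1.1.2.2, ω.2.2)) (k, o) -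
        push ν (fun ω => (ω.1.1.2.2, ω.2.2)) o / L| with hsec
  have htot : d + eA + (eB + sec) ≤ η := by linarith
  have hιn : ∀ ω, 0 ≤ ι Φ ω := fun ω => mul_nonneg (hνl.nonneg ω)
    (mul_nonneg hM'.le (by split_ifs <;> simp))
  have hd0 : 0 ≤ d := Finset.sum_nonneg fun s _ => mul_nonneg (hp.nonneg s) (abs_nonneg _)
  have heA0 : 0 ≤ eA := prob_nonneg hιn _
  have heB0 : 0 ≤ eB := prob_nonneg hιn _
  have hsec0 : 0 ≤ sec := Finset.sum_nonneg fun k _ => Finset.sum_nonneg fun o _ => abs_nonneg _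
  -- the law of the protocol, with `V` as an additional variable
  set g : W → ℝ := fun v => if C' (Φ v) then 1 else 0 with hg
  have hg0 : ∀ v, 0 ≤ g v := fun v => by simp only [hg]; split_ifs <;> simp
  set e := condKernel q g with he
  have hek : IsKernel e := isKernel_condKernel hq hg0
  set ρ := twoWayLaw p e (fun v => w (f v)) with hρ
  have hρl : IsLaw ρ := isLaw_twoWayLaw hp hek hwf
  have hιeq : ι Φ = twoWayLaw p (fun y v => q y v * (M * g v)) (fun v => w (f v)) := by
    funext ω
    simp only [hι, hν, twoWayLaw, comp, hg, hC']
    ring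
  have hdist : ∑ ω, |ρ ω - ι Φ ω| ≤ d := by
    rw [hιeq, hρ, sum_abs_twoWayLaw_sub hp hwf]
    exact Finset.sum_le_sum fun s _ => mul_le_mul_of_nonneg_left
      (sum_abs_condKernel_sub_le hq hg0 M s.2.1) (hp.nonneg s)
  have hreal := push_twoWayLaw (p := p) (q := e) f w
  rw [← hρ] at hreal
  set kA : X × B → Fin L := fun o => (Φ (decode C' (SA o) Φ)).2 with hkA
  set kB : Y × A → Fin L := fun o => (Φ (decode C' (SB o) Φ)).2 with hkB
  refine ⟨fun y => push (e y) f, fun y => (hek y).push f, kA, kB, ?_, ?_⟩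
  · rw [← hreal, prob_push]
    refine (prob_le_add_sum_abs (ν := ι Φ) _).trans ?_
    have : prob (ι Φ) (fun ω => kA (ω.1.1.1, ω.2.1) ≠ kB (ω.1.1.2.1, f ω.1.2)) ≤ eA + eB := by
      refine le_trans (prob_mono hιn fun ω hω => ?_) (prob_or_le hιn _ _)
      by_contra! hcon
      exact hω (by simp only [hkA, hkB]; rw [hcon.1, hcon.2])
    linarith
  -- The pair of key and Eve's view is within d + 2 eB + sec ≤ 2 η of the ideal one, and
  -- `condEntropy_ge_of_close` multiplies this by 4.
  · have hc := condEntropy_ge_of_close hρl (fun ω => kB (ω.1.1.2.1, f ω.1.2))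
      (fun ω => (ω.1.1.2.2, ω.2.2)) (m := push ν (fun ω => (ω.1.1.2.2, ω.2.2))) (η := 2 * η) hL ?_
    · rw [← hreal]
      refine le_trans (le_of_eq ?_) (hc.trans (le_of_eq ?_))
      · ring
      · exact condEntropy_congr_push (by rw [push_push])
    · have t1 := sum_abs_push_sub_le ρ (ι Φ)
        (fun ω => (kB (ω.1.1.2.1, f ω.1.2), ω.1.1.2.2, ω.2.2))
      have t2 := sum_abs_push_sub_push_le hιn
        (fun ω => (kB (ω.1.1.2.1, f ω.1.2), ω.1.1.2.2, ω.2.2))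
        (fun ω => ((Φ ω.1.2).2, ω.1.1.2.2, ω.2.2))
      have t3 : prob (ι Φ) (fun ω => (kB (ω.1.1.2.1, f ω.1.2), ω.1.1.2.2, ω.2.2) ≠
          ((Φ ω.1.2).2, ω.1.1.2.2, ω.2.2)) ≤ eB := prob_mono hιn fun ω hω hcon => hω (by
        simp only [hkB]; rw [hcon])
      rw [← Fintype.sum_prod_type'
        (f := fun k o => |push (ι Φ) (fun ω => ((Φ ω.1.2).2, ω.1.1.2.2, ω.2.2)) (k, o) -
          push ν (fun ω => (ω.1.1.2.2, ω.2.2)) o / L|)] at hsec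
      rw [← Fintype.sum_prod_type'
        (f := fun k o => |push ρ (fun ω => (kB (ω.1.1.2.1, f ω.1.2), ω.1.1.2.2, ω.2.2)) (k, o) -
          push ν (fun ω => (ω.1.1.2.2, ω.2.2)) o / L|)]
      have t4 : ∑ x : Fin L × Z × C,
          |push ρ (fun ω => (kB (ω.1.1.2.1, f ω.1.2), ω.1.1.2.2, ω.2.2)) (x.1, x.2) -
            push ν (fun ω => (ω.1.1.2.2, ω.2.2)) x.2 / L| ≤
          ∑ ω, |ρ ω - ι Φ ω| + 2 * eB + sec := by
        rw [hsec]
        refine le_trans ?_ (add_le_add (add_le_add t1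
          (t2.trans (mul_le_mul_of_nonneg_left t3 two_pos.le))) le_rfl)
        rw [← Finset.sum_add_distrib, ← Finset.sum_add_distrib]
        exact Finset.sum_le_sum fun x _ => (abs_sub_le _ _ _).trans
          (add_le_add (abs_sub_le _ _ _) le_rfl)
      linarith

end
end Info

/-! ### Input ensembles and random codes -/

namespace Info

/-- An input law `r` for the channel `w`, together with bounds, up to probability `ε`, on the mass
of the input, on the number of inputs to be considered given the output `B`, and on the conditional
mass of the input given the output `C`. -/
structure IsInputEnsemble {A B C : Type*} [Fintype A] [Fintype B] [Fintype C] (r : A → ℝ)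
    (w : A → B × C → ℝ) (β ℓ γ ε : ℝ) : Prop where
  isLaw : IsLaw r
  mass_le : prob (comp r w) (fun x => β < r x.1) ≤ ε
  exists_list : ∃ S : B → Finset A, (∀ b, ((S b).card : ℝ) ≤ ℓ) ∧
    prob (comp r w) (fun x => x.1 ∉ S x.2.1) ≤ ε
  cond_le : prob (comp r w) (fun x => γ * push (comp r w) (fun x => x.2.2) x.2.2 <
    push (comp r w) (fun x => (x.1, x.2.2)) (x.1, x.2.2)) ≤ ε

section
set_option linter.unusedSectionVars false
variable {V X Y Z A B C : Type*} [Fintype V] [Fintype X] [Fintype Y] [Fintype Z] [Fintype A]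
  [Fintype B] [Fintype C]

/-- With a trivial source, the estimates for `twoWayLaw` become estimates for a channel alone. -/
theorem prob_twoWayLaw_unit (r : A → ℝ) (w : A → B × C → ℝ) (E : A × B × C → Prop) :
    prob (twoWayLaw (fun _ : Unit × Unit × Unit => 1) (fun _ => r) w)
      (fun ω => E (ω.1.2, ω.2)) = prob (comp r w) E := by
  classical
  rw [prob_eq_sum_ite, prob_eq_sum_ite]
  simp [Fintype.sum_prod_type, twoWayLaw, comp]

theorem isLaw_unit : IsLaw (fun _ : Unit × Unit × Unit => (1 : ℝ)) := ⟨fun _ => zero_le_one, by simp⟩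

/-- Random coding: conditioning the input on a random bin makes it decodable from `B`. -/
theorem IsInputEnsemble.exists_code [Nonempty A] {r : A → ℝ} {w : A → B × C → ℝ}
    (hw : IsKernel w) {β ℓ γ ε t : ℝ} (h : IsInputEnsemble r w β ℓ γ ε) (hβ : 0 ≤ β) {M : ℕ}
    (hM : 0 < M) (ht : 4 * ε + Real.sqrt (β * M) + ℓ * (M : ℝ)⁻¹ ≤ t) (ht' : t ≤ 1 / 2) :
    ∃ r', IsInputEnsemble r' w (2 * M * β) 1 1 t := by
  classical
  have hM' : (0 : ℝ) < M := by exact_mod_cast hM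
  have : Nonempty (Fin M) := ⟨⟨0, hM⟩⟩
  obtain ⟨S, hS, hS'⟩ := h.exists_list
  set i₀ : Fin M := ⟨0, hM⟩
  set C' : Fin M → Prop := fun i => i = i₀ with hC'
  have hπ : avg (fun i : Fin M => if C' i then (1 : ℝ) else 0) = (M : ℝ)⁻¹ := by
    rw [avg_ite_eq, Fintype.card_fin]
  have hq : IsKernel (fun _ : Unit => r) := fun _ => h.isLaw
  set ν := twoWayLaw (fun _ : Unit × Unit × Unit => (1 : ℝ)) (fun _ => r) w with hν
  have hνl : IsLaw ν := isLaw_twoWayLaw isLaw_unit hq hw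
  have b1 := binAvg_condMass_le isLaw_unit hq hw C' hM' hπ hβ
  rw [← hν, prob_twoWayLaw_unit r w (fun x => β < r x.1)] at b1
  have b2 := binAvg_decode_le hνl (fun ω => ω.1.2) (fun ω => S ω.2.1) (fun ω => hS _) C' hπ
    (inv_pos.2 hM')
  rw [prob_twoWayLaw_unit r w (fun x => x.1 ∉ S x.2.1), inv_inv] at b2
  set ι : (A → Fin M) → _ → ℝ := fun Φ ω =>
    ν ω * ((M : ℝ) * if C' (Φ ω.1.2) then 1 else 0) with hι
  have b3 : binAvg (fun Φ : A → Fin M => prob (ι Φ) (fun ω => β < r ω.1.2)) =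
      prob (comp r w) (fun x => β < r x.1) := by
    rw [← prob_twoWayLaw_unit r w (fun x => β < r x.1), ← hν]
    simp_rw [prob_eq_sum_ite]
    rw [binAvg_sum]
    refine Finset.sum_congr rfl fun ω _ => ?_
    split_ifs
    · simp only [hι]
      rw [binAvg_mul_left, binAvg_mul_left,
        binAvg_apply (fun i => if C' i then (1 : ℝ) else 0) ω.1.2, hπ, mul_inv_cancel₀ hM'.ne',
        mul_one]
    · exact binAvg_const 0
  obtain ⟨Φ, hΦ⟩ := exists_le_binAvg (fun Φ : A → Fin M =>
    (∑ s : Unit × Unit × Unit, (1 : ℝ) * |(M : ℝ) * (∑ a, r a * if C' (Φ a) then 1 else 0) - 1|) +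
      (prob (ι Φ) (fun ω => decode C' (S ω.2.1) Φ ≠ ω.1.2) + prob (ι Φ) (fun ω => β < r ω.1.2)))
  rw [binAvg_add, binAvg_add, b3] at hΦ
  simp only [Finset.sum_const, Finset.card_univ, Fintype.card_prod, Fintype.card_unit, mul_one,
    one_smul, one_mul] at hΦ b1
  set g : A → ℝ := fun a => if C' (Φ a) then 1 else 0 with hg
  have hg0 : ∀ a, 0 ≤ g a := fun a => by simp only [hg]; split_ifs <;> simp
  have hg1 : ∀ a, g a ≤ 1 := fun a => by simp only [hg]; split_ifs <;> simp
  set P := ∑ a, r a * g a with hP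
  set eB := prob (ι Φ) (fun ω => decode C' (S ω.2.1) Φ ≠ ω.1.2)
  set eT := prob (ι Φ) (fun ω => β < r ω.1.2)
  have hιn : ∀ ω, 0 ≤ ι Φ ω := fun ω => mul_nonneg (hνl.nonneg ω)
    (mul_nonneg hM'.le (by split_ifs <;> simp))
  have heB0 : 0 ≤ eB := prob_nonneg hιn _
  have heT0 : 0 ≤ eT := prob_nonneg hιn _
  have hmass := h.mass_le
  have htot : |(M : ℝ) * P - 1| + (eB + eT) ≤ t := by linarith
  have hd : |(M : ℝ) * P - 1| ≤ 1 / 2 := by linarith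
  -- The chosen bin has at least half of its expected mass 1 / M, so conditioning on it multiplies
  -- masses by at most 2 M.
  have hMP : 1 / 2 ≤ M * P := by linarith [(abs_le.1 hd).1]
  have hP0 : 0 < P := by
    by_contra hcon
    nlinarith
  have hek : IsKernel (condKernel (fun _ : Unit => r) g) := isKernel_condKernel hq hg0
  set r' := condKernel (fun _ : Unit => r) g () with hr'
  have hr'l : IsLaw r' := hek ()
  have hr'le : ∀ a, r' a ≤ 2 * M * r a := fun a => by
    have e : r' a = r a * g a / P := if_neg hP0.ne'
    rw [e, div_le_iff₀ hP0]
    have h0 := h.isLaw.nonneg a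
    have h1 : r a * g a ≤ r a := mul_le_of_le_one_right h0 (hg1 a)
    nlinarith
  have hιeq : ι Φ = twoWayLaw (fun _ : Unit × Unit × Unit => 1)
      (fun _ : Unit => fun a => r a * (M * g a)) w := by
    funext ω
    simp only [hι, hν, twoWayLaw, comp, hg]
    ring
  have hdist : ∑ ω, |twoWayLaw (fun _ : Unit × Unit × Unit => 1) (fun _ : Unit => r') w ω -
      ι Φ ω| ≤ |(M : ℝ) * P - 1| := by
    rw [hιeq, sum_abs_twoWayLaw_sub isLaw_unit hw]
    simpa using sum_abs_condKernel_sub_le hq hg0 M ()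
  -- Since the code is decodable from B, the list is a single point. The value γ = 1 is the trivial
  -- bound: Eve may decode as well.
  refine ⟨r', hr'l, ?_, ⟨fun b => {decode C' (S b) Φ}, fun b => by simp, ?_⟩, ?_⟩
  · rw [← prob_twoWayLaw_unit]
    refine (prob_le_add_sum_abs (ν := ι Φ) _).trans ?_
    have : prob (ι Φ) (fun ω => 2 * M * β < r' ω.1.2) ≤ eT := prob_mono hιn fun ω hω => by
      have := hω.trans_le (hr'le ω.1.2)
      exact lt_of_mul_lt_mul_left this (by positivity)
    linarith
  · rw [← prob_twoWayLaw_unit]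
    refine (prob_le_add_sum_abs (ν := ι Φ) _).trans ?_
    have : prob (ι Φ) (fun ω => ω.1.2 ∉ ({decode C' (S ω.2.1) Φ} : Finset A)) ≤ eB :=
      prob_mono hιn fun ω hω hcon => hω (by simp [hcon])
    linarith
  · have : prob (comp r' w) (fun x => 1 * push (comp r' w) (fun x => x.2.2) x.2.2 <
        push (comp r' w) (fun x => (x.1, x.2.2)) (x.1, x.2.2)) ≤
        prob (comp r' w) (fun _ => False) :=
      prob_mono (isLaw_comp hr'l hw).nonneg fun x hx => by
        rw [one_mul] at hx
        exact absurd hx (not_lt.2 (push_le_push (isLaw_comp hr'l hw).nonneg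
          fun ω hω => (Prod.ext_iff.1 hω).2))
    refine this.trans ?_
    rw [prob_eq_sum_ite]
    simp only [if_false, Finset.sum_const_zero]
    linarith [abs_nonneg ((M : ℝ) * P - 1)]

end
end Info

/-! ### Source ensembles, handled separately from the channel -/

namespace Info

/-- Bounds, up to probability `ε`, on the conditional masses of the auxiliary variable `V` that is
generated from `Y` through `Q`: given `Y` (from above and below), given `X` (from below) and given
`Z` (from above). -/
structure IsSourceEnsemble {V X Y Z : Type*} [Fintype V] [Fintype X] [Fintype Y] [Fintype Z]
    (p : X × Y × Z → ℝ) (Q : Y → V → ℝ) (αy αy' αx αz ε : ℝ) : Prop where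
  mass_le : prob (auxLaw p Q) (fun x => αy < Q x.2.2.1 x.1) ≤ ε
  le_mass : prob (auxLaw p Q) (fun x => Q x.2.2.1 x.1 < αy') ≤ ε
  exists_le_cond : ∃ G : X → V → ℝ, IsKernel G ∧ prob (auxLaw p Q) (fun x => G x.2.1 x.1 < αx) ≤ ε
  cond_le : prob (auxLaw p Q) (fun x => αz * push (auxLaw p Q) (fun x => x.2.2.2) x.2.2.2 <
    push (auxLaw p Q) (fun x => (x.1, x.2.2.2)) (x.1, x.2.2.2)) ≤ ε

section
set_option linter.unusedSectionVars false
variable {V X Y Z A B C Ω α β γ δ : Type*} [Fintype V] [Fintype X] [Fintype Y] [Fintype Z]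
  [Fintype A] [Fintype B] [Fintype C] [Fintype Ω] [Fintype α] [Fintype β] [Fintype γ] [Fintype δ]

theorem push_pair_of_prod {ν : Ω → ℝ} {m : α → ℝ} {m' : β → ℝ} (e : Ω ≃ α × β)
    (h : ∀ ω, ν ω = m (e ω).1 * m' (e ω).2) (F : α → γ) (F' : β → δ) (c : γ) (d : δ) :
    push ν (fun ω => (F (e ω).1, F' (e ω).2)) (c, d) = push m F c * push m' F' d := by
  classical
  rw [push_apply, ← e.symm.sum_comp, Fintype.sum_prod_type, push_apply, push_apply,
    Finset.sum_mul_sum]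
  refine Finset.sum_congr rfl fun a _ => Finset.sum_congr rfl fun b _ => ?_
  rw [h, Equiv.apply_symm_apply]
  by_cases h1 : F a = c <;> by_cases h2 : F' b = d <;> simp [h1, h2]

theorem prob_fst_of_prod {ν : Ω → ℝ} {m : α → ℝ} {m' : β → ℝ} (e : Ω ≃ α × β) (hm' : IsLaw m')
    (h : ∀ ω, ν ω = m (e ω).1 * m' (e ω).2) (E : α → Prop) :
    prob ν (fun ω => E (e ω).1) = prob m E := by
  classical
  rw [prob_eq_sum_ite, ← e.symm.sum_comp, Fintype.sum_prod_type, prob_eq_sum_ite]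
  refine Finset.sum_congr rfl fun a _ => ?_
  simp only [h, Equiv.apply_symm_apply]
  split_ifs
  · rw [← Finset.mul_sum, hm'.sum_eq, mul_one]
  · simp

theorem prob_snd_of_prod {ν : Ω → ℝ} {m : α → ℝ} {m' : β → ℝ} (e : Ω ≃ α × β) (hm : IsLaw m)
    (h : ∀ ω, ν ω = m (e ω).1 * m' (e ω).2) (E : β → Prop) :
    prob ν (fun ω => E (e ω).2) = prob m' E :=
  prob_fst_of_prod (e.trans (Equiv.prodComm α β)) hm
    (fun ω => by rw [h, mul_comm]; rfl) E

/-- Markov's inequality for the size of a list of heavy points. -/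
theorem card_filter_le [DecidableEq V] {m : V → ℝ} (hm : IsLaw m) {α : ℝ} (hα : 0 < α)
    [DecidablePred fun v => α ≤ m v] :
    ((Finset.univ.filter fun v => α ≤ m v).card : ℝ) ≤ α⁻¹ := by
  rw [← one_div, le_div_iff₀ hα, ← hm.sum_eq, ← nsmul_eq_mul]
  refine (Finset.card_nsmul_le_sum _ m α fun v hv => (Finset.mem_filter.1 hv).2).trans ?_
  exact Finset.sum_le_sum_of_subset_of_nonneg (Finset.filter_subset _ _) fun v _ _ => hm.nonneg v

/-- Separating the source from the channel. -/
def regroup (V X Y Z A B C : Type*) :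
    ((X × Y × Z) × (V × A)) × (B × C) ≃ (V × X × Y × Z) × (A × B × C) where
  toFun ω := ((ω.1.2.1, ω.1.1), (ω.1.2.2, ω.2))
  invFun x := ((x.1.2, (x.1.1, x.2.1)), x.2.2)
  left_inv _ := rfl
  right_inv _ := rfl

/-- Key agreement when the source and the input of the channel are handled separately. -/
theorem exists_key_agreement_of_ensembles [Nonempty V] [Nonempty A] {p : X × Y × Z → ℝ}
    (hp : IsLaw p) {Q : Y → V → ℝ} (hQ : IsKernel Q) {r : A → ℝ} {w : A → B × C → ℝ}
    (hw : IsKernel w) {αy αy' αx αz β ℓ γ ε η : ℝ} (hs : IsSourceEnsemble p Q αy αy' αx αz ε)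
    (hr : IsInputEnsemble r w β ℓ γ ε) (hαy : 0 < αy) (hαy' : 0 < αy') (hαx : 0 < αx)
    (hαz : 0 < αz) (hβ : 0 < β) (hγ : 0 < γ) {M L : ℕ} (hM : 0 < M) (hL : 2 ≤ L)
    (hη : 12 * ε + Real.sqrt (αy * β * M) + (ℓ * αx⁻¹ + αy'⁻¹) * (M : ℝ)⁻¹ +
      Real.sqrt (αz * γ * (M * L)) ≤ η) :
    ∃ q' : Y → A → ℝ, IsKernel q' ∧ ∃ (kA : X × B → Fin L) (kB : Y × A → Fin L),
      prob (twoWayLaw p q' w) (fun ω => kA (ω.1.1.1, ω.2.1) ≠ kB (ω.1.1.2.1, ω.1.2)) ≤ η ∧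
      (1 - 8 * η) * (Real.log L - Real.log 2) / Real.log 2 ≤
        condEntropy (twoWayLaw p q' w) (fun ω => kB (ω.1.1.2.1, ω.1.2))
          (fun ω => (ω.1.1.2.2, ω.2.2)) := by
  classical
  have hrl := hr.isLaw
  obtain ⟨S, hS, hS'⟩ := hr.exists_list
  obtain ⟨G, hG, hG'⟩ := hs.exists_le_cond
  -- V and the channel input are independent given Y. Hence mass bounds multiply, and each error
  -- event is covered by a source event and a channel event, which turns 6 ε into 12 ε.
  set q : Y → V × A → ℝ := fun y v => Q y v.1 * r v.2 with hqdef
  have hq : IsKernel q := fun y => ⟨fun v => mul_nonneg ((hQ y).nonneg _) (hrl.nonneg _), by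
    rw [Fintype.sum_prod_type]
    simp only [hqdef, ← Finset.mul_sum, hrl.sum_eq, mul_one, (hQ y).sum_eq]⟩
  have haux := isLaw_auxLaw hp hQ
  have hcomp := isLaw_comp hrl hw
  set ν := twoWayLaw p q (fun v => w v.2) with hν
  have hνl : IsLaw ν := isLaw_twoWayLaw hp hq fun v => hw v.2
  have hprod : ∀ ω, ν ω = auxLaw p Q (regroup V X Y Z A B C ω).1 *
      comp r w (regroup V X Y Z A B C ω).2 := fun ω => by
    simp only [hν, twoWayLaw, comp, auxLaw, regroup, Equiv.coe_fn_mk, hqdef]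
    ring
  have pf := prob_fst_of_prod _ hcomp hprod
  have ps := prob_snd_of_prod _ haux hprod
  have hor : ∀ (E : _ → Prop) (E₁ : V × X × Y × Z → Prop) (E₂ : A × B × C → Prop),
      prob (auxLaw p Q) E₁ ≤ ε → prob (comp r w) E₂ ≤ ε →
      (∀ ω, E ω → E₁ (regroup V X Y Z A B C ω).1 ∨ E₂ (regroup V X Y Z A B C ω).2) →
      prob ν E ≤ 2 * ε := by
    intro E E₁ E₂ h1 h2 h
    refine (prob_mono hνl.nonneg h).trans ((prob_or_le hνl.nonneg _ _).trans ?_)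
    rw [pf E₁, ps E₂]
    linarith
  have hε : 0 ≤ ε := (prob_nonneg hcomp.nonneg _).trans hr.mass_le
  -- The lists for V consist of the points of large conditional mass given X or given Y. The sender
  -- knows its own channel input, so the other factor of its list is a singleton.
  refine exists_key_agreement (W := V × A) hp hq Prod.snd hw hM hL (τ₁ := αy * β) (τ₃ := αz * γ)
    (ℓ₁ := ℓ * αx⁻¹) (ℓ₂ := αy'⁻¹) (ε := 2 * ε) (mul_pos hαy hβ).le (mul_pos hαz hγ).le hν ?_
    (fun o => (Finset.univ.filter fun v => αx ≤ G o.1 v) ×ˢ S o.2) ?_ ?_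
    (fun o => (Finset.univ.filter fun v => αy' ≤ Q o.1 v) ×ˢ {o.2}) ?_ ?_ ?_ (by linarith)
  · refine hor _ _ _ hs.mass_le hr.mass_le fun ω hω => ?_
    by_contra! hcon
    exact absurd hω (not_lt.2 (mul_le_mul hcon.1 hcon.2 (hrl.nonneg _) hαy.le))
  · intro o
    rw [Finset.card_product, mul_comm]
    push_cast
    exact mul_le_mul (hS _) (card_filter_le (hG _) hαx) (Nat.cast_nonneg _)
      ((Nat.cast_nonneg _).trans (hS o.2))
  · refine hor _ _ _ hG' hS' fun ω hω => ?_
    by_contra! hcon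
    refine hω (Finset.mem_product.2 ⟨Finset.mem_filter.2 ⟨Finset.mem_univ _, hcon.1⟩, hcon.2⟩)
  · intro o
    rw [Finset.card_product, Finset.card_singleton, mul_one]
    exact card_filter_le (hQ _) hαy'
  · refine hor _ _ (fun _ => False) hs.le_mass ?_ fun ω hω => ?_
    · rw [prob_eq_sum_ite]; simpa using hε
    · left
      by_contra! hcon
      refine hω (Finset.mem_product.2 ⟨Finset.mem_filter.2 ⟨Finset.mem_univ _, hcon⟩, by simp⟩)
  · refine hor _ _ _ hs.cond_le hr.cond_le fun ω hω => ?_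
    have e1 := push_pair_of_prod _ hprod (fun x => x.2.2.2) (fun x => x.2.2) ω.1.1.2.2 ω.2.2
    have e2 := push_pair_of_prod _ hprod (fun x => (x.1, x.2.2.2)) (fun x => (x.1, x.2.2))
      (ω.1.2.1, ω.1.1.2.2) (ω.1.2.2, ω.2.2)
    have e3 : push ν (fun ω => (ω.1.2, ω.1.1.2.2, ω.2.2)) (ω.1.2, ω.1.1.2.2, ω.2.2) =
        push ν (fun ω => ((ω.1.2.1, ω.1.1.2.2), (ω.1.2.2, ω.2.2)))
          ((ω.1.2.1, ω.1.1.2.2), (ω.1.2.2, ω.2.2)) :=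
      prob_congr fun ω' => by
        simp only [Prod.ext_iff]; tauto
    rw [e3] at hω
    change αz * γ * push ν (fun ω => (ω.1.1.2.2, ω.2.2)) (ω.1.1.2.2, ω.2.2) <
      push ν (fun ω => ((ω.1.2.1, ω.1.1.2.2), (ω.1.2.2, ω.2.2)))
          ((ω.1.2.1, ω.1.1.2.2), (ω.1.2.2, ω.2.2)) at hω
    erw [e1, e2] at hω
    by_contra! hcon
    have := mul_le_mul hcon.1 hcon.2 (push_nonneg hcomp.nonneg _ _)
      (mul_nonneg hαz.le (push_nonneg haux.nonneg _ _))
    refine absurd hω (not_lt.2 (this.trans (le_of_eq ?_)))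
    change αz * push (auxLaw p Q) (fun x => x.2.2.2) ω.1.1.2.2 *
      (γ * push (comp r w) (fun x => x.2.2) ω.2.2) = _
    ring

end
end Info

/-! ### Chernoff's bound and conditional laws -/

namespace Info

section
set_option linter.unusedSectionVars false
variable {Ω α β γ : Type*} [Fintype Ω] [Fintype α] [Fintype β] [Fintype γ]

/-- Chernoff's bound for sums over `N` blocks of `n` independent variables. -/
theorem exists_chernoff {p : α → ℝ} (hp : IsLaw p) (g : α → ℝ) (n : ℕ) {η : ℝ} (hη : 0 < η) :
    ∃ κ : ℝ, 0 ≤ κ ∧ κ < 1 ∧ ∀ N : ℕ,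
      prob (fun f : Fin (N * n) → α => ∏ i, p (f i))
        (fun f => N * (n * (∑ a, p a * g a) + η) ≤ ∑ i, g (f i)) ≤ κ ^ N := by
  classical
  set μ := ∑ a, p a * g a with hμ
  -- φ is the moment generating function of the centred sum of one block, shifted by η. As φ 0 = 1
  -- and the derivative at 0 is -η < 0, some s > 0 has φ s < 1, and κ is this value.
  set φ : ℝ → ℝ := fun s => (∑ a, p a * Real.exp (s * (g a - μ))) ^ n * Real.exp (-(s * η)) with hφ
  have hφ0 : φ 0 = 1 := by simp [hφ, hp.sum_eq]
  have hd : HasDerivAt φ (-η) 0 := by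
    have h1 : HasDerivAt (fun s : ℝ => ∑ a, p a * Real.exp (s * (g a - μ)))
        (∑ a, p a * (Real.exp (0 * (g a - μ)) * (1 * (g a - μ)))) 0 :=
      HasDerivAt.fun_sum fun a _ =>
        (((hasDerivAt_id (0 : ℝ)).mul_const (g a - μ)).exp).const_mul (p a)
    have h2 : HasDerivAt (fun s : ℝ => Real.exp (-(s * η))) (Real.exp (-(0 * η)) * -(1 * η)) 0 :=
      (((hasDerivAt_id (0 : ℝ)).mul_const η).neg).exp
    have h3 := (h1.fun_pow n).fun_mul h2
    refine h3.congr_deriv ?_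
    have e0 : ∑ a, p a * (g a - μ) = 0 := by
      simp only [mul_sub, Finset.sum_sub_distrib, ← Finset.sum_mul, hp.sum_eq, one_mul, hμ, sub_self]
    simp [hp.sum_eq, e0]
  obtain ⟨s, hs0, hs1⟩ : ∃ s : ℝ, 0 < s ∧ φ s < 1 := by
    have h := hd.hasDerivWithinAt (s := Set.Ioi 0)
    rw [hasDerivWithinAt_iff_tendsto_slope] at h
    have h' := (h.eventually (gt_mem_nhds (neg_neg_of_pos hη : -η < 0)))
    have hmem : ∀ᶠ s in nhdsWithin (0 : ℝ) (Set.Ioi 0 \ {0}), 0 < s := by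
      filter_upwards [self_mem_nhdsWithin] with s hs using hs.1
    have hne : (nhdsWithin (0 : ℝ) (Set.Ioi 0 \ {0})).NeBot := by
      rw [Set.sdiff_singleton_eq_self (by simp)]; infer_instance
    obtain ⟨s, h1, h2⟩ := (h'.and hmem).exists
    refine ⟨s, h2, ?_⟩
    rw [slope_def_field, sub_zero, hφ0, div_lt_iff₀ h2, zero_mul] at h1
    linarith
  have hsum0 : 0 ≤ ∑ a, p a * Real.exp (s * (g a - μ)) :=
    Finset.sum_nonneg fun a _ => mul_nonneg (hp.nonneg a) (Real.exp_pos _).le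
  refine ⟨φ s, mul_nonneg (pow_nonneg hsum0 n) (Real.exp_pos _).le, hs1, fun N => ?_⟩
  rw [prob_eq_sum_ite]
  have hpt : ∀ f : Fin (N * n) → α, (if N * (n * μ + η) ≤ ∑ i, g (f i) then ∏ i, p (f i) else 0) ≤
      (∏ i, (p (f i) * Real.exp (s * (g (f i) - μ)))) * Real.exp (-(s * (N * η))) := by
    intro f
    have h0 : 0 ≤ ∏ i, p (f i) := Finset.prod_nonneg fun i _ => hp.nonneg _
    rw [Finset.prod_mul_distrib, ← Real.exp_sum, mul_assoc, ← Real.exp_add]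
    split_ifs with h
    · refine le_mul_of_one_le_right h0 (Real.one_le_exp ?_)
      rw [← Finset.mul_sum, Finset.sum_sub_distrib, Finset.sum_const, Finset.card_univ,
        Fintype.card_fin, nsmul_eq_mul]
      push_cast
      nlinarith [mul_le_mul_of_nonneg_left h hs0.le]
    · exact mul_nonneg h0 (Real.exp_pos _).le
  refine (Finset.sum_le_sum fun f _ => hpt f).trans (le_of_eq ?_)
  rw [← Finset.sum_mul,
    sum_prod_apply (fun (_ : Fin (N * n)) a => p a * Real.exp (s * (g a - μ)))]
  simp only [Finset.prod_const, Finset.card_univ, Fintype.card_fin, hφ]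
  rw [mul_pow, ← pow_mul, mul_comm n N, ← Real.exp_nat_mul]
  congr 2
  ring

theorem prob_le_of_imp_on_support {μ : Ω → ℝ} (hμ : ∀ ω, 0 ≤ μ ω) {E F : Ω → Prop}
    (h : ∀ ω, μ ω ≠ 0 → E ω → F ω) : prob μ E ≤ prob μ F := by
  classical
  rw [prob_eq_sum_ite, prob_eq_sum_ite]
  refine Finset.sum_le_sum fun ω _ => ?_
  by_cases h0 : μ ω = 0
  · simp [h0]
  · by_cases hE : E ω
    · rw [if_pos hE, if_pos (h ω h0 hE)]
    · rw [if_neg hE]; split_ifs <;> simp [hμ ω]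

theorem prob_equiv {ν : Ω → ℝ} {m : α → ℝ} (e : Ω ≃ α) (h : ∀ ω, ν ω = m (e ω)) (E : α → Prop) :
    prob ν (fun ω => E (e ω)) = prob m E := by
  classical
  rw [prob_eq_sum_ite, prob_eq_sum_ite, ← e.sum_comp]
  simp_rw [h]

theorem push_pi {ι : Type*} [Fintype ι] [DecidableEq ι] (p : α → ℝ) (F : α → β) (c : ι → β) :
    push (fun f : ι → α => ∏ i, p (f i)) (fun f i => F (f i)) c = ∏ i, push p F (c i) := by
  classical
  simp_rw [push_apply]
  rw [← sum_prod_apply fun i a => if F a = c i then p a else 0]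
  refine Finset.sum_congr rfl fun f _ => ?_
  rw [Finset.prod_ite_zero]
  simp only [funext_iff, Finset.mem_univ, true_imp_iff]

/-- The conditional law of `A` given `B`. -/
theorem exists_cond {μ : Ω → ℝ} (hμ : IsLaw μ) (A : Ω → α) (B : Ω → β) :
    ∃ G : β → α → ℝ, IsKernel G ∧
      ∀ a b, push μ (fun ω => (A ω, B ω)) (a, b) = push μ B b * G b a := by
  classical
  set P := push μ (fun ω => (A ω, B ω)) with hP
  have hP0 : ∀ x, 0 ≤ P x := push_nonneg hμ.nonneg _
  have hs : ∀ b, ∑ a, P (a, b) = push μ B b := sum_push_pair_left μ A B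
  refine ⟨fun b a => if push μ B b = 0 then push μ A a else P (a, b) / push μ B b, fun b => ?_,
    fun a b => ?_⟩
  · by_cases h : push μ B b = 0
    · simp only [if_pos h]; exact hμ.push A
    · simp only [if_neg h]
      refine ⟨fun a => div_nonneg (hP0 _) (push_nonneg hμ.nonneg _ _), ?_⟩
      rw [← Finset.sum_div, hs, div_self h]
  · by_cases h : push μ B b = 0
    · rw [h, zero_mul]
      exact (Finset.sum_eq_zero_iff_of_nonneg fun a _ => hP0 (a, b)).1 ((hs b).trans h) a
        (Finset.mem_univ a)
    · simp only [if_neg h]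
      rw [mul_div_cancel₀ _ h]

/-- Conditional entropies appear as expectations of logarithms of conditional masses, to which
Chernoff's bound applies. The factor log 2 converts bits into nats. -/
theorem sum_mul_log_cond {μ : Ω → ℝ} (hμ : IsLaw μ) {A : Ω → α} {B : Ω → β} {G : Ω → ℝ}
    (h : ∀ ω, push μ (fun ω => (A ω, B ω)) (A ω, B ω) = push μ B (B ω) * G ω) :
    ∑ ω, μ ω * Real.log (G ω) = -(condEntropy μ A B * Real.log 2) := by
  rw [condEntropy, entropy_eq_sum, entropy_eq_sum, ← sub_div, div_mul_cancel₀ _ log_two_pos.ne',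
    neg_sub_neg, neg_sub, ← Finset.sum_sub_distrib]
  refine Finset.sum_congr rfl fun ω _ => ?_
  rcases (hμ.nonneg ω).eq_or_lt with h0 | h0
  · simp [← h0]
  have h1 := h0.trans_le (le_push_self hμ.nonneg (fun ω => (A ω, B ω)) ω)
  have h2 := h0.trans_le (le_push_self hμ.nonneg B ω)
  have h3 : G ω ≠ 0 := fun h3 => by rw [h, h3, mul_zero] at h1; exact lt_irrefl _ h1
  rw [h, Real.log_mul h2.ne' h3]
  ring

end
end Info

/-! ### Long blocks as ensembles -/

namespace Info

/-- Regrouping quadruples of sequences. -/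
def quadEquiv (ι V X Y Z : Type*) : (ι → V) × (ι → X) × (ι → Y) × (ι → Z) ≃ (ι → V × X × Y × Z) where
  toFun s i := (s.1 i, s.2.1 i, s.2.2.1 i, s.2.2.2 i)
  invFun f := (fun i => (f i).1, fun i => (f i).2.1, fun i => (f i).2.2.1, fun i => (f i).2.2.2)
  left_inv _ := rfl
  right_inv _ := rfl

section
set_option linter.unusedSectionVars false
variable {Ω α β γ V X Y Z A B C : Type*} [Fintype Ω] [Fintype α] [Fintype β] [Fintype γ]
  [Fintype V] [Fintype X] [Fintype Y] [Fintype Z] [Fintype A] [Fintype B] [Fintype C]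

/-- Both deviations come from `exists_chernoff`, for log d and for -log d. Positivity of `d` on the
support of `p` is enough, as the other sequences have no mass. -/
theorem exists_typical {p : α → ℝ} (hp : IsLaw p) (d : α → ℝ) (hd : ∀ a, p a ≠ 0 → 0 < d a) (n : ℕ)
    {η : ℝ} (hη : 0 < η) {μ : ℝ} (hμ : ∑ a, p a * Real.log (d a) = μ) :
    ∃ κ : ℝ, 0 ≤ κ ∧ κ < 1 ∧ ∀ N : ℕ,
      prob (fun f : Fin (N * n) → α => ∏ i, p (f i))
        (fun f => Real.exp (N * (n * μ + η)) < ∏ i, d (f i)) ≤ κ ^ N ∧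
      prob (fun f : Fin (N * n) → α => ∏ i, p (f i))
        (fun f => ∏ i, d (f i) < Real.exp (N * (n * μ - η))) ≤ κ ^ N := by
  obtain ⟨κ₁, h10, h11, h1⟩ := exists_chernoff hp (fun a => Real.log (d a)) n hη
  obtain ⟨κ₂, h20, h21, h2⟩ := exists_chernoff hp (fun a => -Real.log (d a)) n hη
  have hn : ∀ N, ∀ f : Fin (N * n) → α, 0 ≤ ∏ i, p (f i) := fun N f =>
    Finset.prod_nonneg fun i _ => hp.nonneg _
  have hlog : ∀ N, ∀ f : Fin (N * n) → α, ∏ i, p (f i) ≠ 0 →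
      0 < ∏ i, d (f i) ∧ Real.log (∏ i, d (f i)) = ∑ i, Real.log (d (f i)) := fun N f hf => by
    have h0 : ∀ i, 0 < d (f i) := fun i => hd _ (Finset.prod_ne_zero_iff.1 hf i (Finset.mem_univ i))
    exact ⟨Finset.prod_pos fun i _ => h0 i, Real.log_prod fun i _ => (h0 i).ne'⟩
  refine ⟨max κ₁ κ₂, le_max_of_le_left h10, max_lt h11 h21, fun N => ⟨?_, ?_⟩⟩
  · refine (prob_le_of_imp_on_support (hn N) fun f hf hE => ?_).trans
      ((h1 N).trans (pow_le_pow_left₀ h10 (le_max_left _ _) N))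
    obtain ⟨hpos, hl⟩ := hlog N f hf
    rw [hμ, ← hl]
    exact ((Real.lt_log_iff_exp_lt hpos).2 hE).le
  · refine (prob_le_of_imp_on_support (hn N) fun f hf hE => ?_).trans
      ((h2 N).trans (pow_le_pow_left₀ h20 (le_max_right _ _) N))
    obtain ⟨hpos, hl⟩ := hlog N f hf
    simp only [mul_neg, Finset.sum_neg_distrib]
    rw [hμ, ← hl]
    have := ((Real.log_lt_iff_lt_exp hpos).2 hE).le
    linarith

theorem push_of_equiv {ν : Ω → ℝ} {m : α → ℝ} (e : Ω ≃ α) (h : ∀ ω, ν ω = m (e ω)) (F : α → γ) :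
    push ν (fun ω => F (e ω)) = push m F :=
  funext fun c => prob_equiv e h fun a => F a = c

theorem cond_pos {μ : Ω → ℝ} (hμ : IsLaw μ) {A : Ω → α} {B : Ω → β} {G : β → α → ℝ}
    (h : ∀ a b, push μ (fun ω => (A ω, B ω)) (a, b) = push μ B b * G b a) (ω : Ω) (hω : μ ω ≠ 0) :
    0 < G (B ω) (A ω) := by
  have h0 := lt_of_le_of_ne (hμ.nonneg ω) hω.symm
  have h1 := h0.trans_le (le_push_self hμ.nonneg (fun ω => (A ω, B ω)) ω)
  rw [h] at h1
  exact pos_of_mul_pos_right h1 (push_nonneg hμ.nonneg _ _)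

theorem push_auxLaw_pair (p : X × Y × Z → ℝ) (Q : Y → V → ℝ) [DecidableEq γ] (F : X × Y × Z → γ)
    (v : V) (c : γ) : push (auxLaw p Q) (fun x => (x.1, F x.2)) (v, c) =
      ∑ s, if F s = c then p s * Q s.2.1 v else 0 := by
  classical
  rw [push_apply, Fintype.sum_prod_type, Finset.sum_eq_single v]
  · refine Finset.sum_congr rfl fun s _ => ?_
    by_cases h : F s = c <;> simp [h, auxLaw]
  · intro v' _ hv; simp [hv]
  · simp

theorem push_auxLaw_comp_snd {p : X × Y × Z → ℝ} {Q : Y → V → ℝ} (hQ : IsKernel Q) [DecidableEq γ]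
    (F : X × Y × Z → γ) (c : γ) : push (auxLaw p Q) (fun x => F x.2) c =
      ∑ s, if F s = c then p s else 0 := by
  classical
  rw [push_apply, Fintype.sum_prod_type, Finset.sum_comm]
  refine Finset.sum_congr rfl fun s _ => ?_
  by_cases h : F s = c
  · simp only [h, if_true, auxLaw, ← Finset.mul_sum, (hQ _).sum_eq, mul_one]
  · simp [h]

theorem push_auxLaw_of_fst {p : X × Y × Z → ℝ} {Q : Y → V → ℝ} (hQ : IsKernel Q)
    (F : X × Y × Z → γ) (v : V) (c : γ) (y : Y) (hF : ∀ s, F s = c → s.2.1 = y) :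
    push (auxLaw p Q) (fun x => (x.1, F x.2)) (v, c) =
      push (auxLaw p Q) (fun x => F x.2) c * Q y v := by
  classical
  rw [push_auxLaw_pair, push_auxLaw_comp_snd hQ, Finset.sum_mul]
  refine Finset.sum_congr rfl fun s _ => ?_
  split_ifs with h
  · rw [hF s h]
  · rw [zero_mul]

/-- The chain V - Y - X gives H(V | Y, X) = H(V | Y). -/
theorem auxY_eq_sub {p : X × Y × Z → ℝ} (hp : IsLaw p) {Q : Y → V → ℝ} (hQ : IsKernel Q) :
    auxY p Q = condEntropy (auxLaw p Q) (fun x => x.1) (fun x => x.2.1) -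
      condEntropy (auxLaw p Q) (fun x => x.1) (fun x => x.2.2.1) := by
  have h1 := sum_mul_log_cond (isLaw_auxLaw hp hQ) (A := fun x => x.1) (B := fun x => x.2.2.1)
    (G := fun x => Q x.2.2.1 x.1) fun x =>
      push_auxLaw_of_fst hQ (fun s => s.2.1) x.1 x.2.2.1 _ fun _ h => h
  have h2 := sum_mul_log_cond (isLaw_auxLaw hp hQ) (A := fun x => x.1)
    (B := fun x => (x.2.2.1, x.2.1)) (G := fun x => Q x.2.2.1 x.1) fun x =>
      push_auxLaw_of_fst hQ (fun s => (s.2.1, s.1)) x.1 (x.2.2.1, x.2.1) _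
        fun _ h => (Prod.ext_iff.1 h).1
  rw [h1] at h2
  have := mul_right_cancel₀ log_two_pos.ne' (neg_injective h2)
  rw [auxY, condMutualInfo, this]

/-- The chain V - X - Z, a consequence of the independence of Y and Z given X, yields H(V | X, Z) =
H(V | X). -/
theorem auxX_eq_sub [Nonempty V] {p : X × Y × Z → ℝ} (hp : IsLaw p) (hi : IndepGiven p)
    {Q : Y → V → ℝ} (hQ : IsKernel Q) :
    auxX p Q = condEntropy (auxLaw p Q) (fun x => x.1) (fun x => x.2.2.2) -
      condEntropy (auxLaw p Q) (fun x => x.1) (fun x => x.2.1) := by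
  classical
  obtain ⟨m, k, hk, hmk⟩ := hi
  obtain ⟨G, hG, hG'⟩ := exists_cond (isLaw_auxLaw hp hQ) (fun x => x.1) (fun x => x.2.1)
  have h1 := sum_mul_log_cond (isLaw_auxLaw hp hQ) (A := fun x => x.1) (B := fun x => x.2.1)
    (G := fun x => G x.2.1 x.1) fun x => hG' _ _
  have e1 : ∀ v x, push (auxLaw p Q) (fun x => (x.1, x.2.1)) (v, x) = ∑ y, m (x, y) * Q y v := by
    intro v x
    refine (push_auxLaw_pair p Q (fun s => s.1) v x).trans ?_
    rw [Fintype.sum_prod_type, Finset.sum_eq_single x (fun x' _ h => by simp [h]) (by simp),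
      Fintype.sum_prod_type]
    refine Finset.sum_congr rfl fun y _ => ?_
    simp only [if_true, hmk]
    rw [← Finset.sum_mul, ← Finset.mul_sum, (hk x).sum_eq, mul_one]
  have e2 : ∀ x, push (auxLaw p Q) (fun x => x.2.1) x = ∑ y, m (x, y) := by
    intro x
    refine (push_auxLaw_comp_snd hQ (fun s => s.1) x).trans ?_
    rw [Fintype.sum_prod_type, Finset.sum_eq_single x (fun x' _ h => by simp [h]) (by simp),
      Fintype.sum_prod_type]
    refine Finset.sum_congr rfl fun y _ => ?_
    simp only [if_true, hmk]
    rw [← Finset.mul_sum, (hk x).sum_eq, mul_one]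
  have e3 : ∀ v x z, push (auxLaw p Q) (fun x => (x.1, x.2.1, x.2.2.2)) (v, x, z) =
      (∑ y, m (x, y) * Q y v) * k x z := by
    intro v x z
    refine (push_auxLaw_pair p Q (fun s => (s.1, s.2.2)) v (x, z)).trans ?_
    rw [Fintype.sum_prod_type, Finset.sum_eq_single x (fun x' _ h => by simp [h]) (by simp),
      Fintype.sum_prod_type, Finset.sum_mul]
    refine Finset.sum_congr rfl fun y _ => ?_
    rw [Finset.sum_eq_single z (fun z' _ h => by simp [h]) (by simp)]
    simp only [if_true, hmk]
    ring
  have e4 : ∀ x z, push (auxLaw p Q) (fun x => (x.2.1, x.2.2.2)) (x, z) =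
      (∑ y, m (x, y)) * k x z := by
    intro x z
    refine (push_auxLaw_comp_snd hQ (fun s => (s.1, s.2.2)) (x, z)).trans ?_
    rw [Fintype.sum_prod_type, Finset.sum_eq_single x (fun x' _ h => by simp [h]) (by simp),
      Fintype.sum_prod_type, Finset.sum_mul]
    refine Finset.sum_congr rfl fun y _ => ?_
    rw [Finset.sum_eq_single z (fun z' _ h => by simp [h]) (by simp)]
    simp only [if_true, hmk]
  have h2 := sum_mul_log_cond (isLaw_auxLaw hp hQ) (A := fun x => x.1)
    (B := fun x => (x.2.1, x.2.2.2)) (G := fun x => G x.2.1 x.1) fun x => by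
      rw [e3, e4, ← e1, hG', e2]; ring
  rw [h1] at h2
  have := mul_right_cancel₀ log_two_pos.ne' (neg_injective h2)
  rw [auxX, condMutualInfo, this]

/-- Long blocks of a source form a source ensemble whose exponents are conditional entropies. -/
theorem exists_isSourceEnsemble [Nonempty V] {p : X × Y × Z → ℝ} (hp : IsLaw p) {Q : Y → V → ℝ}
    (hQ : IsKernel Q) (n : ℕ) {η : ℝ} (hη : 0 < η) :
    ∃ κ : ℝ, 0 ≤ κ ∧ κ < 1 ∧ ∀ N : ℕ,
      IsSourceEnsemble (block (Fin (N * n)) p) (blockK (Fin (N * n)) Q)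
        (Real.exp (N * (n * -(condEntropy (auxLaw p Q) (fun x => x.1) (fun x => x.2.2.1) *
          Real.log 2) + η)))
        (Real.exp (N * (n * -(condEntropy (auxLaw p Q) (fun x => x.1) (fun x => x.2.2.1) *
          Real.log 2) - η)))
        (Real.exp (N * (n * -(condEntropy (auxLaw p Q) (fun x => x.1) (fun x => x.2.1) *
          Real.log 2) - η)))
        (Real.exp (N * (n * -(condEntropy (auxLaw p Q) (fun x => x.1) (fun x => x.2.2.2) *
          Real.log 2) + η)))
        (κ ^ N) := by
  classical
  set m := auxLaw p Q with hm
  have hml : IsLaw m := isLaw_auxLaw hp hQ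
  obtain ⟨G, hG, hG'⟩ := exists_cond hml (fun x => x.1) (fun x => x.2.1)
  obtain ⟨H, hH, hH'⟩ := exists_cond hml (fun x => x.1) (fun x => x.2.2.2)
  have hY : ∀ v y, push m (fun x => (x.1, x.2.2.1)) (v, y) = push m (fun x => x.2.2.1) y * Q y v :=
    fun v y => push_auxLaw_of_fst hQ (fun s => s.2.1) v y y fun _ h => h
  obtain ⟨κ₁, h10, h11, h1⟩ := exists_typical hml (fun x => Q x.2.2.1 x.1)
    (fun x hx => cond_pos hml hY x hx) n hη (sum_mul_log_cond hml fun x => hY _ _)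
  obtain ⟨κ₂, h20, h21, h2⟩ := exists_typical hml (fun x => G x.2.1 x.1)
    (fun x hx => cond_pos hml hG' x hx) n hη (sum_mul_log_cond hml fun x => hG' _ _)
  obtain ⟨κ₃, h30, h31, h3⟩ := exists_typical hml (fun x => H x.2.2.2 x.1)
    (fun x hx => cond_pos hml hH' x hx) n hη (sum_mul_log_cond hml fun x => hH' _ _)
  refine ⟨max κ₁ (max κ₂ κ₃), le_max_of_le_left h10, max_lt h11 (max_lt h21 h31), fun N => ?_⟩
  have i1 := pow_le_pow_left₀ h10 (le_max_left κ₁ (max κ₂ κ₃)) N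
  have i2 := pow_le_pow_left₀ h20 ((le_max_left κ₂ κ₃).trans (le_max_right κ₁ _)) N
  have i3 := pow_le_pow_left₀ h30 ((le_max_right κ₂ κ₃).trans (le_max_right κ₁ _)) N
  set e := quadEquiv (Fin (N * n)) V X Y Z with he
  have hblock : ∀ ω, auxLaw (block (Fin (N * n)) p) (blockK (Fin (N * n)) Q) ω =
      (fun f : Fin (N * n) → V × X × Y × Z => ∏ i, m (f i)) (e ω) := fun ω => by
    simp only [auxLaw, block, blockK, hm, ← Finset.prod_mul_distrib]
    rfl
  have hbl : ∀ ω, 0 ≤ auxLaw (block (Fin (N * n)) p) (blockK (Fin (N * n)) Q) ω := fun ω => by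
    rw [hblock]; exact Finset.prod_nonneg fun i _ => hml.nonneg _
  refine ⟨?_, ?_, ⟨blockK (Fin (N * n)) G, hG.blockK, ?_⟩, ?_⟩
  · exact (prob_equiv e hblock _).trans_le ((h1 N).1.trans i1)
  · exact (prob_equiv e hblock _).trans_le ((h1 N).2.trans i1)
  · exact (prob_equiv e hblock _).trans_le ((h2 N).2.trans i2)
  · refine le_trans (prob_mono hbl fun ω hω => ?_)
      ((prob_equiv e hblock _).trans_le ((h3 N).1.trans i3))
    have hz : push (auxLaw (block (Fin (N * n)) p) (blockK (Fin (N * n)) Q)) (fun x => x.2.2.2)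
        ω.2.2.2 = ∏ i, push m (fun x => x.2.2.2) (ω.2.2.2 i) :=
      (congrFun (push_of_equiv e hblock (fun f i => (f i).2.2.2)) _).trans
        (push_pi m (fun x => x.2.2.2) _)
    have hvz : push (auxLaw (block (Fin (N * n)) p) (blockK (Fin (N * n)) Q))
        (fun x => (x.1, x.2.2.2)) (ω.1, ω.2.2.2) =
        ∏ i, push m (fun x => (x.1, x.2.2.2)) (ω.1 i, ω.2.2.2 i) := by
      refine Eq.trans ?_ ((congrFun (push_of_equiv e hblock
        (fun f i => ((f i).1, (f i).2.2.2))) (fun i => (ω.1 i, ω.2.2.2 i))).trans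
          (push_pi m (fun x => (x.1, x.2.2.2)) _))
      refine prob_congr fun x => ?_
      simp only [Prod.mk.injEq, funext_iff]
      exact forall_and.symm
    rw [hz, hvz] at hω
    simp_rw [hH'] at hω
    rw [Finset.prod_mul_distrib, mul_comm] at hω
    exact lt_of_mul_lt_mul_left hω (Finset.prod_nonneg fun i _ => push_nonneg hml.nonneg _ _)

/-- Long blocks of independent inputs form an input ensemble. -/
theorem exists_isInputEnsemble [Nonempty A] {r : A → ℝ} (hr : IsLaw r) {w : A → B × C → ℝ}
    (hw : IsKernel w) (n : ℕ) {η : ℝ} (hη : 0 < η) :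
    ∃ κ : ℝ, 0 ≤ κ ∧ κ < 1 ∧ ∀ N : ℕ,
      IsInputEnsemble (fun a : Fin (N * n) → A => ∏ i, r (a i)) (blockW (Fin (N * n)) w)
        (Real.exp (N * (n * -(entropy (comp r w) (fun x => x.1) * Real.log 2) + η)))
        (Real.exp (N * (n * -(condEntropy (comp r w) (fun x => x.1) (fun x => x.2.1) *
          Real.log 2) - η)))⁻¹
        (Real.exp (N * (n * -(condEntropy (comp r w) (fun x => x.1) (fun x => x.2.2) *
          Real.log 2) + η)))
        (κ ^ N) := by
  classical
  set m := comp r w with hm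
  have hml : IsLaw m := isLaw_comp hr hw
  obtain ⟨G, hG, hG'⟩ := exists_cond hml (fun x => x.1) (fun x => x.2.1)
  obtain ⟨H, hH, hH'⟩ := exists_cond hml (fun x => x.1) (fun x => x.2.2)
  have hA : push m (fun x => x.1) = r := by
    rw [hm, push_comp_fst r hw (fun a => a), push_id]
  have hAlog : ∑ x, m x * Real.log (r x.1) = -(entropy m (fun x => x.1) * Real.log 2) := by
    rw [entropy_eq_sum, hA, div_mul_cancel₀ _ log_two_pos.ne', neg_neg]
  obtain ⟨κ₁, h10, h11, h1⟩ := exists_typical hml (fun x => r x.1)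
    (fun x hx => lt_of_le_of_ne (hr.nonneg _) fun h => hx (by rw [hm, comp, ← h, zero_mul])) n hη
    hAlog
  obtain ⟨κ₂, h20, h21, h2⟩ := exists_typical hml (fun x => G x.2.1 x.1)
    (fun x hx => cond_pos hml hG' x hx) n hη (sum_mul_log_cond hml fun x => hG' _ _)
  obtain ⟨κ₃, h30, h31, h3⟩ := exists_typical hml (fun x => H x.2.2 x.1)
    (fun x hx => cond_pos hml hH' x hx) n hη (sum_mul_log_cond hml fun x => hH' _ _)
  refine ⟨max κ₁ (max κ₂ κ₃), le_max_of_le_left h10, max_lt h11 (max_lt h21 h31), fun N => ?_⟩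
  have i1 := pow_le_pow_left₀ h10 (le_max_left κ₁ (max κ₂ κ₃)) N
  have i2 := pow_le_pow_left₀ h20 ((le_max_left κ₂ κ₃).trans (le_max_right κ₁ _)) N
  have i3 := pow_le_pow_left₀ h30 ((le_max_right κ₂ κ₃).trans (le_max_right κ₁ _)) N
  set e := tripleEquiv (Fin (N * n)) A B C with he
  set ν := comp (fun a : Fin (N * n) → A => ∏ i, r (a i)) (blockW (Fin (N * n)) w) with hν
  have hblock : ∀ ω, ν ω = (fun f : Fin (N * n) → A × B × C => ∏ i, m (f i)) (e ω) := fun ω => by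
    simp only [hν, comp, blockW, hm, ← Finset.prod_mul_distrib]
    rfl
  have hbl : ∀ ω, 0 ≤ ν ω := fun ω => by
    rw [hblock]; exact Finset.prod_nonneg fun i _ => hml.nonneg _
  refine ⟨isLaw_pi hr, ?_, ?_, ?_⟩
  · exact (prob_equiv e hblock _).trans_le ((h1 N).1.trans i1)
  · refine ⟨fun b => Finset.univ.filter fun a => Real.exp (N * (n * -(condEntropy m (fun x => x.1)
      (fun x => x.2.1) * Real.log 2) - η)) ≤ blockK (Fin (N * n)) G b a,
      fun b => card_filter_le (hG.blockK b) (Real.exp_pos _), ?_⟩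
    refine le_trans (prob_mono hbl fun ω hω => ?_)
      ((prob_equiv e hblock _).trans_le ((h2 N).2.trans i2))
    exact not_le.1 fun h => hω (Finset.mem_filter.2 ⟨Finset.mem_univ _, h⟩)
  · refine le_trans (prob_mono hbl fun ω hω => ?_)
      ((prob_equiv e hblock _).trans_le ((h3 N).1.trans i3))
    have hz : push ν (fun x => x.2.2) ω.2.2 = ∏ i, push m (fun x => x.2.2) (ω.2.2 i) :=
      (congrFun (push_of_equiv e hblock (fun f i => (f i).2.2)) _).trans
        (push_pi m (fun x => x.2.2) _)
    have hvz : push ν (fun x => (x.1, x.2.2)) (ω.1, ω.2.2) =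
        ∏ i, push m (fun x => (x.1, x.2.2)) (ω.1 i, ω.2.2 i) := by
      refine Eq.trans ?_ ((congrFun (push_of_equiv e hblock
        (fun f i => ((f i).1, (f i).2.2))) (fun i => (ω.1 i, ω.2.2 i))).trans
          (push_pi m (fun x => (x.1, x.2.2)) _))
      refine prob_congr fun x => ?_
      simp only [Prod.mk.injEq, funext_iff]
      exact forall_and.symm
    rw [hz, hvz] at hω
    simp_rw [hH'] at hω
    rw [Finset.prod_mul_distrib, mul_comm] at hω
    exact lt_of_mul_lt_mul_left hω (Finset.prod_nonneg fun i _ => push_nonneg hml.nonneg _ _)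

end
end Info

/-! ### Key agreement over long blocks, in terms of exponents -/

namespace Info

section
set_option linter.unusedSectionVars false
variable {V X Y Z A B C : Type*} [Fintype V] [Fintype X] [Fintype Y] [Fintype Z] [Fintype A]
  [Fintype B] [Fintype C]

open Filter

theorem eventually_exp_mul_le {c : ℝ} (hc : c < 0) {ε : ℝ} (hε : 0 < ε) :
    ∀ᶠ N : ℕ in atTop, Real.exp (N * c) ≤ ε := by
  have h : Tendsto (fun N : ℕ => Real.exp (N * c)) atTop (nhds 0) :=
    Real.tendsto_exp_atBot.comp (tendsto_natCast_atTop_atTop.atTop_mul_const_of_neg hc)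
  exact h.eventually (ge_mem_nhds hε)

theorem eventually_sqrt_exp_mul_le {c : ℝ} (hc : c < 0) {ε : ℝ} (hε : 0 < ε) :
    ∀ᶠ N : ℕ in atTop, Real.sqrt (2 * Real.exp (N * c)) ≤ ε := by
  filter_upwards [eventually_exp_mul_le hc (show 0 < ε ^ 2 / 2 by positivity)] with N hN
  exact Real.sqrt_le_iff.2 ⟨hε.le, by linarith⟩

theorem IsInputEnsemble.mono {r : A → ℝ} {w : A → B × C → ℝ} (hw : IsKernel w) {β β' ℓ γ ε ε' : ℝ}
    (h : IsInputEnsemble r w β ℓ γ ε) (hβ : β ≤ β') (hε : ε ≤ ε') :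
    IsInputEnsemble r w β' ℓ γ ε' := by
  obtain ⟨S, h1, h2⟩ := h.exists_list
  exact ⟨h.isLaw, (prob_mono (isLaw_comp h.isLaw hw).nonneg fun x hx => hβ.trans_lt hx).trans
    (h.mass_le.trans hε), ⟨S, h1, h2.trans hε⟩, h.cond_le.trans hε⟩

theorem IsSourceEnsemble.mono {p : X × Y × Z → ℝ} {Q : Y → V → ℝ} {αy αy' αx αz ε ε' : ℝ}
    (h : IsSourceEnsemble p Q αy αy' αx αz ε) (hε : ε ≤ ε') :
    IsSourceEnsemble p Q αy αy' αx αz ε' := by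
  obtain ⟨G, h1, h2⟩ := h.exists_le_cond
  exact ⟨h.mass_le.trans hε, h.le_mass.trans hε, ⟨G, h1, h2.trans hε⟩, h.cond_le.trans hε⟩

theorem natCeil_exp_le {x : ℝ} (hx : 0 ≤ x) : (⌈Real.exp x⌉₊ : ℝ) ≤ 2 * Real.exp x := by
  have := (Nat.ceil_lt_add_one (Real.exp_pos x).le).le
  linarith [Real.one_le_exp hx]

/-- `a` is the exponent of the number of bins and `b` that of the number of keys. The condition `h1`
makes it possible to condition on a bin given Y, `h2` and `h3` let the two parties decode, and `h4`
is secrecy. -/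
theorem eventually_exists_key [Nonempty V] [Nonempty A] {p : X × Y × Z → ℝ} (hp : IsLaw p)
    {Q : Y → V → ℝ} (hQ : IsKernel Q) {w : A → B × C → ℝ} (hw : IsKernel w) {n m : ℕ}
    {s₁ s₂ s₃ s₄ t₁ t₂ t₃ a b : ℝ}
    (hs : ∀ ε > 0, ∀ᶠ N : ℕ in atTop, IsSourceEnsemble (block (Fin (N * n)) p)
      (blockK (Fin (N * n)) Q) (Real.exp (N * s₁)) (Real.exp (N * s₂)) (Real.exp (N * s₃))
      (Real.exp (N * s₄)) ε)
    (ht : ∀ ε > 0, ∀ᶠ N : ℕ in atTop, ∃ r, IsInputEnsemble r (blockW (Fin (N * m)) w)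
      (Real.exp (N * t₁)) (Real.exp (N * t₂)) (Real.exp (N * t₃)) ε)
    (ha : 0 ≤ a) (hb : 0 < b) (h1 : s₁ + t₁ + a < 0) (h2 : t₂ - s₃ < a) (h3 : -s₂ < a)
    (h4 : s₄ + t₃ + (a + b) < 0) {ε : ℝ} (hε : 0 < ε) (hε1 : ε ≤ 1) :
    ∀ᶠ N : ℕ in atTop, ∃ (L : ℕ) (q : (Fin (N * n) → Y) → (Fin (N * m) → A) → ℝ), 2 ≤ L ∧
      IsKernel q ∧ ∃ (kA : (Fin (N * n) → X) × (Fin (N * m) → B) → Fin L)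
        (kB : (Fin (N * n) → Y) × (Fin (N * m) → A) → Fin L),
        prob (twoWayLaw (block (Fin (N * n)) p) q (blockW (Fin (N * m)) w))
          (fun ω => kA (ω.1.1.1, ω.2.1) ≠ kB (ω.1.1.2.1, ω.1.2)) ≤ ε ∧
        (1 - ε) * (Real.log L / Real.log 2) ≤
          condEntropy (twoWayLaw (block (Fin (N * n)) p) q (blockW (Fin (N * m)) w))
            (fun ω => kB (ω.1.1.2.1, ω.1.2)) (fun ω => (ω.1.1.2.2, ω.2.2)) ∧
        (1 - ε) * (N * b / Real.log 2) ≤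
          condEntropy (twoWayLaw (block (Fin (N * n)) p) q (blockW (Fin (N * m)) w))
            (fun ω => kB (ω.1.1.2.1, ω.1.2)) (fun ω => (ω.1.1.2.2, ω.2.2)) := by
  -- The one-shot error is 16 ε' and enters the equivocation with the factor 8, that is, as ε / 2.
  -- The other half of ε absorbs the losses of log 2 when N is large.
  set ε' := ε / 256 with hε'
  have hε'0 : 0 < ε' := by positivity
  have hNb : Tendsto (fun N : ℕ => (N : ℝ) * b) atTop atTop :=
    tendsto_natCast_atTop_atTop.atTop_mul_const hb
  filter_upwards [hs ε' hε'0, ht ε' hε'0, eventually_sqrt_exp_mul_le h1 hε'0,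
    eventually_exp_mul_le (show t₂ - s₃ - a < 0 by linarith) hε'0,
    eventually_exp_mul_le (show -s₂ - a < 0 by linarith) hε'0,
    eventually_sqrt_exp_mul_le h4 hε'0,
    hNb.eventually_ge_atTop (2 * Real.log 2 + 2 * Real.log 2 / (ε / 2))]
    with N hsN ⟨r, hr⟩ e1 e2 e3 e4 hN
  have hl2 := log_two_pos
  have hNb1 : 2 * Real.log 2 ≤ N * b := by
    have : 0 ≤ 2 * Real.log 2 / (ε / 2) := by positivity
    linarith
  have hNb2 : 2 * Real.log 2 ≤ ε / 2 * (N * b - 2 * Real.log 2) := by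
    have : 2 * Real.log 2 / (ε / 2) ≤ N * b - 2 * Real.log 2 := by linarith
    have := (div_le_iff₀ (by positivity)).1 this
    linarith
  set M := ⌈Real.exp (N * a)⌉₊ with hM
  set L := ⌊Real.exp (N * b)⌋₊ with hL
  have hM0 : 0 < M := Nat.ceil_pos.2 (Real.exp_pos _)
  have hM0' : (0 : ℝ) < M := by exact_mod_cast hM0
  have hM1 : Real.exp (N * a) ≤ M := Nat.le_ceil _
  have hM2 : (M : ℝ) ≤ 2 * Real.exp (N * a) := natCeil_exp_le (by positivity)
  have hfour : (4 : ℝ) ≤ Real.exp (N * b) := by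
    have : Real.exp (2 * Real.log 2) = 4 := by
      rw [two_mul, Real.exp_add, Real.exp_log two_pos]; norm_num
    rw [← this]
    exact Real.exp_le_exp.2 hNb1
  have hL2 : 2 ≤ L := Nat.le_floor (by push_cast; linarith)
  have hL1 : (L : ℝ) ≤ Real.exp (N * b) := Nat.floor_le (Real.exp_pos _).le
  have hL3 : Real.exp (N * b) / 2 ≤ L := by
    have := (Nat.lt_floor_add_one (Real.exp (N * b))).le
    linarith
  have hlogL : N * b - Real.log 2 ≤ Real.log L := by
    have := Real.log_le_log (by positivity) hL3
    rwa [Real.log_div (Real.exp_pos _).ne' two_ne_zero, Real.log_exp] at this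
  obtain ⟨q, hq, kA, kB, hk1, hk2⟩ := exists_key_agreement_of_ensembles
    (isLaw_block (ι := Fin (N * n)) hp) (hQ.blockK (ι := Fin (N * n)))
    (hw.blockW (ι := Fin (N * m))) hsN hr (Real.exp_pos _) (Real.exp_pos _) (Real.exp_pos _)
    (Real.exp_pos _) (Real.exp_pos _) (Real.exp_pos _) hM0 hL2 (η := 16 * ε') (by
      have f1 : Real.sqrt (Real.exp (N * s₁) * Real.exp (N * t₁) * M) ≤ ε' := by
        refine le_trans (Real.sqrt_le_sqrt ?_) e1
        refine (mul_le_mul_of_nonneg_left hM2 (by positivity)).trans (le_of_eq ?_)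
        rw [mul_add, mul_add, Real.exp_add, Real.exp_add]; ring
      have f4 : Real.sqrt (Real.exp (N * s₄) * Real.exp (N * t₃) * (M * L)) ≤ ε' := by
        refine le_trans (Real.sqrt_le_sqrt ?_) e4
        refine (mul_le_mul_of_nonneg_left (mul_le_mul hM2 hL1 (by positivity) (by positivity))
          (by positivity)).trans (le_of_eq ?_)
        rw [mul_add, mul_add, mul_add, Real.exp_add, Real.exp_add, Real.exp_add]; ring
      have f2 : (Real.exp (N * t₂) * (Real.exp (N * s₃))⁻¹ + (Real.exp (N * s₂))⁻¹) * (M : ℝ)⁻¹ ≤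
          2 * ε' := by
        rw [← Real.exp_neg, ← Real.exp_neg, ← Real.exp_add, ← div_eq_mul_inv, div_le_iff₀ hM0']
        have g1 : Real.exp (N * t₂ + -(N * s₃)) = Real.exp (N * (t₂ - s₃ - a)) * Real.exp (N * a) := by
          rw [← Real.exp_add]; congr 1; ring
        have g2 : Real.exp (-(N * s₂)) = Real.exp (N * (-s₂ - a)) * Real.exp (N * a) := by
          rw [← Real.exp_add]; congr 1; ring
        rw [g1, g2, ← add_mul]
        exact mul_le_mul (by linarith) hM1 (Real.exp_pos _).le (by positivity)
      linarith)
  have hmain : (1 - ε / 2) * (Real.log L - Real.log 2) / Real.log 2 ≤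
      (1 - 8 * (16 * ε')) * (Real.log L - Real.log 2) / Real.log 2 := by
    refine le_of_eq ?_
    rw [hε']; ring
  refine ⟨L, q, hL2, hq, kA, kB, hk1.trans (by rw [hε']; linarith),
    le_trans ?_ (hmain.trans hk2), le_trans ?_ (hmain.trans hk2)⟩
  · rw [← mul_div_assoc]
    refine div_le_div_of_nonneg_right ?_ hl2.le
    have : ε / 2 * (N * b - 2 * Real.log 2) ≤ ε / 2 * Real.log L :=
      mul_le_mul_of_nonneg_left (by linarith) (by positivity)
    nlinarith
  · rw [← mul_div_assoc]
    refine div_le_div_of_nonneg_right ?_ hl2.le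
    have : (1 - ε / 2) * (N * b - 2 * Real.log 2) ≤ (1 - ε / 2) * (Real.log L - Real.log 2) :=
      mul_le_mul_of_nonneg_left (by linarith) (by linarith)
    nlinarith

end
end Info

/-! ### Random codes for long blocks, and the choice of the exponents -/

namespace Info

section
set_option linter.unusedSectionVars false
variable {V X Y Z A B C : Type*} [Fintype V] [Fintype X] [Fintype Y] [Fintype Z] [Fintype A]
  [Fintype B] [Fintype C]

open Filter

theorem eventually_pow_le {κ : ℝ} (h0 : 0 ≤ κ) (h1 : κ < 1) {ε : ℝ} (hε : 0 < ε) :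
    ∀ᶠ N : ℕ in atTop, κ ^ N ≤ ε :=
  (tendsto_pow_atTop_nhds_zero_of_lt_one h0 h1).eventually (ge_mem_nhds hε)

theorem chanInfo_kfst_eq (r : A → ℝ) (w : A → B × C → ℝ) :
    chanInfo r (kfst w) = entropy (comp r w) (fun x => x.1) -
      condEntropy (comp r w) (fun x => x.1) (fun x => x.2.1) := by
  refine (mutualInfo_congr_push ?_).symm
  change push (comp r w) (fun x => (x.1, x.2.1)) = push (comp r (kfst w)) (fun x => x)
  rw [push_comp_kfst, push_id]

theorem chanInfo_ksnd_eq (r : A → ℝ) (w : A → B × C → ℝ) :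
    chanInfo r (ksnd w) = entropy (comp r w) (fun x => x.1) -
      condEntropy (comp r w) (fun x => x.1) (fun x => x.2.2) := by
  refine (mutualInfo_congr_push ?_).symm
  change push (comp r w) (fun x => (x.1, x.2.2)) = push (comp r (ksnd w)) (fun x => x)
  rw [push_comp_ksnd, push_id]

/-- Long random codes as input ensembles: the input is determined by `B`. -/
theorem eventually_exists_code [Nonempty A] {w : A → B × C → ℝ} (hw : IsKernel w) {m : ℕ}
    {t₁ t₂ t₃ η : ℝ} (hη : 0 < η) (ht2 : 0 ≤ t₂)
    (ht : ∀ ε > 0, ∀ᶠ N : ℕ in atTop, ∃ r, IsInputEnsemble r (blockW (Fin (N * m)) w)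
      (Real.exp (N * t₁)) (Real.exp (N * t₂)) (Real.exp (N * t₃)) ε)
    (h : t₁ + (t₂ + η) < 0) {ε : ℝ} (hε : 0 < ε) :
    ∀ᶠ N : ℕ in atTop, ∃ r, IsInputEnsemble r (blockW (Fin (N * m)) w)
      (Real.exp (N * (t₁ + t₂ + 2 * η))) (Real.exp (N * 0)) (Real.exp (N * 0)) ε := by
  -- The errors add up to 6 ε', which must be at most ε and, for `exists_code`, at most 1 / 2.
  set ε' := min (ε / 6) (1 / 12) with hε'
  have hε'0 : 0 < ε' := by positivity
  filter_upwards [ht ε' hε'0, eventually_sqrt_exp_mul_le h hε'0,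
    eventually_exp_mul_le (show -η < 0 by linarith) hε'0,
    eventually_exp_mul_le (show -η < 0 by linarith) (show (0 : ℝ) < 1 / 4 by norm_num)]
    with N ⟨r, hr⟩ e1 e2 e3
  -- The bins slightly outnumber the candidates on a list, by one η; a second η absorbs the factor 4
  -- in the bound on the masses.
  set M := ⌈Real.exp (N * (t₂ + η))⌉₊ with hM
  have hM0 : 0 < M := Nat.ceil_pos.2 (Real.exp_pos _)
  have hM0' : (0 : ℝ) < M := by exact_mod_cast hM0
  have hM1 : Real.exp (N * (t₂ + η)) ≤ M := Nat.le_ceil _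
  have hM2 : (M : ℝ) ≤ 2 * Real.exp (N * (t₂ + η)) := natCeil_exp_le (by positivity)
  obtain ⟨r', hr'⟩ := hr.exists_code (hw.blockW (ι := Fin (N * m))) (Real.exp_pos _).le hM0
    (t := 6 * ε') (by
      have f1 : Real.sqrt (Real.exp (N * t₁) * M) ≤ ε' := by
        refine le_trans (Real.sqrt_le_sqrt ?_) e1
        refine (mul_le_mul_of_nonneg_left hM2 (by positivity)).trans (le_of_eq ?_)
        rw [mul_add _ t₁, Real.exp_add (N * t₁)]; ring
      have f2 : Real.exp (N * t₂) * (M : ℝ)⁻¹ ≤ ε' := by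
        rw [← div_eq_mul_inv, div_le_iff₀ hM0']
        have g : Real.exp (N * t₂) = Real.exp (N * -η) * Real.exp (N * (t₂ + η)) := by
          rw [← Real.exp_add]; congr 1; ring
        rw [g]
        exact mul_le_mul e2 hM1 (Real.exp_pos _).le hε'0.le
      linarith) (by linarith [min_le_right (ε / 6) (1 / 12)])
  refine ⟨r', ?_⟩
  rw [mul_zero, Real.exp_zero]
  refine hr'.mono (hw.blockW (ι := Fin (N * m))) ?_ (by linarith [min_le_left (ε / 6) (1 / 12)])
  have g : Real.exp (N * (t₂ + η)) * Real.exp (N * t₁) =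
      Real.exp (N * (t₁ + t₂ + 2 * η)) * Real.exp (N * -η) := by
    rw [← Real.exp_add, ← Real.exp_add]; congr 1; ring
  have h1 : 2 * (M : ℝ) * Real.exp (N * t₁) ≤
      4 * (Real.exp (N * (t₂ + η)) * Real.exp (N * t₁)) := by
    nlinarith [Real.exp_pos (N * t₁)]
  rw [g] at h1
  nlinarith [Real.exp_pos (N * (t₁ + t₂ + 2 * η))]

/-- Every rate below `n I(V; X | Z) + m [I(A; B) - I(A; C)]_+` can be achieved by `n N` uses of the
source and `m N` uses of the channel when `n I(V; Y | X) < m I(A; B)`. -/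
theorem eventually_exists_key_of_lt [Nonempty V] [Nonempty A] {p : X × Y × Z → ℝ} (hp : IsLaw p)
    (hi : IndepGiven p) {Q : Y → V → ℝ} (hQ : IsKernel Q) {r : A → ℝ} (hr : IsLaw r)
    {w : A → B × C → ℝ} (hw : IsKernel w) {n m : ℕ}
    (hlt : n * auxY p Q < m * chanInfo r (kfst w)) {ρ : ℝ} (hρ : 0 < ρ)
    (hρ' : ρ < n * auxX p Q + m * max 0 (chanInfo r (kfst w) - chanInfo r (ksnd w)))
    {ε : ℝ} (hε : 0 < ε) (hε1 : ε ≤ 1) :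
    ∀ᶠ N : ℕ in atTop, ∃ (L : ℕ) (q : (Fin (N * n) → Y) → (Fin (N * m) → A) → ℝ), 2 ≤ L ∧
      IsKernel q ∧ ∃ (kA : (Fin (N * n) → X) × (Fin (N * m) → B) → Fin L)
        (kB : (Fin (N * n) → Y) × (Fin (N * m) → A) → Fin L),
        prob (twoWayLaw (block (Fin (N * n)) p) q (blockW (Fin (N * m)) w))
          (fun ω => kA (ω.1.1.1, ω.2.1) ≠ kB (ω.1.1.2.1, ω.1.2)) ≤ ε ∧
        (1 - ε) * (Real.log L / Real.log 2) ≤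
          condEntropy (twoWayLaw (block (Fin (N * n)) p) q (blockW (Fin (N * m)) w))
            (fun ω => kB (ω.1.1.2.1, ω.1.2)) (fun ω => (ω.1.1.2.2, ω.2.2)) ∧
        (1 - ε) * (N * ρ) ≤
          condEntropy (twoWayLaw (block (Fin (N * n)) p) q (blockW (Fin (N * m)) w))
            (fun ω => kB (ω.1.1.2.1, ω.1.2)) (fun ω => (ω.1.1.2.2, ω.2.2)) := by
  have hl2 := log_two_pos
  have hy0 := auxY_nonneg hp hQ
  have hyeq := auxY_eq_sub hp hQ
  have hxeq := auxX_eq_sub hp hi hQ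
  have hml := isLaw_auxLaw hp hQ
  have hcl := isLaw_comp hr hw
  set HY := condEntropy (auxLaw p Q) (fun x => x.1) (fun x => x.2.2.1) with hHY
  set HX := condEntropy (auxLaw p Q) (fun x => x.1) (fun x => x.2.1) with hHX
  set HZ := condEntropy (auxLaw p Q) (fun x => x.1) (fun x => x.2.2.2) with hHZ
  have hfst := chanInfo_kfst_eq r w
  have hsnd := chanInfo_ksnd_eq r w
  set HA := entropy (comp r w) (fun x => x.1) with hHA
  set HB := condEntropy (comp r w) (fun x => x.1) (fun x => x.2.1) with hHB
  set HC := condEntropy (comp r w) (fun x => x.1) (fun x => x.2.2) with hHC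
  have hHX0 : 0 ≤ HX := condEntropy_nonneg hml _ _
  have hHB0 : 0 ≤ HB := condEntropy_nonneg hcl _ _
  set l := Real.log 2 with hl
  set n' : ℝ := (n : ℝ) with hn'
  set m' : ℝ := (m : ℝ) with hm'
  have hn0 : 0 ≤ n' := Nat.cast_nonneg n
  have hm0 : 0 ≤ m' := Nat.cast_nonneg m
  have hgap : 0 < m' * (HA - HB) - n' * (HX - HY) := by rw [← hfst, ← hyeq]; linarith
  have hYX : n' * HY ≤ n' * HX := mul_le_mul_of_nonneg_left (by linarith) hn0
  have hnX : 0 ≤ n' * HX := mul_nonneg hn0 hHX0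
  have hmB : 0 ≤ m' * HB := mul_nonneg hm0 hHB0
  have hfin : ∀ b, b = ρ * l → ∀ N : ℕ, N * b / l = N * ρ := fun b hb N => by
    rw [hb, ← mul_assoc, mul_div_cancel_right₀ _ hl2.ne']
  set D := n' * auxX p Q + m' * max 0 (chanInfo r (kfst w) - chanInfo r (ksnd w)) - ρ with hD
  have hD0 : 0 < D := by linarith
  -- The conditions on the exponents below lose at most 8 η, so a margin of 10 η suffices.
  obtain ⟨η, hη, hη1, hη2⟩ : ∃ η > 0, 10 * η < l * (m' * (HA - HB) - n' * (HX - HY)) ∧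
      10 * η < l * D := by
    have h1 := mul_pos hl2 hgap
    have h2 := mul_pos hl2 hD0
    refine ⟨min (l * (m' * (HA - HB) - n' * (HX - HY))) (l * D) / 20, by positivity, ?_, ?_⟩
    · linarith [min_le_left (l * (m' * (HA - HB) - n' * (HX - HY))) (l * D)]
    · linarith [min_le_right (l * (m' * (HA - HB) - n' * (HX - HY))) (l * D)]
  obtain ⟨κ₁, k10, k11, hk1⟩ := exists_isSourceEnsemble hp hQ n hη
  obtain ⟨κ₂, k20, k21, hk2⟩ := exists_isInputEnsemble hr hw m hη
  have hs : ∀ ε > 0, ∀ᶠ N : ℕ in atTop, IsSourceEnsemble (block (Fin (N * n)) p)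
      (blockK (Fin (N * n)) Q) (Real.exp (N * (n' * -(HY * l) + η)))
      (Real.exp (N * (n' * -(HY * l) - η))) (Real.exp (N * (n' * -(HX * l) - η)))
      (Real.exp (N * (n' * -(HZ * l) + η))) ε := fun ε hε => by
    filter_upwards [eventually_pow_le k10 k11 hε] with N hN using (hk1 N).mono hN
  have ht : ∀ ε > 0, ∀ᶠ N : ℕ in atTop, ∃ r, IsInputEnsemble r (blockW (Fin (N * m)) w)
      (Real.exp (N * (m' * -(HA * l) + η))) (Real.exp (N * (m' * (HB * l) + η)))
      (Real.exp (N * (m' * -(HC * l) + η))) ε := fun ε hε => by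
    filter_upwards [eventually_pow_le k20 k21 hε] with N hN
    refine ⟨fun a => ∏ i, r (a i), ?_⟩
    have := (hk2 N).mono (hw.blockW (ι := Fin (N * m))) le_rfl hN
    rw [← Real.exp_neg] at this
    have e : -(N * (m' * -(HB * l) - η)) = N * (m' * (HB * l) + η) := by ring
    rwa [e] at this
  have hb : 0 < ρ * l := mul_pos hρ hl2
  have hYXl : n' * HY * l ≤ n' * HX * l := mul_le_mul_of_nonneg_right hYX hl2.le
  have hnXl : 0 ≤ n' * HX * l := mul_nonneg hnX hl2.le
  have hmBl : 0 ≤ m' * HB * l := mul_nonneg hmB hl2.le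
  have hnyl : 0 ≤ l * (n' * (HX - HY)) := mul_nonneg hl2.le (by linarith)
  clear_value n' m' l HY HX HZ HA HB HC
  -- With a nonnegative gain the inputs remain i.i.d., and the bins also cover the uncertainty H(A |
  -- B), so that the channel contributes I(A; B) - I(A; C) to the key. Otherwise a random code comes
  -- first: B determines the input, and the source alone provides the secrecy.
  rcases le_total 0 (chanInfo r (kfst w) - chanInfo r (ksnd w)) with hcase | hcase
  · rw [max_eq_right hcase, hxeq, hfst, hsnd] at hD
    rw [hD] at hη2
    -- The number of bins is just above what decoding from (X, B) requires; `h1` then becomes the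
    -- constraint n I(V; Y | X) < m I(A; B).
    have := eventually_exists_key hp hQ hw hs ht (a := n' * (HX * l) + m' * (HB * l) + 3 * η)
      (b := ρ * l) (by linarith) hb (by linarith) (by linarith) (by linarith) (by linarith)
      hε hε1
    simpa only [← hl, hfin _ rfl] using this
  · rw [max_eq_left hcase, hxeq] at hD
    rw [hD] at hη2
    have ht' : ∀ ε > 0, ∀ᶠ N : ℕ in atTop, ∃ r, IsInputEnsemble r (blockW (Fin (N * m)) w) _ _ _ ε :=
      fun ε hε => eventually_exists_code hw hη (by linarith) ht (by linarith) hε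
    have := eventually_exists_key hp hQ hw hs ht' (a := n' * (HX * l) + 3 * η)
      (b := ρ * l) (by linarith) hb (by linarith) (by linarith) (by linarith) (by linarith)
      hε hε1
    simpa only [← hl, hfin _ rfl] using this

end
end Info

/-! ### Protocols with two rounds -/

namespace PMF

open Classical in
/-- The law of independent letters, indexed by `ι`. -/
def iid {α : Type*} [Fintype α] (ι : Type*) [Fintype ι] (P : PMF α) : PMF (ι → α) :=
  PMF.ofFintype (fun x => ∏ i, P (x i)) (by
    have h := Finset.prod_univ_sum (fun _ : ι => (Finset.univ : Finset α)) (fun _ x => P x)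
    rw [Fintype.piFinset_univ] at h
    rw [← h, ← tsum_fintype (L := .unconditional α) (fun x => P x), P.tsum_coe]
    simp)

theorem iid_apply {α : Type*} [Fintype α] {ι : Type*} [Fintype ι] (P : PMF α) (x : ι → α) :
    iid ι P x = ∏ i, P (x i) := by
  classical
  exact PMF.ofFintype_apply _ _

end PMF

namespace Protocol
open Info

section
variable {X Y Z : Party → Type*}

/-- The schedule in which `a` sends `n` letters, and then the other party `m` letters. -/
@[reducible] def twoRoundSchedule (a : Party) (n m : ℕ) : Schedule where
  rounds := 2
  sender := Fin.cons a fun _ => a.other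
  len := Fin.cons n fun _ => m

/-- The party `a` sends i.i.d. letters, and the other party answers through the kernel `q`. -/
@[reducible] def twoRound [∀ p, Fintype (X p)] (a : Party) (n m : ℕ) (P : PMF (X a))
    (q : (Fin n → Y a) → PMF (Fin m → X a.other)) (L : ℕ)
    (kA : (Fin n → X a) × (Fin m → Y a.other) → Fin L)
    (kB : (Fin n → Y a) × (Fin m → X a.other) → Fin L) : Protocol X Y where
  toSchedule := twoRoundSchedule a n m
  enc := Fin.cases (fun _ => PMF.iid (Fin n) P) (Fin.cases
    (fun v => q (v.2 ⟨0, Nat.zero_lt_one, (Party.other_ne a).symm⟩)) fun r => r.elim0)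
  keyCard := L
  holder := a.other
  key := fun p v => if h : p = a then
      kA (v.1 ⟨0, Nat.zero_lt_two, h.symm⟩, v.2 ⟨1, Nat.one_lt_two, fun h' => Party.other_ne a (h'.trans h)⟩)
    else kB (v.2 ⟨0, Nat.zero_lt_two, fun h' => h h'.symm⟩,
      v.1 ⟨1, Nat.one_lt_two, (Party.ne_iff_eq_other.1 h).symm⟩)

variable [∀ p, Fintype (X p)] {a : Party} {n m : ℕ} {P : PMF (X a)}
  {q : (Fin n → Y a) → PMF (Fin m → X a.other)} {L : ℕ}
  {kA : (Fin n → X a) × (Fin m → Y a.other) → Fin L}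
  {kB : (Fin n → Y a) × (Fin m → X a.other) → Fin L}

/-- The transcript of a protocol with two rounds, as the sequences of the letters of each kind. -/
def twoRoundEquiv (X Y Z : Party → Type*) (a : Party) (n m : ℕ) :
    (twoRoundSchedule a n m).Transcript X Y Z ≃
      (((Fin n → X a) × (Fin n → Y a) × (Fin n → Z a)) × (Fin m → X a.other)) ×
        ((Fin m → Y a.other) × (Fin m → Z a.other)) where
  toFun ω := (((fun i => (ω (0 : Fin 2) i).1, fun i => (ω (0 : Fin 2) i).2.1, fun i => (ω (0 : Fin 2) i).2.2),
    fun i => (ω (1 : Fin 2) i).1), (fun i => (ω (1 : Fin 2) i).2.1, fun i => (ω (1 : Fin 2) i).2.2))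
  invFun t := Fin.cases (fun i => (t.1.1.1 i, t.1.1.2.1 i, t.1.1.2.2 i))
    (Fin.cases (fun i => (t.1.2 i, t.2.1 i, t.2.2 i)) fun r => r.elim0)
  left_inv ω := by
    funext r
    induction r using Fin.cases with
    | zero => rfl
    | succ r => induction r using Fin.cases with
      | zero => rfl
      | succ r => exact r.elim0
  right_inv _ := rfl

theorem twoRound_law (W : TwoDMBC X Y Z)
    (ω : (twoRound a n m P q L kA kB).Transcript X Y Z) :
    (twoRound a n m P q L kA kB).law W ω =
      twoWayLaw (block (Fin n) ((W a).jointLaw P)) (fun y => massFn (q y))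
        (blockW (Fin m) (chan (W a.other))) (twoRoundEquiv X Y Z a n m ω) := by
  have h : ∀ t : Fin n → X a × Y a × Z a, (PMF.iid (Fin n) P fun i => (t i).1).toReal *
      ∏ i, (W a (t i).1 (t i).2).toReal = ∏ i, (W a).jointLaw P (t i) := fun t => by
    rw [PMF.iid_apply, ENNReal.toReal_prod]
    exact Finset.prod_mul_distrib.symm
  rw [law]
  refine (Fin.prod_univ_two _).trans ?_
  refine Eq.trans ?_ (mul_assoc _ _ _).symm
  exact congrArg₂ _ (h (ω (0 : Fin 2))) rfl

theorem twoRound_keyS (ω : (twoRound a n m P q L kA kB).Transcript X Y Z) :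
    (twoRound a n m P q L kA kB).keyS ω = kB ((twoRoundEquiv X Y Z a n m ω).1.1.2.1,
      (twoRoundEquiv X Y Z a n m ω).1.2) :=
  dif_neg (Party.other_ne a)

theorem twoRound_keyEst (ω : (twoRound a n m P q L kA kB).Transcript X Y Z) :
    (twoRound a n m P q L kA kB).keyEst ω = kA ((twoRoundEquiv X Y Z a n m ω).1.1.1,
      (twoRoundEquiv X Y Z a n m ω).2.1) :=
  dif_pos (Party.other_other a)

theorem twoRound_eveView (ω ω' : (twoRound a n m P q L kA kB).Transcript X Y Z) :
    Schedule.eveView ω = Schedule.eveView ω' ↔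
      ((twoRoundEquiv X Y Z a n m ω).1.1.2.2, (twoRoundEquiv X Y Z a n m ω).2.2) =
        ((twoRoundEquiv X Y Z a n m ω').1.1.2.2, (twoRoundEquiv X Y Z a n m ω').2.2) := by
  refine ⟨fun h => Prod.ext (congrFun h (0 : Fin 2)) (congrFun h (1 : Fin 2)), fun h => ?_⟩
  funext r
  induction r using Fin.cases with
  | zero => exact congrArg Prod.fst h
  | succ r => induction r using Fin.cases with
    | zero => exact congrArg Prod.snd h
    | succ r => exact r.elim0

theorem twoRound_sendsIID [∀ p, Nonempty (X p)] :
    (twoRound a n m P q L kA kB).SendsIID a := by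
  -- A law is asked for each party, but only that of `a` is used; the other is filled in by a point
  -- mass.
  refine ⟨Function.update (fun p => PMF.pure (Classical.arbitrary (X p))) a P, fun r hr => ?_⟩
  induction r using Fin.cases with
  | zero =>
    intro v x
    refine (PMF.iid_apply P x).trans ?_
    have : Function.update (fun p => PMF.pure (Classical.arbitrary (X p))) a P a = P :=
      Function.update_self _ _ _
    exact Finset.prod_congr rfl fun i _ => congrArg (fun Q : PMF (X a) => Q (x i)) this.symm
  | succ r => exact absurd hr (by
      induction r using Fin.cases with
      | zero => exact Party.other_ne a
      | succ r => exact r.elim0)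

theorem twoRound_uses : (twoRound a n m P q L kA kB).uses .alice +
    (twoRound a n m P q L kA kB).uses .bob = n + m := by
  have h : ∀ p, (twoRound a n m P q L kA kB).uses p =
      (if a = p then n else 0) + (if a.other = p then m else 0) := fun p => by
    rw [Schedule.uses, Finset.sum_filter]
    exact Fin.sum_univ_two _
  rw [h, h]
  cases a <;> simp [Party.other, add_comm]

variable [∀ p, Fintype (Y p)] [∀ p, Fintype (Z p)]

/-- Security depends on the joint law of the two keys and of Eve's view, the latter only up to
relabelling, so it may be checked after transport along `φ`. -/
theorem secure_of_equiv {prot : Protocol X Y} {W : TwoDMBC X Y Z} {Ω ε : Type*} [Fintype Ω]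
    [Fintype ε] (φ : prot.Transcript X Y Z ≃ Ω) {μ : Ω → ℝ} {S T : Ω → Fin prot.keyCard} {E : Ω → ε}
    (hlaw : ∀ ω, prot.law W ω = μ (φ ω)) (hS : ∀ ω, prot.keyS ω = S (φ ω))
    (hT : ∀ ω : prot.Transcript X Y Z, prot.keyEst ω = T (φ ω))
    (hE : ∀ ω ω' : prot.Transcript X Y Z,
      Schedule.eveView ω = Schedule.eveView ω' ↔ E (φ ω) = E (φ ω'))
    {n m : ℕ} (hn : prot.uses .alice + prot.uses .bob = n + m) (hnm : 0 < n + m) {R δ : ℝ}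
    (hrate : entropy μ S / ((n : ℝ) + m) > R - δ) (herr : prob μ (fun x => T x ≠ S x) < δ)
    (hsec : entropy μ S ≠ 0 → condEntropy μ S E / entropy μ S > 1 - δ) : prot.Secure W R δ := by
  have hpush : push (prot.law W) φ = μ := by
    funext x
    rw [push_equiv, hlaw, Equiv.apply_symm_apply]
  have hent : entropy (prot.law W) prot.keyS = entropy μ S := by
    rw [← hpush, entropy_push, funext hS]
  have hcond : condEntropy (prot.law W) prot.keyS Schedule.eveView = condEntropy μ S E := by
    rw [condEntropy_congr (C := fun ω => S (φ ω)) (D := fun ω => E (φ ω))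
      (fun ω ω' => by rw [hS, hS, hE]) hE]
    refine condEntropy_congr_push ?_
    rw [← hpush, push_push]
  refine ⟨by rw [hn]; exact hnm, ?_, ?_, ?_⟩
  · rw [hent]
    have := congrArg (Nat.cast (R := ℝ)) hn
    push_cast at this
    rwa [this]
  · rw [← hpush, prob_push] at herr
    simp only [hS, hT]
    exact herr
  · rw [hent, hcond]
    exact hsec

theorem twoRound_secure {W : TwoDMBC X Y Z} (hnm : 0 < n + m) {R δ : ℝ}
    {μ : _ → ℝ} (hμ : μ = twoWayLaw (block (Fin n) ((W a).jointLaw P)) (fun y => massFn (q y))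
      (blockW (Fin m) (chan (W a.other))))
    (hrate : entropy μ (fun x => kB (x.1.1.2.1, x.1.2)) / ((n : ℝ) + m) > R - δ)
    (herr : prob μ (fun x => kA (x.1.1.1, x.2.1) ≠ kB (x.1.1.2.1, x.1.2)) < δ)
    (hsec : entropy μ (fun x => kB (x.1.1.2.1, x.1.2)) ≠ 0 →
      condEntropy μ (fun x => kB (x.1.1.2.1, x.1.2)) (fun x => (x.1.1.2.2, x.2.2)) /
        entropy μ (fun x => kB (x.1.1.2.1, x.1.2)) > 1 - δ) :
    (twoRound a n m P q L kA kB).Secure W R δ :=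
  secure_of_equiv (prot := twoRound a n m P q L kA kB) (twoRoundEquiv X Y Z a n m) (μ := μ)
    (S := fun x => kB (x.1.1.2.1, x.1.2)) (T := fun x => kA (x.1.1.1, x.2.1))
    (E := fun x => (x.1.1.2.2, x.2.2)) (fun ω => (twoRound_law W ω).trans (by rw [hμ]))
    twoRound_keyS twoRound_keyEst twoRound_eveView twoRound_uses hnm hrate herr hsec

end
end Protocol

/-! ### Achievability of `L'` -/

namespace TwoDMBC
open Info Filter

section
variable {X Y Z : Party → Type*} [∀ p, Fintype (X p)] [∀ p, Fintype (Y p)] [∀ p, Fintype (Z p)]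
  [∀ p, Nonempty (X p)]

/-- A constant key achieves the rate `0`. -/
theorem exists_secure_of_lt (W : TwoDMBC X Y Z) (a : Party) {R δ : ℝ} (hR : R < δ) (hδ : 0 < δ) :
    ∃ prot : Protocol X Y, prot.SendsIID a ∧ prot.Secure W R δ := by
  have hμ : IsLaw (twoWayLaw (block (Fin 1)
      ((W a).jointLaw (PMF.pure (Classical.arbitrary (X a)))))
      (fun _ => massFn (PMF.pure (Classical.arbitrary (Fin 0 → X a.other))))
      (blockW (Fin 0) (chan (W a.other)))) :=
    isLaw_twoWayLaw (isLaw_block (isLaw_jointLaw _ _)) (fun _ => isLaw_massFn _)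
      (isKernel_chan _).blockW
  have h0 : entropy (twoWayLaw (block (Fin 1)
      ((W a).jointLaw (PMF.pure (Classical.arbitrary (X a)))))
      (fun _ => massFn (PMF.pure (Classical.arbitrary (Fin 0 → X a.other))))
      (blockW (Fin 0) (chan (W a.other)))) (fun _ => (0 : Fin 1)) = 0 :=
    entropy_const hμ (by simp)
  -- One letter is sent because at least one channel use is required. As H(S) = 0, there is no
  -- secrecy condition.
  refine ⟨Protocol.twoRound a 1 0 (PMF.pure (Classical.arbitrary _))
    (fun _ => PMF.pure (Classical.arbitrary _)) 1 (fun _ => 0) (fun _ => 0),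
    Protocol.twoRound_sendsIID, Protocol.twoRound_secure one_pos rfl ?_ ?_ fun h => absurd h0 h⟩
  · rw [h0, zero_div]; linarith
  · simpa [prob] using hδ

theorem exists_secure_of_mem {W : TwoDMBC X Y Z} (hW : W.IsSD) {a : Party} {v : ℝ}
    (hv : v ∈ W.lowerBoundValues a) {R δ : ℝ} (hR : R < v) (hR0 : 0 ≤ R) (hδ : 0 < δ) :
    ∃ prot : Protocol X Y, prot.SendsIID a ∧ prot.Secure W R δ := by
  obtain ⟨n, m, k, P, Q, P', hnm, hlt, rfl⟩ := hv
  have hnm' : (0 : ℝ) < n + m := by exact_mod_cast hnm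
  have hk : Nonempty (Fin k) := by
    obtain ⟨x⟩ := (inferInstance : Nonempty (X a))
    exact ⟨(Q (W a x).support_nonempty.some.1).support_nonempty.some⟩
  rw [infoXY_eq, infoVYgivenX_eq] at hlt
  rw [infoXY_eq, infoXZ_eq, infoVXgivenZ_eq, lt_div_iff₀ hnm'] at hR
  -- ρ is a total for n + m uses, strictly between R (n + m) and what can be achieved; the room
  -- below ρ pays for the factor 1 - ε.
  obtain ⟨ρ, hρ1, hρ2⟩ := exists_between hR
  have hρ0 : 0 < ρ := (mul_nonneg hR0 hnm'.le).trans_lt hρ1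
  obtain ⟨ε, hε0, hε⟩ : ∃ ε > 0, ε ≤ 1 / 2 ∧ ε < δ ∧ R * (n + m) < (1 - ε) * ρ := by
    have h1 : 0 < (ρ - R * (n + m)) / ρ := div_pos (by linarith) hρ0
    refine ⟨min (1 / 2) (min (δ / 2) ((ρ - R * (n + m)) / ρ / 2)), by positivity,
      min_le_left _ _, ?_, ?_⟩
    · exact ((min_le_right _ _).trans (min_le_left _ _)).trans_lt (by linarith)
    · have h2 : min (1 / 2) (min (δ / 2) ((ρ - R * (n + m)) / ρ / 2)) <
          (ρ - R * (n + m)) / ρ :=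
        ((min_le_right _ _).trans (min_le_right _ _)).trans_lt (by linarith)
      rw [lt_div_iff₀ hρ0] at h2
      linarith
  obtain ⟨hε1, hεδ, hερ⟩ := hε
  obtain ⟨N, ⟨L, q, hL, hq, kA, kB, herr, hs1, hs2⟩, hN⟩ :=
    ((eventually_exists_key_of_lt (isLaw_jointLaw (W a) P)
      (indepGiven_jointLaw (hW a).2 P) (fun y => isLaw_massFn (Q y)) (isLaw_massFn P')
      (isKernel_chan (W a.other)) hlt hρ0 hρ2 hε0 (by linarith)).and (eventually_gt_atTop 0)).exists
  have hN' : (0 : ℝ) < N := by exact_mod_cast hN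
  obtain ⟨q, rfl⟩ := exists_pmf_kernel hq
  have hμ := isLaw_twoWayLaw (isLaw_block (ι := Fin (N * n)) (isLaw_jointLaw (W a) P)) hq
    ((isKernel_chan (W a.other)).blockW (ι := Fin (N * m)))
  set μ := twoWayLaw (block (Fin (N * n)) ((W a).jointLaw P)) (fun y => massFn (q y))
    (blockW (Fin (N * m)) (chan (W a.other))) with hμdef
  have hcond := condEntropy_le_entropy hμ (fun ω => kB (ω.1.1.2.1, ω.1.2))
    (fun ω => (ω.1.1.2.2, ω.2.2))
  -- The equivocation is close to log L / log 2, which bounds H(S) from above; this gives the ratio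
  -- in the secrecy condition.
  have hlog := entropy_le_log_card hμ (fun ω => kB (ω.1.1.2.1, ω.1.2))
  rw [Fintype.card_fin] at hlog
  refine ⟨Protocol.twoRound a (N * n) (N * m) P q L kA kB, Protocol.twoRound_sendsIID,
    Protocol.twoRound_secure (by rw [← mul_add]; positivity) hμdef ?_ (herr.trans_lt hεδ)
      fun _ => ?_⟩
  · push_cast
    rw [← mul_add, gt_iff_lt, lt_div_iff₀ (by positivity)]
    have h1 : R * (N * (n + m)) < (1 - ε) * (N * ρ) := by
      have := mul_lt_mul_of_pos_left hερ hN'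
      linarith
    have h2 : (R - δ) * (N * (n + m)) ≤ R * (N * (n + m)) :=
      mul_le_mul_of_nonneg_right (by linarith) (by positivity)
    linarith
  · have hpos : 0 < entropy μ (fun ω => kB (ω.1.1.2.1, ω.1.2)) :=
      (mul_pos (by linarith) (mul_pos hN' hρ0)).trans_le (hs2.trans hcond)
    rw [gt_iff_lt, lt_div_iff₀ hpos]
    calc _ < (1 - ε) * entropy μ (fun ω => kB (ω.1.1.2.1, ω.1.2)) :=
          mul_lt_mul_of_pos_right (by linarith) hpos
      _ ≤ (1 - ε) * (Real.log L / Real.log 2) := mul_le_mul_of_nonneg_left hlog (by linarith)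
      _ ≤ _ := hs1

/-- The supremum need not be attained, so an element within δ / 2 of it is used with half of the
tolerance. If `W.L' a < δ`, which includes the case of an empty set, a constant key is enough. -/
theorem exists_secure_L' {W : TwoDMBC X Y Z} (hW : W.IsSD) (a : Party) {δ : ℝ} (hδ : 0 < δ) :
    ∃ prot : Protocol X Y, prot.SendsIID a ∧ prot.Secure W (W.L' a) δ := by
  rcases lt_or_ge (W.L' a) δ with h | h
  · exact W.exists_secure_of_lt a h hδ
  · have hne : (W.lowerBoundValues a).Nonempty := by
      by_contra hne
      rw [L', Set.not_nonempty_iff_eq_empty.1 hne, Real.sSup_empty] at h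
      linarith
    obtain ⟨v, hv, hlt⟩ := exists_lt_of_lt_csSup hne (show W.L' a - δ / 2 < W.L' a by linarith)
    obtain ⟨prot, h1, h2, h3, h4, h5⟩ := exists_secure_of_mem hW hv hlt (by linarith) (half_pos hδ)
    refine ⟨prot, h1, h2, by linarith, h4.trans (by linarith), fun h6 => ?_⟩
    have := h5 h6
    linarith

theorem L'_mem_achievableRates {W : TwoDMBC X Y Z} (hW : W.IsSD) (a : Party) :
    W.L' a ∈ W.achievableRates (fun prot => prot.SendsIID a) :=
  ⟨W.L'_nonneg a, fun _ hδ => exists_secure_L' hW a hδ⟩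

end
end TwoDMBC

end

theorem theorem2 {X Y Z : Party → Type*}
    [∀ p, Fintype (X p)] [∀ p, Fintype (Y p)] [∀ p, Fintype (Z p)] [∀ p, Nonempty (X p)]
    (W : TwoDMBC X Y Z) (hW : W.IsSD) :
    W.IsSecretKeyCapacity (fun prot => ∃ a, prot.SendsIID a) (max (W.L' .alice) (W.L' .bob)) ∧
    (∀ a, (W.lowerBoundValues a).Nonempty →
      W.IsSecretKeyCapacity (fun prot => prot.SendsIID a) (W.L' a)) := by
  -- Both values are achievable in the larger class, even if one of the sets is empty and its
  -- supremum is 0 by convention.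
  have hsub : ∀ a, W.L' a ∈ W.achievableRates (fun prot => ∃ a, prot.SendsIID a) := fun a =>
    ⟨W.L'_nonneg a, fun δ hδ =>
      let ⟨prot, h1, h2⟩ := TwoDMBC.exists_secure_L' hW a hδ
      ⟨prot, ⟨a, h1⟩, h2⟩⟩
  refine ⟨⟨?_, fun R hR => TwoDMBC.le_max_of_mem_achievableRates hW hR⟩, fun a hne =>
    ⟨TwoDMBC.L'_mem_achievableRates hW a, fun R hR =>
      TwoDMBC.le_L'_of_mem_achievableRates hW hne hR⟩⟩
  rcases max_choice (W.L' .alice) (W.L' .bob) with h | h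
  · rw [h]; exact hsub _
  · rw [h]; exact hsub _
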